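/- **Setting.** Let $T>0$, $p>1$, $1/p+1/q=1$. $\mathbb{R}^d$ is the Euclidean space of column vectors, $\mathbb{R}^{d,*}$ that of row vectors. $\mathcal P^p(\mathbb R^d)$ is the set of Borel probabilities on $\mathbb{R}^d$ with finite $p$-th moment, with the Wasserstein metric $W_p$; $\mathcal M_p(m)=(\int\|x\|^p\,m(dx))^{1/p}$; $X\sharp\mathbb P$ is the law of $X$; $\lambda$ is Lebesgue measure on $[0,T]$; $\Gamma=C([0,T],\mathbb R^d)$ and $\Gamma^*=C([0,T],\mathbb R^{d,*})$ carry the sup norm. A function $\Phi$ on $\mathcal P^p(\mathbb R^d)$ with values in $\mathbb R$ or $\mathbb{R}^d$ is of class $C^1$ if there is a continuous $\frac{\delta\Phi}{\delta m}(m,y)$ on $\mathcal P^p(\mathbb R^d)\times\mathbb R^d$, with $\frac{\delta\Phi}{\delta m}(m,\cdot)$ integrable against every $m'\in\mathcal P^p(\mathbb R^d)$, such that for all $m,m'\in\mathcal P^p(\mathbb R^d)$ $$\lim_{s\downarrow0}\frac{\Phi((1-s)m+sm')-\Phi(m)}{s}=\int\frac{\delta\Phi}{\delta m}(m,y)\,[m'(dy)-m(dy)].$$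 Its intrinsic derivative is $\nabla_m\Phi(m,y)=\nabla_y\frac{\delta\Phi}{\delta m}(m,y)$. Let $U$ be a closed subset of a Banach space and let $f:[0,T]\times\mathbb R^d\times\mathcal P^p(\mathbb R^d)\times U\to\mathbb R^d$, $f_0:[0,T]\times\mathbb R^d\times\mathcal P^p(\mathbb R^d)\times U\to\mathbb R$, $\sigma:\mathbb R^d\times\mathcal P^p(\mathbb R^d)\to\mathbb R$ be continuous, such that, for some constants $C$ (all appearing constants may be different) and some $\varsigma:[0,\infty)\to[0,\infty)$ with $\varsigma(r)\to0=\varsigma(0)$ as $r\downarrow0$: * $\|f(t,x,m,u)\|\le C(1+\|x\|+\mathcal M_p(m)+\|u\|)$, $|f_0(t,x,m,u)|\le C(1+\|x\|^p+\mathcal M_p^p(m)+\|u\|^p)$, $|\sigma(x,m)|\le C(1+\|x\|^p+\mathcal M_p^p(m))$; * $\|f(t_1,x,m,u)-f(t_2,x,m,u)\|\le\varsigma(|t_1-t_2|)(1+\|x\|+\mathcal M_p(m)+\|u\|)$ and $|f_0(t_1,x,m,u)-f_0(t_2,x,m,u)|\le\varsigma(|t_1-t_2|)(1+\|x\|^p+\mathcal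 M^p_p(m)+\|u\|^p)$; * $f$, $f_0$, $\sigma$ are continuously differentiable with respect to $x$ and $m$: the derivatives $\nabla_x$ and the intrinsic derivatives $\nabla_m$ (taken for fixed values of the other variables) exist and are continuous in all their variables; * $\nabla_xf$ and $\nabla_mf$ are bounded; * $\|\nabla_xf_0(t,x,m,u)\|^q\le C(1+\|x\|^p+\mathcal M_p^p(m)+\|u\|^p)$, $\|\nabla_mf_0(t,x,m,y,u)\|^q\le C(1+\|x\|^p+\|y\|^p+\mathcal M_p^p(m)+\|u\|^p)$; * $\|\nabla_x\sigma(x,m)\|^q\le C(1+\|x\|^p+\mathcal M_p^p(m))$, $\|\nabla_m\sigma(x,m,y)\|^q\le C(1+\|x\|^p+\|y\|^p+\mathcal M_p^p(m))$. Let $(\Omega,\mathcal F,\mathbb P)$ be a probability space (in particular, any standard one). A control process is a pair $(X,u)$ where $X\in L^p(\Omega;\Gamma)$, $u:[0,T]\times\Omega\to U$ is (strongly) jointly measurable with $\int_0^T\mathbb E\|u(t)\|^p\,dt<\infty$, and, for $\mathbb P$-a.e. $\omega$ and all $t\in[0,T]$, $X(t,\omega)=X(0,\omega)+\int_0^tf(\tau,X(\tau,\omega),X(\tau)\sharp\mathbb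 P,u(\tau,\omega))\,d\tau$. Its cost is $$J(X,u)=\mathbb E\Big[\sigma(X(T),X(T)\sharp\mathbb P)+\int_0^Tf_0(t,X(t),X(t)\sharp\mathbb P,u(t))\,dt\Big].$$ For $X_0\in L^p(\Omega;\mathbb R^d)$, $\mathcal A(X_0)$ is the set of control processes with $X(0)=X_0$ a.s.; for $m_0\in\mathcal P^p(\mathbb R^d)$, $\operatorname{Adm}(m_0)$ is the set of those with $X(0)\sharp\mathbb P=m_0$. * $(X^*,u^*)\in\mathcal A(X_0)$ is a *strong local $L^p$-minimizer* at $X_0$ if for some $\varepsilon>0$ one has $J(X^*,u^*)\le J(X,u)$ for all $(X,u)\in\mathcal A(X_0)$ with $\big(\mathbb E\sup_{t}\|X(t)-X^*(t)\|^p\big)^{1/p}\le\varepsilon$. * $(X^*,u^*)\in\operatorname{Adm}(m_0)$ is a *strong local $W_p$-minimizer* at $m_0$ if for some $\varepsilon>0$ one has $J(X^*,u^*)\le J(X,u)$ for all $(X,u)\in\operatorname{Adm}(m_0)$ with $W_p(X(t)\sharp\mathbb P,X^*(t)\sharp\mathbb P)\le\varepsilon$ for all $t\in[0,T]$. * $(X^*,u^*)\in\operatorname{Adm}(m_0)$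 is a *Pontryagin local $W_p$-minimizer* at $m_0$ if the same holds for those $(X,u)$ that satisfy in addition $(\lambda\otimes\mathbb P)\{(t,\omega):u^*(t,\omega)\ne u(t,\omega)\}\le\varepsilon$. A time $s\in[0,T)$ is *regular* for $(X,u)$ if $\mathbb{E}\|u(s)\|^p<\infty$ and, as $h\downarrow0$, with $f[\tau]=f(\tau,X(\tau),X(\tau)\sharp\mathbb P,u(\tau))$ and likewise $f_0[\tau]$, $\mathbb E\big\|\frac1h\int_s^{s+h}f[\tau]\,d\tau-f[s]\big\|^p\to0$ and $\mathbb E\big|\frac1h\int_s^{s+h}f_0[\tau]\,d\tau-f_0[s]\big|\to0$. Put $H(t,x,m,\psi,u)=\psi f(t,x,m,u)-f_0(t,x,m,u)$. **Statement.** Let $(X^*,u^*)$ be a Pontryagin local $W_p$-minimizer at some $m_0\in\mathcal P^p(\mathbb R^d)$, or a strong local $L^p$-minimizer at some $X_0\in L^p(\Omega;\mathbb R^d)$, or a strong local $W_p$-minimizer at some $m_0\in\mathcal P^p(\mathbb R^d)$. Write $m^*(t)=X^*(t)\sharp\mathbb P$. Then there is $\Psi\in L^q(\Omega;\Gamma^*)$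 such that: 1. (costate equation) for $\mathbb P$-a.e. $\omega$, $\Psi(\cdot,\omega)$ solves, in the integral sense on $[0,T]$, $$\begin{aligned}\frac{d}{dt}\Psi(t,\omega)=&-\Psi(t,\omega)\nabla_xf(t,X^*(t,\omega),m^*(t),u^*(t,\omega))+\nabla_xf_0(t,X^*(t,\omega),m^*(t),u^*(t,\omega))\\&-\int_\Omega\Psi(t,\omega')\nabla_mf(t,X^*(t,\omega'),m^*(t),X^*(t,\omega),u^*(t,\omega'))\,\mathbb P(d\omega')\\&+\int_\Omega\nabla_mf_0(t,X^*(t,\omega'),m^*(t),X^*(t,\omega),u^*(t,\omega'))\,\mathbb P(d\omega');\end{aligned}$$ 2. (transversality) for $\mathbb P$-a.e. $\omega$, $$\Psi(T,\omega)=-\nabla_x\sigma(X^*(T,\omega),m^*(T))-\int_\Omega\nabla_m\sigma(X^*(T,\omega'),m^*(T),X^*(T,\omega))\,\mathbb P(d\omega');$$ 3. (maximization of the Hamiltonian) at every $s\in[0,T)$ that is regular for $(X^*,u^*)$, $$\mathbb E\,H(s,X^*(s),m^*(s),\Psi(s),u^*(s))=\max_{\nu\in L^p(\Omega;U)}\mathbb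 E\,H(s,X^*(s),m^*(s),\Psi(s),\nu),$$ and, equivalently, for $\mathbb P$-a.e. $\omega$, $$H(s,X^*(s,\omega),m^*(s),\Psi(s,\omega),u^*(s,\omega))=\max_{u\in U}H(s,X^*(s,\omega),m^*(s),\Psi(s,\omega),u).$$ -/

import Mathlib

open MeasureTheory Set Filter Topology
open scoped ENNReal

namespace MFC

noncomputable section

/-! ### The state space and the Wasserstein space -/

/-- The state space `ℝᵈ` of column vectors, with its Euclidean norm. -/
abbrev Rd (d : ℕ) : Type := EuclideanSpace ℝ (Fin d)

/-- Row vectors `ℝ^{d,*}`, that is, linear functionals on `ℝᵈ`, with the (dual) Euclidean norm. -/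
abbrev RdStar (d : ℕ) : Type := Rd d →L[ℝ] ℝ

/-- `𝒫ᵖ(ℝᵈ)`: Borel probability measures on `ℝᵈ` with finite `p`-th moment. -/
structure PSpace (p : ℝ) (d : ℕ) where
  /-- the underlying measure -/
  meas : Measure (Rd d)
  isProb : IsProbabilityMeasure meas
  memLp : MemLp (fun x : Rd d => x) (ENNReal.ofReal p) meas

instance {p : ℝ} {d : ℕ} (m : PSpace p d) : IsProbabilityMeasure m.meas := m.isProb

/-- The plans between `μ` and `ν`: measures on the product with marginals `μ` and `ν`. -/
def plans {d : ℕ} (μ ν : Measure (Rd d)) : Set (Measure (Rd d × Rd d)) :=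
  {π | π.map Prod.fst = μ ∧ π.map Prod.snd = ν}

/-- The Wasserstein distance
`W_p(μ, ν) = inf_π (∫ ‖x' - x''‖ᵖ π(d(x', x'')))^{1/p}`, as an extended nonnegative number. -/
def wasserstein (p : ℝ) {d : ℕ} (μ ν : Measure (Rd d)) : ℝ≥0∞ :=
  ⨅ π ∈ plans μ ν, eLpNorm (fun z : Rd d × Rd d => z.1 - z.2) (ENNReal.ofReal p) π

lemma wasserstein_self (p : ℝ) {d : ℕ} (μ : Measure (Rd d)) : wasserstein p μ μ = 0 := by
  have hdiag : Measurable (fun x : Rd d => (x, x)) := by fun_prop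
  have hmem : μ.map (fun x => (x, x)) ∈ plans μ μ := by
    constructor
    · rw [Measure.map_map measurable_fst hdiag]; exact Measure.map_id
    · rw [Measure.map_map measurable_snd hdiag]; exact Measure.map_id
  refine le_antisymm (iInf₂_le_of_le _ hmem (le_of_eq ?_)) bot_le
  rw [eLpNorm_map_measure (by fun_prop) hdiag.aemeasurable]
  have : ((fun z : Rd d × Rd d => z.1 - z.2) ∘ fun x => (x, x)) = fun _ => 0 := by
    funext x; simp
  rw [this, eLpNorm_zero']

lemma wasserstein_le_symm (p : ℝ) {d : ℕ} (μ ν : Measure (Rd d)) :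
    wasserstein p μ ν ≤ wasserstein p ν μ := by
  refine le_iInf₂ fun π hπ => ?_
  have hmem : π.map Prod.swap ∈ plans μ ν := by
    constructor
    · rw [Measure.map_map measurable_fst measurable_swap]; exact hπ.2
    · rw [Measure.map_map measurable_snd measurable_swap]; exact hπ.1
  refine iInf₂_le_of_le _ hmem (le_of_eq ?_)
  rw [eLpNorm_map_measure (by fun_prop) measurable_swap.aemeasurable]
  have : ((fun z : Rd d × Rd d => z.1 - z.2) ∘ Prod.swap) = -(fun z : Rd d × Rd d => z.1 - z.2) := by
    funext x; simp
  rw [this, eLpNorm_neg]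

/-- Gluing of two plans with a common marginal. -/
lemma exists_glue {d : ℕ} (π₁ π₂ : Measure (Rd d × Rd d)) [IsProbabilityMeasure π₁]
    [IsProbabilityMeasure π₂] (h : π₁.map Prod.snd = π₂.map Prod.fst) :
    ∃ ρ : Measure ((Rd d × Rd d) × Rd d),
      ρ.map Prod.fst = π₁ ∧ ρ.map (fun z => (z.1.2, z.2)) = π₂ := by
  refine ⟨π₁.compProd (π₂.condKernel.comap Prod.snd measurable_snd), ?_, ?_⟩
  · exact Measure.fst_compProd _ _
  · have hg : Measurable (fun z : (Rd d × Rd d) × Rd d => (z.1.2, z.2)) := by fun_prop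
    refine Measure.ext_of_lintegral _ fun g hgm => ?_
    rw [lintegral_map hgm hg]
    have hc := Measure.lintegral_compProd (μ := π₁)
      (κ := π₂.condKernel.comap Prod.snd measurable_snd) (hgm.comp hg)
    simp only [Function.comp_def] at hc
    rw [hc]
    conv_rhs => rw [← π₂.disintegrate π₂.condKernel, Measure.lintegral_compProd hgm]
    have h' : π₂.fst = π₁.map Prod.snd := h.symm
    rw [h', lintegral_map _ measurable_snd]
    · simp
    · exact Measurable.lintegral_kernel_prod_right hgm

lemma wasserstein_triangle (p : ℝ) (hp : 1 < p) {d : ℕ} (μ₁ μ₂ μ₃ : Measure (Rd d))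
    [IsProbabilityMeasure μ₁] [IsProbabilityMeasure μ₂] :
    wasserstein p μ₁ μ₃ ≤ wasserstein p μ₁ μ₂ + wasserstein p μ₂ μ₃ := by
  refine ENNReal.le_iInf₂_add_iInf₂ fun π₁ h₁ π₂ h₂ => ?_
  have hp₁ : IsProbabilityMeasure π₁ := by
    constructor
    have := congrArg (fun m => m univ) h₁.1
    simpa [Measure.map_apply measurable_fst MeasurableSet.univ] using this
  have hp₂ : IsProbabilityMeasure π₂ := by
    constructor
    have := congrArg (fun m => m univ) h₂.1
    simpa [Measure.map_apply measurable_fst MeasurableSet.univ] using this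
  obtain ⟨ρ, hρ₁, hρ₂⟩ := exists_glue π₁ π₂ (h₁.2.trans h₂.1.symm)
  have m12 : Measurable (fun z : (Rd d × Rd d) × Rd d => (z.1.2, z.2)) := by fun_prop
  have m02 : Measurable (fun z : (Rd d × Rd d) × Rd d => (z.1.1, z.2)) := by fun_prop
  have hmem : ρ.map (fun z => (z.1.1, z.2)) ∈ plans μ₁ μ₃ := by
    constructor
    · rw [Measure.map_map measurable_fst m02, ← h₁.1, ← hρ₁,
        Measure.map_map measurable_fst measurable_fst]
      rfl
    · rw [Measure.map_map measurable_snd m02, ← h₂.2, ← hρ₂,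
        Measure.map_map measurable_snd m12]
      rfl
  refine iInf₂_le_of_le _ hmem ?_
  have hp1 : 1 ≤ ENNReal.ofReal p := by
    rw [← ENNReal.ofReal_one]; exact ENNReal.ofReal_le_ofReal hp.le
  rw [← hρ₁, ← hρ₂, eLpNorm_map_measure (by fun_prop) (by fun_prop),
    eLpNorm_map_measure (by fun_prop) (by fun_prop),
    eLpNorm_map_measure (by fun_prop) (by fun_prop)]
  refine le_trans (le_of_eq ?_) (eLpNorm_add_le (by fun_prop) (by fun_prop) hp1)
  congr 1
  funext z
  simp

/-- `𝒫ᵖ(ℝᵈ)` carries the distance `W_p` and the topology that it induces. -/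
instance {p : ℝ} [hp : Fact (1 < p)] {d : ℕ} : PseudoEMetricSpace (PSpace p d) where
  edist m m' := wasserstein p m.meas m'.meas
  edist_self m := wasserstein_self p m.meas
  edist_comm m m' := le_antisymm (wasserstein_le_symm p _ _) (wasserstein_le_symm p _ _)
  edist_triangle m₁ m₂ m₃ := wasserstein_triangle p hp.out _ _ _

/-- The root `M_p(m) = (∫ ‖x‖ᵖ m(dx))^{1/p}` of the `p`-th moment. -/
def PSpace.Mp {p : ℝ} {d : ℕ} (m : PSpace p d) : ℝ := (∫ x, ‖x‖ ^ p ∂m.meas) ^ (1 / p)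

/-- The mixture `(1 - s) m + s m'`, for `s ∈ [0, 1]`. -/
def PSpace.mix {p : ℝ} {d : ℕ} (s : unitInterval) (m m' : PSpace p d) : PSpace p d where
  meas := ENNReal.ofReal (1 - s) • m.meas + ENNReal.ofReal s • m'.meas
  isProb := ⟨by
    have h0 := s.2.1
    have h1 := s.2.2
    simp only [Measure.coe_add, Measure.coe_smul, Pi.add_apply, Pi.smul_apply, measure_univ,
      smul_eq_mul, mul_one]
    rw [← ENNReal.ofReal_add (by linarith) h0]
    simp⟩
  memLp := by
    have h := m.memLp.smul_measure (c := ENNReal.ofReal (1 - s)) ENNReal.ofReal_ne_top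
    have h' := m'.memLp.smul_measure (c := ENNReal.ofReal s) ENNReal.ofReal_ne_top
    refine ⟨by fun_prop, ?_⟩
    by_cases hp : ENNReal.ofReal p = 0
    · simp [hp]
    · have ht : ENNReal.ofReal p ≠ ∞ := ENNReal.ofReal_ne_top
      rw [eLpNorm_lt_top_iff_lintegral_rpow_enorm_lt_top hp ht, lintegral_add_measure]
      exact ENNReal.add_lt_top.2 ⟨lintegral_rpow_enorm_lt_top_of_eLpNorm_lt_top hp ht h.2,
        lintegral_rpow_enorm_lt_top_of_eLpNorm_lt_top hp ht h'.2⟩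

/-- The law `X ♯ P` of a random vector `X ∈ Lᵖ(Ω; ℝᵈ)`. -/
def PSpace.law {p : ℝ} {d : ℕ} {Ω : Type*} [MeasurableSpace Ω] (P : Measure Ω)
    [IsProbabilityMeasure P] (X : Ω → Rd d) (hX : MemLp X (ENNReal.ofReal p) P) :
    PSpace p d where
  meas := P.map X
  isProb := Measure.isProbabilityMeasure_map hX.1.aemeasurable
  memLp := (memLp_map_measure_iff (by fun_prop) hX.1.aemeasurable).2 hX

/-! ### Derivatives with respect to a measure -/

section Derivative

variable {p : ℝ} [Fact (1 < p)] {d : ℕ} {F : Type*} [NormedAddCommGroup F] [NormedSpace ℝ F]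

/-- `δΦ : 𝒫ᵖ(ℝᵈ) × ℝᵈ → F` is a flat derivative of `Φ`. It is unique up to the addition of a
function of `m`; that function does not affect the intrinsic derivative below. -/
structure IsFlatDeriv (Φ : PSpace p d → F) (δΦ : PSpace p d → Rd d → F) : Prop where
  continuous : Continuous fun z : PSpace p d × Rd d => δΦ z.1 z.2
  integrable : ∀ m m' : PSpace p d, Integrable (δΦ m) m'.meas
  tendsto : ∀ m m' : PSpace p d,
    Tendsto (fun s : unitInterval => (s : ℝ)⁻¹ • (Φ (PSpace.mix s m m') - Φ m)) (𝓝[>] 0)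
      (𝓝 (∫ y, δΦ m y ∂m'.meas - ∫ y, δΦ m y ∂m.meas))

open Classical in
/-- A flat derivative of `Φ`, if there is one. -/
def flatDeriv (Φ : PSpace p d → F) : PSpace p d → Rd d → F :=
  if h : ∃ δΦ, IsFlatDeriv Φ δΦ then h.choose else 0

/-- The intrinsic derivative `∇_m Φ(m, y) = ∇_y (δΦ/δm)(m, y)`. -/
def intrinsicDeriv (Φ : PSpace p d → F) (m : PSpace p d) (y : Rd d) : Rd d →L[ℝ] F :=
  fderiv ℝ (flatDeriv Φ m) y

/-- `Φ` is of class `C¹` in the flat sense and its flat derivative is differentiable in `y`,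
so that the intrinsic derivative exists. -/
def HasIntrinsicDeriv (Φ : PSpace p d → F) : Prop :=
  (∃ δΦ, IsFlatDeriv Φ δΦ) ∧ ∀ m, Differentiable ℝ (flatDeriv Φ m)

end Derivative

/-! ### The control problem -/

/-- The data of the mean field type control problem: the horizon `T > 0`, conjugate exponents
`p, q > 1`, the control set `U`, the dynamics `f`, the running cost `f₀` and the terminal cost
`σ`. Only the values of `f`, `f₀` at times in `[0, T]` and controls in `U` matter. -/
structure Problem (d : ℕ) (V : Type*) where
  T : ℝ
  T_pos : 0 < T
  p : ℝ
  q : ℝ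
  hpq : p.HolderConjugate q
  U : Set V
  f : ℝ → Rd d → PSpace p d → V → Rd d
  f₀ : ℝ → Rd d → PSpace p d → V → ℝ
  σ : Rd d → PSpace p d → ℝ

namespace Problem

variable {d : ℕ} {V : Type*}

instance (𝒞 : Problem d V) : Fact (1 < 𝒞.p) := ⟨𝒞.hpq.lt⟩

/-- Paths `C([0, T], F)` with the sup norm: `Γ` for `F = ℝᵈ` and `Γ*` for `F = ℝ^{d,*}`. -/
abbrev Path (𝒞 : Problem d V) (F : Type*) [TopologicalSpace F] : Type _ := C(Icc (0 : ℝ) 𝒞.T, F)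

/-- The value `γ(t)` of a path at `t ∈ [0, T]` (constant continuation outside `[0, T]`). -/
def ev (𝒞 : Problem d V) {F : Type*} [TopologicalSpace F] (γ : 𝒞.Path F) (t : ℝ) : F :=
  IccExtend 𝒞.T_pos.le γ t

section State

variable (𝒞 : Problem d V) {Ω : Type*} [MeasurableSpace Ω] (P : Measure Ω)

/-- The space `𝒳ᵖ = Lᵖ(Ω; Γ)`. -/
structure State where
  path : Ω → 𝒞.Path (Rd d)
  memLp : MemLp path (ENNReal.ofReal 𝒞.p) P

variable {𝒞 P}

/-- The random vector `X(t)`. -/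
def State.at (X : 𝒞.State P) (t : ℝ) (ω : Ω) : Rd d := 𝒞.ev (X.path ω) t

lemma State.memLp_at (X : 𝒞.State P) (t : ℝ) : MemLp (X.at t) (ENNReal.ofReal 𝒞.p) P := by
  refine X.memLp.of_le ?_ (Eventually.of_forall fun ω => ?_)
  · exact (continuous_eval_const (projIcc 0 𝒞.T 𝒞.T_pos.le t)).comp_aestronglyMeasurable X.memLp.1
  · exact (X.path ω).norm_coe_le_norm _

variable [IsProbabilityMeasure P]

/-- The law `X(t) ♯ P`. -/
def State.law (X : 𝒞.State P) (t : ℝ) : PSpace 𝒞.p d := PSpace.law P (X.at t) (X.memLp_at t)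

end State

variable [NormedAddCommGroup V]

/-- The standing assumptions on the data. -/
structure Assumptions (𝒞 : Problem d V) : Prop where
  U_closed : IsClosed 𝒞.U
  -- continuity
  f_cont : ContinuousOn (fun z : ℝ × Rd d × PSpace 𝒞.p d × V => 𝒞.f z.1 z.2.1 z.2.2.1 z.2.2.2)
    (Icc 0 𝒞.T ×ˢ univ ×ˢ univ ×ˢ 𝒞.U)
  f₀_cont : ContinuousOn (fun z : ℝ × Rd d × PSpace 𝒞.p d × V => 𝒞.f₀ z.1 z.2.1 z.2.2.1 z.2.2.2)
    (Icc 0 𝒞.T ×ˢ univ ×ˢ univ ×ˢ 𝒞.U)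
  σ_cont : Continuous fun z : Rd d × PSpace 𝒞.p d => 𝒞.σ z.1 z.2
  -- growth
  growth : ∃ C : ℝ,
    (∀ t ∈ Icc 0 𝒞.T, ∀ x m, ∀ u ∈ 𝒞.U, ‖𝒞.f t x m u‖ ≤ C * (1 + ‖x‖ + m.Mp + ‖u‖)) ∧
    (∀ t ∈ Icc 0 𝒞.T, ∀ x m, ∀ u ∈ 𝒞.U,
      |𝒞.f₀ t x m u| ≤ C * (1 + ‖x‖ ^ 𝒞.p + m.Mp ^ 𝒞.p + ‖u‖ ^ 𝒞.p)) ∧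
    (∀ x m, |𝒞.σ x m| ≤ C * (1 + ‖x‖ ^ 𝒞.p + m.Mp ^ 𝒞.p))
  -- modulus of continuity in time
  modulus : ∃ ς : ℝ → ℝ, (∀ r, 0 ≤ r → 0 ≤ ς r) ∧ Tendsto ς (𝓝[≥] 0) (𝓝 0) ∧
    (∀ t₁ ∈ Icc 0 𝒞.T, ∀ t₂ ∈ Icc 0 𝒞.T, ∀ x m, ∀ u ∈ 𝒞.U,
      ‖𝒞.f t₁ x m u - 𝒞.f t₂ x m u‖ ≤ ς |t₁ - t₂| * (1 + ‖x‖ + m.Mp + ‖u‖)) ∧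
    (∀ t₁ ∈ Icc 0 𝒞.T, ∀ t₂ ∈ Icc 0 𝒞.T, ∀ x m, ∀ u ∈ 𝒞.U,
      |𝒞.f₀ t₁ x m u - 𝒞.f₀ t₂ x m u|
        ≤ ς |t₁ - t₂| * (1 + ‖x‖ ^ 𝒞.p + m.Mp ^ 𝒞.p + ‖u‖ ^ 𝒞.p))
  -- derivatives of the dynamics
  f_diff_x : ∀ t ∈ Icc 0 𝒞.T, ∀ m, ∀ u ∈ 𝒞.U, Differentiable ℝ fun x => 𝒞.f t x m u
  f_diff_m : ∀ t ∈ Icc 0 𝒞.T, ∀ x, ∀ u ∈ 𝒞.U, HasIntrinsicDeriv fun m => 𝒞.f t x m u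
  f_x_cont : ContinuousOn (fun z : ℝ × Rd d × PSpace 𝒞.p d × V =>
      fderiv ℝ (fun x => 𝒞.f z.1 x z.2.2.1 z.2.2.2) z.2.1)
    (Icc 0 𝒞.T ×ˢ univ ×ˢ univ ×ˢ 𝒞.U)
  f_m_cont : ContinuousOn (fun z : ℝ × Rd d × PSpace 𝒞.p d × Rd d × V =>
      intrinsicDeriv (fun m => 𝒞.f z.1 z.2.1 m z.2.2.2.2) z.2.2.1 z.2.2.2.1)
    (Icc 0 𝒞.T ×ˢ univ ×ˢ univ ×ˢ univ ×ˢ 𝒞.U)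
  f_x_bound : ∃ C : ℝ, ∀ t ∈ Icc 0 𝒞.T, ∀ x m, ∀ u ∈ 𝒞.U,
    ‖fderiv ℝ (fun x => 𝒞.f t x m u) x‖ ≤ C
  f_m_bound : ∃ C : ℝ, ∀ t ∈ Icc 0 𝒞.T, ∀ x m y, ∀ u ∈ 𝒞.U,
    ‖intrinsicDeriv (fun m => 𝒞.f t x m u) m y‖ ≤ C
  -- derivatives of the running cost
  f₀_diff_x : ∀ t ∈ Icc 0 𝒞.T, ∀ m, ∀ u ∈ 𝒞.U, Differentiable ℝ fun x => 𝒞.f₀ t x m u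
  f₀_diff_m : ∀ t ∈ Icc 0 𝒞.T, ∀ x, ∀ u ∈ 𝒞.U, HasIntrinsicDeriv fun m => 𝒞.f₀ t x m u
  f₀_x_cont : ContinuousOn (fun z : ℝ × Rd d × PSpace 𝒞.p d × V =>
      fderiv ℝ (fun x => 𝒞.f₀ z.1 x z.2.2.1 z.2.2.2) z.2.1)
    (Icc 0 𝒞.T ×ˢ univ ×ˢ univ ×ˢ 𝒞.U)
  f₀_m_cont : ContinuousOn (fun z : ℝ × Rd d × PSpace 𝒞.p d × Rd d × V =>
      intrinsicDeriv (fun m => 𝒞.f₀ z.1 z.2.1 m z.2.2.2.2) z.2.2.1 z.2.2.2.1)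
    (Icc 0 𝒞.T ×ˢ univ ×ˢ univ ×ˢ univ ×ˢ 𝒞.U)
  f₀_x_bound : ∃ C : ℝ, ∀ t ∈ Icc 0 𝒞.T, ∀ x m, ∀ u ∈ 𝒞.U,
    ‖fderiv ℝ (fun x => 𝒞.f₀ t x m u) x‖ ^ 𝒞.q
      ≤ C * (1 + ‖x‖ ^ 𝒞.p + m.Mp ^ 𝒞.p + ‖u‖ ^ 𝒞.p)
  f₀_m_bound : ∃ C : ℝ, ∀ t ∈ Icc 0 𝒞.T, ∀ x m y, ∀ u ∈ 𝒞.U,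
    ‖intrinsicDeriv (fun m => 𝒞.f₀ t x m u) m y‖ ^ 𝒞.q
      ≤ C * (1 + ‖x‖ ^ 𝒞.p + ‖y‖ ^ 𝒞.p + m.Mp ^ 𝒞.p + ‖u‖ ^ 𝒞.p)
  -- derivatives of the terminal cost
  σ_diff_x : ∀ m, Differentiable ℝ fun x => 𝒞.σ x m
  σ_diff_m : ∀ x, HasIntrinsicDeriv fun m => 𝒞.σ x m
  σ_x_cont : Continuous fun z : Rd d × PSpace 𝒞.p d => fderiv ℝ (fun x => 𝒞.σ x z.2) z.1
  σ_m_cont : Continuous fun z : Rd d × PSpace 𝒞.p d × Rd d =>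
    intrinsicDeriv (fun m => 𝒞.σ z.1 m) z.2.1 z.2.2
  σ_x_bound : ∃ C : ℝ, ∀ x m,
    ‖fderiv ℝ (fun x => 𝒞.σ x m) x‖ ^ 𝒞.q ≤ C * (1 + ‖x‖ ^ 𝒞.p + m.Mp ^ 𝒞.p)
  σ_m_bound : ∃ C : ℝ, ∀ x m y,
    ‖intrinsicDeriv (fun m => 𝒞.σ x m) m y‖ ^ 𝒞.q
      ≤ C * (1 + ‖x‖ ^ 𝒞.p + ‖y‖ ^ 𝒞.p + m.Mp ^ 𝒞.p)

section Spaces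

variable (𝒞 : Problem d V) {Ω : Type*} [MeasurableSpace Ω] (P : Measure Ω)

/-- The space `𝒰ᵖ` of controls: jointly measurable maps `[0, T] × Ω → U` with
`∫₀ᵀ ∫_Ω ‖u(t, ω)‖ᵖ P(dω) dt < ∞`. -/
structure Control where
  val : ℝ → Ω → V
  meas : StronglyMeasurable fun z : Icc (0 : ℝ) 𝒞.T × Ω => val z.1 z.2
  mem : ∀ t ∈ Icc 0 𝒞.T, ∀ ω, val t ω ∈ 𝒞.U
  memLp : MemLp (fun z : ℝ × Ω => val z.1 z.2) (ENNReal.ofReal 𝒞.p)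
    ((volume.restrict (Icc 0 𝒞.T)).prod P)

end Spaces

/-- `x` solves `dx/dt = b(t)` on `[0, T]`: `b` is integrable and
`x(t) = x(0) + ∫₀ᵗ b(τ) dτ` for every `t ∈ [0, T]`. -/
def Solves (𝒞 : Problem d V) {F : Type*} [NormedAddCommGroup F] [NormedSpace ℝ F]
    (x : 𝒞.Path F) (b : ℝ → F) : Prop :=
  IntervalIntegrable b volume 0 𝒞.T ∧
    ∀ t ∈ Icc 0 𝒞.T, 𝒞.ev x t = 𝒞.ev x 0 + ∫ τ in (0 : ℝ)..t, b τ

section Minimizers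

variable (𝒞 : Problem d V) {Ω : Type*} [MeasurableSpace Ω] {P : Measure Ω}
  [IsProbabilityMeasure P]

/-- `(X, u)` is a Lagrangian control process. -/
def IsLagrangian (X : 𝒞.State P) (u : 𝒞.Control P) : Prop :=
  ∀ᵐ ω ∂P, 𝒞.Solves (X.path ω) fun t => 𝒞.f t (X.at t ω) (X.law t) (u.val t ω)

/-- The payoff `J_L(X, u)`. -/
def payoff (X : 𝒞.State P) (u : 𝒞.Control P) : ℝ :=
  ∫ ω, (𝒞.σ (X.at 𝒞.T ω) (X.law 𝒞.T)
    + ∫ t in (0 : ℝ)..𝒞.T, 𝒞.f₀ t (X.at t ω) (X.law t) (u.val t ω)) ∂P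

/-- `(X, u) ∈ 𝒜_L(X₀)`: a control process with the initial assignment `X₀`. -/
def MemA (X₀ : Ω → Rd d) (X : 𝒞.State P) (u : 𝒞.Control P) : Prop :=
  𝒞.IsLagrangian X u ∧ X.at 0 =ᵐ[P] X₀

/-- `(X, u) ∈ Adm_L(m₀)`: a control process with the initial distribution `m₀`. -/
def MemAdm (m₀ : PSpace 𝒞.p d) (X : 𝒞.State P) (u : 𝒞.Control P) : Prop :=
  𝒞.IsLagrangian X u ∧ X.law 0 = m₀

/-- `(λ ⊗ P){(t, ω) ∈ [0, T] × Ω : u(t, ω) ≠ v(t, ω)}`. -/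
def controlDiff (u v : 𝒞.Control P) : ℝ≥0∞ :=
  ((volume.restrict (Icc 0 𝒞.T)).prod P) {z : ℝ × Ω | u.val z.1 z.2 ≠ v.val z.1 z.2}

/-- `(X⋆, u⋆)` is a strong local `Lᵖ`-minimizer at `X₀`. -/
def IsStrongLpMin (X₀ : Ω → Rd d) (X' : 𝒞.State P) (u' : 𝒞.Control P) : Prop :=
  𝒞.MemA X₀ X' u' ∧ ∃ ε : ℝ, 0 < ε ∧ ∀ (X : 𝒞.State P) (u : 𝒞.Control P), 𝒞.MemA X₀ X u →
    eLpNorm (X.path - X'.path) (ENNReal.ofReal 𝒞.p) P ≤ ENNReal.ofReal ε →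
    𝒞.payoff X' u' ≤ 𝒞.payoff X u

/-- `(X⋆, u⋆)` is a strong local `W_p`-minimizer at `m₀`. -/
def IsStrongWpMin (m₀ : PSpace 𝒞.p d) (X' : 𝒞.State P) (u' : 𝒞.Control P) : Prop :=
  𝒞.MemAdm m₀ X' u' ∧ ∃ ε : ℝ, 0 < ε ∧ ∀ (X : 𝒞.State P) (u : 𝒞.Control P), 𝒞.MemAdm m₀ X u →
    (∀ t ∈ Icc 0 𝒞.T,
      wasserstein 𝒞.p (X.law t).meas (X'.law t).meas ≤ ENNReal.ofReal ε) →
    𝒞.payoff X' u' ≤ 𝒞.payoff X u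

/-- `(X⋆, u⋆)` is a Pontryagin local `W_p`-minimizer at `m₀`. -/
def IsPontryaginWpMin (m₀ : PSpace 𝒞.p d) (X' : 𝒞.State P) (u' : 𝒞.Control P) : Prop :=
  𝒞.MemAdm m₀ X' u' ∧ ∃ ε : ℝ, 0 < ε ∧ ∀ (X : 𝒞.State P) (u : 𝒞.Control P), 𝒞.MemAdm m₀ X u →
    (∀ t ∈ Icc 0 𝒞.T,
      wasserstein 𝒞.p (X.law t).meas (X'.law t).meas ≤ ENNReal.ofReal ε) →
    𝒞.controlDiff u' u ≤ ENNReal.ofReal ε →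
    𝒞.payoff X' u' ≤ 𝒞.payoff X u

/-! ### The objects in the maximum principle -/

/-- The time `t` is regular for the process `(X, u)`. The `Lᵖ`- and `L¹`-seminorms are used in
place of their powers, and `t + h ≤ T` for all small `h > 0` requires `t < T`. -/
def IsRegular (X : 𝒞.State P) (u : 𝒞.Control P) (t : ℝ) : Prop :=
  t ∈ Ico 0 𝒞.T ∧ eLpNorm (u.val t) (ENNReal.ofReal 𝒞.p) P < ∞ ∧
  Tendsto (fun h : ℝ => eLpNorm (fun ω =>
      (1 / h) • (∫ τ in t..(t + h), 𝒞.f τ (X.at τ ω) (X.law τ) (u.val τ ω))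
        - 𝒞.f t (X.at t ω) (X.law t) (u.val t ω)) (ENNReal.ofReal 𝒞.p) P) (𝓝[>] 0) (𝓝 0) ∧
  Tendsto (fun h : ℝ => eLpNorm (fun ω =>
      (1 / h) • (∫ τ in t..(t + h), 𝒞.f₀ τ (X.at τ ω) (X.law τ) (u.val τ ω))
        - 𝒞.f₀ t (X.at t ω) (X.law t) (u.val t ω)) 1 P) (𝓝[>] 0) (𝓝 0)

/-- The Pontryagin function `H(t, x, m, ψ, u) = ψ f(t, x, m, u) - f₀(t, x, m, u)`. -/
def hamiltonian (t : ℝ) (x : Rd d) (m : PSpace 𝒞.p d) (ψ : RdStar d) (u : V) : ℝ :=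
  ψ (𝒞.f t x m u) - 𝒞.f₀ t x m u

/-- `ℍ(t, X, Ψ, ν) = 𝔼 H(t, X, X ♯ P, Ψ, ν)` for `X ∈ Lᵖ(Ω; ℝᵈ)`. -/
def meanHamiltonian (t : ℝ) (X : Ω → Rd d) (hX : MemLp X (ENNReal.ofReal 𝒞.p) P)
    (Ψ : Ω → RdStar d) (ν : Ω → V) : ℝ :=
  ∫ ω, 𝒞.hamiltonian t (X ω) (PSpace.law P X hX) (Ψ ω) (ν ω) ∂P

/-- The costate equation: for a.e. `ω`, `Ψ(·, ω)` solves
`dΨ/dt = -Ψ ∇ₓf + ∇ₓf₀ - ∫ Ψ(t, ω') ∇ₘf(t, X(t, ω'), X(t)♯P, X(t, ω), u(t, ω')) P(dω')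
  + ∫ ∇ₘf₀(t, X(t, ω'), X(t)♯P, X(t, ω), u(t, ω')) P(dω')`. -/
def CostateEquation (X : 𝒞.State P) (u : 𝒞.Control P) (Ψ : Ω → 𝒞.Path (RdStar d)) : Prop :=
  ∀ᵐ ω ∂P, 𝒞.Solves (Ψ ω) fun t =>
    -((𝒞.ev (Ψ ω) t).comp (fderiv ℝ (fun x => 𝒞.f t x (X.law t) (u.val t ω)) (X.at t ω)))
    + fderiv ℝ (fun x => 𝒞.f₀ t x (X.law t) (u.val t ω)) (X.at t ω)
    - ∫ ω', (𝒞.ev (Ψ ω') t).comp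
        (intrinsicDeriv (fun m => 𝒞.f t (X.at t ω') m (u.val t ω')) (X.law t) (X.at t ω)) ∂P
    + ∫ ω', intrinsicDeriv (fun m => 𝒞.f₀ t (X.at t ω') m (u.val t ω')) (X.law t) (X.at t ω) ∂P

/-- The transversality condition at time `T`. -/
def Transversality (X : 𝒞.State P) (Ψ : Ω → 𝒞.Path (RdStar d)) : Prop :=
  ∀ᵐ ω ∂P, 𝒞.ev (Ψ ω) 𝒞.T =
    -fderiv ℝ (fun x => 𝒞.σ x (X.law 𝒞.T)) (X.at 𝒞.T ω)
    - ∫ ω', intrinsicDeriv (fun m => 𝒞.σ (X.at 𝒞.T ω') m) (X.law 𝒞.T) (X.at 𝒞.T ω) ∂P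

/-- The admissible values `ν ∈ Lᵖ(Ω; U)` of the control at a fixed time. -/
def LpU (P : Measure Ω) : Set (Ω → V) :=
  {ν | MemLp ν (ENNReal.ofReal 𝒞.p) P ∧ ∀ ω, ν ω ∈ 𝒞.U}

/-- Maximization of the Hamiltonian at time `s`, integral form. -/
def IntegralMaximum (X : 𝒞.State P) (u : 𝒞.Control P) (Ψ : Ω → 𝒞.Path (RdStar d)) (s : ℝ) :
    Prop :=
  IsGreatest ((fun ν => 𝒞.meanHamiltonian s (X.at s) (X.memLp_at s) (fun ω => 𝒞.ev (Ψ ω) s) ν)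
      '' 𝒞.LpU P)
    (𝒞.meanHamiltonian s (X.at s) (X.memLp_at s) (fun ω => 𝒞.ev (Ψ ω) s) (u.val s))

/-- Maximization of the Hamiltonian at time `s`, pointwise form. -/
def PointwiseMaximum (X : 𝒞.State P) (u : 𝒞.Control P) (Ψ : Ω → 𝒞.Path (RdStar d)) (s : ℝ) :
    Prop :=
  ∀ᵐ ω ∂P, IsGreatest
    ((fun v => 𝒞.hamiltonian s (X.at s ω) (X.law s) (𝒞.ev (Ψ ω) s) v) '' 𝒞.U)
    (𝒞.hamiltonian s (X.at s ω) (X.law s) (𝒞.ev (Ψ ω) s) (u.val s ω))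

end Minimizers

end Problem

end

end MFC

/-!
The maximum principle is proved with needle variations: the control `u` of the minimizer is
replaced by a competing value `ν` on a short time interval `(s, s + η]`, the cost is expanded to
the first order in `η`, and the costate turns the linear part of the expansion into a difference of
Hamiltonians.

*Existence.* The state and the costate both solve Volterra equations in `L^r(Ω; C([0, T], F))`
whose driver depends in a Lipschitz way on the value of the random path and on its `L^r`-norm at
the current time. Such an equation has a solution, and an approximate solution is close to it
(`IsVolterraDriver.exists_solution`, `IsVolterraDriver.eLpNorm_sub_le`), because the integral
operator is a contraction for an exponentially weighted norm. This yields `Problem.exists_state`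
and `Problem.exists_costate`.

*Differentiation in the measure.* A flat derivative controls a function only along segments of
mixtures. The segment between the laws of two random vectors `Y` and `Y'` is continuous for the
Wasserstein metric, and on it the mean value inequality, combined with the derivative of the flat
derivative in the space variable, gives an expansion whose linear part is the pairing of the
intrinsic derivative with `Y' - Y` (`IsFlatDeriv.exists_expansion`). The measures on the segment
are mixtures, not laws of interpolations, so nothing is required of the probability space.

*Needles.* At a regular time the states of needles of length `η` differ from the original state by
`O(η)` in `L^p` at each time, while the supremum over time is only `O(η ^ (1 - 1 / p))`
(`Problem.exists_needle_state`). Along a sequence of sufficiently short needles the states converge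
almost surely with a domination in `L^p` (`Problem.exists_isNeedleSequence`), so that the
remainders of the expansions of the terminal cost and of the Hamiltonian are `o(η)`
(`Problem.IsNeedleSequence.tendsto_terminal`, `Problem.IsNeedleSequence.tendsto_running`).

*The increment of the cost.* By the costate equation, transversality and an integration by parts,
the increment of the cost is the sum of these remainders and of minus the integral over the needle
of the difference of the Hamiltonians with the controls `ν` and `u` (`Problem.payoff_sub_eq`).
Divided by `η`, the Hamiltonian with the control `ν` converges by dominated convergence
(`Problem.IsNeedleSequence.tendsto_mean_hamAlong_const`), and the one with the control `u`
converges by the regularity of `s` (`Problem.IsRegular.tendsto_mean_hamAlong`). A minimizer of any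
of the three kinds admits all sufficiently short needles as competitors, which gives the maximum
condition in integral form (`Problem.IsRegular.integralMaximum`).

*The pointwise form.* For a fixed `v` in `U`, the integral form is applied to the control that
takes the value `v` exactly where this raises the Hamiltonian. Countably many values `v` suffice,
although `U` need not be separable, since the sets of positions, costates and levels at which a
value of the control exceeds the level are open in a second countable space
(`Problem.IntegralMaximum.pointwiseMaximum`).
-/

set_option linter.unusedSectionVars false

namespace MFC

/-! ### Measurability, dominated convergence and Hölder's inequality -/

/-- Continuity on a closed set that carries almost all values suffices for the measurability of a
composition. The values outside the set are arbitrary, as are the data at times outside `[0, T]` and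
at control values outside `U`. -/
lemma aestronglyMeasurable_comp_of_continuousOn {β Z E : Type*} [MeasurableSpace β]
    {μ : Measure β} [TopologicalSpace Z] [TopologicalSpace.PseudoMetrizableSpace Z]
    [TopologicalSpace E] {S : Set Z} (hS : IsClosed S) {φ : Z → E} (hφ : ContinuousOn φ S)
    {g : β → Z} (hg : AEStronglyMeasurable g μ) (hgS : ∀ᵐ x ∂μ, g x ∈ S) :
    AEStronglyMeasurable (fun x => φ (g x)) μ := by
  rcases S.eq_empty_or_nonempty with rfl | hne
  · have : μ = 0 := by simpa [ae_eq_bot] using hgS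
    subst this
    exact aestronglyMeasurable_zero_measure _
  · borelize Z
    obtain ⟨g', hg', hmem, heq⟩ :=
      AEStronglyMeasurable.exists_stronglyMeasurable_range_subset hg hS.measurableSet hne hgS
    have h1 : StronglyMeasurable fun x => (⟨g' x, hmem x⟩ : S) :=
      (Embedding.comp_stronglyMeasurable_iff (g := ((↑) : S → Z)) IsEmbedding.subtypeVal).1 hg'
    have h2 : StronglyMeasurable fun x => φ (g' x) :=
      (continuousOn_iff_continuous_domRestrict.1 hφ).comp_stronglyMeasurable h1
    refine ⟨_, h2, ?_⟩
    filter_upwards [heq] with x hx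
    rw [hx]

lemma memLp_of_norm_rpow_le {β E : Type*} [MeasurableSpace β] {μ : Measure β}
    [NormedAddCommGroup E] {q : ℝ} (hq : 0 < q) {g : β → E} (hg : AEStronglyMeasurable g μ)
    {b : β → ℝ} (hb : Integrable b μ) (h : ∀ᵐ x ∂μ, ‖g x‖ ^ q ≤ b x) :
    MemLp g (ENNReal.ofReal q) μ := by
  have hq0 : ENNReal.ofReal q ≠ 0 := by simpa using hq
  rw [← integrable_norm_rpow_iff hg hq0 ENNReal.ofReal_ne_top, ENNReal.toReal_ofReal hq.le]
  refine hb.mono' ((Real.continuous_rpow_const hq.le).comp_aestronglyMeasurable hg.norm) ?_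
  filter_upwards [h] with x hx
  rwa [Real.norm_of_nonneg (by positivity)]

lemma integrable_norm_rpow {β E : Type*} [MeasurableSpace β] {μ : Measure β}
    [NormedAddCommGroup E] {q : ℝ} (hq : 0 < q) {g : β → E} (hg : MemLp g (ENNReal.ofReal q) μ) :
    Integrable (fun x => ‖g x‖ ^ q) μ := by
  have hq0 : ENNReal.ofReal q ≠ 0 := by simpa using hq
  simpa [ENNReal.toReal_ofReal hq.le] using
    (integrable_norm_rpow_iff hg.1 hq0 ENNReal.ofReal_ne_top).2 hg

/-- Dominated convergence in `L^q`, the domination being that of the `q`-th powers. -/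
lemma tendsto_eLpNorm_zero_of_dominated {β ι E : Type*} [MeasurableSpace β] {μ : Measure β}
    [NormedAddCommGroup E] {q : ℝ} (hq : 0 < q) {l : Filter ι} [l.IsCountablyGenerated]
    {g : ι → β → E} (hg : ∀ᶠ i in l, AEStronglyMeasurable (g i) μ)
    {b : β → ℝ} (hb : Integrable b μ) (h : ∀ᶠ i in l, ∀ᵐ x ∂μ, ‖g i x‖ ^ q ≤ b x)
    (hlim : ∀ᵐ x ∂μ, Tendsto (fun i => g i x) l (𝓝 0)) :
    Tendsto (fun i => eLpNorm (g i) (ENNReal.ofReal q) μ) l (𝓝 0) := by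
  have hq0 : ENNReal.ofReal q ≠ 0 := by simpa using hq
  have key : Tendsto (fun i => ∫⁻ x, ‖g i x‖ₑ ^ q ∂μ) l (𝓝 (∫⁻ _, 0 ∂μ)) := by
    refine tendsto_lintegral_filter_of_dominated_convergence' (fun x => ‖b x‖ₑ) ?_ ?_ hb.2.ne ?_
    · filter_upwards [hg] with i hi
      exact hi.enorm.pow_const _
    · filter_upwards [h] with i hi
      filter_upwards [hi] with x hx
      rw [← ofReal_norm, ENNReal.ofReal_rpow_of_nonneg (norm_nonneg _) hq.le,
        ← ofReal_norm]
      exact ENNReal.ofReal_le_ofReal (hx.trans (le_abs_self _))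
    · filter_upwards [hlim] with x hx
      have h1 : Tendsto (fun i => ‖g i x‖ₑ) l (𝓝 0) := by
        simpa [Function.comp_def] using (continuous_enorm.tendsto _).comp hx
      simpa [hq] using h1.ennrpow_const q
  have h2 := key.ennrpow_const (1 / q)
  simp only [lintegral_zero] at h2
  rw [ENNReal.zero_rpow_of_pos (by positivity)] at h2
  refine h2.congr fun i => ?_
  rw [eLpNorm_eq_lintegral_rpow_enorm_toReal hq0 ENNReal.ofReal_ne_top,
    ENNReal.toReal_ofReal hq.le]

lemma lintegral_enorm_mul_le {β E F : Type*} [MeasurableSpace β] (μ : Measure β)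
    [NormedAddCommGroup E] [NormedAddCommGroup F] {p q : ℝ} (hpq : p.HolderConjugate q)
    {f : β → E} {g : β → F} (hf : AEStronglyMeasurable f μ) (hg : AEStronglyMeasurable g μ) :
    ∫⁻ x, ‖f x‖ₑ * ‖g x‖ₑ ∂μ
      ≤ eLpNorm f (ENNReal.ofReal q) μ * eLpNorm g (ENNReal.ofReal p) μ := by
  have hq0 : ENNReal.ofReal q ≠ 0 := by simpa using hpq.symm.pos
  have hp0 : ENNReal.ofReal p ≠ 0 := by simpa using hpq.pos
  rw [eLpNorm_eq_lintegral_rpow_enorm_toReal hq0 ENNReal.ofReal_ne_top,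
    eLpNorm_eq_lintegral_rpow_enorm_toReal hp0 ENNReal.ofReal_ne_top,
    ENNReal.toReal_ofReal hpq.pos.le, ENNReal.toReal_ofReal hpq.symm.pos.le]
  exact ENNReal.lintegral_mul_le_Lp_mul_Lq μ hpq.symm hf.enorm hg.enorm

lemma integrable_clm_apply {β E F : Type*} [MeasurableSpace β] {μ : Measure β}
    [NormedAddCommGroup E] [NormedSpace ℝ E] [NormedAddCommGroup F] [NormedSpace ℝ F]
    {p q : ℝ} (hpq : p.HolderConjugate q)
    {f : β → E →L[ℝ] F} {g : β → E} (hf : MemLp f (ENNReal.ofReal q) μ)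
    (hg : MemLp g (ENNReal.ofReal p) μ) : Integrable (fun x => f x (g x)) μ := by
  refine ⟨?_, ?_⟩
  · exact (isBoundedBilinearMap_apply.continuous (𝕜 := ℝ)).comp_aestronglyMeasurable
      (hf.1.prodMk hg.1)
  · refine lt_of_le_of_lt (lintegral_mono fun x => ?_) (lt_of_le_of_lt
      (lintegral_enorm_mul_le μ hpq hf.1 hg.1) (ENNReal.mul_lt_top hf.2 hg.2))
    exact (f x).le_opENorm (g x)

lemma one_le_ofReal {p : ℝ} (hp : 1 < p) : 1 ≤ ENNReal.ofReal p := by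
  rw [← ENNReal.ofReal_one]; exact ENNReal.ofReal_le_ofReal hp.le

lemma add_rpow_le_mul {q : ℝ} (hq : 1 ≤ q) {a b : ℝ} (ha : 0 ≤ a) (hb : 0 ≤ b) :
    (a + b) ^ q ≤ 2 ^ (q - 1) * (a ^ q + b ^ q) := by
  have := NNReal.rpow_add_le_mul_rpow_add_rpow ⟨a, ha⟩ ⟨b, hb⟩ hq
  exact_mod_cast this

lemma norm_integral_rpow_le {Ω F : Type*} [MeasurableSpace Ω] {P : Measure Ω}
    [IsProbabilityMeasure P] [NormedAddCommGroup F] [NormedSpace ℝ F] {q : ℝ} (hq : 1 < q)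
    {g : Ω → F} (hg : AEStronglyMeasurable g P) {b : Ω → ℝ} (hb : Integrable b P)
    (h : ∀ᵐ ω ∂P, ‖g ω‖ ^ q ≤ b ω) : ‖∫ ω, g ω ∂P‖ ^ q ≤ ∫ ω, b ω ∂P := by
  have hq0 : 0 < q := by linarith
  have hgm := memLp_of_norm_rpow_le hq0 hg hb h
  have hgi : Integrable (fun ω => ‖g ω‖) P :=
    (hgm.integrable (one_le_ofReal hq)).norm
  calc ‖∫ ω, g ω ∂P‖ ^ q ≤ (∫ ω, ‖g ω‖ ∂P) ^ q :=
        Real.rpow_le_rpow (norm_nonneg _) (norm_integral_le_integral_norm _) hq0.le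
    _ ≤ ∫ ω, ‖g ω‖ ^ q ∂P :=
        (convexOn_rpow hq.le).map_integral_le
          (Real.continuous_rpow_const hq0.le).continuousOn isClosed_Ici
          (Eventually.of_forall fun ω => norm_nonneg (g ω)) hgi (integrable_norm_rpow hq0 hgm)
    _ ≤ ∫ ω, b ω ∂P := integral_mono_ae (integrable_norm_rpow hq0 hgm) hb h

/-! ### Laws and mixtures in the Wasserstein space -/

section Wasserstein

variable {p : ℝ} {d : ℕ} {Ω : Type*} [MeasurableSpace Ω] {P : Measure Ω}

lemma wasserstein_map_le {Y Y' : Ω → Rd d} (hY : AEMeasurable Y P) (hY' : AEMeasurable Y' P) :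
    wasserstein p (P.map Y) (P.map Y') ≤ eLpNorm (fun ω => Y ω - Y' ω) (ENNReal.ofReal p) P := by
  have hmem : P.map (fun ω => (Y ω, Y' ω)) ∈ plans (P.map Y) (P.map Y') := by
    constructor
    · rw [AEMeasurable.map_map_of_aemeasurable (by fun_prop) (hY.prodMk hY')]; rfl
    · rw [AEMeasurable.map_map_of_aemeasurable (by fun_prop) (hY.prodMk hY')]; rfl
  refine iInf₂_le_of_le _ hmem (le_of_eq ?_)
  rw [eLpNorm_map_measure (by fun_prop) (hY.prodMk hY')]
  rfl

lemma PSpace.ext_meas {m m' : PSpace p d} (h : m.meas = m'.meas) : m = m' := by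
  cases m; cases m'; cases h; rfl

lemma PSpace.mix_zero (m m' : PSpace p d) : PSpace.mix 0 m m' = m := by
  apply PSpace.ext_meas; simp [PSpace.mix]

lemma PSpace.mix_one (m m' : PSpace p d) : PSpace.mix 1 m m' = m' := by
  apply PSpace.ext_meas; simp [PSpace.mix]

lemma PSpace.mix_mix (s h r : unitInterval) (hr : (r : ℝ) = s + h * (1 - s)) (m m' : PSpace p d) :
    PSpace.mix h (PSpace.mix s m m') m' = PSpace.mix r m m' := by
  apply PSpace.ext_meas
  have h0 := h.2.1
  have h1 := h.2.2
  have s0 := s.2.1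
  have s1 := s.2.2
  simp only [PSpace.mix]
  rw [smul_add, smul_smul, smul_smul, add_assoc, ← add_smul, ← ENNReal.ofReal_mul (by linarith),
    ← ENNReal.ofReal_mul (by linarith), ← ENNReal.ofReal_add (by nlinarith) (by linarith), hr]
  congr 3 <;> ring

lemma PSpace.integral_mix {F : Type*} [NormedAddCommGroup F] [NormedSpace ℝ F]
    (s : unitInterval) (m m' : PSpace p d) {g : Rd d → F} (hg : Integrable g m.meas)
    (hg' : Integrable g m'.meas) :
    ∫ y, g y ∂(PSpace.mix s m m').meas
      = (1 - (s : ℝ)) • ∫ y, g y ∂m.meas + (s : ℝ) • ∫ y, g y ∂m'.meas := by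
  have s0 := s.2.1
  have s1 := s.2.2
  simp only [PSpace.mix]
  rw [integral_add_measure (hg.smul_measure ENNReal.ofReal_ne_top)
    (hg'.smul_measure ENNReal.ofReal_ne_top), integral_smul_measure, integral_smul_measure,
    ENNReal.toReal_ofReal (by linarith), ENNReal.toReal_ofReal (by linarith)]

lemma PSpace.Mp_rpow (hp : 0 < p) (m : PSpace p d) : m.Mp ^ p = ∫ x, ‖x‖ ^ p ∂m.meas := by
  rw [PSpace.Mp, ← Real.rpow_mul (integral_nonneg fun x => by positivity),
    one_div_mul_cancel hp.ne', Real.rpow_one]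

lemma PSpace.Mp_nonneg (m : PSpace p d) : 0 ≤ m.Mp :=
  Real.rpow_nonneg (integral_nonneg fun x => by positivity) _

variable [hp : Fact (1 < p)] [IsProbabilityMeasure P]

lemma edist_law_le {Y Y' : Ω → Rd d} (hY : MemLp Y (ENNReal.ofReal p) P)
    (hY' : MemLp Y' (ENNReal.ofReal p) P) :
    edist (PSpace.law P Y hY) (PSpace.law P Y' hY')
      ≤ eLpNorm (fun ω => Y ω - Y' ω) (ENNReal.ofReal p) P :=
  wasserstein_map_le hY.1.aemeasurable hY'.1.aemeasurable

lemma PSpace.Mp_law_rpow {Y : Ω → Rd d} (hY : MemLp Y (ENNReal.ofReal p) P) :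
    (PSpace.law P Y hY).Mp ^ p = ∫ ω, ‖Y ω‖ ^ p ∂P := by
  have hp0 : 0 < p := by linarith [hp.out]
  rw [PSpace.Mp_rpow hp0]
  simp only [PSpace.law]
  rw [integral_map hY.1.aemeasurable]
  exact ((Real.continuous_rpow_const hp0.le).comp continuous_norm).aestronglyMeasurable

lemma PSpace.Mp_mix_rpow_le (s : unitInterval) (m m' : PSpace p d) :
    (PSpace.mix s m m').Mp ^ p ≤ m.Mp ^ p + m'.Mp ^ p := by
  have hp0 : 0 < p := by linarith [hp.out]
  have s0 := s.2.1
  have s1 := s.2.2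
  rw [PSpace.Mp_rpow hp0, PSpace.integral_mix s m m'
    (integrable_norm_rpow hp0 m.memLp) (integrable_norm_rpow hp0 m'.memLp),
    ← PSpace.Mp_rpow hp0, ← PSpace.Mp_rpow hp0]
  have h1 := Real.rpow_nonneg m.Mp_nonneg p
  have h2 := Real.rpow_nonneg m'.Mp_nonneg p
  simp only [smul_eq_mul]
  nlinarith

lemma edist_mix_le_of_le {Y Y' : Ω → Rd d} (hY : MemLp Y (ENNReal.ofReal p) P)
    (hY' : MemLp Y' (ENNReal.ofReal p) P) {s r : unitInterval} (hsr : s ≤ r) :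
    edist (PSpace.mix s (PSpace.law P Y hY) (PSpace.law P Y' hY'))
        (PSpace.mix r (PSpace.law P Y hY) (PSpace.law P Y' hY'))
      ≤ ENNReal.ofReal (r - s) ^ (1 / p)
        * eLpNorm (fun ω => Y ω - Y' ω) (ENNReal.ofReal p) P := by
  have hp1 : 1 < p := hp.out
  have hp0 : ENNReal.ofReal p ≠ 0 := by simpa using zero_lt_one.trans hp1
  have hsr' : (s : ℝ) ≤ r := hsr
  have s0 := s.2.1
  have r1 := r.2.2
  have m1 := hY.1.aemeasurable
  have m2 := hY'.1.aemeasurable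
  -- the part of the mass common to both mixtures stays in place, the rest moves from `Y` to `Y'`
  set π : Measure (Rd d × Rd d) := ENNReal.ofReal (1 - r) • P.map (fun ω => (Y ω, Y ω))
    + ENNReal.ofReal s • P.map (fun ω => (Y' ω, Y' ω))
    + ENNReal.ofReal (r - s) • P.map (fun ω => (Y ω, Y' ω)) with hπ
  have hmem : π ∈ plans (PSpace.mix s (PSpace.law P Y hY) (PSpace.law P Y' hY')).meas
      (PSpace.mix r (PSpace.law P Y hY) (PSpace.law P Y' hY')).meas := by
    have e1 : ENNReal.ofReal (1 - s) = ENNReal.ofReal (1 - r) + ENNReal.ofReal (r - s) := by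
      rw [← ENNReal.ofReal_add (by linarith) (by linarith)]; congr 1; ring
    have e2 : ENNReal.ofReal r = ENNReal.ofReal s + ENNReal.ofReal (r - s) := by
      rw [← ENNReal.ofReal_add (by linarith) (by linarith)]; congr 1; ring
    constructor
    · simp only [hπ, PSpace.mix, PSpace.law]
      rw [Measure.map_add _ _ measurable_fst, Measure.map_add _ _ measurable_fst,
        Measure.map_smul, Measure.map_smul, Measure.map_smul,
        AEMeasurable.map_map_of_aemeasurable (by fun_prop) (m1.prodMk m1),
        AEMeasurable.map_map_of_aemeasurable (by fun_prop) (m2.prodMk m2),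
        AEMeasurable.map_map_of_aemeasurable (by fun_prop) (m1.prodMk m2), e1, add_smul]
      simp only [Function.comp_def]
      abel
    · simp only [hπ, PSpace.mix, PSpace.law]
      rw [Measure.map_add _ _ measurable_snd, Measure.map_add _ _ measurable_snd,
        Measure.map_smul, Measure.map_smul, Measure.map_smul,
        AEMeasurable.map_map_of_aemeasurable (by fun_prop) (m1.prodMk m1),
        AEMeasurable.map_map_of_aemeasurable (by fun_prop) (m2.prodMk m2),
        AEMeasurable.map_map_of_aemeasurable (by fun_prop) (m1.prodMk m2), e2, add_smul]
      simp only [Function.comp_def]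
      abel
  refine iInf₂_le_of_le _ hmem (le_of_eq ?_)
  have hm : Measurable (fun z : Rd d × Rd d => ‖z.1 - z.2‖ₑ ^ p) := by fun_prop
  rw [eLpNorm_eq_lintegral_rpow_enorm_toReal hp0 ENNReal.ofReal_ne_top,
    eLpNorm_eq_lintegral_rpow_enorm_toReal hp0 ENNReal.ofReal_ne_top,
    ENNReal.toReal_ofReal (by linarith), hπ, lintegral_add_measure, lintegral_add_measure,
    lintegral_smul_measure, lintegral_smul_measure, lintegral_smul_measure,
    lintegral_map' hm.aemeasurable (m1.prodMk m1), lintegral_map' hm.aemeasurable (m2.prodMk m2),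
    lintegral_map' hm.aemeasurable (m1.prodMk m2)]
  have hp' : 0 < p := by linarith
  simp only [sub_self, enorm_zero, ENNReal.zero_rpow_of_pos hp', lintegral_zero, mul_zero,
    zero_add, smul_eq_mul]
  rw [ENNReal.mul_rpow_of_nonneg _ _ (by positivity)]

/-- Along a segment of mixtures the Wasserstein metric is only Hölder continuous, of exponent
`1 / p`. This is enough for the continuity of the segment. -/
lemma edist_mix_le {Y Y' : Ω → Rd d} (hY : MemLp Y (ENNReal.ofReal p) P)
    (hY' : MemLp Y' (ENNReal.ofReal p) P) (s r : unitInterval) :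
    edist (PSpace.mix s (PSpace.law P Y hY) (PSpace.law P Y' hY'))
        (PSpace.mix r (PSpace.law P Y hY) (PSpace.law P Y' hY'))
      ≤ ENNReal.ofReal |(r : ℝ) - s| ^ (1 / p)
        * eLpNorm (fun ω => Y ω - Y' ω) (ENNReal.ofReal p) P := by
  rcases le_total s r with h | h
  · have h' : (s : ℝ) ≤ r := h
    rw [abs_of_nonneg (by linarith)]
    exact edist_mix_le_of_le hY hY' h
  · have h' : (r : ℝ) ≤ s := h
    rw [abs_of_nonpos (by linarith), edist_comm, neg_sub]
    exact edist_mix_le_of_le hY hY' h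

lemma edist_law_mix_le {Y Y' : Ω → Rd d} (hY : MemLp Y (ENNReal.ofReal p) P)
    (hY' : MemLp Y' (ENNReal.ofReal p) P) (r : unitInterval) :
    edist (PSpace.mix r (PSpace.law P Y hY) (PSpace.law P Y' hY')) (PSpace.law P Y hY)
      ≤ eLpNorm (fun ω => Y ω - Y' ω) (ENNReal.ofReal p) P := by
  have hp1 : 1 < p := hp.out
  have h := edist_mix_le hY hY' 0 r
  rw [PSpace.mix_zero, edist_comm] at h
  refine h.trans (mul_le_of_le_one_left' ?_)
  refine ENNReal.rpow_le_one ?_ (by positivity)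
  have r0 := r.2.1
  have r1 := r.2.2
  rw [ENNReal.ofReal_le_one]
  simpa [abs_of_nonneg r0] using r1

lemma continuous_mix {Y Y' : Ω → Rd d} (hY : MemLp Y (ENNReal.ofReal p) P)
    (hY' : MemLp Y' (ENNReal.ofReal p) P) :
    Continuous fun s : unitInterval =>
      PSpace.mix s (PSpace.law P Y hY) (PSpace.law P Y' hY') := by
  have hp1 : 1 < p := hp.out
  rw [continuous_iff_continuousAt]
  intro s
  rw [ContinuousAt, EMetric.tendsto_nhds]
  intro ε hε
  have hfin : eLpNorm (fun ω => Y ω - Y' ω) (ENNReal.ofReal p) P ≠ ∞ := (hY.sub hY').2.ne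
  have hlim : Tendsto (fun r : unitInterval => ENNReal.ofReal |(s : ℝ) - r| ^ (1 / p)
      * eLpNorm (fun ω => Y ω - Y' ω) (ENNReal.ofReal p) P) (𝓝 s) (𝓝 0) := by
    have h0 : Tendsto (fun r : unitInterval => |(s : ℝ) - r|) (𝓝 s) (𝓝 0) := by
      have : Continuous fun r : unitInterval => |(s : ℝ) - r| := by fun_prop
      simpa using this.tendsto s
    have h1 := (ENNReal.tendsto_ofReal h0).ennrpow_const (1 / p)
    rw [ENNReal.ofReal_zero, ENNReal.zero_rpow_of_pos (by positivity)] at h1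
    simpa using ENNReal.Tendsto.mul_const h1 (Or.inr hfin)
  filter_upwards [hlim.eventually (gt_mem_nhds hε)] with r hr
  exact (edist_mix_le hY hY' r s).trans_lt hr

end Wasserstein

/-! ### First-order expansion along laws of random vectors -/

lemma enorm_integral_le_of_norm_le_mul {Ω F : Type*} [MeasurableSpace Ω] {P : Measure Ω}
    [NormedAddCommGroup F] [NormedSpace ℝ F] {p q : ℝ} (hpq : p.HolderConjugate q) {E : Type*}
    [NormedAddCommGroup E] {g : Ω → ℝ} {Y : Ω → E}
    (hg : AEStronglyMeasurable g P) (hY : AEStronglyMeasurable Y P) {f : Ω → F}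
    (hf : ∀ᵐ ω ∂P, ‖f ω‖ ≤ g ω * ‖Y ω‖) :
    ‖∫ ω, f ω ∂P‖ₑ ≤ eLpNorm g (ENNReal.ofReal q) P * eLpNorm Y (ENNReal.ofReal p) P := by
  refine (enorm_integral_le_lintegral_enorm _).trans
    ((lintegral_mono_ae ?_).trans (lintegral_enorm_mul_le P hpq hg hY))
  filter_upwards [hf] with ω hω
  rw [← ofReal_norm, ← ofReal_norm, ← ofReal_norm, ← ENNReal.ofReal_mul (norm_nonneg _)]
  exact ENNReal.ofReal_le_ofReal (hω.trans
    (mul_le_mul_of_nonneg_right (le_abs_self _) (norm_nonneg _)))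

section FlatDeriv

variable {p : ℝ} [hp : Fact (1 < p)] {d : ℕ} {F : Type*} [NormedAddCommGroup F] [NormedSpace ℝ F]

/-- The one-sided directional derivative at the left end of a segment of mixtures gives the right
derivative at every point but the last. -/
lemma IsFlatDeriv.hasDerivWithinAt_mix {Φ : PSpace p d → F} {δ : PSpace p d → Rd d → F}
    (h : IsFlatDeriv Φ δ) (m m' : PSpace p d) {s : ℝ} (hs : s ∈ Ico (0 : ℝ) 1) :
    HasDerivWithinAt (fun r : ℝ => Φ (PSpace.mix (projIcc 0 1 zero_le_one r) m m'))
      (∫ y, δ (PSpace.mix (projIcc 0 1 zero_le_one s) m m') y ∂m'.meas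
        - ∫ y, δ (PSpace.mix (projIcc 0 1 zero_le_one s) m m') y ∂m.meas) (Ici s) s := by
  rw [← hasDerivWithinAt_Ioi_iff_Ici, hasDerivWithinAt_iff_tendsto_slope' (by simp)]
  set s' : unitInterval := projIcc 0 1 zero_le_one s with hs'
  have hs'v : (s' : ℝ) = s := by
    rw [hs', projIcc_of_mem zero_le_one ⟨hs.1, hs.2.le⟩]
  have h1s : 0 < 1 - s := by linarith [hs.2]
  have h1 := h.tendsto (PSpace.mix s' m m') m'
  rw [PSpace.integral_mix s' m m' (h.integrable _ _) (h.integrable _ _), hs'v] at h1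
  -- `(1 - s) m + s m'` moves towards `m'` with the speed `1 / (1 - s)`
  have hθ : Tendsto (fun r : ℝ => projIcc (0 : ℝ) 1 zero_le_one ((r - s) / (1 - s))) (𝓝[>] s)
      (𝓝[>] (0 : unitInterval)) := by
    refine tendsto_nhdsWithin_iff.2 ⟨?_, ?_⟩
    · have hc : Continuous fun r : ℝ => projIcc (0 : ℝ) 1 zero_le_one ((r - s) / (1 - s)) :=
        continuous_projIcc.comp (by fun_prop)
      have := hc.tendsto s
      simp only [sub_self, zero_div] at this
      rw [projIcc_of_le_left zero_le_one le_rfl] at this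
      exact this.mono_left nhdsWithin_le_nhds
    · filter_upwards [self_mem_nhdsWithin] with r hr
      have hr' : s < r := hr
      change ((0 : unitInterval) : ℝ) < (projIcc (0 : ℝ) 1 zero_le_one ((r - s) / (1 - s)) : ℝ)
      rw [coe_projIcc]
      simp only [Icc.coe_zero, lt_sup_iff, lt_inf_iff]
      exact Or.inr ⟨zero_lt_one, div_pos (by linarith) h1s⟩
  have h2 := (h1.comp hθ).const_smul ((1 - s)⁻¹)
  have hval : (1 - s)⁻¹ • (∫ y, δ (PSpace.mix s' m m') y ∂m'.meas
      - ((1 - s) • ∫ y, δ (PSpace.mix s' m m') y ∂m.meas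
        + s • ∫ y, δ (PSpace.mix s' m m') y ∂m'.meas))
      = ∫ y, δ (PSpace.mix s' m m') y ∂m'.meas - ∫ y, δ (PSpace.mix s' m m') y ∂m.meas := by
    rw [inv_smul_eq_iff₀ h1s.ne']
    module
  rw [hval] at h2
  refine h2.congr' ?_
  filter_upwards [Ioo_mem_nhdsGT hs.2] with r hr
  have hmem : (r - s) / (1 - s) ∈ Icc (0 : ℝ) 1 :=
    ⟨div_nonneg (by linarith [hr.1]) h1s.le, (div_le_one h1s).2 (by linarith [hr.2])⟩
  have hmem' : r ∈ Icc (0 : ℝ) 1 := ⟨by linarith [hs.1, hr.1], hr.2.le⟩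
  simp only [Function.comp_apply, slope, vsub_eq_sub]
  rw [projIcc_of_mem zero_le_one hmem, PSpace.mix_mix s' ⟨_, hmem⟩ ⟨r, hmem'⟩ _ m m',
    projIcc_of_mem zero_le_one hmem', smul_smul]
  · congr 1
    have : r - s ≠ 0 := by linarith [hr.1]
    field_simp
  · simp only [hs'v]
    field_simp
    ring

/-- Mean value inequality along the segment from `m` to `m'`. -/
lemma IsFlatDeriv.norm_sub_sub_le {Φ : PSpace p d → F} {δ : PSpace p d → Rd d → F}
    (h : IsFlatDeriv Φ δ) (hΦ : Continuous Φ) {m m' : PSpace p d}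
    (hmix : Continuous fun s : unitInterval => PSpace.mix s m m') (c : F) {C : ℝ}
    (hC : ∀ s : unitInterval, ‖∫ y, δ (PSpace.mix s m m') y ∂m'.meas
      - ∫ y, δ (PSpace.mix s m m') y ∂m.meas - c‖ ≤ C) :
    ‖Φ m' - Φ m - c‖ ≤ C := by
  have hcont : Continuous fun r : ℝ =>
      Φ (PSpace.mix (projIcc 0 1 zero_le_one r) m m') - r • c :=
    (hΦ.comp (hmix.comp continuous_projIcc)).sub (by fun_prop)
  have key := norm_image_sub_le_of_norm_deriv_right_le_segment (a := (0 : ℝ)) (b := 1)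
    (f := fun r : ℝ => Φ (PSpace.mix (projIcc 0 1 zero_le_one r) m m') - r • c)
    (f' := fun r : ℝ => (∫ y, δ (PSpace.mix (projIcc 0 1 zero_le_one r) m m') y ∂m'.meas
        - ∫ y, δ (PSpace.mix (projIcc 0 1 zero_le_one r) m m') y ∂m.meas) - c) (C := C)
    hcont.continuousOn
    (fun s hs => by
      have := ((hasDerivAt_id s).smul_const c).hasDerivWithinAt (s := Ici s)
      rw [one_smul] at this
      exact (h.hasDerivWithinAt_mix m m' hs).sub this)
    (fun s _ => hC _) 1 (right_mem_Icc.2 zero_le_one)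
  have e0 : projIcc (0 : ℝ) 1 zero_le_one 0 = 0 := projIcc_of_le_left zero_le_one le_rfl
  have e1 : projIcc (0 : ℝ) 1 zero_le_one 1 = 1 := projIcc_of_right_le zero_le_one le_rfl
  simp only [e0, e1, PSpace.mix_zero, PSpace.mix_one] at key
  simpa [sub_right_comm] using key

variable {Ω : Type*} [MeasurableSpace Ω] {P : Measure Ω} [IsProbabilityMeasure P]

lemma IsFlatDeriv.integral_law_sub {Φ : PSpace p d → F} {δ : PSpace p d → Rd d → F}
    (h : IsFlatDeriv Φ δ) (μ : PSpace p d) {Y Y' : Ω → Rd d} (hY : MemLp Y (ENNReal.ofReal p) P)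
    (hY' : MemLp Y' (ENNReal.ofReal p) P) :
    Integrable (fun ω => δ μ (Y' ω) - δ μ (Y ω)) P ∧
    ∫ y, δ μ y ∂(PSpace.law P Y' hY').meas - ∫ y, δ μ y ∂(PSpace.law P Y hY).meas
      = ∫ ω, (δ μ (Y' ω) - δ μ (Y ω)) ∂P := by
  have hc : Continuous (δ μ) := h.continuous.comp (by fun_prop : Continuous fun y => (μ, y))
  have i1 : Integrable (fun ω => δ μ (Y ω)) P :=
    (integrable_map_measure hc.aestronglyMeasurable hY.1.aemeasurable).1
      (h.integrable μ (PSpace.law P Y hY))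
  have i2 : Integrable (fun ω => δ μ (Y' ω)) P :=
    (integrable_map_measure hc.aestronglyMeasurable hY'.1.aemeasurable).1
      (h.integrable μ (PSpace.law P Y' hY'))
  refine ⟨i2.sub i1, ?_⟩
  rw [integral_sub i2 i1]
  simp only [PSpace.law]
  rw [integral_map hY.1.aemeasurable hc.aestronglyMeasurable,
    integral_map hY'.1.aemeasurable hc.aestronglyMeasurable]

/-- A bounded intrinsic derivative makes `Φ` Lipschitz along random vectors. -/
lemma IsFlatDeriv.norm_law_sub_le {Φ : PSpace p d → F} {δ : PSpace p d → Rd d → F}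
    (h : IsFlatDeriv Φ δ) (hΦ : Continuous Φ) (hd : ∀ m, Differentiable ℝ (δ m)) {C : ℝ}
    (hC : ∀ m y, ‖fderiv ℝ (δ m) y‖ ≤ C) {Y Y' : Ω → Rd d}
    (hY : MemLp Y (ENNReal.ofReal p) P) (hY' : MemLp Y' (ENNReal.ofReal p) P) :
    ‖Φ (PSpace.law P Y' hY') - Φ (PSpace.law P Y hY)‖
      ≤ C * (eLpNorm (fun ω => Y' ω - Y ω) (ENNReal.ofReal p) P).toReal := by
  have hC0 : 0 ≤ C := (norm_nonneg _).trans (hC (PSpace.law P Y hY) 0)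
  have hsub : MemLp (fun ω => Y' ω - Y ω) (ENNReal.ofReal p) P := hY'.sub hY
  have h1 : ∫ ω, ‖Y' ω - Y ω‖ ∂P
      ≤ (eLpNorm (fun ω => Y' ω - Y ω) (ENNReal.ofReal p) P).toReal := by
    have hi := hsub.integrable (one_le_ofReal hp.out)
    rw [integral_norm_eq_lintegral_enorm hi.1, ← eLpNorm_one_eq_lintegral_enorm]
    exact ENNReal.toReal_mono hsub.2.ne
      (eLpNorm_le_eLpNorm_of_exponent_le (one_le_ofReal hp.out) hsub.1)
  have key := h.norm_sub_sub_le hΦ (continuous_mix hY hY') 0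
    (C := C * (eLpNorm (fun ω => Y' ω - Y ω) (ENNReal.ofReal p) P).toReal) fun s => by
      obtain ⟨_, heq⟩ := h.integral_law_sub
        (PSpace.mix s (PSpace.law P Y hY) (PSpace.law P Y' hY')) hY hY'
      rw [sub_zero, heq]
      refine (norm_integral_le_of_norm_le
        ((hsub.integrable (one_le_ofReal hp.out)).norm.const_mul C)
        (Eventually.of_forall fun ω => ?_)).trans ?_
      · exact Convex.norm_image_sub_le_of_norm_fderiv_le (fun y _ => (hd _) y)
          (fun y _ => hC _ y) convex_univ (mem_univ _) (mem_univ _)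
      · rw [integral_const_mul]
        exact mul_le_mul_of_nonneg_left h1 hC0
  simpa using key

/-- First-order expansion of `Φ` at the law of `Y`: the relative error is small in `L^p`, and it is
bounded in terms of the growth of the intrinsic derivative. -/
lemma IsFlatDeriv.exists_expansion {q : ℝ} (hpq : p.HolderConjugate q) {ι : Type*} {l : Filter ι}
    [l.IsCountablyGenerated] {Φ : PSpace p d → F} {δ : PSpace p d → Rd d → F}
    (h : IsFlatDeriv Φ δ) (hΦ : Continuous Φ) {D : PSpace p d → Rd d → Rd d →L[ℝ] F}
    (hD : ∀ m y, HasFDerivAt (δ m) (D m y) y)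
    (hDc : Continuous fun z : PSpace p d × Rd d => D z.1 z.2) {C a : ℝ} (hC : 0 ≤ C) (ha : 0 ≤ a)
    (hbound : ∀ m y, ‖D m y‖ ^ q ≤ C * (a + ‖y‖ ^ p + m.Mp ^ p))
    {Y : Ω → Rd d} {Y' : ι → Ω → Rd d} (hY : MemLp Y (ENNReal.ofReal p) P)
    (hY' : ∀ i, MemLp (Y' i) (ENNReal.ofReal p) P) {Z : Ω → ℝ} (hZ : MemLp Z (ENNReal.ofReal p) P)
    (hYZ : ∀ᵐ ω ∂P, ‖Y ω‖ ≤ Z ω)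
    (hdom : ∀ᵐ ω ∂P, ∀ i, ‖Y' i ω‖ ≤ Z ω)
    (hlim : ∀ᵐ ω ∂P, Tendsto (fun i => Y' i ω) l (𝓝 (Y ω))) :
    ∃ ε : ι → ℝ≥0∞, Tendsto ε l (𝓝 0) ∧
      (∀ i, ε i ≤ ENNReal.ofReal (2 ^ q * C * (a + 3 * ∫ ω, ‖Z ω‖ ^ p ∂P)) ^ (1 / q)) ∧
      ∀ i, ‖Φ (PSpace.law P (Y' i) (hY' i)) - Φ (PSpace.law P Y hY)
          - ∫ ω, D (PSpace.law P Y hY) (Y ω) (Y' i ω - Y ω) ∂P‖ₑ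
        ≤ ε i * eLpNorm (fun ω => Y' i ω - Y ω) (ENNReal.ofReal p) P := by
  have hp1 : 1 < p := hp.out
  have hp0 : 0 < p := by linarith
  have hq0 : 0 < q := hpq.symm.pos
  have hq00 : ENNReal.ofReal q ≠ 0 := by simpa using hq0
  set m : PSpace p d := PSpace.law P Y hY with hm
  set W : ℝ := ∫ ω, ‖Z ω‖ ^ p ∂P with hW
  have hW0 : 0 ≤ W := integral_nonneg fun ω => by positivity
  have hZi : Integrable (fun ω => ‖Z ω‖ ^ p) P := integrable_norm_rpow hp0 hZ
  have hZabs : ∀ {ω : Ω} {x : Rd d}, ‖x‖ ≤ Z ω → ‖x‖ ^ p ≤ ‖Z ω‖ ^ p := fun hx =>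
    Real.rpow_le_rpow (norm_nonneg _) (hx.trans (le_abs_self _)) hp0.le
  have hmW : m.Mp ^ p ≤ W := by
    rw [hm, PSpace.Mp_law_rpow]
    refine integral_mono_ae (integrable_norm_rpow hp0 hY) hZi ?_
    filter_upwards [hYZ] with ω hω using hZabs hω
  have hm'W : ∀ i, (PSpace.law P (Y' i) (hY' i)).Mp ^ p ≤ W := by
    intro i
    rw [PSpace.Mp_law_rpow]
    refine integral_mono_ae (integrable_norm_rpow hp0 (hY' i)) hZi ?_
    filter_upwards [hdom] with ω hω using hZabs (hω i)
  -- the measures on the segment from the law of `Y` to the law of `Y' i`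
  set M : ι → unitInterval → PSpace p d := fun i s => PSpace.mix s m (PSpace.law P (Y' i) (hY' i))
    with hM
  -- the relative error of the expansion of `δ (M i s)`; the value `0 / 0 = 0` is harmless
  set g : ι × unitInterval → Ω → ℝ := fun k ω =>
    ‖δ (M k.1 k.2) (Y' k.1 ω) - δ (M k.1 k.2) (Y ω) - D m (Y ω) (Y' k.1 ω - Y ω)‖
      / ‖Y' k.1 ω - Y ω‖ with hg
  have hδc : ∀ μ, Continuous (δ μ) := fun μ =>
    h.continuous.comp (by fun_prop : Continuous fun y => (μ, y))
  have hDm : ∀ μ, Continuous (D μ) := fun μ =>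
    hDc.comp (by fun_prop : Continuous fun y => (μ, y))
  have hDapp : ∀ i, AEStronglyMeasurable (fun ω => D m (Y ω) (Y' i ω - Y ω)) P := fun i =>
    (isBoundedBilinearMap_apply.continuous (𝕜 := ℝ)).comp_aestronglyMeasurable
      (((hDm m).comp_aestronglyMeasurable hY.1).prodMk ((hY' i).1.sub hY.1))
  have hgm : ∀ k, AEStronglyMeasurable (g k) P := fun k =>
    (((((hδc _).comp_aestronglyMeasurable (hY' k.1).1).sub
      ((hδc _).comp_aestronglyMeasurable hY.1)).sub (hDapp k.1)).norm.aemeasurable.div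
      ((hY' k.1).1.sub hY.1).norm.aemeasurable).aestronglyMeasurable
  have hgle : ∀ k ω B, 0 ≤ B → (∀ r ∈ segment ℝ (Y ω) (Y' k.1 ω),
      ‖D (M k.1 k.2) r - D m (Y ω)‖ ≤ B) → g k ω ≤ B := by
    intro k ω B hB hr
    refine div_le_of_le_mul₀ (norm_nonneg _) hB ?_
    exact (convex_segment (Y ω) (Y' k.1 ω)).norm_image_sub_le_of_norm_hasFDerivWithin_le'
      (fun r _ => (hD _ r).hasFDerivWithinAt) hr (left_mem_segment _ _ _) (right_mem_segment _ _ _)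
  have hg0 : ∀ k ω, 0 ≤ g k ω := fun k ω => by positivity
  set b : Ω → ℝ := fun ω => 2 ^ q * C * (a + ‖Z ω‖ ^ p + 2 * W) with hb
  have hbi : Integrable b P :=
    (((integrable_const a).add hZi).add (integrable_const (2 * W))).const_mul _
  have hgb : ∀ᵐ ω ∂P, ∀ k, ‖g k ω‖ ^ q ≤ b ω := by
    filter_upwards [hYZ, hdom] with ω h1 h2 k
    set B : ℝ := (C * (a + ‖Z ω‖ ^ p + 2 * W)) ^ (1 / q) with hB
    have hBin : 0 ≤ C * (a + ‖Z ω‖ ^ p + 2 * W) := by positivity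
    have hDB : ∀ μ y, ‖y‖ ≤ Z ω → μ.Mp ^ p ≤ 2 * W → ‖D μ y‖ ≤ B := by
      intro μ y hy hμ
      have : (‖D μ y‖ ^ q) ^ (1 / q) ≤ B := by
        refine Real.rpow_le_rpow (by positivity) ((hbound μ y).trans ?_) (by positivity)
        exact mul_le_mul_of_nonneg_left (by linarith [hZabs hy]) hC
      rwa [← Real.rpow_mul (norm_nonneg _), mul_one_div_cancel hq0.ne', Real.rpow_one] at this
    have hMW : (M k.1 k.2).Mp ^ p ≤ 2 * W :=
      (PSpace.Mp_mix_rpow_le _ _ _).trans (by linarith [hmW, hm'W k.1])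
    have hle : g k ω ≤ 2 * B := by
      refine hgle k ω _ (by positivity) fun r hr => (norm_sub_le _ _).trans ?_
      have hrZ : ‖r‖ ≤ Z ω := by
        simpa using (convex_closedBall (0 : Rd d) (Z ω)).segment_subset
          (by simpa using h1) (by simpa using h2 k.1) hr
      linarith [hDB _ _ hrZ hMW, hDB _ _ h1 (by linarith : m.Mp ^ p ≤ 2 * W)]
    rw [Real.norm_of_nonneg (hg0 _ _)]
    calc g k ω ^ q ≤ (2 * B) ^ q := Real.rpow_le_rpow (hg0 _ _) hle hq0.le
      _ = b ω := by
        rw [Real.mul_rpow (by norm_num) (by positivity), hB, ← Real.rpow_mul hBin,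
          one_div_mul_cancel hq0.ne', Real.rpow_one, hb]
        ring
  have hYlim : Tendsto (fun i => eLpNorm (fun ω => Y' i ω - Y ω) (ENNReal.ofReal p) P) l
      (𝓝 0) := by
    refine tendsto_eLpNorm_zero_of_dominated hp0
      (Eventually.of_forall fun i => (hY' i).1.sub hY.1) (hZi.const_mul (2 ^ p))
      (Eventually.of_forall fun i => ?_) ?_
    · filter_upwards [hYZ, hdom] with ω h1 h2
      rw [← Real.mul_rpow (by norm_num) (norm_nonneg _)]
      refine Real.rpow_le_rpow (norm_nonneg _) ((norm_sub_le _ _).trans ?_) hp0.le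
      have := h2 i
      have := le_abs_self (Z ω)
      rw [Real.norm_eq_abs]
      linarith
    · filter_upwards [hlim] with ω hω
      simpa using hω.sub_const (Y ω)
  have hglim : ∀ᵐ ω ∂P, Tendsto (fun k => g k ω) (l ×ˢ ⊤) (𝓝 0) := by
    filter_upwards [hlim] with ω hω
    have hDat := hDc.tendsto (m, Y ω)
    rw [Metric.tendsto_nhds]
    intro ε hε
    have hev : ∀ᶠ z : PSpace p d × Rd d in 𝓝 (m, Y ω), dist (D z.1 z.2) (D m (Y ω)) < ε / 2 :=
      (Metric.tendsto_nhds.1 hDat) _ (half_pos hε)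
    obtain ⟨ρ, hρ, hball⟩ := EMetric.mem_nhds_iff.1 hev
    have e1 : ∀ᶠ i in l, edist (Y' i ω) (Y ω) < ρ := EMetric.tendsto_nhds.1 hω ρ hρ
    have e2 := hYlim.eventually (gt_mem_nhds hρ)
    filter_upwards [(e1.and e2).prod_inl ⊤] with k hk
    rw [Real.dist_eq, sub_zero, abs_of_nonneg (hg0 _ _)]
    refine lt_of_le_of_lt (hgle k ω (ε / 2) (by positivity) fun r hr => ?_) (half_lt_self hε)
    rw [← dist_eq_norm]
    refine le_of_lt (hball (a := (M k.1 k.2, r)) ?_)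
    rw [Metric.mem_eball, Prod.edist_eq]
    refine max_lt ?_ ?_
    · refine (edist_law_mix_le hY (hY' k.1) k.2).trans_lt ?_
      have : eLpNorm (fun ω => Y ω - Y' k.1 ω) (ENNReal.ofReal p) P
          = eLpNorm (fun ω => Y' k.1 ω - Y ω) (ENNReal.ofReal p) P := by
        rw [← eLpNorm_neg]; congr 1; ext1 ω; simp
      rw [this]; exact hk.2
    · refine lt_of_le_of_lt ?_ hk.1
      rw [edist_dist, edist_dist]
      refine ENNReal.ofReal_le_ofReal ?_
      obtain ⟨x, y, hx, hy, hxy, rfl⟩ := hr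
      rw [dist_eq_norm, dist_eq_norm]
      have : x • Y ω + y • Y' k.1 ω - Y ω = y • (Y' k.1 ω - Y ω) := by
        have : x = 1 - y := by linarith
        subst this; module
      rw [this, norm_smul, Real.norm_of_nonneg hy]
      exact mul_le_of_le_one_left (norm_nonneg _) (by linarith)
  -- the convergence along `l ×ˢ ⊤` is uniform in the position on the segment
  have hconv : Tendsto (fun k => eLpNorm (g k) (ENNReal.ofReal q) P) (l ×ˢ ⊤) (𝓝 0) :=
    tendsto_eLpNorm_zero_of_dominated hq0 (Eventually.of_forall hgm) hbi
      (Eventually.of_forall fun k => hgb.mono fun ω hω => hω k) hglim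
  have hsup : ∀ i, (⨆ s, eLpNorm (g (i, s)) (ENNReal.ofReal q) P)
      ≤ ENNReal.ofReal (2 ^ q * C * (a + 3 * W)) ^ (1 / q) := by
    intro i
    refine iSup_le fun s => ?_
    rw [eLpNorm_eq_lintegral_rpow_enorm_toReal hq00 ENNReal.ofReal_ne_top,
      ENNReal.toReal_ofReal hq0.le]
    refine ENNReal.rpow_le_rpow ?_ (by positivity)
    calc ∫⁻ ω, ‖g (i, s) ω‖ₑ ^ q ∂P ≤ ∫⁻ ω, ENNReal.ofReal (b ω) ∂P := by
          refine lintegral_mono_ae ?_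
          filter_upwards [hgb] with ω hω
          rw [← ofReal_norm, ENNReal.ofReal_rpow_of_nonneg (norm_nonneg _) hq0.le]
          exact ENNReal.ofReal_le_ofReal (hω _)
      _ = ENNReal.ofReal (∫ ω, b ω ∂P) :=
          (ofReal_integral_eq_lintegral_ofReal hbi (Eventually.of_forall fun ω => by
            simp only [hb, Pi.zero_apply]; positivity)).symm
      _ = ENNReal.ofReal (2 ^ q * C * (a + 3 * W)) := by
          congr 1
          simp only [hb]
          rw [integral_const_mul, integral_add (f := fun ω => a + ‖Z ω‖ ^ p)
            ((integrable_const a).add hZi) (integrable_const _),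
            integral_add (integrable_const a) hZi]
          simp only [integral_const, probReal_univ, one_smul, ← hW]
          ring
  refine ⟨fun i => ⨆ s, eLpNorm (g (i, s)) (ENNReal.ofReal q) P, ?_, hsup, fun i => ?_⟩
  · rw [ENNReal.tendsto_nhds_zero]
    intro ε hε
    have hev := (ENNReal.tendsto_nhds_zero.1 hconv) ε hε
    rw [Filter.eventually_prod_iff] at hev
    obtain ⟨pa, hpa, pb, hpb, hab⟩ := hev
    rw [eventually_top] at hpb
    filter_upwards [hpa] with i hi
    exact iSup_le fun s => hab hi (hpb s)
  · set R : ℝ≥0∞ := (⨆ s, eLpNorm (g (i, s)) (ENNReal.ofReal q) P)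
      * eLpNorm (fun ω => Y' i ω - Y ω) (ENNReal.ofReal p) P with hR
    have hRfin : R ≠ ∞ := ENNReal.mul_ne_top
      (ne_top_of_le_ne_top (ENNReal.rpow_ne_top_of_nonneg (by positivity) ENNReal.ofReal_ne_top)
        (hsup i)) ((hY' i).sub hY).2.ne
    rw [← ofReal_norm]
    refine ENNReal.ofReal_le_of_le_toReal ?_
    refine h.norm_sub_sub_le hΦ (continuous_mix hY (hY' i)) _ fun s => ?_
    obtain ⟨hint, heq⟩ := h.integral_law_sub (M i s) hY (hY' i)
    have hDmem : MemLp (fun ω => D m (Y ω)) (ENNReal.ofReal q) P := by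
      refine memLp_of_norm_rpow_le hq0 ((hDm m).comp_aestronglyMeasurable hY.1)
        (((integrable_const (a + W)).add hZi).const_mul C) ?_
      filter_upwards [hYZ] with ω hω
      refine (hbound _ _).trans (mul_le_mul_of_nonneg_left ?_ hC)
      simp only [Pi.add_apply]
      linarith [hZabs hω]
    have hDi := integrable_clm_apply hpq hDmem ((hY' i).sub hY)
    simp only [Pi.sub_apply] at hDi
    rw [heq, ← integral_sub hint hDi,
      ← ENNReal.toReal_ofReal (norm_nonneg _), ofReal_norm]
    refine ENNReal.toReal_mono hRfin ((enorm_integral_le_of_norm_le_mul hpq (hgm (i, s))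
      ((hY' i).1.sub hY.1) (Eventually.of_forall fun ω => ?_)).trans
      (mul_le_mul_left (le_iSup (fun s => eLpNorm (g (i, s)) (ENNReal.ofReal q) P) s) _))
    simp only [hg, Pi.sub_apply]
    rcases eq_or_ne ‖Y' i ω - Y ω‖ 0 with h0 | h0
    · have h0' : Y' i ω = Y ω := sub_eq_zero.1 (norm_eq_zero.1 h0)
      simp [h0']
    · rw [div_mul_cancel₀ _ h0]

end FlatDeriv

/-! ### Volterra equations in `L^r(Ω; C([0, T], F))` -/

section Volterra

variable {Ω : Type*} [MeasurableSpace Ω] {P : Measure Ω} {T : ℝ}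
  {F : Type*} [NormedAddCommGroup F] [NormedSpace ℝ F]

lemma norm_contMap_smul_le {S : Type*} [TopologicalSpace S] [CompactSpace S] (w : C(S, ℝ))
    (γ : C(S, F)) : ‖w • γ‖ ≤ ‖w‖ * ‖γ‖ := by
  refine (ContinuousMap.norm_le _ (by positivity)).2 fun t => ?_
  change ‖w t • γ t‖ ≤ _
  rw [norm_smul]
  exact mul_le_mul (w.norm_coe_le_norm t) (γ.norm_coe_le_norm t) (norm_nonneg _) (norm_nonneg _)

lemma continuous_contMap_smul {S : Type*} [TopologicalSpace S] [CompactSpace S] (w : C(S, ℝ)) :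
    Continuous fun γ : C(S, F) => w • γ := by
  refine (LipschitzWith.of_dist_le_mul (K := ‖w‖₊) fun γ γ' => ?_).continuous
  rw [dist_eq_norm, dist_eq_norm, coe_nnnorm]
  have : w • γ - w • γ' = w • (γ - γ') := by
    ext t; exact (smul_sub (w t) (γ t) (γ' t)).symm
  rw [this]
  exact norm_contMap_smul_le w _

/-- A random path is measurable as soon as its values are, since it is the limit of its Bernstein
approximations. -/
lemma aestronglyMeasurable_path (hT : 0 < T) {γ : Ω → C(Icc (0 : ℝ) T, F)}
    (h : ∀ t, AEStronglyMeasurable (fun ω => γ ω t) P) : AEStronglyMeasurable γ P := by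
  set e := iccHomeoI (0 : ℝ) T hT
  let γ' : Ω → C(unitInterval, F) := fun ω => (γ ω).comp (e.symm : C(unitInterval, Icc (0 : ℝ) T))
  have h' : AEStronglyMeasurable γ' P := by
    refine aestronglyMeasurable_of_tendsto_ae atTop
      (f := fun n ω => bernsteinApproximation n (γ' ω)) (fun n => ?_)
      (Eventually.of_forall fun ω => bernsteinApproximation_uniform (γ' ω))
    simp only [bernsteinApproximation]
    refine Finset.aestronglyMeasurable_fun_sum _ fun k _ => ?_
    have hc : Continuous fun x : F => bernstein n k • ContinuousMap.const unitInterval x :=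
      (continuous_contMap_smul _).comp ContinuousMap.continuous_const'
    exact hc.comp_aestronglyMeasurable (h (e.symm (bernstein.z k)))
  have hγ : γ = fun ω => (γ' ω).comp (e : C(Icc (0 : ℝ) T, unitInterval)) := by
    funext ω; ext t; simp [γ']
  rw [hγ]
  exact (ContinuousMap.continuous_precomp _).comp_aestronglyMeasurable h'

/-- Hölder's inequality in the time variable. For a short time interval, the factor
`α univ ^ (1 - 1 / r)` is small. -/
lemma eLpNorm_integral_norm_le {α : Measure ℝ} [IsFiniteMeasure α] [SFinite P] {r : ℝ} (hr : 1 < r)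
    {g : ℝ → Ω → F} (hg : AEStronglyMeasurable (fun z : ℝ × Ω => g z.1 z.2) (α.prod P)) :
    eLpNorm (fun ω => ∫ t, ‖g t ω‖ ∂α) (ENNReal.ofReal r) P
      ≤ α univ ^ (1 - 1 / r) * eLpNorm (fun z : ℝ × Ω => g z.1 z.2) (ENNReal.ofReal r)
        (α.prod P) := by
  have hr0 : 0 < r := by linarith
  have hr00 : ENNReal.ofReal r ≠ 0 := by simpa using hr0
  have hgs : ∀ᵐ ω ∂P, AEStronglyMeasurable (fun t => g t ω) α := hg.prod_swap.prodMk_left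
  rw [eLpNorm_eq_lintegral_rpow_enorm_toReal hr00 ENNReal.ofReal_ne_top,
    eLpNorm_eq_lintegral_rpow_enorm_toReal hr00 ENNReal.ofReal_ne_top,
    ENNReal.toReal_ofReal hr0.le, ← ENNReal.rpow_le_rpow_iff hr0,
    ENNReal.mul_rpow_of_nonneg _ _ hr0.le, ← ENNReal.rpow_mul, ← ENNReal.rpow_mul,
    ← ENNReal.rpow_mul, one_div_mul_cancel hr0.ne', ENNReal.rpow_one, ENNReal.rpow_one,
    lintegral_prod_symm _ (hg.enorm.pow_const _)]
  have hexp : 0 ≤ 1 - 1 / r := by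
    rw [sub_nonneg, div_le_one hr0]; exact hr.le
  have hc : (α univ ^ (1 - 1 / r)) ^ r ≠ ∞ :=
    ENNReal.rpow_ne_top_of_nonneg hr0.le (ENNReal.rpow_ne_top_of_nonneg hexp (measure_ne_top _ _))
  rw [ENNReal.rpow_mul, ← lintegral_const_mul' _ _ hc]
  refine lintegral_mono_ae ?_
  filter_upwards [hgs] with ω hω
  have h1 : ‖∫ t, ‖g t ω‖ ∂α‖ₑ ≤ eLpNorm (fun t => g t ω) 1 α := by
    refine (enorm_integral_le_lintegral_enorm _).trans ?_
    simp [eLpNorm_one_eq_lintegral_enorm]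
  have h2 := h1.trans (eLpNorm_le_eLpNorm_mul_rpow_measure_univ (one_le_ofReal hr) hω)
  simp only [ENNReal.toReal_one, ENNReal.toReal_ofReal hr0.le, div_one] at h2
  refine (ENNReal.rpow_le_rpow h2 hr0.le).trans (le_of_eq ?_)
  rw [ENNReal.mul_rpow_of_nonneg _ _ hr0.le, mul_comm,
    eLpNorm_eq_lintegral_rpow_enorm_toReal hr00 ENNReal.ofReal_ne_top,
    ENNReal.toReal_ofReal hr0.le, ← ENNReal.rpow_mul, ← ENNReal.rpow_mul,
    one_div_mul_cancel hr0.ne', ENNReal.rpow_one]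

lemma memLp_integral_norm {α : Measure ℝ} [IsFiniteMeasure α] [SFinite P] {r : ℝ} (hr : 1 < r)
    {g : ℝ → Ω → F} (hg : MemLp (fun z : ℝ × Ω => g z.1 z.2) (ENNReal.ofReal r) (α.prod P)) :
    MemLp (fun ω => ∫ t, ‖g t ω‖ ∂α) (ENNReal.ofReal r) P := by
  refine ⟨hg.1.norm.prod_swap.integral_prod_right', (eLpNorm_integral_norm_le hr hg.1).trans_lt ?_⟩
  refine ENNReal.mul_lt_top (ENNReal.rpow_lt_top_of_nonneg ?_ (measure_ne_top _ _)) hg.2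
  rw [sub_nonneg, div_le_one (by linarith)]; exact hr.le

lemma integral_exp_mul_abs_le {K : ℝ} (hK : 0 < K) (c t : ℝ) :
    |∫ τ in c..t, Real.exp (K * |τ - c|)| ≤ Real.exp (K * |t - c|) / K := by
  -- the case `c = 0 ≤ t`
  have key : ∀ b : ℝ, 0 ≤ b → |∫ τ in (0 : ℝ)..b, Real.exp (K * |τ|)| ≤ Real.exp (K * |b|) / K := by
    intro b hb
    have h1 : ∫ τ in (0 : ℝ)..b, Real.exp (K * |τ|) = ∫ τ in (0 : ℝ)..b, Real.exp (K * τ) := by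
      refine intervalIntegral.integral_congr fun τ hτ => ?_
      rw [uIcc_of_le hb] at hτ
      simp only [abs_of_nonneg hτ.1]
    rw [h1, intervalIntegral.integral_comp_mul_left (f := Real.exp) hK.ne', mul_zero, integral_exp,
      Real.exp_zero, abs_of_nonneg hb, smul_eq_mul, abs_of_nonneg]
    · rw [div_eq_inv_mul]
      exact mul_le_mul_of_nonneg_left (by linarith) (by positivity)
    · have : 1 ≤ Real.exp (K * b) := Real.one_le_exp (by positivity)
      exact mul_nonneg (by positivity) (by linarith)
  have hshift : ∫ τ in c..t, Real.exp (K * |τ - c|)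
      = ∫ τ in (0 : ℝ)..(t - c), Real.exp (K * |τ|) := by
    rw [intervalIntegral.integral_comp_sub_right (fun τ => Real.exp (K * |τ|)) c, sub_self]
  rw [hshift]
  rcases le_total 0 (t - c) with h | h
  · exact key _ h
  · have h2 : ∫ τ in (0 : ℝ)..(t - c), Real.exp (K * |τ|)
        = -∫ τ in (0 : ℝ)..(-(t - c)), Real.exp (K * |τ|) := by
      have := intervalIntegral.integral_comp_neg (a := 0) (b := t - c)
        (fun τ => Real.exp (K * |τ|))
      simp only [abs_neg, neg_zero] at this
      rw [this, intervalIntegral.integral_symm]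
    rw [h2, abs_neg, ← abs_neg (t - c)]
    exact key _ (by linarith)

/-- The weight `t ↦ exp (-K |t - c|)` that turns the Volterra operator into a contraction. -/
noncomputable def expWeight (T K c : ℝ) : C(Icc (0 : ℝ) T, ℝ) :=
  ⟨fun t => Real.exp (-(K * |(t : ℝ) - c|)), by fun_prop⟩

lemma expWeight_neg_smul (K c : ℝ) (γ : C(Icc (0 : ℝ) T, F)) :
    expWeight T (-K) c • expWeight T K c • γ = γ := by
  ext t
  simp [expWeight, smul_smul, ← Real.exp_add]

lemma expWeight_smul_neg (K c : ℝ) (γ : C(Icc (0 : ℝ) T, F)) :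
    expWeight T K c • expWeight T (-K) c • γ = γ := by
  ext t
  simp [expWeight, smul_smul, ← Real.exp_add]

lemma norm_expWeight_neg_le {K c : ℝ} (hK : 0 ≤ K) (hc : c ∈ Icc 0 T) :
    ‖expWeight T (-K) c‖ ≤ Real.exp (K * T) := by
  rw [ContinuousMap.norm_le _ (Real.exp_pos _).le]
  intro t
  simp only [expWeight, ContinuousMap.coe_mk, Real.norm_eq_abs, Real.abs_exp, Real.exp_le_exp,
    neg_mul, neg_neg]
  refine mul_le_mul_of_nonneg_left (abs_le.2 ⟨?_, ?_⟩) hK <;> linarith [t.2.1, t.2.2, hc.1, hc.2]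

lemma memLp_weight_smul {r : ℝ≥0∞} (w : C(Icc (0 : ℝ) T, ℝ)) {X : Ω → C(Icc (0 : ℝ) T, F)}
    (hX : MemLp X r P) : MemLp (fun ω => w • X ω) r P := by
  refine hX.of_le_mul (c := ‖w‖)
    ((continuous_contMap_smul w).comp_aestronglyMeasurable hX.1)
    (Eventually.of_forall fun ω => ?_)
  exact norm_contMap_smul_le _ _

end Volterra

section VolterraSolution

variable {Ω : Type*} [MeasurableSpace Ω] {P : Measure Ω} [IsProbabilityMeasure P] {T : ℝ}
  {F : Type*} [NormedAddCommGroup F] [NormedSpace ℝ F]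

/-- The driver `N` of a Volterra equation for random paths: it depends on the random path `X`
through its value and its law-like `L^r` seminorm at the current time, in a Lipschitz way. -/
structure IsVolterraDriver (P : Measure Ω) (hT : 0 < T) (r L : ℝ)
    (N : (Ω → C(Icc (0 : ℝ) T, F)) → ℝ → Ω → F) : Prop where
  aestronglyMeasurable : ∀ X, MemLp X (ENNReal.ofReal r) P →
    AEStronglyMeasurable (fun z : ℝ × Ω => N X z.1 z.2) ((volume.restrict (Icc 0 T)).prod P)
  lipschitz : ∀ X X', MemLp X (ENNReal.ofReal r) P → MemLp X' (ENNReal.ofReal r) P →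
    ∀ t ∈ Icc 0 T, ∀ ω, ‖N X t ω - N X' t ω‖ ≤ L * (‖IccExtend hT.le (X ω) t
        - IccExtend hT.le (X' ω) t‖
      + (eLpNorm (fun ω => IccExtend hT.le (X ω) t - IccExtend hT.le (X' ω) t)
        (ENNReal.ofReal r) P).toReal)
  memLp_zero : MemLp (fun z : ℝ × Ω => N 0 z.1 z.2) (ENNReal.ofReal r)
    ((volume.restrict (Icc 0 T)).prod P)

variable {hT : 0 < T} {r L : ℝ} {N : (Ω → C(Icc (0 : ℝ) T, F)) → ℝ → Ω → F}

lemma eLpNorm_path_eval_le (hT : 0 < T) (X : Ω → C(Icc (0 : ℝ) T, F)) (r : ℝ≥0∞) (t : ℝ) :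
    eLpNorm (fun ω => IccExtend hT.le (X ω) t) r P ≤ eLpNorm X r P :=
  eLpNorm_mono fun ω => (X ω).norm_coe_le_norm _

lemma IsVolterraDriver.memLp (h : IsVolterraDriver P hT r L N) (hL : 0 ≤ L)
    {X : Ω → C(Icc (0 : ℝ) T, F)} (hX : MemLp X (ENNReal.ofReal r) P) :
    MemLp (fun z : ℝ × Ω => N X z.1 z.2) (ENNReal.ofReal r)
      ((volume.restrict (Icc 0 T)).prod P) := by
  have hX' : MemLp (fun z : ℝ × Ω => ‖X z.2‖) (ENNReal.ofReal r)
      ((volume.restrict (Icc 0 T)).prod P) := hX.norm.comp_snd _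
  have hb : MemLp (fun z : ℝ × Ω => ‖N 0 z.1 z.2‖
      + L * (‖X z.2‖ + (eLpNorm X (ENNReal.ofReal r) P).toReal)) (ENNReal.ofReal r)
      ((volume.restrict (Icc 0 T)).prod P) :=
    h.memLp_zero.norm.add ((hX'.add (memLp_const _)).const_mul L)
  refine hb.mono (h.aestronglyMeasurable X hX) ?_
  have hmem : ∀ᵐ z : ℝ × Ω ∂((volume.restrict (Icc 0 T)).prod P), z.1 ∈ Icc 0 T :=
    Measure.quasiMeasurePreserving_fst.ae (ae_restrict_mem measurableSet_Icc)
  filter_upwards [hmem] with z hz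
  have h1 := h.lipschitz X 0 hX (MemLp.zero' (ε := C(Icc (0 : ℝ) T, F))) z.1 hz z.2
  have h2 : ‖IccExtend hT.le (X z.2) z.1‖ ≤ ‖X z.2‖ := (X z.2).norm_coe_le_norm _
  have h3 : (eLpNorm (fun ω => IccExtend hT.le (X ω) z.1) (ENNReal.ofReal r) P).toReal
      ≤ (eLpNorm X (ENNReal.ofReal r) P).toReal :=
    ENNReal.toReal_mono hX.2.ne (eLpNorm_path_eval_le hT X _ _)
  have h0 : ∀ ω, IccExtend hT.le ((0 : Ω → C(Icc (0 : ℝ) T, F)) ω) z.1 = 0 := fun ω => rfl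
  simp only [h0, sub_zero] at h1
  have h4 : ‖N X z.1 z.2‖ ≤ ‖N 0 z.1 z.2‖ + ‖N X z.1 z.2 - N 0 z.1 z.2‖ := by
    have := norm_add_le (N 0 z.1 z.2) (N X z.1 z.2 - N 0 z.1 z.2)
    rwa [add_sub_cancel] at this
  refine (h4.trans (add_le_add le_rfl (h1.trans (mul_le_mul_of_nonneg_left
    (add_le_add h2 h3) hL)))).trans (le_abs_self _)

lemma ae_intervalIntegrable_of_memLp {g : ℝ → Ω → F} (hr : 1 < r) (hT' : 0 < T)
    (hg : MemLp (fun z : ℝ × Ω => g z.1 z.2) (ENNReal.ofReal r)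
      ((volume.restrict (Icc 0 T)).prod P)) :
    ∀ᵐ ω ∂P, IntervalIntegrable (fun t => g t ω) volume 0 T := by
  have hi := (hg.integrable (one_le_ofReal hr)).prod_left_ae
  filter_upwards [hi] with ω hω
  rw [intervalIntegrable_iff_integrableOn_Icc_of_le hT'.le]
  exact hω

lemma intervalIntegrable_mono_mem {E : Type*} [NormedAddCommGroup E] {g : ℝ → E} {a b c t : ℝ}
    (h : IntervalIntegrable g volume a b)
    (hab : a ≤ b) (hc : c ∈ Icc a b) (ht : t ∈ Icc a b) : IntervalIntegrable g volume c t :=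
  h.mono_set (by rw [uIcc_of_le hab]; exact (uIcc_subset_Icc hc ht))

/-- The difference of two Volterra integrals in the weighted norm. -/
lemma IsVolterraDriver.norm_integral_sub_le (h : IsVolterraDriver P hT r L N) (hL : 0 ≤ L)
    {K : ℝ} (hK : 0 < K) {c : ℝ} (hc : c ∈ Icc 0 T)
    {X X' : Ω → C(Icc (0 : ℝ) T, F)} (hX : MemLp X (ENNReal.ofReal r) P)
    (hX' : MemLp X' (ENNReal.ofReal r) P) {ω : Ω}
    (hi : IntervalIntegrable (fun t => N X t ω) volume 0 T)
    (hi' : IntervalIntegrable (fun t => N X' t ω) volume 0 T) {t : ℝ} (ht : t ∈ Icc 0 T) :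
    ‖(∫ τ in c..t, N X τ ω) - ∫ τ in c..t, N X' τ ω‖ ≤ L / K * Real.exp (K * |t - c|)
      * (‖expWeight T K c • (X ω - X' ω)‖
        + (eLpNorm (fun ω => expWeight T K c • (X ω - X' ω)) (ENNReal.ofReal r) P).toReal) := by
  set a : Ω → ℝ := fun ω => ‖expWeight T K c • (X ω - X' ω)‖ with ha
  set A : ℝ := (eLpNorm (fun ω => expWeight T K c • (X ω - X' ω)) (ENNReal.ofReal r) P).toReal
    with hA
  have hpt : ∀ τ ∈ Icc 0 T, ∀ ω, ‖IccExtend hT.le (X ω) τ - IccExtend hT.le (X' ω) τ‖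
      ≤ Real.exp (K * |τ - c|) * a ω := by
    intro τ hτ ω
    have h1 := (expWeight T K c • (X ω - X' ω)).norm_coe_le_norm ⟨τ, hτ⟩
    have h2 : (expWeight T K c • (X ω - X' ω)) ⟨τ, hτ⟩
        = Real.exp (-(K * |τ - c|)) • (X ω ⟨τ, hτ⟩ - X' ω ⟨τ, hτ⟩) := rfl
    rw [h2, norm_smul, Real.norm_eq_abs, Real.abs_exp, Real.exp_neg,
      inv_mul_le_iff₀ (Real.exp_pos _)] at h1
    rwa [IccExtend_of_mem hT.le _ hτ, IccExtend_of_mem hT.le _ hτ]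
  have hmemw := memLp_weight_smul (expWeight T K c) (hX.sub hX')
  have hLp : ∀ τ ∈ Icc 0 T, (eLpNorm (fun ω => IccExtend hT.le (X ω) τ
      - IccExtend hT.le (X' ω) τ) (ENNReal.ofReal r) P).toReal ≤ Real.exp (K * |τ - c|) * A := by
    intro τ hτ
    have h1 := eLpNorm_le_mul_eLpNorm_of_ae_le_mul
      (f := fun ω => IccExtend hT.le (X ω) τ - IccExtend hT.le (X' ω) τ)
      (g := fun ω => expWeight T K c • (X ω - X' ω)) (μ := P)
      (Eventually.of_forall (hpt τ hτ)) (ENNReal.ofReal r)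
    have h2 := ENNReal.toReal_mono (ENNReal.mul_ne_top ENNReal.ofReal_ne_top hmemw.2.ne) h1
    rwa [ENNReal.toReal_mul, ENNReal.toReal_ofReal (Real.exp_pos _).le] at h2
  rw [← intervalIntegral.integral_sub (intervalIntegrable_mono_mem hi hT.le hc ht)
    (intervalIntegrable_mono_mem hi' hT.le hc ht)]
  have hbd : ∀ᵐ τ ∂volume.restrict (uIoc c t), ‖N X τ ω - N X' τ ω‖
      ≤ L * (a ω + A) * Real.exp (K * |τ - c|) := by
    filter_upwards [ae_restrict_mem measurableSet_uIoc] with τ hτ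
    have hτ' : τ ∈ Icc 0 T := uIcc_subset_Icc hc ht (uIoc_subset_uIcc hτ)
    refine (h.lipschitz X X' hX hX' τ hτ' ω).trans ?_
    calc _ ≤ L * (Real.exp (K * |τ - c|) * a ω + Real.exp (K * |τ - c|) * A) :=
          mul_le_mul_of_nonneg_left (add_le_add (hpt τ hτ' ω) (hLp τ hτ')) hL
      _ = _ := by ring
  have hA0 : 0 ≤ a ω + A := add_nonneg (norm_nonneg _) ENNReal.toReal_nonneg
  refine (intervalIntegral.norm_integral_le_abs_of_norm_le hbd
    (Continuous.intervalIntegrable (by fun_prop) _ _)).trans ?_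
  rw [intervalIntegral.integral_const_mul, abs_mul, abs_of_nonneg (mul_nonneg hL hA0)]
  refine (mul_le_mul_of_nonneg_left (integral_exp_mul_abs_le hK c t)
    (mul_nonneg hL hA0)).trans (le_of_eq ?_)
  ring

/-- The contraction estimate in `L^r`: the pathwise norm and its `L^r`-norm each contribute one
quarter. -/
lemma eLpNorm_le_add_half {E E' : Type*} [NormedAddCommGroup E] [NormedAddCommGroup E']
    (hr : 1 < r) {u : Ω → E}
    {a : Ω → E'} {B : Ω → ℝ} (ha : MemLp a (ENNReal.ofReal r) P)
    (hB : AEStronglyMeasurable B P)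
    (h : ∀ᵐ ω ∂P, ‖u ω‖ ≤ B ω + 1 / 4 * (‖a ω‖ + (eLpNorm a (ENNReal.ofReal r) P).toReal)) :
    eLpNorm u (ENNReal.ofReal r) P ≤ eLpNorm B (ENNReal.ofReal r) P
      + ENNReal.ofReal (1 / 2) * eLpNorm a (ENNReal.ofReal r) P := by
  set A := (eLpNorm a (ENNReal.ofReal r) P).toReal
  have hr1 := one_le_ofReal hr
  have hr0 : ENNReal.ofReal r ≠ 0 := by simpa using zero_lt_one.trans hr
  have hm1 : AEStronglyMeasurable (fun ω => (1 / 4 : ℝ) * (‖a ω‖ + A)) P :=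
    (ha.1.norm.add aestronglyMeasurable_const).const_mul _
  have h1 : eLpNorm (fun ω => (1 / 4 : ℝ) * (‖a ω‖ + A)) (ENNReal.ofReal r) P
      ≤ ENNReal.ofReal (1 / 2) * eLpNorm a (ENNReal.ofReal r) P := by
    have e1 : eLpNorm (fun ω => (1 / 4 : ℝ) * (‖a ω‖ + A)) (ENNReal.ofReal r) P
        = ENNReal.ofReal (1 / 4) * eLpNorm (fun ω => ‖a ω‖ + A) (ENNReal.ofReal r) P := by
      have := eLpNorm_const_smul (1 / 4 : ℝ) (fun ω => ‖a ω‖ + A) (ENNReal.ofReal r) P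
      rw [← ofReal_norm, Real.norm_of_nonneg (by norm_num)] at this
      exact this
    have e2 : eLpNorm (fun ω => ‖a ω‖ + A) (ENNReal.ofReal r) P
        ≤ eLpNorm a (ENNReal.ofReal r) P + eLpNorm a (ENNReal.ofReal r) P := by
      refine (eLpNorm_add_le (f := fun ω => ‖a ω‖) (g := fun _ => A) ha.1.norm
        aestronglyMeasurable_const hr1).trans (add_le_add (le_of_eq (eLpNorm_norm _)) ?_)
      rw [eLpNorm_const _ hr0 (IsProbabilityMeasure.ne_zero P), measure_univ, ENNReal.one_rpow,
        mul_one, ← ofReal_norm, Real.norm_of_nonneg ENNReal.toReal_nonneg,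
        ENNReal.ofReal_toReal ha.2.ne]
    rw [e1]
    refine (mul_le_mul_right e2 _).trans (le_of_eq ?_)
    rw [← two_mul, ← mul_assoc]
    congr 1
    rw [← ENNReal.ofReal_ofNat, ← ENNReal.ofReal_mul (by norm_num)]
    norm_num
  refine (eLpNorm_mono_ae_real h).trans ((eLpNorm_add_le hB hm1 hr1).trans ?_)
  exact add_le_add le_rfl h1

/-- Stability: a random path that satisfies the Volterra equation up to the error `B` is close to
the solution. -/
lemma IsVolterraDriver.eLpNorm_sub_le (h : IsVolterraDriver P hT r L N) (hr : 1 < r) (hL : 0 ≤ L)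
    {c : ℝ} (hc : c ∈ Icc 0 T) {x₀ : Ω → F} {X Y : Ω → C(Icc (0 : ℝ) T, F)}
    (hX : MemLp X (ENNReal.ofReal r) P) (hY : MemLp Y (ENNReal.ofReal r) P)
    (hXeq : ∀ᵐ ω ∂P, ∀ t ∈ Icc 0 T, IccExtend hT.le (X ω) t = x₀ ω + ∫ τ in c..t, N X τ ω)
    {B : Ω → ℝ} (hB : AEStronglyMeasurable B P)
    (hYeq : ∀ᵐ ω ∂P, ∀ t ∈ Icc 0 T,
      ‖IccExtend hT.le (Y ω) t - (x₀ ω + ∫ τ in c..t, N Y τ ω)‖ ≤ B ω) :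
    eLpNorm (fun ω => X ω - Y ω) (ENNReal.ofReal r) P
      ≤ ENNReal.ofReal (2 * Real.exp ((4 * L + 1) * T)) * eLpNorm B (ENNReal.ofReal r) P := by
  -- `L / K ≤ 1 / 4`, as the contraction estimate needs
  set K := 4 * L + 1 with hKdef
  have hK : 0 < K := by positivity
  set a : Ω → C(Icc (0 : ℝ) T, F) := fun ω => expWeight T K c • (X ω - Y ω) with ha
  have ham : MemLp a (ENNReal.ofReal r) P := memLp_weight_smul _ (hX.sub hY)
  have hLK : L / K ≤ 1 / 4 := by rw [div_le_div_iff₀ hK (by norm_num)]; linarith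
  have key : ∀ᵐ ω ∂P, ‖a ω‖ ≤ B ω
      + 1 / 4 * (‖a ω‖ + (eLpNorm a (ENNReal.ofReal r) P).toReal) := by
    filter_upwards [hXeq, hYeq, ae_intervalIntegrable_of_memLp hr hT (h.memLp hL hX),
      ae_intervalIntegrable_of_memLp hr hT (h.memLp hL hY)] with ω h1 h2 h3 h4
    have hB0 : 0 ≤ B ω := (norm_nonneg _).trans (h2 c hc)
    have hA0 : 0 ≤ ‖a ω‖ + (eLpNorm a (ENNReal.ofReal r) P).toReal :=
      add_nonneg (norm_nonneg _) ENNReal.toReal_nonneg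
    refine (ContinuousMap.norm_le _ (by positivity)).2 fun t => ?_
    have e : a ω t = Real.exp (-(K * |(t : ℝ) - c|)) • (X ω t - Y ω t) := rfl
    have h5 := h.norm_integral_sub_le hL hK hc hX hY h3 h4 t.2
    have h6 := h1 t t.2
    have h7 := h2 t t.2
    rw [IccExtend_of_mem hT.le _ t.2] at h6 h7
    have h8 : X ω t - Y ω t = ((∫ τ in c..t, N X τ ω) - ∫ τ in c..t, N Y τ ω)
        - (Y ω t - (x₀ ω + ∫ τ in c..t, N Y τ ω)) := by
      rw [h6]; abel
    rw [e, norm_smul, Real.norm_eq_abs, Real.abs_exp, Real.exp_neg,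
      inv_mul_le_iff₀ (Real.exp_pos _), h8]
    refine (norm_sub_le _ _).trans ?_
    have hE : 1 ≤ Real.exp (K * |(t : ℝ) - c|) := Real.one_le_exp (by positivity)
    calc _ ≤ 1 / 4 * Real.exp (K * |(t : ℝ) - c|)
          * (‖a ω‖ + (eLpNorm a (ENNReal.ofReal r) P).toReal)
          + Real.exp (K * |(t : ℝ) - c|) * B ω := by
          refine add_le_add (h5.trans ?_) (h7.trans (le_mul_of_one_le_left hB0 hE))
          gcongr
      _ = _ := by ring
  have h1 := eLpNorm_le_add_half hr ham hB key
  have h2 : eLpNorm a (ENNReal.ofReal r) P ≤ 2 * eLpNorm B (ENNReal.ofReal r) P := by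
    have hfin : ENNReal.ofReal (1 / 2) * eLpNorm a (ENNReal.ofReal r) P ≠ ∞ :=
      ENNReal.mul_ne_top ENNReal.ofReal_ne_top ham.2.ne
    have hsplit : eLpNorm a (ENNReal.ofReal r) P = ENNReal.ofReal (1 / 2)
        * eLpNorm a (ENNReal.ofReal r) P + ENNReal.ofReal (1 / 2)
        * eLpNorm a (ENNReal.ofReal r) P := by
      rw [← add_mul, ← ENNReal.ofReal_add (by norm_num) (by norm_num)]; norm_num
    have h3 : ENNReal.ofReal (1 / 2) * eLpNorm a (ENNReal.ofReal r) P
        ≤ eLpNorm B (ENNReal.ofReal r) P := by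
      refine (ENNReal.add_le_add_iff_right hfin).1 ?_
      rwa [← hsplit]
    rw [hsplit, ← two_mul]
    exact mul_le_mul_right h3 2
  have h3 : ∀ᵐ ω ∂P, ‖X ω - Y ω‖ ≤ Real.exp (K * T) * ‖a ω‖ := by
    refine Eventually.of_forall fun ω => ?_
    have := norm_contMap_smul_le (expWeight T (-K) c) (a ω)
    rw [ha, expWeight_neg_smul] at this
    exact this.trans (mul_le_mul_of_nonneg_right (norm_expWeight_neg_le hK.le hc) (norm_nonneg _))
  refine (eLpNorm_le_mul_eLpNorm_of_ae_le_mul h3 _).trans ((mul_le_mul_right h2 _).trans ?_)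
  rw [← mul_assoc]
  refine mul_le_mul_left (le_of_eq ?_) _
  rw [← ENNReal.ofReal_ofNat, ← ENNReal.ofReal_mul (Real.exp_pos _).le, mul_comm]

end VolterraSolution

section VolterraExistence

variable {Ω : Type*} [MeasurableSpace Ω] {P : Measure Ω} [IsProbabilityMeasure P] {T : ℝ}
  {F : Type*} [NormedAddCommGroup F] [NormedSpace ℝ F]
  {hT : 0 < T} {r L : ℝ} {N : (Ω → C(Icc (0 : ℝ) T, F)) → ℝ → Ω → F}

/-- The path `t ↦ x + ∫_c^t g`, with the junk value `0` if it is not continuous. -/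
noncomputable def primitivePath (T c : ℝ) (x : F) (g : ℝ → F) : C(Icc (0 : ℝ) T, F) :=
  ContinuousMap.mkD (fun t : Icc (0 : ℝ) T => x + ∫ τ in c..t, g τ) 0

lemma primitivePath_apply {c : ℝ} (hT : 0 < T) (hc : c ∈ Icc 0 T) (x : F) {g : ℝ → F}
    (hg : IntervalIntegrable g volume 0 T) (t : Icc (0 : ℝ) T) :
    primitivePath T c x g t = x + ∫ τ in c..t, g τ := by
  have hcont : Continuous fun t : Icc (0 : ℝ) T => x + ∫ τ in c..t, g τ := by
    have h1 : IntegrableOn g (Icc 0 T) :=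
      (intervalIntegrable_iff_integrableOn_Icc_of_le hT.le).1 hg
    have h2 := intervalIntegral.continuousOn_primitive_interval' (μ := volume) hg
      (a := c) (by rwa [uIcc_of_le hT.le])
    rw [uIcc_of_le hT.le] at h2
    exact continuous_const.add (continuousOn_iff_continuous_domRestrict.1 h2)
  rw [primitivePath, ContinuousMap.mkD_apply_of_continuous hcont]

lemma norm_primitivePath_le {c : ℝ} (hT : 0 < T) (hc : c ∈ Icc 0 T) (x : F) {g : ℝ → F}
    (hg : IntervalIntegrable g volume 0 T) :
    ‖primitivePath T c x g‖ ≤ ‖x‖ + ∫ τ in Icc 0 T, ‖g τ‖ := by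
  have hg' : IntegrableOn g (Icc 0 T) :=
    (intervalIntegrable_iff_integrableOn_Icc_of_le hT.le).1 hg
  have h0 : 0 ≤ ∫ τ in Icc 0 T, ‖g τ‖ := integral_nonneg fun _ => norm_nonneg _
  refine (ContinuousMap.norm_le _ (by positivity)).2 fun t => ?_
  rw [primitivePath_apply hT hc x hg]
  refine (norm_add_le _ _).trans (add_le_add le_rfl ?_)
  refine (intervalIntegral.norm_integral_le_integral_norm_uIoc).trans ?_
  exact setIntegral_mono_set hg'.norm (Eventually.of_forall fun _ => norm_nonneg _)
    (LE.le.eventuallyLE (uIoc_subset_uIcc.trans (uIcc_subset_Icc hc t.2)))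

lemma aestronglyMeasurable_intervalIntegral {g : ℝ → Ω → F}
    (hg : AEStronglyMeasurable (fun z : ℝ × Ω => g z.1 z.2) ((volume.restrict (Icc 0 T)).prod P))
    {c t : ℝ} (hc : c ∈ Icc 0 T) (ht : t ∈ Icc 0 T) :
    AEStronglyMeasurable (fun ω => ∫ τ in c..t, g τ ω) P := by
  have key : ∀ a ∈ Icc 0 T, ∀ b ∈ Icc 0 T,
      AEStronglyMeasurable (fun ω => ∫ τ in Ioc a b, g τ ω) P := by
    intro a ha b hb
    have hle : (volume.restrict (Ioc a b)).prod P ≤ (volume.restrict (Icc 0 T)).prod P :=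
      Measure.prod_mono (Measure.restrict_mono
        (Ioc_subset_Icc_self.trans (Icc_subset_Icc ha.1 hb.2)) le_rfl) le_rfl
    exact (hg.mono_measure hle).prod_swap.integral_prod_right'
  simp only [intervalIntegral]
  exact (key c hc t ht).sub (key t ht c hc)

lemma IsVolterraDriver.memLp_primitivePath (h : IsVolterraDriver P hT r L N) (hr : 1 < r)
    (hL : 0 ≤ L) {c : ℝ} (hc : c ∈ Icc 0 T) {x₀ : Ω → F} (hx₀ : MemLp x₀ (ENNReal.ofReal r) P)
    {X : Ω → C(Icc (0 : ℝ) T, F)} (hX : MemLp X (ENNReal.ofReal r) P) :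
    MemLp (fun ω => primitivePath T c (x₀ ω) fun t => N X t ω) (ENNReal.ofReal r) P := by
  have hN := h.memLp hL hX
  have hi := ae_intervalIntegrable_of_memLp hr hT hN
  refine (hx₀.norm.add (memLp_integral_norm hr hN)).mono' ?_ ?_
  · refine aestronglyMeasurable_path hT fun t => ?_
    refine (hx₀.1.add (aestronglyMeasurable_intervalIntegral hN.1 hc t.2)).congr ?_
    filter_upwards [hi] with ω hω
    exact (primitivePath_apply hT hc _ hω t).symm
  · filter_upwards [hi] with ω hω
    exact norm_primitivePath_le hT hc _ hω

/-- Existence for Volterra equations: the integral operator is a contraction of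
`L^r(Ω; C([0, T], F))` for the norm of paths weighted with `expWeight`. The initial time `c` may be
any point of `[0, T]`, so that the lemma covers equations with a terminal condition. -/
theorem IsVolterraDriver.exists_solution [CompleteSpace F] (h : IsVolterraDriver P hT r L N)
    (hr : 1 < r) (hL : 0 ≤ L) {c : ℝ} (hc : c ∈ Icc 0 T) {x₀ : Ω → F}
    (hx₀ : MemLp x₀ (ENNReal.ofReal r) P) :
    ∃ X : Ω → C(Icc (0 : ℝ) T, F), MemLp X (ENNReal.ofReal r) P ∧
      ∀ᵐ ω ∂P, IntervalIntegrable (fun t => N X t ω) volume 0 T ∧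
        ∀ t ∈ Icc 0 T, IccExtend hT.le (X ω) t = x₀ ω + ∫ τ in c..t, N X τ ω := by
  have : Fact (1 ≤ ENNReal.ofReal r) := ⟨one_le_ofReal hr⟩
  -- `L / K ≤ 1 / 4`, as the contraction estimate needs
  set K := 4 * L + 1 with hKdef
  have hK : 0 < K := by positivity
  have hLK : L / K ≤ 1 / 4 := by rw [div_le_div_iff₀ hK (by norm_num)]; linarith
  -- the Volterra operator, conjugated with the weight
  let U : (Ω → C(Icc (0 : ℝ) T, F)) → Ω → C(Icc (0 : ℝ) T, F) := fun y ω =>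
    expWeight T (-K) c • y ω
  let Θ : (Ω → C(Icc (0 : ℝ) T, F)) → Ω → C(Icc (0 : ℝ) T, F) := fun X ω =>
    primitivePath T c (x₀ ω) fun t => N X t ω
  have hU : ∀ y : Lp C(Icc (0 : ℝ) T, F) (ENNReal.ofReal r) P,
      MemLp (U y) (ENNReal.ofReal r) P := fun y => memLp_weight_smul _ (Lp.memLp y)
  have hS : ∀ y : Lp C(Icc (0 : ℝ) T, F) (ENNReal.ofReal r) P,
      MemLp (fun ω => expWeight T K c • Θ (U y) ω) (ENNReal.ofReal r) P := fun y =>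
    memLp_weight_smul _ (h.memLp_primitivePath hr hL hc hx₀ (hU y))
  let S : Lp C(Icc (0 : ℝ) T, F) (ENNReal.ofReal r) P →
      Lp C(Icc (0 : ℝ) T, F) (ENNReal.ofReal r) P := fun y => (hS y).toLp _
  have hcontr : ContractingWith (1 / 2) S := by
    refine ⟨by rw [← NNReal.coe_lt_coe]; norm_num, fun y y' => ?_⟩
    rw [Lp.edist_toLp_toLp, Lp.edist_def]
    have key := eLpNorm_le_add_half (P := P) hr
      (u := (fun ω => expWeight T K c • Θ (U y) ω) - fun ω => expWeight T K c • Θ (U y') ω)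
      (a := ⇑y - ⇑y') (B := fun _ => 0) ((Lp.memLp y).sub (Lp.memLp y'))
      aestronglyMeasurable_const ?_
    · refine key.trans (le_of_eq ?_)
      rw [eLpNorm_zero', zero_add]
      congr 1
      rw [ENNReal.ofReal]
      congr 1
      ext; simp
    · filter_upwards [ae_intervalIntegrable_of_memLp hr hT (h.memLp hL (hU y)),
        ae_intervalIntegrable_of_memLp hr hT (h.memLp hL (hU y'))] with ω h3 h4
      rw [zero_add]
      have hA0 : 0 ≤ ‖(⇑y - ⇑y') ω‖ + (eLpNorm (⇑y - ⇑y') (ENNReal.ofReal r) P).toReal :=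
        add_nonneg (norm_nonneg _) ENNReal.toReal_nonneg
      refine (ContinuousMap.norm_le _ (by positivity)).2 fun t => ?_
      have h5 := h.norm_integral_sub_le hL hK hc (hU y) (hU y') h3 h4 t.2
      have h6 : ∀ ω, expWeight T K c • (U y ω - U y' ω) = (⇑y - ⇑y') ω := by
        intro ω
        have : expWeight T K c • (U y ω - U y' ω)
            = expWeight T K c • U y ω - expWeight T K c • U y' ω := by
          ext t; exact smul_sub (expWeight T K c t) (U y ω t) (U y' ω t)
        rw [this, expWeight_smul_neg, expWeight_smul_neg]; rfl
      simp only [h6] at h5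
      have e : ((fun ω => expWeight T K c • Θ (U y) ω) - fun ω => expWeight T K c • Θ (U y') ω) ω t
          = Real.exp (-(K * |(t : ℝ) - c|)) • (Θ (U y) ω t - Θ (U y') ω t) :=
        (smul_sub (Real.exp (-(K * |(t : ℝ) - c|))) (Θ (U y) ω t) (Θ (U y') ω t)).symm
      rw [e, norm_smul, Real.norm_eq_abs, Real.abs_exp, Real.exp_neg,
        inv_mul_le_iff₀ (Real.exp_pos _), primitivePath_apply hT hc _ h3,
        primitivePath_apply hT hc _ h4, add_sub_add_left_eq_sub]
      refine h5.trans ?_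
      rw [← mul_assoc, mul_comm (Real.exp _)]
      gcongr
  set y := hcontr.fixedPoint S with hy
  have hfix : S y = y := hcontr.fixedPoint_isFixedPt
  refine ⟨U y, hU y, ?_⟩
  have hae : (fun ω => expWeight T K c • Θ (U y) ω) =ᵐ[P] y := by
    have := (hS y).coeFn_toLp
    have h2 : ⇑(S y) =ᵐ[P] y := by rw [hfix]
    exact this.symm.trans h2
  filter_upwards [hae, ae_intervalIntegrable_of_memLp hr hT (h.memLp hL (hU y))] with ω h1 h2
  refine ⟨h2, fun t ht => ?_⟩
  have h3 : U y ω = Θ (U y) ω := by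
    change expWeight T (-K) c • y ω = _
    rw [← h1, expWeight_neg_smul]
  rw [h3, IccExtend_of_mem hT.le _ ht]
  exact primitivePath_apply hT hc _ h2 ⟨t, ht⟩

end VolterraExistence

lemma HasIntrinsicDeriv.isFlatDeriv {p : ℝ} {d : ℕ} [Fact (1 < p)] {F : Type*}
    [NormedAddCommGroup F] [NormedSpace ℝ F] {Φ : PSpace p d → F} (h : HasIntrinsicDeriv Φ) :
    IsFlatDeriv Φ (flatDeriv Φ) := by
  rw [flatDeriv, dif_pos h.1]
  exact h.1.choose_spec

namespace Problem

/-! ### Composition of the data with states and controls -/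

section Composition

variable {d : ℕ} {V : Type*} {𝒞 : Problem d V}
  {Ω : Type*} [MeasurableSpace Ω] {P : Measure Ω}

lemma p_pos (𝒞 : Problem d V) : 0 < 𝒞.p := 𝒞.hpq.pos

lemma q_pos (𝒞 : Problem d V) : 0 < 𝒞.q := 𝒞.hpq.symm.pos

lemma one_lt_q (𝒞 : Problem d V) : 1 < 𝒞.q := 𝒞.hpq.symm.lt

lemma zero_mem (𝒞 : Problem d V) : (0 : ℝ) ∈ Icc 0 𝒞.T := left_mem_Icc.2 𝒞.T_pos.le

lemma T_mem (𝒞 : Problem d V) : 𝒞.T ∈ Icc 0 𝒞.T := right_mem_Icc.2 𝒞.T_pos.le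

/-- Lebesgue measure on `[0, T]`. -/
noncomputable abbrev timeMeasure (𝒞 : Problem d V) : Measure ℝ := volume.restrict (Icc 0 𝒞.T)

lemma ae_mem_time (𝒞 : Problem d V) (P : Measure Ω) :
    ∀ᵐ z : ℝ × Ω ∂(𝒞.timeMeasure.prod P), z.1 ∈ Icc 0 𝒞.T :=
  Measure.quasiMeasurePreserving_fst.ae (ae_restrict_mem measurableSet_Icc)

lemma continuous_ev (𝒞 : Problem d V) {F : Type*} [TopologicalSpace F] (γ : 𝒞.Path F) :
    Continuous (𝒞.ev γ) := γ.continuous.Icc_extend'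

lemma norm_ev_le (𝒞 : Problem d V) {F : Type*} [NormedAddCommGroup F] (γ : 𝒞.Path F) (t : ℝ) :
    ‖𝒞.ev γ t‖ ≤ ‖γ‖ := γ.norm_coe_le_norm _

lemma aestronglyMeasurable_ev {F : Type*} [NormedAddCommGroup F] {Ψ : Ω → 𝒞.Path F}
    (hΨ : AEStronglyMeasurable Ψ P) (t : ℝ) :
    AEStronglyMeasurable (fun ω => 𝒞.ev (Ψ ω) t) P :=
  (continuous_eval_const (projIcc 0 𝒞.T 𝒞.T_pos.le t)).comp_aestronglyMeasurable hΨ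

lemma memLp_ev {F : Type*} [NormedAddCommGroup F] {r : ℝ≥0∞} {Ψ : Ω → 𝒞.Path F}
    (hΨ : MemLp Ψ r P) (t : ℝ) : MemLp (fun ω => 𝒞.ev (Ψ ω) t) r P :=
  hΨ.of_le (aestronglyMeasurable_ev hΨ.1 t) (Eventually.of_forall fun _ => 𝒞.norm_ev_le _ _)

lemma aestronglyMeasurable_ev_prod {F : Type*} [NormedAddCommGroup F] {Ψ : Ω → 𝒞.Path F}
    [SFinite P] (hΨ : AEStronglyMeasurable Ψ P) (α : Measure ℝ) :
    AEStronglyMeasurable (fun z : ℝ × Ω => 𝒞.ev (Ψ z.2) z.1) (α.prod P) := by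
  have h1 : AEStronglyMeasurable (fun z : ℝ × Ω => projIcc 0 𝒞.T 𝒞.T_pos.le z.1) (α.prod P) :=
    (continuous_projIcc.measurable.comp measurable_fst).aestronglyMeasurable
  exact (by fun_prop : Continuous fun y : 𝒞.Path F × Icc (0 : ℝ) 𝒞.T =>
    y.1 y.2).comp_aestronglyMeasurable (hΨ.comp_snd.prodMk h1)

variable [IsProbabilityMeasure P]

lemma State.continuous_law (X : 𝒞.State P) : Continuous X.law := by
  rw [continuous_iff_continuousAt]
  intro t
  rw [ContinuousAt, tendsto_iff_edist_tendsto_0]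
  have hlim : Tendsto (fun s => eLpNorm (fun ω => X.at s ω - X.at t ω) (ENNReal.ofReal 𝒞.p) P)
      (𝓝 t) (𝓝 0) := by
    refine tendsto_eLpNorm_zero_of_dominated 𝒞.p_pos
      (Eventually.of_forall fun s => (X.memLp_at s).1.sub (X.memLp_at t).1)
      ((integrable_norm_rpow 𝒞.p_pos X.memLp).const_mul (2 ^ 𝒞.p))
      (Eventually.of_forall fun s => Eventually.of_forall fun ω => ?_)
      (Eventually.of_forall fun ω => ?_)
    · rw [← Real.mul_rpow (by norm_num) (norm_nonneg _)]
      refine Real.rpow_le_rpow (norm_nonneg _) ((norm_sub_le _ _).trans ?_) 𝒞.p_pos.le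
      have h1 : ‖X.at s ω‖ ≤ ‖X.path ω‖ := 𝒞.norm_ev_le _ _
      have h2 : ‖X.at t ω‖ ≤ ‖X.path ω‖ := 𝒞.norm_ev_le _ _
      linarith
    · have := ((𝒞.continuous_ev (X.path ω)).tendsto t).sub_const (X.at t ω)
      simpa [State.at] using this
  exact tendsto_of_tendsto_of_tendsto_of_le_of_le tendsto_const_nhds hlim (fun _ => bot_le)
    fun s => edist_law_le (X.memLp_at s) (X.memLp_at t)

/-- The norm of a state in `L^p(Ω; Γ)`. -/
noncomputable def State.lpNorm (X : 𝒞.State P) : ℝ :=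
  (eLpNorm X.path (ENNReal.ofReal 𝒞.p) P).toReal

lemma State.lpNorm_nonneg (X : 𝒞.State P) : 0 ≤ X.lpNorm := ENNReal.toReal_nonneg

lemma State.Mp_law_le (X : 𝒞.State P) (t : ℝ) : (X.law t).Mp ≤ X.lpNorm := by
  have hp0 : ENNReal.ofReal 𝒞.p ≠ 0 := by simpa using 𝒞.p_pos
  have h1 : ENNReal.ofReal (X.law t).Mp = eLpNorm (X.at t) (ENNReal.ofReal 𝒞.p) P := by
    rw [(X.memLp_at t).eLpNorm_eq_integral_rpow_norm hp0 ENNReal.ofReal_ne_top,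
      ENNReal.toReal_ofReal 𝒞.p_pos.le, ← PSpace.Mp_law_rpow (X.memLp_at t),
      ← Real.rpow_mul (PSpace.Mp_nonneg _), mul_inv_cancel₀ 𝒞.p_pos.ne', Real.rpow_one]
    rfl
  have h2 : eLpNorm (X.at t) (ENNReal.ofReal 𝒞.p) P ≤ eLpNorm X.path (ENNReal.ofReal 𝒞.p) P :=
    eLpNorm_mono fun ω => 𝒞.norm_ev_le _ _
  rw [← h1] at h2
  rw [← ENNReal.toReal_ofReal (PSpace.Mp_nonneg (X.law t))]
  exact ENNReal.toReal_mono X.memLp.2.ne h2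

variable [NormedAddCommGroup V]

/-- The points at which the data of the problem are meaningful. -/
def dataSet (𝒞 : Problem d V) : Set (ℝ × Rd d × PSpace 𝒞.p d × V) :=
  Icc 0 𝒞.T ×ˢ univ ×ˢ univ ×ˢ 𝒞.U

lemma isClosed_dataSet (h𝒞 : 𝒞.Assumptions) : IsClosed 𝒞.dataSet :=
  isClosed_Icc.prod (isClosed_univ.prod (isClosed_univ.prod h𝒞.U_closed))

lemma isClosed_dataSet' (h𝒞 : 𝒞.Assumptions) :
    IsClosed (Icc 0 𝒞.T ×ˢ (univ : Set (Rd d)) ×ˢ (univ : Set (PSpace 𝒞.p d)) ×ˢ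
      (univ : Set (Rd d)) ×ˢ 𝒞.U) :=
  isClosed_Icc.prod (isClosed_univ.prod (isClosed_univ.prod (isClosed_univ.prod h𝒞.U_closed)))

lemma Control.stronglyMeasurable_at (u : 𝒞.Control P) {t : ℝ} (ht : t ∈ Icc 0 𝒞.T) :
    StronglyMeasurable (u.val t) :=
  u.meas.comp_measurable (g := fun ω => ((⟨t, ht⟩ : Icc (0 : ℝ) 𝒞.T), ω)) (by fun_prop)

section Comp

variable {E : Type*} [TopologicalSpace E]

/-- Joint measurability of a datum of the problem along a state, a flow of laws and a control. -/
lemma aestronglyMeasurable_comp (h𝒞 : 𝒞.Assumptions) {φ : ℝ → Rd d → PSpace 𝒞.p d → V → E}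
    (hφ : ContinuousOn (fun z : ℝ × Rd d × PSpace 𝒞.p d × V => φ z.1 z.2.1 z.2.2.1 z.2.2.2)
      (Icc 0 𝒞.T ×ˢ univ ×ˢ univ ×ˢ 𝒞.U)) (X X' : 𝒞.State P) (u : 𝒞.Control P) :
    AEStronglyMeasurable
      (fun z : ℝ × Ω => φ z.1 (X.at z.1 z.2) (X'.law z.1) (u.val z.1 z.2))
      (𝒞.timeMeasure.prod P) := by
  refine aestronglyMeasurable_comp_of_continuousOn (isClosed_dataSet h𝒞) hφ
    (g := fun z : ℝ × Ω => (z.1, X.at z.1 z.2, X'.law z.1, u.val z.1 z.2)) ?_ ?_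
  · refine AEStronglyMeasurable.prodMk measurable_fst.aestronglyMeasurable
      (AEStronglyMeasurable.prodMk (aestronglyMeasurable_ev_prod X.memLp.1 _)
      (AEStronglyMeasurable.prodMk ?_ u.memLp.1))
    exact X'.continuous_law.comp_aestronglyMeasurable measurable_fst.aestronglyMeasurable
  · filter_upwards [𝒞.ae_mem_time P] with z hz
    exact ⟨hz, mem_univ _, mem_univ _, u.mem _ hz _⟩

lemma aestronglyMeasurable_comp_at (h𝒞 : 𝒞.Assumptions)
    {φ : ℝ → Rd d → PSpace 𝒞.p d → V → E}
    (hφ : ContinuousOn (fun z : ℝ × Rd d × PSpace 𝒞.p d × V => φ z.1 z.2.1 z.2.2.1 z.2.2.2)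
      (Icc 0 𝒞.T ×ˢ univ ×ˢ univ ×ˢ 𝒞.U)) {t : ℝ} (ht : t ∈ Icc 0 𝒞.T) {x : Ω → Rd d}
    (hx : AEStronglyMeasurable x P) (m : PSpace 𝒞.p d) {ν : Ω → V}
    (hν : AEStronglyMeasurable ν P) (hνU : ∀ ω, ν ω ∈ 𝒞.U) :
    AEStronglyMeasurable (fun ω => φ t (x ω) m (ν ω)) P := by
  refine aestronglyMeasurable_comp_of_continuousOn (isClosed_dataSet h𝒞) hφ
    (g := fun ω => (t, x ω, m, ν ω)) ?_ (Eventually.of_forall fun ω =>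
      ⟨ht, mem_univ _, mem_univ _, hνU ω⟩)
  exact aestronglyMeasurable_const.prodMk (hx.prodMk (aestronglyMeasurable_const.prodMk hν))

/-- Joint measurability of an intrinsic derivative in `(t, ω, ω')`, the derivative being taken of
the datum at `ω` in the direction of `ω'`. -/
lemma aestronglyMeasurable_comp_prod (h𝒞 : 𝒞.Assumptions)
    {φ : ℝ → Rd d → PSpace 𝒞.p d → Rd d → V → E}
    (hφ : ContinuousOn (fun z : ℝ × Rd d × PSpace 𝒞.p d × Rd d × V =>
      φ z.1 z.2.1 z.2.2.1 z.2.2.2.1 z.2.2.2.2)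
      (Icc 0 𝒞.T ×ˢ univ ×ˢ univ ×ˢ univ ×ˢ 𝒞.U)) (X : 𝒞.State P) (u : 𝒞.Control P) :
    AEStronglyMeasurable
      (fun z : (ℝ × Ω) × Ω => φ z.1.1 (X.at z.1.1 z.1.2) (X.law z.1.1) (X.at z.1.1 z.2)
        (u.val z.1.1 z.1.2)) ((𝒞.timeMeasure.prod P).prod P) := by
  have hX := aestronglyMeasurable_ev_prod (𝒞 := 𝒞) X.memLp.1 𝒞.timeMeasure
  have ht : AEStronglyMeasurable (fun z : (ℝ × Ω) × Ω => z.1.1) ((𝒞.timeMeasure.prod P).prod P) :=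
    (measurable_fst.comp measurable_fst).aestronglyMeasurable
  have hX2 : AEStronglyMeasurable (fun z : (ℝ × Ω) × Ω => X.at z.1.1 z.2)
      ((𝒞.timeMeasure.prod P).prod P) := by
    have h1 : AEStronglyMeasurable (fun z : (ℝ × Ω) × Ω => projIcc 0 𝒞.T 𝒞.T_pos.le z.1.1)
        ((𝒞.timeMeasure.prod P).prod P) :=
      continuous_projIcc.comp_aestronglyMeasurable ht
    exact (by fun_prop : Continuous fun y : 𝒞.Path (Rd d) × Icc (0 : ℝ) 𝒞.T =>
      y.1 y.2).comp_aestronglyMeasurable (X.memLp.1.comp_snd.prodMk h1)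
  refine aestronglyMeasurable_comp_of_continuousOn (isClosed_dataSet' h𝒞) hφ
    (g := fun z : (ℝ × Ω) × Ω => (z.1.1, X.at z.1.1 z.1.2, X.law z.1.1, X.at z.1.1 z.2,
      u.val z.1.1 z.1.2)) ?_ ?_
  · refine ht.prodMk (AEStronglyMeasurable.prodMk hX.comp_fst (AEStronglyMeasurable.prodMk
      (X.continuous_law.comp_aestronglyMeasurable ht) (hX2.prodMk u.memLp.1.comp_fst)))
  · have : ∀ᵐ z : (ℝ × Ω) × Ω ∂((𝒞.timeMeasure.prod P).prod P), z.1.1 ∈ Icc 0 𝒞.T :=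
      Measure.quasiMeasurePreserving_fst.ae (𝒞.ae_mem_time P)
    filter_upwards [this] with z hz
    exact ⟨hz, mem_univ _, mem_univ _, mem_univ _, u.mem _ hz _⟩

lemma aestronglyMeasurable_comp_at' (h𝒞 : 𝒞.Assumptions)
    {φ : ℝ → Rd d → PSpace 𝒞.p d → Rd d → V → E}
    (hφ : ContinuousOn (fun z : ℝ × Rd d × PSpace 𝒞.p d × Rd d × V =>
      φ z.1 z.2.1 z.2.2.1 z.2.2.2.1 z.2.2.2.2)
      (Icc 0 𝒞.T ×ˢ univ ×ˢ univ ×ˢ univ ×ˢ 𝒞.U)) {t : ℝ} (ht : t ∈ Icc 0 𝒞.T) {x : Ω → Rd d}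
    (hx : AEStronglyMeasurable x P) (m : PSpace 𝒞.p d) {y : Ω → Rd d}
    (hy : AEStronglyMeasurable y P) {ν : Ω → V}
    (hν : AEStronglyMeasurable ν P) (hνU : ∀ ω, ν ω ∈ 𝒞.U) :
    AEStronglyMeasurable (fun ω => φ t (x ω) m (y ω) (ν ω)) P := by
  refine aestronglyMeasurable_comp_of_continuousOn (isClosed_dataSet' h𝒞) hφ
    (g := fun ω => (t, x ω, m, y ω, ν ω)) ?_ (Eventually.of_forall fun ω =>
      ⟨ht, mem_univ _, mem_univ _, mem_univ _, hνU ω⟩)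
  exact aestronglyMeasurable_const.prodMk (hx.prodMk (aestronglyMeasurable_const.prodMk
    (hy.prodMk hν)))

end Comp

lemma memLp_bound (X X' : 𝒞.State P) (u : 𝒞.Control P) :
    MemLp (fun z : ℝ × Ω => 1 + ‖X.path z.2‖ + X'.lpNorm + ‖u.val z.1 z.2‖)
      (ENNReal.ofReal 𝒞.p) (𝒞.timeMeasure.prod P) := by
  have h1 : MemLp (fun z : ℝ × Ω => ‖X.path z.2‖) (ENNReal.ofReal 𝒞.p) (𝒞.timeMeasure.prod P) :=
    X.memLp.norm.comp_snd 𝒞.timeMeasure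
  have h2 : MemLp (fun _ : ℝ × Ω => (1 : ℝ)) (ENNReal.ofReal 𝒞.p) (𝒞.timeMeasure.prod P) :=
    memLp_const 1
  have h3 : MemLp (fun _ : ℝ × Ω => X'.lpNorm) (ENNReal.ofReal 𝒞.p) (𝒞.timeMeasure.prod P) :=
    memLp_const _
  exact ((h2.add h1).add h3).add u.memLp.norm

lemma exists_growth (h𝒞 : 𝒞.Assumptions) : ∃ C : ℝ, 0 ≤ C ∧
    (∀ t ∈ Icc 0 𝒞.T, ∀ x m, ∀ u ∈ 𝒞.U, ‖𝒞.f t x m u‖ ≤ C * (1 + ‖x‖ + m.Mp + ‖u‖)) ∧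
    (∀ t ∈ Icc 0 𝒞.T, ∀ x m, ∀ u ∈ 𝒞.U,
      |𝒞.f₀ t x m u| ≤ C * (1 + ‖x‖ ^ 𝒞.p + m.Mp ^ 𝒞.p + ‖u‖ ^ 𝒞.p)) ∧
    (∀ x m, |𝒞.σ x m| ≤ C * (1 + ‖x‖ ^ 𝒞.p + m.Mp ^ 𝒞.p)) := by
  obtain ⟨C, h1, h2, h3⟩ := h𝒞.growth
  refine ⟨|C|, abs_nonneg C, fun t ht x m u hu => (h1 t ht x m u hu).trans ?_,
    fun t ht x m u hu => (h2 t ht x m u hu).trans ?_, fun x m => (h3 x m).trans ?_⟩ <;>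
  · have := m.Mp_nonneg
    gcongr
    exact le_abs_self C

lemma memLp_f (h𝒞 : 𝒞.Assumptions) (X X' : 𝒞.State P) (u : 𝒞.Control P) :
    MemLp (fun z : ℝ × Ω => 𝒞.f z.1 (X.at z.1 z.2) (X'.law z.1) (u.val z.1 z.2))
      (ENNReal.ofReal 𝒞.p) (𝒞.timeMeasure.prod P) := by
  obtain ⟨C, hC0, hC, -, -⟩ := exists_growth h𝒞
  refine (memLp_bound X X' u).of_le_mul (c := C) (aestronglyMeasurable_comp h𝒞 h𝒞.f_cont X X' u) ?_
  filter_upwards [𝒞.ae_mem_time P] with z hz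
  have h1 : ‖X.at z.1 z.2‖ ≤ ‖X.path z.2‖ := 𝒞.norm_ev_le (X.path z.2) z.1
  have h2 := X'.Mp_law_le z.1
  have h3 := X'.lpNorm_nonneg
  rw [Real.norm_of_nonneg (by positivity)]
  refine (hC z.1 hz _ _ _ (u.mem _ hz _)).trans (mul_le_mul_of_nonneg_left ?_ hC0)
  linarith

/-- Constants that bound the derivatives of `f` make it Lipschitz along random vectors. -/
lemma exists_lipschitz (h𝒞 : 𝒞.Assumptions) : ∃ L : ℝ, 0 ≤ L ∧
    (∀ t ∈ Icc 0 𝒞.T, ∀ x m, ∀ u ∈ 𝒞.U, ‖fderiv ℝ (fun x => 𝒞.f t x m u) x‖ ≤ L) ∧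
    (∀ t ∈ Icc 0 𝒞.T, ∀ x m y, ∀ u ∈ 𝒞.U, ‖intrinsicDeriv (fun m => 𝒞.f t x m u) m y‖ ≤ L) ∧
    (∀ t ∈ Icc 0 𝒞.T, ∀ m, ∀ u ∈ 𝒞.U, ∀ x x', ‖𝒞.f t x m u - 𝒞.f t x' m u‖ ≤ L * ‖x - x'‖) := by
  obtain ⟨C₁, h₁⟩ := h𝒞.f_x_bound
  obtain ⟨C₂, h₂⟩ := h𝒞.f_m_bound
  refine ⟨max 0 (max C₁ C₂), le_max_left _ _, fun t ht x m u hu =>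
    (h₁ t ht x m u hu).trans (by simp), fun t ht x m y u hu => (h₂ t ht x m y u hu).trans (by simp),
    fun t ht m u hu x x' => ?_⟩
  exact Convex.norm_image_sub_le_of_norm_fderiv_le (fun y _ => h𝒞.f_diff_x t ht m u hu y)
    (fun y _ => (h₁ t ht y m u hu).trans (by simp)) convex_univ (mem_univ _) (mem_univ _)

lemma continuous_f_m (h𝒞 : 𝒞.Assumptions) {t : ℝ} (ht : t ∈ Icc 0 𝒞.T) (x : Rd d) {u : V}
    (hu : u ∈ 𝒞.U) : Continuous fun m => 𝒞.f t x m u :=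
  h𝒞.f_cont.comp_continuous (f := fun m : PSpace 𝒞.p d => (t, x, m, u)) (by fun_prop)
    fun m => ⟨ht, mem_univ _, mem_univ _, hu⟩

/-- The velocity is Lipschitz in the position and in the random vector whose law is the measure
argument. -/
lemma norm_f_sub_le (h𝒞 : 𝒞.Assumptions) {L : ℝ}
    (hL₁ : ∀ t ∈ Icc 0 𝒞.T, ∀ x m y, ∀ u ∈ 𝒞.U, ‖intrinsicDeriv (fun m => 𝒞.f t x m u) m y‖ ≤ L)
    (hL₂ : ∀ t ∈ Icc 0 𝒞.T, ∀ m, ∀ u ∈ 𝒞.U, ∀ x x', ‖𝒞.f t x m u - 𝒞.f t x' m u‖ ≤ L * ‖x - x'‖)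
    {t : ℝ} (ht : t ∈ Icc 0 𝒞.T) {u : V} (hu : u ∈ 𝒞.U) (x x' : Rd d) {Y Y' : Ω → Rd d}
    (hY : MemLp Y (ENNReal.ofReal 𝒞.p) P) (hY' : MemLp Y' (ENNReal.ofReal 𝒞.p) P) :
    ‖𝒞.f t x (PSpace.law P Y hY) u - 𝒞.f t x' (PSpace.law P Y' hY') u‖
      ≤ L * (‖x - x'‖ + (eLpNorm (fun ω => Y ω - Y' ω) (ENNReal.ofReal 𝒞.p) P).toReal) := by
  have h1 := hL₂ t ht (PSpace.law P Y hY) u hu x x'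
  have hd : HasIntrinsicDeriv fun m => 𝒞.f t x' m u := h𝒞.f_diff_m t ht x' u hu
  have h2 := hd.isFlatDeriv.norm_law_sub_le (continuous_f_m h𝒞 ht x' hu) hd.2
    (fun m y => hL₁ t ht x' m y u hu) hY' hY
  have h3 := norm_add_le (𝒞.f t x (PSpace.law P Y hY) u - 𝒞.f t x' (PSpace.law P Y hY) u)
    (𝒞.f t x' (PSpace.law P Y hY) u - 𝒞.f t x' (PSpace.law P Y' hY') u)
  rw [sub_add_sub_cancel] at h3
  linarith

open Classical in
/-- The right-hand side of the state equation as the driver of a Volterra equation. Paths that are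
not in `L^p` have no law in the Wasserstein space; for them the value is `0`. -/
noncomputable def stateDriver (u : 𝒞.Control P) (X : Ω → 𝒞.Path (Rd d)) (t : ℝ) (ω : Ω) : Rd d :=
  if h : MemLp X (ENNReal.ofReal 𝒞.p) P then
    𝒞.f t (𝒞.ev (X ω) t) (State.law ⟨X, h⟩ t) (u.val t ω) else 0

lemma stateDriver_apply (u : 𝒞.Control P) (X : 𝒞.State P) (t : ℝ) (ω : Ω) :
    stateDriver u X.path t ω = 𝒞.f t (X.at t ω) (X.law t) (u.val t ω) := by
  rw [stateDriver, dif_pos X.memLp]; rfl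

lemma isVolterraDriver_state (h𝒞 : 𝒞.Assumptions) {L : ℝ}
    (hL₁ : ∀ t ∈ Icc 0 𝒞.T, ∀ x m y, ∀ u ∈ 𝒞.U, ‖intrinsicDeriv (fun m => 𝒞.f t x m u) m y‖ ≤ L)
    (hL₂ : ∀ t ∈ Icc 0 𝒞.T, ∀ m, ∀ u ∈ 𝒞.U, ∀ x x', ‖𝒞.f t x m u - 𝒞.f t x' m u‖ ≤ L * ‖x - x'‖)
    (u : 𝒞.Control P) : IsVolterraDriver P 𝒞.T_pos 𝒞.p L (stateDriver u) where
  aestronglyMeasurable X hX := by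
    have h1 := (memLp_f h𝒞 ⟨X, hX⟩ ⟨X, hX⟩ u).1
    refine h1.congr (Eventually.of_forall fun z => ?_)
    exact (stateDriver_apply u ⟨X, hX⟩ _ _).symm
  lipschitz X X' hX hX' t ht ω := by
    rw [stateDriver_apply u ⟨X, hX⟩, stateDriver_apply u ⟨X', hX'⟩]
    exact norm_f_sub_le h𝒞 hL₁ hL₂ ht (u.mem t ht ω) _ _
      (State.memLp_at ⟨X, hX⟩ t) (State.memLp_at ⟨X', hX'⟩ t)
  memLp_zero := by
    have h0 : MemLp (0 : Ω → 𝒞.Path (Rd d)) (ENNReal.ofReal 𝒞.p) P :=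
      MemLp.zero' (ε := 𝒞.Path (Rd d))
    refine (memLp_congr_ae (Eventually.of_forall fun z => ?_)).1 (memLp_f h𝒞 ⟨0, h0⟩ ⟨0, h0⟩ u)
    exact (stateDriver_apply u ⟨0, h0⟩ _ _).symm

end Composition

/-! ### Existence and stability of states -/

section Existence

variable {d : ℕ} {V : Type*} {𝒞 : Problem d V} [NormedAddCommGroup V]
  {Ω : Type*} [MeasurableSpace Ω] {P : Measure Ω} [IsProbabilityMeasure P]

/-- The state equation has a solution for every control and every initial value in `L^p`. -/
lemma exists_state (h𝒞 : 𝒞.Assumptions) (u : 𝒞.Control P) {x₀ : Ω → Rd d}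
    (hx₀ : MemLp x₀ (ENNReal.ofReal 𝒞.p) P) :
    ∃ X : 𝒞.State P, 𝒞.IsLagrangian X u ∧ X.at 0 =ᵐ[P] x₀ := by
  obtain ⟨L, hL0, -, hL₁, hL₂⟩ := exists_lipschitz h𝒞
  obtain ⟨X, hX, hXeq⟩ := (isVolterraDriver_state h𝒞 hL₁ hL₂ u).exists_solution 𝒞.hpq.lt hL0
    𝒞.zero_mem hx₀
  have h0 : ∀ᵐ ω ∂P, 𝒞.ev (X ω) 0 = x₀ ω := by
    filter_upwards [hXeq] with ω hω
    have := hω.2 0 𝒞.zero_mem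
    rwa [intervalIntegral.integral_same, add_zero] at this
  refine ⟨⟨X, hX⟩, ?_, h0⟩
  filter_upwards [hXeq, h0] with ω hω hω0
  have e : (fun t => stateDriver u X t ω) = fun t => 𝒞.f t (State.at ⟨X, hX⟩ t ω)
      (State.law ⟨X, hX⟩ t) (u.val t ω) := funext fun t => stateDriver_apply u ⟨X, hX⟩ t ω
  rw [e] at hω
  refine ⟨hω.1, fun t ht => ?_⟩
  rw [hω0]
  exact hω.2 t ht

/-- Two states with the same initial value are close if the first one satisfies the state equation
of the second one up to a small error. -/
lemma exists_state_stability (h𝒞 : 𝒞.Assumptions) : ∃ C : ℝ, 0 ≤ C ∧ ∀ (X Y : 𝒞.State P)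
    (u : 𝒞.Control P), 𝒞.IsLagrangian Y u → Y.at 0 =ᵐ[P] X.at 0 → ∀ B : Ω → ℝ,
    AEStronglyMeasurable B P → (∀ᵐ ω ∂P, ∀ t ∈ Icc 0 𝒞.T, ‖X.at t ω - (X.at 0 ω
      + ∫ τ in (0 : ℝ)..t, 𝒞.f τ (X.at τ ω) (X.law τ) (u.val τ ω))‖ ≤ B ω) →
    eLpNorm (Y.path - X.path) (ENNReal.ofReal 𝒞.p) P
      ≤ ENNReal.ofReal C * eLpNorm B (ENNReal.ofReal 𝒞.p) P := by
  obtain ⟨L, hL0, -, hL₁, hL₂⟩ := exists_lipschitz h𝒞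
  refine ⟨2 * Real.exp ((4 * L + 1) * 𝒞.T), by positivity, fun X Y u hYu h0 B hB hXB => ?_⟩
  have e : ∀ (X : 𝒞.State P) ω, (fun t => stateDriver u X.path t ω) = fun t =>
      𝒞.f t (X.at t ω) (X.law t) (u.val t ω) := fun X ω => funext fun t => stateDriver_apply u X t ω
  refine (isVolterraDriver_state h𝒞 hL₁ hL₂ u).eLpNorm_sub_le 𝒞.hpq.lt hL0
    𝒞.zero_mem (x₀ := X.at 0) Y.memLp X.memLp ?_ hB ?_
  · filter_upwards [hYu, h0] with ω h1 h2 t ht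
    rw [e, ← h2]
    exact h1.2 t ht
  · filter_upwards [hXB] with ω h1 t ht
    rw [e]
    exact h1 t ht

end Existence

/-! ### The costate -/

section Costate

variable {d : ℕ} {V : Type*} {𝒞 : Problem d V} [NormedAddCommGroup V]
  {Ω : Type*} [MeasurableSpace Ω] {P : Measure Ω} [IsProbabilityMeasure P]

lemma exists_growth_deriv (h𝒞 : 𝒞.Assumptions) : ∃ C : ℝ, 0 ≤ C ∧
    (∀ t ∈ Icc 0 𝒞.T, ∀ x m, ∀ u ∈ 𝒞.U, ‖fderiv ℝ (fun x => 𝒞.f₀ t x m u) x‖ ^ 𝒞.q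
      ≤ C * (1 + ‖x‖ ^ 𝒞.p + m.Mp ^ 𝒞.p + ‖u‖ ^ 𝒞.p)) ∧
    (∀ t ∈ Icc 0 𝒞.T, ∀ x m y, ∀ u ∈ 𝒞.U, ‖intrinsicDeriv (fun m => 𝒞.f₀ t x m u) m y‖ ^ 𝒞.q
      ≤ C * (1 + ‖x‖ ^ 𝒞.p + ‖y‖ ^ 𝒞.p + m.Mp ^ 𝒞.p + ‖u‖ ^ 𝒞.p)) ∧
    (∀ x m, ‖fderiv ℝ (fun x => 𝒞.σ x m) x‖ ^ 𝒞.q ≤ C * (1 + ‖x‖ ^ 𝒞.p + m.Mp ^ 𝒞.p)) ∧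
    (∀ x m y, ‖intrinsicDeriv (fun m => 𝒞.σ x m) m y‖ ^ 𝒞.q
      ≤ C * (1 + ‖x‖ ^ 𝒞.p + ‖y‖ ^ 𝒞.p + m.Mp ^ 𝒞.p)) := by
  obtain ⟨C₁, h₁⟩ := h𝒞.f₀_x_bound
  obtain ⟨C₂, h₂⟩ := h𝒞.f₀_m_bound
  obtain ⟨C₃, h₃⟩ := h𝒞.σ_x_bound
  obtain ⟨C₄, h₄⟩ := h𝒞.σ_m_bound
  have e₁ : C₁ ≤ |C₁| + |C₂| + |C₃| + |C₄| := by
    linarith [le_abs_self C₁, abs_nonneg C₂, abs_nonneg C₃, abs_nonneg C₄]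
  have e₂ : C₂ ≤ |C₁| + |C₂| + |C₃| + |C₄| := by
    linarith [le_abs_self C₂, abs_nonneg C₁, abs_nonneg C₃, abs_nonneg C₄]
  have e₃ : C₃ ≤ |C₁| + |C₂| + |C₃| + |C₄| := by
    linarith [le_abs_self C₃, abs_nonneg C₁, abs_nonneg C₂, abs_nonneg C₄]
  have e₄ : C₄ ≤ |C₁| + |C₂| + |C₃| + |C₄| := by
    linarith [le_abs_self C₄, abs_nonneg C₁, abs_nonneg C₂, abs_nonneg C₃]
  refine ⟨|C₁| + |C₂| + |C₃| + |C₄|, by positivity,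
    fun t ht x m u hu => (h₁ t ht x m u hu).trans ?_,
    fun t ht x m y u hu => (h₂ t ht x m y u hu).trans ?_, fun x m => (h₃ x m).trans ?_,
    fun x m y => (h₄ x m y).trans ?_⟩ <;>
  · have := m.Mp_nonneg
    refine mul_le_mul_of_nonneg_right (by assumption) (by positivity)

/-- `∇ₓf` along a control process. -/
noncomputable def dxf (X : 𝒞.State P) (u : 𝒞.Control P) (t : ℝ) (ω : Ω) : Rd d →L[ℝ] Rd d :=
  fderiv ℝ (fun x => 𝒞.f t x (X.law t) (u.val t ω)) (X.at t ω)

/-- `∇ₓf₀` along a control process. -/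
noncomputable def dxf₀ (X : 𝒞.State P) (u : 𝒞.Control P) (t : ℝ) (ω : Ω) : RdStar d :=
  fderiv ℝ (fun x => 𝒞.f₀ t x (X.law t) (u.val t ω)) (X.at t ω)

/-- `∇ₘf` along a control process: the vector field is the one at `ω`, and the derivative is
evaluated at the position of `ω'`. -/
noncomputable def dmf (X : 𝒞.State P) (u : 𝒞.Control P) (t : ℝ) (ω ω' : Ω) : Rd d →L[ℝ] Rd d :=
  intrinsicDeriv (fun m => 𝒞.f t (X.at t ω) m (u.val t ω)) (X.law t) (X.at t ω')

/-- `∇ₘf₀` along a control process, with the conventions of `dmf`. -/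
noncomputable def dmf₀ (X : 𝒞.State P) (u : 𝒞.Control P) (t : ℝ) (ω ω' : Ω) : RdStar d :=
  intrinsicDeriv (fun m => 𝒞.f₀ t (X.at t ω) m (u.val t ω)) (X.law t) (X.at t ω')

/-- The right-hand side of the costate equation. -/
noncomputable def costateRhs (X : 𝒞.State P) (u : 𝒞.Control P) (Ψ : Ω → 𝒞.Path (RdStar d))
    (t : ℝ) (ω : Ω) : RdStar d :=
  -((𝒞.ev (Ψ ω) t).comp (dxf X u t ω)) + dxf₀ X u t ω
    - ∫ ω', (𝒞.ev (Ψ ω') t).comp (dmf X u t ω' ω) ∂P + ∫ ω', dmf₀ X u t ω' ω ∂P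

lemma costateEquation_iff {X : 𝒞.State P} {u : 𝒞.Control P} {Ψ : Ω → 𝒞.Path (RdStar d)} :
    𝒞.CostateEquation X u Ψ ↔
      ∀ᵐ ω ∂P, 𝒞.Solves (Ψ ω) fun t => costateRhs X u Ψ t ω := Iff.rfl

lemma measurePreserving_swap_right {α : Measure ℝ} [SFinite α] :
    MeasurePreserving (fun z : (ℝ × Ω) × Ω => ((z.1.1, z.2), z.1.2)) ((α.prod P).prod P)
      ((α.prod P).prod P) := by
  have h1 := measurePreserving_prodAssoc α P P
  have h2 := (MeasurePreserving.id α).prod (Measure.measurePreserving_swap (μ := P) (ν := P))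
  exact (h1.symm _).comp (h2.comp h1)

lemma aestronglyMeasurable_dxf (h𝒞 : 𝒞.Assumptions) (X : 𝒞.State P) (u : 𝒞.Control P) :
    AEStronglyMeasurable (fun z : ℝ × Ω => dxf X u z.1 z.2) (𝒞.timeMeasure.prod P) :=
  aestronglyMeasurable_comp h𝒞 (φ := fun t x m v => fderiv ℝ (fun x => 𝒞.f t x m v) x)
    h𝒞.f_x_cont X X u

lemma aestronglyMeasurable_dxf₀ (h𝒞 : 𝒞.Assumptions) (X : 𝒞.State P) (u : 𝒞.Control P) :
    AEStronglyMeasurable (fun z : ℝ × Ω => dxf₀ X u z.1 z.2) (𝒞.timeMeasure.prod P) :=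
  aestronglyMeasurable_comp h𝒞 (φ := fun t x m v => fderiv ℝ (fun x => 𝒞.f₀ t x m v) x)
    h𝒞.f₀_x_cont X X u

lemma aestronglyMeasurable_dmf (h𝒞 : 𝒞.Assumptions) (X : 𝒞.State P) (u : 𝒞.Control P) :
    AEStronglyMeasurable (fun z : (ℝ × Ω) × Ω => dmf X u z.1.1 z.1.2 z.2)
      ((𝒞.timeMeasure.prod P).prod P) :=
  aestronglyMeasurable_comp_prod h𝒞
    (φ := fun t x m y v => intrinsicDeriv (fun m => 𝒞.f t x m v) m y) h𝒞.f_m_cont X u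

lemma aestronglyMeasurable_dmf₀ (h𝒞 : 𝒞.Assumptions) (X : 𝒞.State P) (u : 𝒞.Control P) :
    AEStronglyMeasurable (fun z : (ℝ × Ω) × Ω => dmf₀ X u z.1.1 z.1.2 z.2)
      ((𝒞.timeMeasure.prod P).prod P) :=
  aestronglyMeasurable_comp_prod h𝒞
    (φ := fun t x m y v => intrinsicDeriv (fun m => 𝒞.f₀ t x m v) m y) h𝒞.f₀_m_cont X u

lemma aestronglyMeasurable_dmf_at (h𝒞 : 𝒞.Assumptions) (X : 𝒞.State P) (u : 𝒞.Control P) {t : ℝ}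
    (ht : t ∈ Icc 0 𝒞.T) (ω : Ω) : AEStronglyMeasurable (fun ω' => dmf X u t ω' ω) P :=
  aestronglyMeasurable_comp_at' h𝒞
    (φ := fun t x m y v => intrinsicDeriv (fun m => 𝒞.f t x m v) m y) h𝒞.f_m_cont ht
    (X.memLp_at t).1 _ aestronglyMeasurable_const (u.stronglyMeasurable_at ht).aestronglyMeasurable
    fun ω => u.mem t ht ω

lemma aestronglyMeasurable_dmf₀_at (h𝒞 : 𝒞.Assumptions) (X : 𝒞.State P) (u : 𝒞.Control P) {t : ℝ}
    (ht : t ∈ Icc 0 𝒞.T) (ω : Ω) : AEStronglyMeasurable (fun ω' => dmf₀ X u t ω' ω) P :=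
  aestronglyMeasurable_comp_at' h𝒞
    (φ := fun t x m y v => intrinsicDeriv (fun m => 𝒞.f₀ t x m v) m y) h𝒞.f₀_m_cont ht
    (X.memLp_at t).1 _ aestronglyMeasurable_const (u.stronglyMeasurable_at ht).aestronglyMeasurable
    fun ω => u.mem t ht ω

lemma State.norm_at_rpow_le (X : 𝒞.State P) (t : ℝ) (ω : Ω) :
    ‖X.at t ω‖ ^ 𝒞.p ≤ ‖X.path ω‖ ^ 𝒞.p :=
  Real.rpow_le_rpow (norm_nonneg _) (𝒞.norm_ev_le _ _) 𝒞.p_pos.le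

lemma State.Mp_law_rpow_le (X : 𝒞.State P) (t : ℝ) : (X.law t).Mp ^ 𝒞.p ≤ X.lpNorm ^ 𝒞.p :=
  Real.rpow_le_rpow (PSpace.Mp_nonneg _) (X.Mp_law_le t) 𝒞.p_pos.le

lemma State.integrable_path (X : 𝒞.State P) : Integrable (fun ω => ‖X.path ω‖ ^ 𝒞.p) P :=
  integrable_norm_rpow 𝒞.p_pos X.memLp

lemma Control.integrable_rpow (u : 𝒞.Control P) :
    Integrable (fun z : ℝ × Ω => ‖u.val z.1 z.2‖ ^ 𝒞.p) (𝒞.timeMeasure.prod P) :=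
  integrable_norm_rpow 𝒞.p_pos u.memLp

/-- The dominating function for the derivatives of the running cost. -/
lemma integrable_bound (X : 𝒞.State P) (u : 𝒞.Control P) (c : ℝ) :
    Integrable (fun z : ℝ × Ω => c + ‖X.path z.2‖ ^ 𝒞.p + ‖u.val z.1 z.2‖ ^ 𝒞.p)
      (𝒞.timeMeasure.prod P) := by
  have h1 : Integrable (fun z : ℝ × Ω => ‖X.path z.2‖ ^ 𝒞.p) (𝒞.timeMeasure.prod P) :=
    X.integrable_path.comp_snd 𝒞.timeMeasure
  exact ((integrable_const c).add h1).add u.integrable_rpow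

lemma memLp_dxf₀ (h𝒞 : 𝒞.Assumptions) (X : 𝒞.State P) (u : 𝒞.Control P) :
    MemLp (fun z : ℝ × Ω => dxf₀ X u z.1 z.2) (ENNReal.ofReal 𝒞.q) (𝒞.timeMeasure.prod P) := by
  obtain ⟨C, hC, h1, -, -, -⟩ := exists_growth_deriv h𝒞
  refine memLp_of_norm_rpow_le 𝒞.q_pos (aestronglyMeasurable_dxf₀ h𝒞 X u)
    ((integrable_bound X u (1 + X.lpNorm ^ 𝒞.p)).const_mul C) ?_
  filter_upwards [𝒞.ae_mem_time P] with z hz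
  refine (h1 z.1 hz _ _ _ (u.mem _ hz _)).trans (mul_le_mul_of_nonneg_left ?_ hC)
  linarith [X.norm_at_rpow_le z.1 z.2, X.Mp_law_rpow_le z.1]

lemma norm_dmf₀_rpow_le {C : ℝ} (hC : 0 ≤ C)
    (h : ∀ t ∈ Icc 0 𝒞.T, ∀ x m y, ∀ u ∈ 𝒞.U, ‖intrinsicDeriv (fun m => 𝒞.f₀ t x m u) m y‖ ^ 𝒞.q
      ≤ C * (1 + ‖x‖ ^ 𝒞.p + ‖y‖ ^ 𝒞.p + m.Mp ^ 𝒞.p + ‖u‖ ^ 𝒞.p)) (X : 𝒞.State P)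
    (u : 𝒞.Control P) {t : ℝ} (ht : t ∈ Icc 0 𝒞.T) (ω ω' : Ω) :
    ‖dmf₀ X u t ω ω'‖ ^ 𝒞.q ≤ C * (1 + ‖X.path ω‖ ^ 𝒞.p + ‖X.path ω'‖ ^ 𝒞.p + X.lpNorm ^ 𝒞.p
      + ‖u.val t ω‖ ^ 𝒞.p) := by
  refine (h t ht _ _ _ _ (u.mem _ ht _)).trans (mul_le_mul_of_nonneg_left ?_ hC)
  linarith [X.norm_at_rpow_le t ω, X.norm_at_rpow_le t ω', X.Mp_law_rpow_le t]

lemma Control.ae_integrable_rpow (u : 𝒞.Control P) :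
    ∀ᵐ t ∂𝒞.timeMeasure, Integrable (fun ω => ‖u.val t ω‖ ^ 𝒞.p) P :=
  u.integrable_rpow.prod_right_ae

lemma ae_prod_of_ae_fst {α : Measure ℝ} {p : ℝ → Prop} (h : ∀ᵐ t ∂α, p t) :
    ∀ᵐ z : ℝ × Ω ∂(α.prod P), p z.1 :=
  Measure.quasiMeasurePreserving_fst.ae h

lemma memLp_integral_dmf₀ (h𝒞 : 𝒞.Assumptions) (X : 𝒞.State P) (u : 𝒞.Control P) :
    MemLp (fun z : ℝ × Ω => ∫ ω', dmf₀ X u z.1 ω' z.2 ∂P) (ENNReal.ofReal 𝒞.q)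
      (𝒞.timeMeasure.prod P) := by
  obtain ⟨C, hC, -, h2, -, -⟩ := exists_growth_deriv h𝒞
  have hI : Integrable (fun z : ℝ × Ω => ∫ ω', ‖u.val z.1 ω'‖ ^ 𝒞.p ∂P) (𝒞.timeMeasure.prod P) :=
    u.integrable_rpow.integral_prod_left.comp_fst P
  have hX : Integrable (fun z : ℝ × Ω => ‖X.path z.2‖ ^ 𝒞.p) (𝒞.timeMeasure.prod P) :=
    X.integrable_path.comp_snd 𝒞.timeMeasure
  have hmeas := ((aestronglyMeasurable_dmf₀ h𝒞 X u).comp_measurePreserving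
    measurePreserving_swap_right).integral_prod_right'
  refine memLp_of_norm_rpow_le 𝒞.q_pos hmeas
    (((((integrable_const (1 + (∫ ω, ‖X.path ω‖ ^ 𝒞.p ∂P) + X.lpNorm ^ 𝒞.p)).add hX).add
      hI)).const_mul C) ?_
  filter_upwards [𝒞.ae_mem_time P, ae_prod_of_ae_fst u.ae_integrable_rpow] with z hz hu
  have i1 : Integrable (fun ω' => 1 + ‖X.path ω'‖ ^ 𝒞.p) P :=
    (integrable_const 1).add X.integrable_path
  have i2 : Integrable (fun ω' => 1 + ‖X.path ω'‖ ^ 𝒞.p + ‖X.path z.2‖ ^ 𝒞.p) P :=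
    i1.add (integrable_const _)
  have i3 : Integrable (fun ω' => 1 + ‖X.path ω'‖ ^ 𝒞.p + ‖X.path z.2‖ ^ 𝒞.p + X.lpNorm ^ 𝒞.p) P :=
    i2.add (integrable_const _)
  refine (norm_integral_rpow_le 𝒞.one_lt_q (aestronglyMeasurable_dmf₀_at h𝒞 X u hz z.2)
    ((i3.add hu).const_mul C)
    (Eventually.of_forall fun ω' => norm_dmf₀_rpow_le hC h2 X u hz ω' z.2)).trans (le_of_eq ?_)
  simp only [Pi.add_apply]
  rw [integral_const_mul, integral_add i3 hu, integral_add i2 (integrable_const _),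
    integral_add i1 (integrable_const _), integral_add (integrable_const _) X.integrable_path]
  simp only [integral_const, probReal_univ, one_smul]
  ring

lemma norm_dmf_le {L : ℝ}
    (hL : ∀ t ∈ Icc 0 𝒞.T, ∀ x m y, ∀ u ∈ 𝒞.U, ‖intrinsicDeriv (fun m => 𝒞.f t x m u) m y‖ ≤ L)
    (X : 𝒞.State P) (u : 𝒞.Control P) {t : ℝ} (ht : t ∈ Icc 0 𝒞.T) (ω ω' : Ω) :
    ‖dmf X u t ω ω'‖ ≤ L := hL t ht _ _ _ _ (u.mem t ht ω)

lemma aestronglyMeasurable_clm_comp {β E F G : Type*} [MeasurableSpace β] {μ : Measure β}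
    [NormedAddCommGroup E] [NormedSpace ℝ E] [NormedAddCommGroup F] [NormedSpace ℝ F]
    [NormedAddCommGroup G] [NormedSpace ℝ G] {f : β → F →L[ℝ] G} {g : β → E →L[ℝ] F}
    (hf : AEStronglyMeasurable f μ) (hg : AEStronglyMeasurable g μ) :
    AEStronglyMeasurable (fun x => (f x).comp (g x)) μ :=
  (isBoundedBilinearMap_comp.continuous (𝕜 := ℝ)).comp_aestronglyMeasurable (hf.prodMk hg)

lemma integrable_ev_comp_dmf (h𝒞 : 𝒞.Assumptions) {L : ℝ}
    (hL : ∀ t ∈ Icc 0 𝒞.T, ∀ x m y, ∀ u ∈ 𝒞.U, ‖intrinsicDeriv (fun m => 𝒞.f t x m u) m y‖ ≤ L)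
    (X : 𝒞.State P) (u : 𝒞.Control P) {Ψ : Ω → 𝒞.Path (RdStar d)}
    (hΨ : MemLp Ψ (ENNReal.ofReal 𝒞.q) P) {t : ℝ} (ht : t ∈ Icc 0 𝒞.T) (ω : Ω) :
    Integrable (fun ω' => (𝒞.ev (Ψ ω') t).comp (dmf X u t ω' ω)) P := by
  have h1 := (memLp_ev hΨ t).integrable (one_le_ofReal 𝒞.one_lt_q)
  refine (h1.norm.mul_const L).mono' (aestronglyMeasurable_clm_comp h1.1
    (aestronglyMeasurable_dmf_at h𝒞 X u ht ω)) (Eventually.of_forall fun ω' => ?_)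
  refine ((𝒞.ev (Ψ ω') t).opNorm_comp_le _).trans ?_
  exact mul_le_mul_of_nonneg_left (norm_dmf_le hL X u ht ω' ω) (norm_nonneg _)

lemma memLp_fun_add {β E : Type*} [MeasurableSpace β] {μ : Measure β} [NormedAddCommGroup E]
    {r : ℝ≥0∞} {f g : β → E} (hf : MemLp f r μ) (hg : MemLp g r μ) :
    MemLp (fun x => f x + g x) r μ := hf.add hg

lemma costateRhs_zero (X : 𝒞.State P) (u : 𝒞.Control P) (t : ℝ) (ω : Ω) :
    costateRhs X u 0 t ω = dxf₀ X u t ω + ∫ ω', dmf₀ X u t ω' ω ∂P := by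
  have h1 : ∀ A : Rd d →L[ℝ] Rd d, (0 : RdStar d).comp A = 0 := fun A => by ext; simp
  have h0 : costateRhs X u 0 t ω = -((0 : RdStar d).comp (dxf X u t ω)) + dxf₀ X u t ω
    - ∫ ω', (0 : RdStar d).comp (dmf X u t ω' ω) ∂P + ∫ ω', dmf₀ X u t ω' ω ∂P := rfl
  have h2 : ∫ ω', (0 : RdStar d).comp (dmf X u t ω' ω) ∂P = 0 := by
    rw [integral_congr_ae (Eventually.of_forall fun ω' => h1 (dmf X u t ω' ω)), integral_zero]
  rw [h0, h1, h2, neg_zero, zero_add, sub_zero]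

lemma aestronglyMeasurable_costateRhs (h𝒞 : 𝒞.Assumptions) (X : 𝒞.State P) (u : 𝒞.Control P)
    {Ψ : Ω → 𝒞.Path (RdStar d)} (hΨ : MemLp Ψ (ENNReal.ofReal 𝒞.q) P) :
    AEStronglyMeasurable (fun z : ℝ × Ω => costateRhs X u Ψ z.1 z.2) (𝒞.timeMeasure.prod P) := by
  have e1 := aestronglyMeasurable_ev_prod (𝒞 := 𝒞) hΨ.1 𝒞.timeMeasure
  have e2 : AEStronglyMeasurable (fun z : (ℝ × Ω) × Ω =>
      (𝒞.ev (Ψ z.1.2) z.1.1).comp (dmf X u z.1.1 z.1.2 z.2)) ((𝒞.timeMeasure.prod P).prod P) :=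
    aestronglyMeasurable_clm_comp e1.comp_fst (aestronglyMeasurable_dmf h𝒞 X u)
  have e3 := (e2.comp_measurePreserving measurePreserving_swap_right).integral_prod_right'
  exact (((aestronglyMeasurable_clm_comp e1 (aestronglyMeasurable_dxf h𝒞 X u)).neg.add
    (aestronglyMeasurable_dxf₀ h𝒞 X u)).sub e3).add (memLp_integral_dmf₀ h𝒞 X u).1

lemma norm_costateRhs_sub_le (h𝒞 : 𝒞.Assumptions) {L : ℝ} (hL0 : 0 ≤ L)
    (hL : ∀ t ∈ Icc 0 𝒞.T, ∀ x m, ∀ u ∈ 𝒞.U, ‖fderiv ℝ (fun x => 𝒞.f t x m u) x‖ ≤ L)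
    (hL₁ : ∀ t ∈ Icc 0 𝒞.T, ∀ x m y, ∀ u ∈ 𝒞.U, ‖intrinsicDeriv (fun m => 𝒞.f t x m u) m y‖ ≤ L)
    (X : 𝒞.State P) (u : 𝒞.Control P) {Ψ Ψ' : Ω → 𝒞.Path (RdStar d)}
    (hΨ : MemLp Ψ (ENNReal.ofReal 𝒞.q) P) (hΨ' : MemLp Ψ' (ENNReal.ofReal 𝒞.q) P)
    {t : ℝ} (ht : t ∈ Icc 0 𝒞.T) (ω : Ω) :
    ‖costateRhs X u Ψ t ω - costateRhs X u Ψ' t ω‖ ≤ L * (‖𝒞.ev (Ψ ω) t - 𝒞.ev (Ψ' ω) t‖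
      + (eLpNorm (fun ω' => 𝒞.ev (Ψ ω') t - 𝒞.ev (Ψ' ω') t)
          (ENNReal.ofReal 𝒞.q) P).toReal) := by
  have hsub : MemLp (fun ω' => 𝒞.ev (Ψ ω') t - 𝒞.ev (Ψ' ω') t) (ENNReal.ofReal 𝒞.q) P :=
    (memLp_ev hΨ t).sub (memLp_ev hΨ' t)
  have h1 : costateRhs X u Ψ t ω - costateRhs X u Ψ' t ω
      = -((𝒞.ev (Ψ ω) t - 𝒞.ev (Ψ' ω) t).comp (dxf X u t ω))
        - ∫ ω', (𝒞.ev (Ψ ω') t - 𝒞.ev (Ψ' ω') t).comp (dmf X u t ω' ω) ∂P := by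
    simp only [ContinuousLinearMap.sub_comp]
    rw [integral_sub (integrable_ev_comp_dmf h𝒞 hL₁ X u hΨ ht ω)
      (integrable_ev_comp_dmf h𝒞 hL₁ X u hΨ' ht ω)]
    simp only [costateRhs]
    abel
  have hi := hsub.integrable (one_le_ofReal 𝒞.one_lt_q)
  have h2 : ‖∫ ω', (𝒞.ev (Ψ ω') t - 𝒞.ev (Ψ' ω') t).comp (dmf X u t ω' ω) ∂P‖
      ≤ L * (eLpNorm (fun ω' => 𝒞.ev (Ψ ω') t - 𝒞.ev (Ψ' ω') t)
        (ENNReal.ofReal 𝒞.q) P).toReal := by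
    refine (norm_integral_le_of_norm_le (hi.norm.const_mul L)
      (Eventually.of_forall fun ω' => ?_)).trans ?_
    · refine (ContinuousLinearMap.opNorm_comp_le _ _).trans ?_
      rw [mul_comm]
      exact mul_le_mul_of_nonneg_right (norm_dmf_le hL₁ X u ht ω' ω) (norm_nonneg _)
    · rw [integral_const_mul]
      refine mul_le_mul_of_nonneg_left ?_ hL0
      rw [integral_norm_eq_lintegral_enorm hi.1, ← eLpNorm_one_eq_lintegral_enorm]
      exact ENNReal.toReal_mono hsub.2.ne
        (eLpNorm_le_eLpNorm_of_exponent_le (one_le_ofReal 𝒞.one_lt_q) hsub.1)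
  rw [h1, mul_add]
  refine (norm_sub_le _ _).trans (add_le_add ?_ h2)
  rw [norm_neg, mul_comm]
  exact (ContinuousLinearMap.opNorm_comp_le _ _).trans
    (mul_le_mul_of_nonneg_left (hL t ht _ _ _ (u.mem t ht ω)) (norm_nonneg _))

lemma memLp_costateRhs_zero (h𝒞 : 𝒞.Assumptions) (X : 𝒞.State P) (u : 𝒞.Control P) :
    MemLp (fun z : ℝ × Ω => costateRhs X u 0 z.1 z.2) (ENNReal.ofReal 𝒞.q)
      (𝒞.timeMeasure.prod P) := by
  have h1 := memLp_dxf₀ h𝒞 X u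
  have h2 := memLp_integral_dmf₀ h𝒞 X u
  simp_rw [costateRhs_zero]
  exact memLp_fun_add h1 h2

lemma isVolterraDriver_costate (h𝒞 : 𝒞.Assumptions) {L : ℝ} (hL0 : 0 ≤ L)
    (hL : ∀ t ∈ Icc 0 𝒞.T, ∀ x m, ∀ u ∈ 𝒞.U, ‖fderiv ℝ (fun x => 𝒞.f t x m u) x‖ ≤ L)
    (hL₁ : ∀ t ∈ Icc 0 𝒞.T, ∀ x m y, ∀ u ∈ 𝒞.U, ‖intrinsicDeriv (fun m => 𝒞.f t x m u) m y‖ ≤ L)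
    (X : 𝒞.State P) (u : 𝒞.Control P) :
    IsVolterraDriver P 𝒞.T_pos 𝒞.q L (costateRhs X u) where
  aestronglyMeasurable _ hΨ := aestronglyMeasurable_costateRhs h𝒞 X u hΨ
  lipschitz _ _ hΨ hΨ' _ ht ω := norm_costateRhs_sub_le h𝒞 hL0 hL hL₁ X u hΨ hΨ' ht ω
  memLp_zero := memLp_costateRhs_zero h𝒞 X u

/-- The terminal value of the costate. -/
noncomputable def terminalCostate (X : 𝒞.State P) (ω : Ω) : RdStar d :=
  -fderiv ℝ (fun x => 𝒞.σ x (X.law 𝒞.T)) (X.at 𝒞.T ω)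
    - ∫ ω', intrinsicDeriv (fun m => 𝒞.σ (X.at 𝒞.T ω') m) (X.law 𝒞.T) (X.at 𝒞.T ω) ∂P

lemma memLp_terminalCostate (h𝒞 : 𝒞.Assumptions) (X : 𝒞.State P) :
    MemLp (terminalCostate X) (ENNReal.ofReal 𝒞.q) P := by
  obtain ⟨C, hC, -, -, h3, h4⟩ := exists_growth_deriv h𝒞
  have hXT := (X.memLp_at 𝒞.T).1
  have hI : Integrable (fun ω => ‖X.path ω‖ ^ 𝒞.p) P := X.integrable_path
  have m1 : MemLp (fun ω => fderiv ℝ (fun x => 𝒞.σ x (X.law 𝒞.T)) (X.at 𝒞.T ω))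
      (ENNReal.ofReal 𝒞.q) P := by
    refine memLp_of_norm_rpow_le 𝒞.q_pos (h𝒞.σ_x_cont.comp_aestronglyMeasurable
      (hXT.prodMk aestronglyMeasurable_const))
      (((integrable_const (1 + X.lpNorm ^ 𝒞.p)).add hI).const_mul C)
      (Eventually.of_forall fun ω => (h3 _ _).trans (mul_le_mul_of_nonneg_left ?_ hC))
    simp only [Pi.add_apply]
    linarith [X.norm_at_rpow_le 𝒞.T ω, X.Mp_law_rpow_le 𝒞.T]
  refine m1.neg.sub (memLp_of_norm_rpow_le 𝒞.q_pos ?_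
      (((integrable_const (1 + X.lpNorm ^ 𝒞.p + ∫ ω, ‖X.path ω‖ ^ 𝒞.p ∂P)).add hI).const_mul C) ?_)
  · have : AEStronglyMeasurable (fun z : Ω × Ω => intrinsicDeriv (fun m => 𝒞.σ (X.at 𝒞.T z.2) m)
        (X.law 𝒞.T) (X.at 𝒞.T z.1)) (P.prod P) :=
      h𝒞.σ_m_cont.comp_aestronglyMeasurable
        (hXT.comp_snd.prodMk (aestronglyMeasurable_const.prodMk hXT.comp_fst))
    exact this.integral_prod_right'
  · refine Eventually.of_forall fun ω => ?_
    have i1 : Integrable (fun ω' => 1 + X.lpNorm ^ 𝒞.p + ‖X.path ω‖ ^ 𝒞.p + ‖X.path ω'‖ ^ 𝒞.p) P :=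
      (integrable_const _).add hI
    refine (norm_integral_rpow_le 𝒞.one_lt_q (h𝒞.σ_m_cont.comp_aestronglyMeasurable
      (hXT.prodMk (aestronglyMeasurable_const.prodMk aestronglyMeasurable_const)))
      (i1.const_mul C) (Eventually.of_forall fun ω' =>
        (h4 (X.at 𝒞.T ω') (X.law 𝒞.T) (X.at 𝒞.T ω)).trans
        (mul_le_mul_of_nonneg_left ?_ hC))).trans (le_of_eq ?_)
    · linarith [X.norm_at_rpow_le 𝒞.T ω, X.norm_at_rpow_le 𝒞.T ω', X.Mp_law_rpow_le 𝒞.T]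
    · rw [integral_const_mul, integral_add (integrable_const _) hI]
      simp only [integral_const, probReal_univ, one_smul, Pi.add_apply]
      ring

/-- The costate equation has a solution with the prescribed terminal value. -/
lemma exists_costate (h𝒞 : 𝒞.Assumptions) (X : 𝒞.State P) (u : 𝒞.Control P) :
    ∃ Ψ : Ω → 𝒞.Path (RdStar d), MemLp Ψ (ENNReal.ofReal 𝒞.q) P ∧
      𝒞.CostateEquation X u Ψ ∧ 𝒞.Transversality X Ψ := by
  obtain ⟨L, hL0, hL, hL₁, -⟩ := exists_lipschitz h𝒞
  obtain ⟨Ψ, hΨ, hΨeq⟩ := (isVolterraDriver_costate h𝒞 hL0 hL hL₁ X u).exists_solution 𝒞.one_lt_q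
    hL0 𝒞.T_mem (memLp_terminalCostate h𝒞 X)
  refine ⟨Ψ, hΨ, costateEquation_iff.2 ?_, ?_⟩
  · filter_upwards [hΨeq] with ω hω
    refine ⟨hω.1, fun t ht => ?_⟩
    have h1 : 𝒞.ev (Ψ ω) t = _ := hω.2 t ht
    have h0 : 𝒞.ev (Ψ ω) 0 = _ := hω.2 0 𝒞.zero_mem
    -- the Volterra equation starts at the time `T`, the costate equation at the time `0`
    have h2 := intervalIntegral.integral_add_adjacent_intervals
      (intervalIntegrable_mono_mem hω.1 𝒞.T_pos.le 𝒞.T_mem 𝒞.zero_mem)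
      (intervalIntegrable_mono_mem hω.1 𝒞.T_pos.le 𝒞.zero_mem ht)
    rw [h1, h0, add_assoc, h2]
  · filter_upwards [hΨeq] with ω hω
    have h1 : 𝒞.ev (Ψ ω) 𝒞.T = _ := hω.2 𝒞.T 𝒞.T_mem
    rw [intervalIntegral.integral_same, add_zero] at h1
    exact h1

end Costate

end Problem

/-! ### First-order expansions along converging states -/

section Expansion

/-- The flat derivative of a Hamiltonian, from those of the velocity and of the running cost. -/
lemma IsFlatDeriv.clm_comp_sub {p : ℝ} [Fact (1 < p)] {d : ℕ} {F G : Type*} [NormedAddCommGroup F]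
    [NormedSpace ℝ F] [CompleteSpace F] [NormedAddCommGroup G] [NormedSpace ℝ G] [CompleteSpace G]
    {Φ : PSpace p d → F} {δ : PSpace p d → Rd d → F} {Φ₀ : PSpace p d → G}
    {δ₀ : PSpace p d → Rd d → G} (h : IsFlatDeriv Φ δ) (h₀ : IsFlatDeriv Φ₀ δ₀) (ψ : F →L[ℝ] G) :
    IsFlatDeriv (fun m => ψ (Φ m) - Φ₀ m) (fun m y => ψ (δ m y) - δ₀ m y) where
  continuous := (ψ.continuous.comp h.continuous).sub h₀.continuous
  integrable m m' := (ψ.integrable_comp (h.integrable m m')).sub (h₀.integrable m m')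
  tendsto m m' := by
    have h1 := ((ψ.continuous.tendsto _).comp (h.tendsto m m')).sub (h₀.tendsto m m')
    have e : ∀ ν : PSpace p d, ∫ y, (ψ (δ m y) - δ₀ m y) ∂ν.meas
        = ψ (∫ y, δ m y ∂ν.meas) - ∫ y, δ₀ m y ∂ν.meas := fun ν => by
      rw [integral_sub (ψ.integrable_comp (h.integrable m ν)) (h₀.integrable m ν),
        ψ.integral_comp_comm (h.integrable m ν)]
    rw [e, e]
    convert h1 using 2
    · simp only [Function.comp_apply, map_smul, map_sub]
      rw [← smul_sub]
      congr 1
      abel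
    · rw [map_sub]; abel

lemma enorm_le_mul_of_norm_le {E E' E'' : Type*} [NormedAddCommGroup E] [NormedAddCommGroup E']
    [NormedAddCommGroup E''] {x : E} {y : E'} {z : E''} (h : ‖x‖ ≤ ‖y‖ * ‖z‖) :
    ‖x‖ₑ ≤ ‖y‖ₑ * ‖z‖ₑ := by
  rw [← ofReal_norm, ← ofReal_norm, ← ofReal_norm, ← ENNReal.ofReal_mul (norm_nonneg _)]
  exact ENNReal.ofReal_le_ofReal h

/-- Integrated first-order expansion of functions that vary with the index: the remainder, divided
by the increment, is dominated in `L^q`. -/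
lemma exists_lintegral_remainder_le {β E F : Type*} [MeasurableSpace β] {μ : Measure β}
    [NormedAddCommGroup E] [NormedSpace ℝ E] [NormedAddCommGroup F] [NormedSpace ℝ F] {p q : ℝ}
    (hpq : p.HolderConjugate q) {G : ℕ → β → E → F} {G' : ℕ → β → E → E →L[ℝ] F}
    {A : β → E →L[ℝ] F} {x : β → E} {x' : ℕ → β → E} {b ζ : β → ℝ}
    (hG : ∀ᵐ z ∂μ, ∀ n y, HasFDerivAt (G n z) (G' n z y) y)
    (hA : ∀ᵐ z ∂μ, Tendsto (fun i : ℕ × E => G' i.1 z i.2) (atTop ×ˢ 𝓝 (x z)) (𝓝 (A z)))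
    (hb : Integrable b μ)
    (hbound : ∀ᵐ z ∂μ, ∀ n y, ‖y‖ ≤ ζ z → ‖G' n z y - A z‖ ^ q ≤ b z)
    (hx : AEStronglyMeasurable x μ) (hx' : ∀ n, AEStronglyMeasurable (x' n) μ)
    (hxζ : ∀ᵐ z ∂μ, ‖x z‖ ≤ ζ z) (hxζ' : ∀ᵐ z ∂μ, ∀ n, ‖x' n z‖ ≤ ζ z)
    (hlim : ∀ᵐ z ∂μ, Tendsto (fun n => x' n z) atTop (𝓝 (x z)))
    (hmeas : ∀ n, AEStronglyMeasurable
      (fun z => G n z (x' n z) - G n z (x z) - A z (x' n z - x z)) μ) :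
    ∃ ε : ℕ → ℝ≥0∞, Tendsto ε atTop (𝓝 0) ∧ ∀ n,
      ∫⁻ z, ‖G n z (x' n z) - G n z (x z) - A z (x' n z - x z)‖ₑ ∂μ
        ≤ ε n * eLpNorm (fun z => x' n z - x z) (ENNReal.ofReal p) μ := by
  have hq0 := hpq.symm.pos
  set R : ℕ → β → F := fun n z => G n z (x' n z) - G n z (x z) - A z (x' n z - x z) with hR
  set g : ℕ → β → ℝ := fun n z => ‖R n z‖ / ‖x' n z - x z‖ with hg
  have hgm : ∀ n, AEStronglyMeasurable (g n) μ := fun n =>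
    ((hmeas n).norm.aemeasurable.div ((hx' n).sub hx).norm.aemeasurable).aestronglyMeasurable
  -- a bound for `G' - A` on a ball around both points is a bound for the quotient
  have key : ∀ z, (∀ n y, HasFDerivAt (G n z) (G' n z y) y) → ∀ n (s : Set E), Convex ℝ s →
      x z ∈ s → x' n z ∈ s → ∀ C, (∀ y ∈ s, ‖G' n z y - A z‖ ≤ C) →
      ‖R n z‖ ≤ C * ‖x' n z - x z‖ := by
    intro z hz n s hs h1 h2 C hC
    have := hs.norm_image_sub_le_of_norm_hasFDerivWithin_le
      (f := fun y => G n z y - A z y) (f' := fun y => G' n z y - A z) (C := C)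
      (fun y _ => ((hz n y).sub (A z).hasFDerivAt).hasFDerivWithinAt) hC h1 h2
    refine le_trans (le_of_eq ?_) this
    simp only [hR, map_sub]
    congr 1
    abel
  have hgle : ∀ z n C, 0 ≤ C → ‖R n z‖ ≤ C * ‖x' n z - x z‖ → g n z ≤ C := by
    intro z n C hC h
    exact div_le_of_le_mul₀ (norm_nonneg _) hC h
  have hg0 : ∀ n z, 0 ≤ g n z := fun n z => by positivity
  refine ⟨fun n => eLpNorm (g n) (ENNReal.ofReal q) μ, ?_, fun n => ?_⟩
  · refine tendsto_eLpNorm_zero_of_dominated hq0 (Eventually.of_forall hgm) hb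
      (Eventually.of_forall fun n => ?_) ?_
    · filter_upwards [hG, hbound, hxζ, hxζ'] with z h1 h2 h3 h4
      have hb0 : 0 ≤ b z := le_trans (by positivity) (h2 n _ h3)
      have : g n z ≤ b z ^ (1 / q) := by
        refine hgle z n _ (by positivity) (key z h1 n (Metric.closedBall 0 (ζ z))
          (convex_closedBall _ _) (by simpa using h3) (by simpa using h4 n) _ fun y hy => ?_)
        rw [one_div, ← Real.rpow_le_rpow_iff (norm_nonneg _) (by positivity) hq0,
          Real.rpow_inv_rpow hb0 hq0.ne']
        exact h2 n y (by simpa using hy)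
      rw [Real.norm_of_nonneg (hg0 n z)]
      refine (Real.rpow_le_rpow (hg0 n z) this hq0.le).trans (le_of_eq ?_)
      rw [one_div, Real.rpow_inv_rpow hb0 hq0.ne']
    · filter_upwards [hG, hA, hlim] with z h1 h2 h3
      rw [Metric.tendsto_nhds]
      intro ε hε
      have h4 : ∀ᶠ i in atTop ×ˢ 𝓝 (x z), ‖G' i.1 z i.2 - A z‖ < ε / 2 := by
        have := (Metric.tendsto_nhds.1 h2) (ε / 2) (by positivity)
        simpa [dist_eq_norm] using this
      obtain ⟨p₁, hp₁, p₂, hp₂, h5⟩ := eventually_prod_iff.1 h4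
      obtain ⟨r, hr, hr'⟩ := Metric.eventually_nhds_iff_ball.1 hp₂
      filter_upwards [hp₁, h3 (Metric.ball_mem_nhds _ hr)] with n h6 h7
      have : g n z ≤ ε / 2 := hgle z n _ (by positivity) (key z h1 n (Metric.ball (x z) r)
        (convex_ball _ _) (Metric.mem_ball_self hr) h7 _ fun y hy => (h5 h6 (hr' y hy)).le)
      rw [dist_zero_right, Real.norm_of_nonneg (hg0 n z)]
      linarith
  · refine (lintegral_mono_ae ?_).trans (lintegral_enorm_mul_le μ hpq (hgm n) ((hx' n).sub hx))
    filter_upwards [hG] with z h1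
    refine enorm_le_mul_of_norm_le ?_
    rw [Real.norm_of_nonneg (hg0 n z)]
    change ‖R n z‖ ≤ ‖R n z‖ / ‖x' n z - x z‖ * ‖x' n z - x z‖
    rcases eq_or_ne (x' n z - x z) 0 with h0 | h0
    · have h00 : x' n z = x z := sub_eq_zero.1 h0
      simp [hR, h00]
    · rw [div_mul_cancel₀ _ (norm_ne_zero_iff.2 h0)]

lemma rpow_le_one_add {x r : ℝ} (hx : 0 ≤ x) (hr : 0 ≤ r) (hr1 : r ≤ 1) : x ^ r ≤ 1 + x := by
  rcases le_total x 1 with h | h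
  · exact (Real.rpow_le_one hx h hr).trans (by linarith)
  · exact (Real.rpow_le_rpow_of_exponent_le h hr1).trans (by rw [Real.rpow_one]; linarith)

variable {p q : ℝ} [hp : Fact (1 < p)] {d : ℕ} {Ω : Type*} [MeasurableSpace Ω] {P : Measure Ω}
  [IsProbabilityMeasure P]

/-- The increments of functions of a position and a law, with a random position and a law that both
depend on a parameter `z`, are given by the derivatives in `x` and `m` up to an error which is
`o(h)` in the mean, where `h n` bounds the increments in `L^p`. -/
lemma tendsto_lintegral_remainder_div (hpq : p.HolderConjugate q) {β : Type*} [MeasurableSpace β]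
    {μ : Measure β} [IsFiniteMeasure μ] {K : β → Rd d → PSpace p d → ℝ}
    {Kx : β → Rd d → PSpace p d → RdStar d} {Km : β → PSpace p d → Rd d → RdStar d}
    {δ : β → PSpace p d → Rd d → ℝ} {x : β → Rd d} {x' : ℕ → β → Rd d}
    {Y : β → Ω → Rd d} {Y' : ℕ → β → Ω → Rd d} {a ζ : β → ℝ} {Z : Ω → ℝ} {C : ℝ} {h : ℕ → ℝ≥0∞}
    (hY : ∀ z, MemLp (Y z) (ENNReal.ofReal p) P)
    (hY' : ∀ n z, MemLp (Y' n z) (ENNReal.ofReal p) P)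
    (hKx : ∀ᵐ z ∂μ, ∀ x m, HasFDerivAt (fun x => K z x m) (Kx z x m) x)
    (hKxc : ∀ᵐ z ∂μ, Continuous fun w : Rd d × PSpace p d => Kx z w.1 w.2)
    (hK : ∀ᵐ z ∂μ, Continuous (K z (x z)))
    (hδ : ∀ᵐ z ∂μ, IsFlatDeriv (K z (x z)) (δ z))
    (hKm : ∀ᵐ z ∂μ, ∀ m y, HasFDerivAt (δ z m) (Km z m y) y)
    (hKmc : ∀ᵐ z ∂μ, Continuous fun w : PSpace p d × Rd d => Km z w.1 w.2)
    (hC : 0 ≤ C) (ha : Integrable a μ) (ha0 : ∀ z, 0 ≤ a z)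
    (hKxb : ∀ᵐ z ∂μ, ∀ x m, ‖Kx z x m‖ ^ q ≤ C * (a z + ‖x‖ ^ p + m.Mp ^ p))
    (hKmb : ∀ᵐ z ∂μ, ∀ m y, ‖Km z m y‖ ^ q ≤ C * (a z + ‖y‖ ^ p + m.Mp ^ p))
    (hZ : MemLp Z (ENNReal.ofReal p) P) (hYZ : ∀ z, ∀ᵐ ω ∂P, ‖Y z ω‖ ≤ Z ω)
    (hYZ' : ∀ z, ∀ᵐ ω ∂P, ∀ n, ‖Y' n z ω‖ ≤ Z ω)
    (hYlim : ∀ z, ∀ᵐ ω ∂P, Tendsto (fun n => Y' n z ω) atTop (𝓝 (Y z ω)))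
    (hYh : ∀ n z, eLpNorm (fun ω => Y' n z ω - Y z ω) (ENNReal.ofReal p) P ≤ h n)
    (hh : Tendsto h atTop (𝓝 0)) (hh0 : ∀ n, h n ≠ 0) (hh1 : ∀ n, h n ≠ ∞)
    (hx : AEStronglyMeasurable x μ) (hx' : ∀ n, AEStronglyMeasurable (x' n) μ)
    (hζ : Integrable (fun z => ζ z ^ p) μ) (hxζ : ∀ᵐ z ∂μ, ‖x z‖ ≤ ζ z)
    (hxζ' : ∀ᵐ z ∂μ, ∀ n, ‖x' n z‖ ≤ ζ z)
    (hxlim : ∀ᵐ z ∂μ, Tendsto (fun n => x' n z) atTop (𝓝 (x z)))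
    (hxh : ∀ n, eLpNorm (fun z => x' n z - x z) (ENNReal.ofReal p) μ ≤ h n)
    (hm1 : ∀ n, AEStronglyMeasurable (fun z => K z (x' n z) (PSpace.law P (Y' n z) (hY' n z))
      - K z (x z) (PSpace.law P (Y' n z) (hY' n z))
      - Kx z (x z) (PSpace.law P (Y z) (hY z)) (x' n z - x z)) μ)
    (hm2 : ∀ n, AEStronglyMeasurable (fun z => K z (x z) (PSpace.law P (Y' n z) (hY' n z))
      - K z (x z) (PSpace.law P (Y z) (hY z))
      - ∫ ω, Km z (PSpace.law P (Y z) (hY z)) (Y z ω) (Y' n z ω - Y z ω) ∂P) μ) :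
    Tendsto (fun n => (∫⁻ z, ‖K z (x' n z) (PSpace.law P (Y' n z) (hY' n z))
      - K z (x z) (PSpace.law P (Y z) (hY z))
      - Kx z (x z) (PSpace.law P (Y z) (hY z)) (x' n z - x z)
      - ∫ ω, Km z (PSpace.law P (Y z) (hY z)) (Y z ω) (Y' n z ω - Y z ω) ∂P‖ₑ ∂μ) / h n)
      atTop (𝓝 0) := by
  have hq0 := hpq.symm.pos
  have hq1 := hpq.symm.lt
  have hp0 := hpq.pos
  set m : β → PSpace p d := fun z => PSpace.law P (Y z) (hY z) with hm
  set m' : ℕ → β → PSpace p d := fun n z => PSpace.law P (Y' n z) (hY' n z) with hm'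
  set M : ℝ := ∫ ω, ‖Z ω‖ ^ p ∂P with hM
  have hM0 : 0 ≤ M := integral_nonneg fun ω => by positivity
  have hZi := integrable_norm_rpow hp0 hZ
  have hMle : ∀ z, (m z).Mp ^ p ≤ M := fun z => by
    rw [hm, PSpace.Mp_law_rpow]
    refine integral_mono_ae (integrable_norm_rpow hp0 (hY z)) hZi ?_
    filter_upwards [hYZ z] with ω hω
    exact Real.rpow_le_rpow (norm_nonneg _) (hω.trans (le_abs_self _)) hp0.le
  have hMle' : ∀ n z, (m' n z).Mp ^ p ≤ M := fun n z => by
    rw [hm', PSpace.Mp_law_rpow]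
    refine integral_mono_ae (integrable_norm_rpow hp0 (hY' n z)) hZi ?_
    filter_upwards [hYZ' z] with ω hω
    exact Real.rpow_le_rpow (norm_nonneg _) ((hω n).trans (le_abs_self _)) hp0.le
  have hmlim : ∀ z, Tendsto (fun n => m' n z) atTop (𝓝 (m z)) := fun z => by
    rw [tendsto_iff_edist_tendsto_0]
    exact tendsto_of_tendsto_of_tendsto_of_le_of_le tendsto_const_nhds hh (fun _ => bot_le)
      fun n => (edist_law_le (hY' n z) (hY z)).trans (hYh n z)
  -- the increment in `x`
  obtain ⟨ε₁, hε₁, hR₁⟩ := exists_lintegral_remainder_le (μ := μ) hpq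
    (G := fun n z y => K z y (m' n z)) (G' := fun n z y => Kx z y (m' n z))
    (A := fun z => Kx z (x z) (m z)) (x := x) (x' := x') (ζ := ζ)
    (b := fun z => 2 ^ (q - 1) * (C * (a z + ζ z ^ p + M) + C * (a z + ζ z ^ p + M)))
    (by filter_upwards [hKx] with z hz n y using hz y _)
    (by
      filter_upwards [hKxc] with z hz
      have h1 : Tendsto (fun i : ℕ × Rd d => (i.2, m' i.1 z)) (atTop ×ˢ 𝓝 (x z))
          (𝓝 (x z, m z)) := by
        rw [nhds_prod_eq]
        exact tendsto_snd.prodMk ((hmlim z).comp tendsto_fst)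
      exact (hz.tendsto (x z, m z)).comp h1)
    (by
      have : Integrable (fun z => C * (a z + ζ z ^ p + M)) μ :=
        ((ha.add hζ).add (integrable_const M)).const_mul C
      exact (this.add this).const_mul _)
    (by
      filter_upwards [hKxb, hxζ] with z hz hzζ n y hy
      refine (Real.rpow_le_rpow (norm_nonneg _) (norm_sub_le _ _) hq0.le).trans
        ((add_rpow_le_mul hq1.le (norm_nonneg _) (norm_nonneg _)).trans ?_)
      refine mul_le_mul_of_nonneg_left (add_le_add ?_ ?_) (by positivity)
      · refine (hz _ _).trans (mul_le_mul_of_nonneg_left ?_ hC)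
        linarith [hMle' n z, Real.rpow_le_rpow (norm_nonneg y) hy hp0.le]
      · refine (hz _ _).trans (mul_le_mul_of_nonneg_left ?_ hC)
        linarith [hMle z, Real.rpow_le_rpow (norm_nonneg (x z)) hzζ hp0.le])
    hx hx' hxζ hxζ' hxlim hm1
  -- the increment in `m`
  set R₂ : ℕ → β → ℝ := fun n z => K z (x z) (m' n z) - K z (x z) (m z)
      - ∫ ω, Km z (m z) (Y z ω) (Y' n z ω - Y z ω) ∂P with hR₂
  have hexp : ∀ᵐ z ∂μ, ∃ ε : ℕ → ℝ≥0∞, Tendsto ε atTop (𝓝 0) ∧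
      (∀ n, ε n ≤ ENNReal.ofReal (2 ^ q * C * (a z + 3 * M)) ^ (1 / q)) ∧
      ∀ n, ‖R₂ n z‖ₑ ≤ ε n * eLpNorm (Y' n z - Y z) (ENNReal.ofReal p) P := by
    filter_upwards [hK, hδ, hKm, hKmc, hKmb] with z h1 h2 h3 h4 h5
    exact h2.exists_expansion hpq h1 h3 h4 hC (ha0 z) h5 (hY z) (fun n => hY' n z) hZ (hYZ z)
      (hYZ' z) (hYlim z)
  have hR₂lim : Tendsto (fun n => ∫⁻ z, ‖R₂ n z‖ₑ / h n ∂μ) atTop (𝓝 (∫⁻ _, 0 ∂μ)) := by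
    refine tendsto_lintegral_filter_of_dominated_convergence'
      (fun z => ‖1 + 2 ^ q * C * (a z + 3 * M)‖ₑ)
      (Eventually.of_forall fun n => (hm2 n).enorm.div_const _)
      (Eventually.of_forall fun n => ?_) ?_ ?_
    · filter_upwards [hexp] with z hz
      obtain ⟨ε, -, hε, hle⟩ := hz
      refine ENNReal.div_le_of_le_mul ((hle n).trans (mul_le_mul' ((hε n).trans ?_) (hYh n z)))
      have h0 : 0 ≤ 2 ^ q * C * (a z + 3 * M) := by
        have := ha0 z; positivity
      rw [ENNReal.ofReal_rpow_of_nonneg h0 (by positivity), ← ofReal_norm]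
      refine ENNReal.ofReal_le_ofReal ((rpow_le_one_add h0 (by positivity) ?_).trans
        (le_abs_self _))
      rw [div_le_one hq0]; exact hq1.le
    · exact ((integrable_const (1 : ℝ)).add
        ((ha.add (integrable_const (3 * M))).const_mul (2 ^ q * C))).2.ne
    · filter_upwards [hexp] with z hz
      obtain ⟨ε, hε, -, hle⟩ := hz
      refine tendsto_of_tendsto_of_tendsto_of_le_of_le tendsto_const_nhds hε (fun _ => bot_le)
        fun n => ENNReal.div_le_of_le_mul ((hle n).trans (mul_le_mul' le_rfl (hYh n z)))
  rw [lintegral_zero] at hR₂lim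
  have hsum := hε₁.add hR₂lim
  rw [add_zero] at hsum
  refine tendsto_of_tendsto_of_tendsto_of_le_of_le tendsto_const_nhds hsum (fun _ => bot_le)
    fun n => ?_
  refine ENNReal.div_le_of_le_mul ?_
  rw [add_mul]
  simp_rw [ENNReal.div_eq_inv_mul]
  rw [lintegral_const_mul' _ _ (ENNReal.inv_ne_top.2 (hh0 n)), mul_comm _ (∫⁻ z, ‖R₂ n z‖ₑ ∂μ),
    mul_assoc, ENNReal.inv_mul_cancel (hh0 n) (hh1 n), mul_one]
  refine le_trans ?_ (add_le_add ((hR₁ n).trans (mul_le_mul' le_rfl (hxh n))) le_rfl)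
  rw [← lintegral_add_left' (hm1 n).enorm]
  refine lintegral_mono fun z => ?_
  refine le_trans (le_of_eq ?_) (enorm_add_le _ _)
  congr 1
  simp only [hR₂]
  ring

end Expansion

/-! ### Domination of rapidly converging sequences -/

section Domination

variable {Ω : Type*} [MeasurableSpace Ω] {P : Measure Ω} {E : Type*} [NormedAddCommGroup E]

/-- A sequence whose `L^p`-norms have summable `p`-th powers is dominated in `L^p` and converges to
zero almost everywhere. -/
lemma exists_dominating_of_tsum_ne_top {p : ℝ} (hp : 0 < p) {Δ : ℕ → Ω → E}
    (hΔ : ∀ n, AEStronglyMeasurable (Δ n) P)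
    (hsum : ∑' n, eLpNorm (Δ n) (ENNReal.ofReal p) P ^ p ≠ ∞) :
    ∃ W : Ω → ℝ, MemLp W (ENNReal.ofReal p) P ∧ (∀ᵐ ω ∂P, ∀ n, ‖Δ n ω‖ ≤ W ω) ∧
      ∀ᵐ ω ∂P, Tendsto (fun n => Δ n ω) atTop (𝓝 0) := by
  have hp0 : ENNReal.ofReal p ≠ 0 := by simpa using hp
  have hwm : ∀ n, AEMeasurable (fun ω => ‖Δ n ω‖ₑ ^ p) P := fun n => (hΔ n).enorm.pow_const _
  have hint : ∫⁻ ω, ∑' n, ‖Δ n ω‖ₑ ^ p ∂P ≠ ∞ := by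
    rw [lintegral_tsum hwm]
    convert hsum using 4 with n
    rw [eLpNorm_eq_lintegral_rpow_enorm_toReal hp0 ENNReal.ofReal_ne_top,
      ENNReal.toReal_ofReal hp.le, ← ENNReal.rpow_mul, one_div_mul_cancel hp.ne',
      ENNReal.rpow_one]
  have hWm : AEMeasurable (fun ω => ∑' n, ‖Δ n ω‖ₑ ^ p) P := AEMeasurable.tsum hwm
  have hfin : ∀ᵐ ω ∂P, ∑' n, ‖Δ n ω‖ₑ ^ p ≠ ∞ := by
    filter_upwards [ae_lt_top' hWm hint] with ω hω using hω.ne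
  -- the dominating function is the `ℓ^p`-norm of the sequence at each point
  refine ⟨fun ω => (∑' n, ‖Δ n ω‖ₑ ^ p).toReal ^ (1 / p), ?_, ?_, ?_⟩
  · refine memLp_of_norm_rpow_le hp (hWm.ennreal_toReal.pow_const _).aestronglyMeasurable
      (integrable_toReal_of_lintegral_ne_top hWm hint) (Eventually.of_forall fun ω => ?_)
    rw [Real.norm_of_nonneg (by positivity), ← Real.rpow_mul ENNReal.toReal_nonneg,
      one_div_mul_cancel hp.ne', Real.rpow_one]
  · filter_upwards [hfin] with ω hω n
    have h1 : ‖Δ n ω‖ₑ ^ p ≤ ∑' n, ‖Δ n ω‖ₑ ^ p := ENNReal.le_tsum n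
    have h2 := ENNReal.toReal_mono hω h1
    rw [← ENNReal.toReal_rpow, toReal_enorm] at h2
    rw [one_div, ← Real.rpow_le_rpow_iff (norm_nonneg _) (by positivity) hp,
      Real.rpow_inv_rpow ENNReal.toReal_nonneg hp.ne']
    exact h2
  · filter_upwards [hfin] with ω hω
    have h1 := ENNReal.tendsto_atTop_zero_of_tsum_ne_top hω
    have h2 := (ENNReal.continuous_rpow_const (y := p⁻¹)).tendsto 0 |>.comp h1
    rw [ENNReal.zero_rpow_of_pos (by positivity)] at h2
    refine tendsto_zero_iff_enorm_tendsto_zero.2 (h2.congr fun n => ?_)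
    simp only [Function.comp_apply]
    rw [← ENNReal.rpow_mul, mul_inv_cancel₀ hp.ne', ENNReal.rpow_one]

lemma eLpNorm_prod_le {β : Type*} [MeasurableSpace β] {α : Measure β} [SFinite α] [SFinite P]
    {p : ℝ} (hp : 0 < p)
    {g : β → Ω → E} (hg : AEStronglyMeasurable (fun z : β × Ω => g z.1 z.2) (α.prod P)) {c : ℝ≥0∞}
    (hc : ∀ᵐ t ∂α, eLpNorm (g t) (ENNReal.ofReal p) P ≤ c) :
    eLpNorm (fun z : β × Ω => g z.1 z.2) (ENNReal.ofReal p) (α.prod P)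
      ≤ α univ ^ (1 / p) * c := by
  have hp0 : ENNReal.ofReal p ≠ 0 := by simpa using hp
  rw [eLpNorm_eq_lintegral_rpow_enorm_toReal hp0 ENNReal.ofReal_ne_top,
    ENNReal.toReal_ofReal hp.le, lintegral_prod _ (hg.enorm.pow_const _)]
  have h1 : ∫⁻ t, ∫⁻ ω, ‖g t ω‖ₑ ^ p ∂P ∂α ≤ α univ * c ^ p := by
    rw [mul_comm, ← lintegral_const]
    refine lintegral_mono_ae ?_
    filter_upwards [hc] with t ht
    have := ENNReal.rpow_le_rpow ht hp.le
    rwa [eLpNorm_eq_lintegral_rpow_enorm_toReal hp0 ENNReal.ofReal_ne_top,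
      ENNReal.toReal_ofReal hp.le, ← ENNReal.rpow_mul, one_div_mul_cancel hp.ne',
      ENNReal.rpow_one] at this
  refine (ENNReal.rpow_le_rpow h1 (by positivity)).trans (le_of_eq ?_)
  rw [ENNReal.mul_rpow_of_nonneg _ _ (by positivity), ← ENNReal.rpow_mul,
    mul_one_div_cancel hp.ne', ENNReal.rpow_one]

end Domination

namespace Problem

/-! ### Needle variations -/

section Needle

variable {d : ℕ} {V : Type*} {𝒞 : Problem d V} [NormedAddCommGroup V]
  {Ω : Type*} [MeasurableSpace Ω] {P : Measure Ω} [IsProbabilityMeasure P]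

/-- The control that is constant in time. -/
def Control.const (ν : Ω → V) (hν : StronglyMeasurable ν) (hνU : ∀ ω, ν ω ∈ 𝒞.U)
    (hνp : MemLp ν (ENNReal.ofReal 𝒞.p) P) : 𝒞.Control P where
  val _ := ν
  meas := hν.comp_measurable measurable_snd
  mem _ _ := hνU
  memLp := hνp.comp_snd 𝒞.timeMeasure

open Classical in
/-- The needle variation: the control `v` on the time interval `(s, s + h]`, and `u` elsewhere. -/
noncomputable def Control.needle (u v : 𝒞.Control P) (s h : ℝ) : 𝒞.Control P where
  val t := if t ∈ Ioc s (s + h) then v.val t else u.val t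
  meas := by
    have hset : MeasurableSet {z : Icc (0 : ℝ) 𝒞.T × Ω | (z.1 : ℝ) ∈ Ioc s (s + h)} :=
      (measurable_subtype_coe.comp measurable_fst) measurableSet_Ioc
    have e : (fun z : Icc (0 : ℝ) 𝒞.T × Ω =>
        (if (z.1 : ℝ) ∈ Ioc s (s + h) then v.val z.1 else u.val z.1) z.2)
        = fun z => if (z.1 : ℝ) ∈ Ioc s (s + h) then v.val z.1 z.2 else u.val z.1 z.2 := by
      funext z
      split_ifs <;> rfl
    rw [e]
    exact StronglyMeasurable.ite hset v.meas u.meas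
  mem t ht ω := by
    split_ifs
    · exact v.mem t ht ω
    · exact u.mem t ht ω
  memLp := by
    have hset : MeasurableSet {z : ℝ × Ω | z.1 ∈ Ioc s (s + h)} := measurable_fst measurableSet_Ioc
    have := MemLp.piecewise hset (v.memLp.restrict _) (u.memLp.restrict _)
    refine (memLp_congr_ae (Eventually.of_forall fun z => ?_)).1 this
    by_cases hz : z.1 ∈ Ioc s (s + h)
    · rw [piecewise_eq_of_mem _ _ _ (by exact hz), if_pos hz]
    · rw [piecewise_eq_of_notMem _ _ _ (by exact hz), if_neg hz]

lemma Control.needle_of_mem (u v : 𝒞.Control P) {s h t : ℝ} (ht : t ∈ Ioc s (s + h)) :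
    (u.needle v s h).val t = v.val t := if_pos ht

lemma Control.needle_of_notMem (u v : 𝒞.Control P) {s h t : ℝ} (ht : t ∉ Ioc s (s + h)) :
    (u.needle v s h).val t = u.val t := if_neg ht

lemma controlDiff_needle_le (u v : 𝒞.Control P) (s h : ℝ) :
    𝒞.controlDiff u (u.needle v s h) ≤ ENNReal.ofReal h := by
  have hsub : {z : ℝ × Ω | u.val z.1 z.2 ≠ (u.needle v s h).val z.1 z.2}
      ⊆ Ioc s (s + h) ×ˢ univ := by
    intro z hz
    refine ⟨?_, mem_univ _⟩
    by_contra hn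
    exact hz (by rw [u.needle_of_notMem v hn])
  refine (measure_mono hsub).trans ?_
  rw [Measure.prod_prod, measure_univ, mul_one]
  refine (Measure.restrict_apply_le _ _).trans ?_
  rw [Real.volume_Ioc, add_sub_cancel_left]

/-- The velocity along a state and a control. -/
noncomputable def velocity (X : 𝒞.State P) (u : 𝒞.Control P) (t : ℝ) (ω : Ω) : Rd d :=
  𝒞.f t (X.at t ω) (X.law t) (u.val t ω)

lemma memLp_velocity (h𝒞 : 𝒞.Assumptions) (X : 𝒞.State P) (u : 𝒞.Control P) :
    MemLp (fun z : ℝ × Ω => velocity X u z.1 z.2) (ENNReal.ofReal 𝒞.p) (𝒞.timeMeasure.prod P) :=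
  memLp_f h𝒞 X X u

lemma ae_intervalIntegrable_velocity (h𝒞 : 𝒞.Assumptions) (X : 𝒞.State P) (u : 𝒞.Control P) :
    ∀ᵐ ω ∂P, IntervalIntegrable (fun t => velocity X u t ω) volume 0 𝒞.T :=
  ae_intervalIntegrable_of_memLp 𝒞.hpq.lt 𝒞.T_pos (memLp_velocity h𝒞 X u)

lemma aestronglyMeasurable_integral_velocity (h𝒞 : 𝒞.Assumptions) (X : 𝒞.State P) (u : 𝒞.Control P)
    {a b : ℝ} (ha : a ∈ Icc 0 𝒞.T) (hb : b ∈ Icc 0 𝒞.T) :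
    AEStronglyMeasurable (fun ω => ∫ τ in a..b, velocity X u τ ω) P :=
  aestronglyMeasurable_intervalIntegral (memLp_velocity h𝒞 X u).1 ha hb

lemma norm_velocity_le {C : ℝ} (hC0 : 0 ≤ C)
    (hC : ∀ t ∈ Icc 0 𝒞.T, ∀ x m, ∀ u ∈ 𝒞.U, ‖𝒞.f t x m u‖ ≤ C * (1 + ‖x‖ + m.Mp + ‖u‖))
    (X : 𝒞.State P) (u : 𝒞.Control P) {t : ℝ} (ht : t ∈ Icc 0 𝒞.T) (ω : Ω) :
    ‖velocity X u t ω‖ ≤ C * (1 + ‖X.path ω‖ + X.lpNorm + ‖u.val t ω‖) := by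
  have h1 : ‖X.at t ω‖ ≤ ‖X.path ω‖ := 𝒞.norm_ev_le (X.path ω) t
  refine (hC t ht _ _ _ (u.mem _ ht _)).trans (mul_le_mul_of_nonneg_left ?_ hC0)
  linarith [X.Mp_law_le t]

lemma memLp_growth_bound (X : 𝒞.State P) {ν : Ω → V} (hν : MemLp ν (ENNReal.ofReal 𝒞.p) P) (C : ℝ) :
    MemLp (fun ω => C * (1 + ‖X.path ω‖ + X.lpNorm + ‖ν ω‖)) (ENNReal.ofReal 𝒞.p) P := by
  have h1 : MemLp (fun _ : Ω => (1 : ℝ)) (ENNReal.ofReal 𝒞.p) P := memLp_const 1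
  have h3 : MemLp (fun _ : Ω => X.lpNorm) (ENNReal.ofReal 𝒞.p) P := memLp_const _
  exact (((h1.add X.memLp.norm).add h3).add hν.norm).const_mul C

lemma memLp_velocity_at (h𝒞 : 𝒞.Assumptions) (X : 𝒞.State P) (u : 𝒞.Control P) {t : ℝ}
    (ht : t ∈ Icc 0 𝒞.T) (hu : MemLp (u.val t) (ENNReal.ofReal 𝒞.p) P) :
    MemLp (velocity X u t) (ENNReal.ofReal 𝒞.p) P := by
  obtain ⟨C, hC0, hC, -, -⟩ := exists_growth h𝒞
  exact (memLp_growth_bound X hu C).mono' (aestronglyMeasurable_comp_at h𝒞 h𝒞.f_cont ht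
    (X.memLp_at t).1 _ (u.stronglyMeasurable_at ht).aestronglyMeasurable (u.mem t ht))
    (Eventually.of_forall fun ω => norm_velocity_le hC0 hC X u ht ω)

/-- The velocity has a linear rate at `s` if its primitive in `L^p` grows at most linearly to the
right of `s`. -/
def HasLinearRate (X : 𝒞.State P) (u : 𝒞.Control P) (s : ℝ) : Prop :=
  ∃ C : ℝ, 0 ≤ C ∧ ∀ᶠ δ in 𝓝[>] (0 : ℝ), ∀ k, 0 < k → k ≤ δ →
    eLpNorm (fun ω => ∫ τ in s..(s + k), velocity X u τ ω) (ENNReal.ofReal 𝒞.p) P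
      ≤ ENNReal.ofReal (C * k)

lemma IsRegular.memLp {X : 𝒞.State P} {u : 𝒞.Control P} {s : ℝ} (hs : 𝒞.IsRegular X u s) :
    MemLp (u.val s) (ENNReal.ofReal 𝒞.p) P :=
  ⟨(u.stronglyMeasurable_at (Ico_subset_Icc_self hs.1)).aestronglyMeasurable, hs.2.1⟩

lemma eventually_forall_le {Q : ℝ → Prop} (h : ∀ᶠ k in 𝓝[>] (0 : ℝ), Q k) :
    ∀ᶠ δ in 𝓝[>] (0 : ℝ), ∀ k, 0 < k → k ≤ δ → Q k := by
  obtain ⟨ε, hε, hQ⟩ := mem_nhdsGT_iff_exists_Ioo_subset.1 h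
  filter_upwards [Ioo_mem_nhdsGT hε] with δ hδ k hk hkδ
  exact hQ ⟨hk, hkδ.trans_lt hδ.2⟩

/-- At a regular time the difference quotients of the state are bounded in `L^p`. -/
lemma IsRegular.hasLinearRate (h𝒞 : 𝒞.Assumptions) {X : 𝒞.State P} {u : 𝒞.Control P} {s : ℝ}
    (hs : 𝒞.IsRegular X u s) : HasLinearRate X u s := by
  have hsT := Ico_subset_Icc_self hs.1
  have hv := memLp_velocity_at h𝒞 X u hsT hs.memLp
  have h1 : ∀ᶠ k in 𝓝[>] (0 : ℝ), eLpNorm (fun ω => (1 / k) • (∫ τ in s..(s + k),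
      velocity X u τ ω) - velocity X u s ω) (ENNReal.ofReal 𝒞.p) P ≤ 1 :=
    hs.2.2.1.eventually_le_const zero_lt_one
  have h2 : ∀ᶠ k in 𝓝[>] (0 : ℝ), k ∈ Ioo 0 (𝒞.T - s) := Ioo_mem_nhdsGT (by linarith [hs.1.2])
  refine ⟨1 + (eLpNorm (velocity X u s) (ENNReal.ofReal 𝒞.p) P).toReal, by positivity,
    eventually_forall_le ?_⟩
  filter_upwards [h1, h2] with k hk hkT
  have hk0 : k ≠ 0 := hkT.1.ne'
  have hm := aestronglyMeasurable_integral_velocity h𝒞 X u hsT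
    (b := s + k) ⟨by linarith [hsT.1, hkT.1], by linarith [hkT.2]⟩
  have e : (fun ω => ∫ τ in s..(s + k), velocity X u τ ω) = k • ((fun ω => (1 / k) •
      (∫ τ in s..(s + k), velocity X u τ ω) - velocity X u s ω) + velocity X u s) := by
    funext ω
    simp only [Pi.smul_apply, Pi.add_apply, sub_add_cancel, smul_smul]
    rw [mul_one_div_cancel hk0, one_smul]
  rw [e, eLpNorm_const_smul]
  have h3 := eLpNorm_add_le ((hm.const_smul (1 / k)).sub hv.1) hv.1 (one_le_ofReal 𝒞.hpq.lt)
  rw [mul_comm (1 + _), ENNReal.ofReal_mul hkT.1.le, ENNReal.ofReal_add zero_le_one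
    ENNReal.toReal_nonneg, ENNReal.ofReal_toReal hv.2.ne, ENNReal.ofReal_one,
    Real.enorm_eq_ofReal hkT.1.le]
  exact mul_le_mul' le_rfl (h3.trans (add_le_add hk le_rfl))

/-- A constant control has a linear rate at every time, since the growth condition bounds the
velocity by a time-independent function in `L^p`. -/
lemma hasLinearRate_const (h𝒞 : 𝒞.Assumptions) (X : 𝒞.State P) {ν : Ω → V}
    (hν : StronglyMeasurable ν) (hνU : ∀ ω, ν ω ∈ 𝒞.U) (hνp : MemLp ν (ENNReal.ofReal 𝒞.p) P)
    {s : ℝ} (hs : s ∈ Ico 0 𝒞.T) : HasLinearRate X (Control.const ν hν hνU hνp) s := by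
  obtain ⟨C, hC0, hC, -, -⟩ := exists_growth h𝒞
  have hG := memLp_growth_bound X hνp C
  refine ⟨(eLpNorm (fun ω => C * (1 + ‖X.path ω‖ + X.lpNorm + ‖ν ω‖))
    (ENNReal.ofReal 𝒞.p) P).toReal,
    ENNReal.toReal_nonneg, eventually_forall_le ?_⟩
  filter_upwards [Ioo_mem_nhdsGT (show (0 : ℝ) < 𝒞.T - s by linarith [hs.2])] with k hk
  rw [mul_comm, ENNReal.ofReal_mul hk.1.le, ENNReal.ofReal_toReal hG.2.ne,
    ← Real.enorm_eq_ofReal hk.1.le, ← eLpNorm_const_smul]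
  refine eLpNorm_mono fun ω => ?_
  have := intervalIntegral.norm_integral_le_of_norm_le_const (a := s) (b := s + k)
    (f := fun τ => velocity X (Control.const ν hν hνU hνp) τ ω)
    (C := C * (1 + ‖X.path ω‖ + X.lpNorm + ‖ν ω‖)) fun τ hτ => by
      rw [uIoc_of_le (by linarith [hk.1])] at hτ
      exact norm_velocity_le hC0 hC X _ ⟨by linarith [hτ.1, hs.1], by linarith [hτ.2, hk.2]⟩ ω
  rw [add_sub_cancel_left, abs_of_pos hk.1] at this
  refine this.trans ?_
  rw [Pi.smul_apply, smul_eq_mul, mul_comm]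
  exact le_abs_self _

end Needle

/-! ### The states of needle variations -/

section NeedleState

variable {d : ℕ} {V : Type*} {𝒞 : Problem d V} [NormedAddCommGroup V]
  {Ω : Type*} [MeasurableSpace Ω] {P : Measure Ω} [IsProbabilityMeasure P]

lemma velocity_needle_of_mem (X : 𝒞.State P) (u v : 𝒞.Control P) {s h t : ℝ}
    (ht : t ∈ Ioc s (s + h)) (ω : Ω) : velocity X (u.needle v s h) t ω = velocity X v t ω := by
  rw [velocity, u.needle_of_mem v ht]; rfl

lemma velocity_needle_of_notMem (X : 𝒞.State P) (u v : 𝒞.Control P) {s h t : ℝ}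
    (ht : t ∉ Ioc s (s + h)) (ω : Ω) : velocity X (u.needle v s h) t ω = velocity X u t ω := by
  rw [velocity, u.needle_of_notMem v ht]; rfl

/-- The excess of the velocity that the needle produces along an unperturbed state. -/
noncomputable def needleExcess (X : 𝒞.State P) (u v : 𝒞.Control P) (s h t : ℝ) (ω : Ω) : Rd d :=
  velocity X (u.needle v s h) t ω - velocity X u t ω

lemma memLp_needleExcess (h𝒞 : 𝒞.Assumptions) (X : 𝒞.State P) (u v : 𝒞.Control P) (s h : ℝ) :
    MemLp (fun z : ℝ × Ω => needleExcess X u v s h z.1 z.2) (ENNReal.ofReal 𝒞.p)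
      (𝒞.timeMeasure.prod P) :=
  (memLp_velocity h𝒞 X (u.needle v s h)).sub (memLp_velocity h𝒞 X u)

lemma ae_intervalIntegrable_needleExcess (h𝒞 : 𝒞.Assumptions) (X : 𝒞.State P) (u v : 𝒞.Control P)
    (s h : ℝ) : ∀ᵐ ω ∂P, IntervalIntegrable (fun t => needleExcess X u v s h t ω) volume 0 𝒞.T :=
  ae_intervalIntegrable_of_memLp 𝒞.hpq.lt 𝒞.T_pos (memLp_needleExcess h𝒞 X u v s h)

lemma needleExcess_of_notMem (X : 𝒞.State P) (u v : 𝒞.Control P) {s h t : ℝ}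
    (ht : t ∉ Ioc s (s + h)) (ω : Ω) : needleExcess X u v s h t ω = 0 := by
  rw [needleExcess, velocity_needle_of_notMem X u v ht, sub_self]

lemma needleExcess_of_mem (X : 𝒞.State P) (u v : 𝒞.Control P) {s h t : ℝ}
    (ht : t ∈ Ioc s (s + h)) (ω : Ω) :
    needleExcess X u v s h t ω = velocity X v t ω - velocity X u t ω := by
  rw [needleExcess, velocity_needle_of_mem X u v ht]

/-- The accumulated excess velocity at the time `t` is an integral over the part of the needle
before `t`; its length is `max 0 (min (t - s) h)`. -/
lemma integral_needleExcess (X : 𝒞.State P) (u v : 𝒞.Control P) {s h : ℝ} (hs : 0 ≤ s)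
    (hh : 0 < h) (hsh : s + h ≤ 𝒞.T) {t : ℝ} (ht : t ∈ Icc 0 𝒞.T) {ω : Ω}
    (hu : IntervalIntegrable (fun t => velocity X u t ω) volume 0 𝒞.T)
    (hv : IntervalIntegrable (fun t => velocity X v t ω) volume 0 𝒞.T)
    (hi : IntervalIntegrable (fun t => needleExcess X u v s h t ω) volume 0 𝒞.T) :
    ∫ τ in (0 : ℝ)..t, needleExcess X u v s h τ ω
      = (∫ τ in s..(s + max 0 (min (t - s) h)), velocity X v τ ω)
        - ∫ τ in s..(s + max 0 (min (t - s) h)), velocity X u τ ω := by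
  have hsT : s ∈ Icc 0 𝒞.T := ⟨hs, by linarith⟩
  rcases le_or_gt t s with hts | hts
  · have h0 : max 0 (min (t - s) h) = 0 := max_eq_left ((min_le_left _ _).trans (by linarith))
    rw [h0, add_zero, intervalIntegral.integral_same, intervalIntegral.integral_same, sub_zero]
    refine intervalIntegral.integral_zero_ae (Eventually.of_forall fun τ hτ => ?_)
    rw [uIoc_of_le ht.1] at hτ
    exact needleExcess_of_notMem X u v (fun h' => absurd h'.1 (by linarith [hτ.2])) ω
  -- the excess vanishes outside the needle, so only its part before `t` counts
  · set k := min (t - s) h with hk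
    have hk0 : 0 < k := lt_min (by linarith) hh
    have hkh : k ≤ h := min_le_right _ _
    have hkt : k ≤ t - s := min_le_left _ _
    have hskT : s + k ∈ Icc 0 𝒞.T := ⟨by linarith, by linarith⟩
    rw [max_eq_right hk0.le]
    have hmono : ∀ {g : ℝ → Rd d}, IntervalIntegrable g volume 0 𝒞.T → ∀ {a b : ℝ},
        a ∈ Icc 0 𝒞.T → b ∈ Icc 0 𝒞.T → IntervalIntegrable g volume a b :=
      fun hg _ _ ha hb => intervalIntegrable_mono_mem hg 𝒞.T_pos.le ha hb
    rw [← intervalIntegral.integral_add_adjacent_intervals (hmono hi 𝒞.zero_mem hsT)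
      (hmono hi hsT ht),
      ← intervalIntegral.integral_add_adjacent_intervals (hmono hi hsT hskT) (hmono hi hskT ht)]
    have h1 : ∫ τ in (0 : ℝ)..s, needleExcess X u v s h τ ω = 0 := by
      refine intervalIntegral.integral_zero_ae (Eventually.of_forall fun τ hτ => ?_)
      rw [uIoc_of_le hs] at hτ
      exact needleExcess_of_notMem X u v (fun h' => absurd h'.1 (by linarith [hτ.2])) ω
    have h2 : ∫ τ in (s + k)..t, needleExcess X u v s h τ ω = 0 := by
      refine intervalIntegral.integral_zero_ae (Eventually.of_forall fun τ hτ => ?_)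
      rw [uIoc_of_le (by linarith)] at hτ
      refine needleExcess_of_notMem X u v (fun h' => ?_) ω
      have : k < min (t - s) h := lt_min (by linarith [hτ.1, hτ.2]) (by linarith [hτ.1, h'.2])
      exact absurd this (by rw [← hk]; exact lt_irrefl _)
    have h3 : ∫ τ in s..(s + k), needleExcess X u v s h τ ω
        = ∫ τ in s..(s + k), (velocity X v τ ω - velocity X u τ ω) := by
      refine intervalIntegral.integral_congr_ae (Eventually.of_forall fun τ hτ => ?_)
      rw [uIoc_of_le (by linarith)] at hτ
      exact needleExcess_of_mem X u v ⟨hτ.1, by linarith [hτ.2]⟩ ω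
    rw [h1, h2, h3, zero_add, add_zero,
      intervalIntegral.integral_sub (hmono hv hsT hskT) (hmono hu hsT hskT)]

/-- If both velocities have a linear rate at `s`, then the accumulated excess velocity is of the
order `h` in `L^p`, at each time. -/
lemma eLpNorm_integral_needleExcess_le (h𝒞 : 𝒞.Assumptions) (X : 𝒞.State P) (u v : 𝒞.Control P)
    {s h : ℝ} (hs : 0 ≤ s) (hh : 0 < h) (hsh : s + h ≤ 𝒞.T) {C₁ C₂ : ℝ} (hC₁ : 0 ≤ C₁)
    (hC₂ : 0 ≤ C₂)
    (hu : ∀ k, 0 < k → k ≤ h → eLpNorm (fun ω => ∫ τ in s..(s + k), velocity X u τ ω)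
      (ENNReal.ofReal 𝒞.p) P ≤ ENNReal.ofReal (C₁ * k))
    (hv : ∀ k, 0 < k → k ≤ h → eLpNorm (fun ω => ∫ τ in s..(s + k), velocity X v τ ω)
      (ENNReal.ofReal 𝒞.p) P ≤ ENNReal.ofReal (C₂ * k)) {t : ℝ} (ht : t ∈ Icc 0 𝒞.T) :
    eLpNorm (fun ω => ∫ τ in (0 : ℝ)..t, needleExcess X u v s h τ ω) (ENNReal.ofReal 𝒞.p) P
      ≤ ENNReal.ofReal ((C₁ + C₂) * h) := by
  set k := max 0 (min (t - s) h) with hk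
  have hkh : k ≤ h := max_le hh.le (min_le_right _ _)
  have hk0 : 0 ≤ k := le_max_left _ _
  have hsT : s ∈ Icc 0 𝒞.T := ⟨hs, by linarith⟩
  have hskT : s + k ∈ Icc 0 𝒞.T := ⟨by linarith, by linarith⟩
  have hae : (fun ω => ∫ τ in (0 : ℝ)..t, needleExcess X u v s h τ ω) =ᵐ[P]
      (fun ω => ∫ τ in s..(s + k), velocity X v τ ω)
        - fun ω => ∫ τ in s..(s + k), velocity X u τ ω := by
    filter_upwards [ae_intervalIntegrable_velocity h𝒞 X u, ae_intervalIntegrable_velocity h𝒞 X v,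
      ae_intervalIntegrable_needleExcess h𝒞 X u v s h] with ω h1 h2 h3
    exact integral_needleExcess X u v hs hh hsh ht h1 h2 h3
  have hbd : ∀ {C : ℝ} {w : 𝒞.Control P}, 0 ≤ C → (∀ k, 0 < k → k ≤ h →
      eLpNorm (fun ω => ∫ τ in s..(s + k), velocity X w τ ω)
      (ENNReal.ofReal 𝒞.p) P ≤ ENNReal.ofReal (C * k)) →
      eLpNorm (fun ω => ∫ τ in s..(s + k), velocity X w τ ω) (ENNReal.ofReal 𝒞.p) P
        ≤ ENNReal.ofReal (C * h) := by
    intro C w hC hw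
    rcases hk0.eq_or_lt with h0 | h0
    · rw [← h0, add_zero]
      simp
    · exact (hw k h0 hkh).trans (ENNReal.ofReal_le_ofReal (mul_le_mul_of_nonneg_left hkh hC))
  rw [eLpNorm_congr_ae hae, add_mul, ENNReal.ofReal_add (by positivity) (by positivity)]
  exact ((eLpNorm_sub_le (aestronglyMeasurable_integral_velocity h𝒞 X v hsT hskT)
    (aestronglyMeasurable_integral_velocity h𝒞 X u hsT hskT) (one_le_ofReal 𝒞.hpq.lt)).trans
    (add_le_add (hbd hC₂ hv) (hbd hC₁ hu))).trans (add_comm _ _).le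

/-- The path that accumulates the excess velocity. -/
noncomputable def needleExcessPath (X : 𝒞.State P) (u v : 𝒞.Control P) (s h : ℝ) (ω : Ω) :
    𝒞.Path (Rd d) :=
  primitivePath 𝒞.T 0 0 fun t => needleExcess X u v s h t ω

lemma ae_ev_needleExcessPath (h𝒞 : 𝒞.Assumptions) (X : 𝒞.State P) (u v : 𝒞.Control P) (s h : ℝ) :
    ∀ᵐ ω ∂P, ∀ t ∈ Icc 0 𝒞.T, 𝒞.ev (needleExcessPath X u v s h ω) t
      = ∫ τ in (0 : ℝ)..t, needleExcess X u v s h τ ω := by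
  filter_upwards [ae_intervalIntegrable_needleExcess h𝒞 X u v s h] with ω hω t ht
  rw [ev, IccExtend_of_mem _ _ ht, needleExcessPath,
    primitivePath_apply 𝒞.T_pos 𝒞.zero_mem _ hω, zero_add]

lemma memLp_needleExcessPath (h𝒞 : 𝒞.Assumptions) (X : 𝒞.State P) (u v : 𝒞.Control P) (s h : ℝ) :
    MemLp (needleExcessPath X u v s h) (ENNReal.ofReal 𝒞.p) P := by
  have hg := memLp_needleExcess h𝒞 X u v s h
  have hi := ae_intervalIntegrable_needleExcess h𝒞 X u v s h
  refine (memLp_integral_norm 𝒞.hpq.lt hg).mono' ?_ ?_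
  · refine aestronglyMeasurable_path 𝒞.T_pos fun t => ?_
    refine (aestronglyMeasurable_intervalIntegral hg.1 𝒞.zero_mem t.2).congr ?_
    filter_upwards [hi] with ω hω
    rw [needleExcessPath, primitivePath_apply 𝒞.T_pos 𝒞.zero_mem _ hω, zero_add]
  · filter_upwards [hi] with ω hω
    refine (norm_primitivePath_le 𝒞.T_pos 𝒞.zero_mem _ hω).trans (le_of_eq ?_)
    rw [norm_zero, zero_add]

/-- The norm of the supremum over the time is only of the order `h ^ (1 - 1 / p)`, which is still
enough for its convergence to zero. -/
lemma eLpNorm_needleExcessPath_le (h𝒞 : 𝒞.Assumptions) (X : 𝒞.State P) (u v : 𝒞.Control P)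
    {s h : ℝ} (hs : 0 ≤ s) (hsh : s + h ≤ 𝒞.T) :
    eLpNorm (needleExcessPath X u v s h) (ENNReal.ofReal 𝒞.p) P
      ≤ ENNReal.ofReal h ^ (1 - 1 / 𝒞.p) * eLpNorm (fun z : ℝ × Ω => velocity X v z.1 z.2
        - velocity X u z.1 z.2) (ENNReal.ofReal 𝒞.p) (𝒞.timeMeasure.prod P) := by
  have hsub : Ioc s (s + h) ⊆ Icc 0 𝒞.T := fun t ht => ⟨by linarith [ht.1], ht.2.trans hsh⟩
  have hle : (volume.restrict (Ioc s (s + h))).prod P ≤ 𝒞.timeMeasure.prod P :=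
    Measure.prod_mono (Measure.restrict_mono hsub le_rfl) le_rfl
  have hm : MemLp (fun z : ℝ × Ω => velocity X v z.1 z.2 - velocity X u z.1 z.2)
      (ENNReal.ofReal 𝒞.p) (𝒞.timeMeasure.prod P) :=
    (memLp_velocity h𝒞 X v).sub (memLp_velocity h𝒞 X u)
  have h1 := eLpNorm_integral_norm_le (α := volume.restrict (Ioc s (s + h)))
    (g := fun t ω => velocity X v t ω - velocity X u t ω) 𝒞.hpq.lt (hm.1.mono_measure hle)
  rw [Measure.restrict_apply_univ, Real.volume_Ioc, add_sub_cancel_left] at h1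
  refine le_trans ?_ (h1.trans (mul_le_mul' le_rfl (eLpNorm_mono_measure _ hle)))
  refine eLpNorm_mono_ae ?_
  filter_upwards [ae_intervalIntegrable_needleExcess h𝒞 X u v s h] with ω hω
  refine (norm_primitivePath_le 𝒞.T_pos 𝒞.zero_mem _ hω).trans ?_
  rw [norm_zero, zero_add]
  refine le_trans (le_of_eq ?_) (le_abs_self _)
  rw [← inter_eq_right.2 hsub, ← setIntegral_indicator measurableSet_Ioc]
  refine setIntegral_congr_fun measurableSet_Icc fun t _ => ?_
  by_cases ht : t ∈ Ioc s (s + h)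
  · simp only [indicator_of_mem ht, needleExcess_of_mem X u v ht]
  · simp only [indicator_of_notMem ht, needleExcess_of_notMem X u v ht, norm_zero]

/-- The state corrected by the accumulated excess velocity. It solves the state equation of the
needle variation up to an error of the order of the correction. -/
noncomputable def correctedState (h𝒞 : 𝒞.Assumptions) (X : 𝒞.State P) (u v : 𝒞.Control P)
    (s h : ℝ) : 𝒞.State P :=
  ⟨fun ω => X.path ω + needleExcessPath X u v s h ω,
    memLp_fun_add X.memLp (memLp_needleExcessPath h𝒞 X u v s h)⟩

lemma correctedState_at (h𝒞 : 𝒞.Assumptions) (X : 𝒞.State P) (u v : 𝒞.Control P) (s h t : ℝ)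
    (ω : Ω) : (correctedState h𝒞 X u v s h).at t ω
      = X.at t ω + 𝒞.ev (needleExcessPath X u v s h ω) t := rfl

lemma aestronglyMeasurable_norm_ev_add {D : Ω → 𝒞.Path (Rd d)} (hD : AEStronglyMeasurable D P)
    (L c : ℝ) : AEStronglyMeasurable (fun z : ℝ × Ω => L * (‖𝒞.ev (D z.2) z.1‖ + c))
      (𝒞.timeMeasure.prod P) := by
  have h1 := (aestronglyMeasurable_ev_prod (𝒞 := 𝒞) hD 𝒞.timeMeasure).norm
  have h2 : AEStronglyMeasurable (fun z : ℝ × Ω => ‖𝒞.ev (D z.2) z.1‖ + c)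
    (𝒞.timeMeasure.prod P) := h1.add aestronglyMeasurable_const
  exact h2.const_mul L

lemma eLpNorm_integral_norm_ev_add_le {D : Ω → 𝒞.Path (Rd d)} (hD : AEStronglyMeasurable D P)
    {L c : ℝ} (hL0 : 0 ≤ L) (hc : 0 ≤ c)
    (hDt : ∀ t ∈ Icc 0 𝒞.T, eLpNorm (fun ω => 𝒞.ev (D ω) t) (ENNReal.ofReal 𝒞.p) P
      ≤ ENNReal.ofReal c) :
    eLpNorm (fun ω => ∫ τ in Icc 0 𝒞.T, ‖L * (‖𝒞.ev (D ω) τ‖ + c)‖) (ENNReal.ofReal 𝒞.p) P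
      ≤ ENNReal.ofReal (𝒞.T * (L * 2 * c)) := by
  have hp1 := one_le_ofReal 𝒞.hpq.lt
  have hT0 := 𝒞.T_pos
  have hmeas := aestronglyMeasurable_norm_ev_add (𝒞 := 𝒞) hD L c
  refine (eLpNorm_integral_norm_le (g := fun τ ω => L * (‖𝒞.ev (D ω) τ‖ + c))
    𝒞.hpq.lt hmeas).trans ?_
  have h1 := eLpNorm_prod_le (g := fun τ ω => L * (‖𝒞.ev (D ω) τ‖ + c)) 𝒞.p_pos hmeas
    (c := ENNReal.ofReal (L * 2 * c)) (by
    filter_upwards [ae_restrict_mem measurableSet_Icc] with t ht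
    have e : (fun ω => L * (‖𝒞.ev (D ω) t‖ + c))
        = L • ((fun ω => ‖𝒞.ev (D ω) t‖) + fun _ => c) := rfl
    rw [e, eLpNorm_const_smul, mul_assoc, ENNReal.ofReal_mul hL0, Real.enorm_eq_ofReal hL0]
    refine mul_le_mul' le_rfl ((eLpNorm_add_le (aestronglyMeasurable_ev hD t).norm
      aestronglyMeasurable_const hp1).trans ?_)
    rw [eLpNorm_norm, eLpNorm_const c (zero_lt_one.trans_le hp1).ne'
      (IsProbabilityMeasure.ne_zero P), measure_univ, ENNReal.one_rpow, mul_one, two_mul,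
      ENNReal.ofReal_add hc hc, Real.enorm_eq_ofReal hc]
    exact add_le_add (hDt t ht) le_rfl)
  refine (mul_le_mul' le_rfl h1).trans (le_of_eq ?_)
  rw [Measure.restrict_apply_univ, Real.volume_Icc, sub_zero, ← mul_assoc,
    ← ENNReal.rpow_add _ _ (by simpa using hT0) ENNReal.ofReal_ne_top, sub_add_cancel,
    ENNReal.rpow_one, ← ENNReal.ofReal_mul hT0.le]

lemma eLpNorm_ev_needleExcessPath (h𝒞 : 𝒞.Assumptions) (X : 𝒞.State P) (u v : 𝒞.Control P)
    (s h : ℝ) {t : ℝ} (ht : t ∈ Icc 0 𝒞.T) :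
    eLpNorm (fun ω => 𝒞.ev (needleExcessPath X u v s h ω) t) (ENNReal.ofReal 𝒞.p) P
      = eLpNorm (fun ω => ∫ τ in (0 : ℝ)..t, needleExcess X u v s h τ ω)
        (ENNReal.ofReal 𝒞.p) P := by
  refine eLpNorm_congr_ae ?_
  filter_upwards [ae_ev_needleExcessPath h𝒞 X u v s h] with ω hω using hω t ht

/-- The residual of the corrected state in the state equation of the needle variation. -/
lemma ae_norm_correctedState_sub_le (h𝒞 : 𝒞.Assumptions) {L : ℝ} (hL0 : 0 ≤ L)
    (hL₁ : ∀ t ∈ Icc 0 𝒞.T, ∀ x m y, ∀ u ∈ 𝒞.U, ‖intrinsicDeriv (fun m => 𝒞.f t x m u) m y‖ ≤ L)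
    (hL₂ : ∀ t ∈ Icc 0 𝒞.T, ∀ m, ∀ u ∈ 𝒞.U, ∀ x x', ‖𝒞.f t x m u - 𝒞.f t x' m u‖ ≤ L * ‖x - x'‖)
    {X : 𝒞.State P} {u : 𝒞.Control P} (v : 𝒞.Control P) (hX : 𝒞.IsLagrangian X u) (s h : ℝ)
    {c : ℝ} (hc : 0 ≤ c)
    (hD : ∀ t ∈ Icc 0 𝒞.T, eLpNorm (fun ω => 𝒞.ev (needleExcessPath X u v s h ω) t)
      (ENNReal.ofReal 𝒞.p) P ≤ ENNReal.ofReal c) :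
    ∀ᵐ ω ∂P, ∀ t ∈ Icc 0 𝒞.T, ‖(correctedState h𝒞 X u v s h).at t ω
      - ((correctedState h𝒞 X u v s h).at 0 ω
        + ∫ τ in (0 : ℝ)..t, velocity (correctedState h𝒞 X u v s h) (u.needle v s h) τ ω)‖
      ≤ ∫ τ in Icc 0 𝒞.T, ‖L * (‖𝒞.ev (needleExcessPath X u v s h ω) τ‖ + c)‖ := by
  set X₁ := correctedState h𝒞 X u v s h with hX₁
  set D := needleExcessPath X u v s h with hDdef
  have hX₁at : ∀ t ω, X₁.at t ω = X.at t ω + 𝒞.ev (D ω) t := fun t ω => rfl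
  filter_upwards [hX, ae_ev_needleExcessPath h𝒞 X u v s h, ae_intervalIntegrable_velocity h𝒞 X u,
    ae_intervalIntegrable_velocity h𝒞 X (u.needle v s h),
    ae_intervalIntegrable_velocity h𝒞 X₁ (u.needle v s h)] with ω h1 h2 h3 h4 h5 t ht
  have hmono : ∀ {g : ℝ → Rd d}, IntervalIntegrable g volume 0 𝒞.T →
      IntervalIntegrable g volume 0 t :=
    fun hg => intervalIntegrable_mono_mem hg 𝒞.T_pos.le 𝒞.zero_mem ht
  have e1 : X.at t ω = X.at 0 ω + ∫ τ in (0 : ℝ)..t, velocity X u τ ω := h1.2 t ht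
  have e2 : 𝒞.ev (D ω) t = ∫ τ in (0 : ℝ)..t,
      (velocity X (u.needle v s h) τ ω - velocity X u τ ω) := h2 t ht
  have e3 : 𝒞.ev (D ω) 0 = 0 := by
    rw [h2 0 𝒞.zero_mem, intervalIntegral.integral_same]
  rw [intervalIntegral.integral_sub (hmono h4) (hmono h3)] at e2
  have e4 : X₁.at t ω - (X₁.at 0 ω + ∫ τ in (0 : ℝ)..t, velocity X₁ (u.needle v s h) τ ω)
      = ∫ τ in (0 : ℝ)..t, (velocity X (u.needle v s h) τ ω
        - velocity X₁ (u.needle v s h) τ ω) := by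
    rw [intervalIntegral.integral_sub (hmono h4) (hmono h5), hX₁at, hX₁at, e1, e2, e3]
    abel
  rw [e4]
  have hci : Continuous fun τ => ‖L * (‖𝒞.ev (D ω) τ‖ + c)‖ := by
    have := 𝒞.continuous_ev (D ω); fun_prop
  refine (intervalIntegral.norm_integral_le_of_norm_le ht.1
    (g := fun τ => ‖L * (‖𝒞.ev (D ω) τ‖ + c)‖)
    (Eventually.of_forall fun τ hτ => ?_) (hci.intervalIntegrable _ _)).trans ?_
  · have hτT : τ ∈ Icc 0 𝒞.T := ⟨hτ.1.le, hτ.2.trans ht.2⟩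
    refine (norm_f_sub_le h𝒞 hL₁ hL₂ hτT ((u.needle v s h).mem τ hτT ω) _ _
      (X.memLp_at τ) (X₁.memLp_at τ)).trans (le_trans ?_ (le_abs_self _))
    refine mul_le_mul_of_nonneg_left (add_le_add (le_of_eq ?_) ?_) hL0
    · rw [hX₁at, sub_add_cancel_left, norm_neg]
    · refine ENNReal.toReal_le_of_le_ofReal hc (le_trans (le_of_eq ?_) (hD τ hτT))
      rw [← eLpNorm_neg]
      congr 1
      funext ω
      simp only [Pi.neg_apply, hX₁at, sub_add_cancel_left, neg_neg]
  · rw [intervalIntegral.integral_of_le ht.1]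
    exact setIntegral_mono_set hci.integrableOn_Icc (Eventually.of_forall fun _ => norm_nonneg _)
      (LE.le.eventuallyLE (Ioc_subset_Icc_self.trans (Icc_subset_Icc le_rfl ht.2)))

/-- The states of needle variations: they differ from the unperturbed one by at most a multiple of
the accumulated excess velocity at each time, in `L^p`. -/
lemma exists_needle_state (h𝒞 : 𝒞.Assumptions) : ∃ K : ℝ, 0 ≤ K ∧ ∀ (X : 𝒞.State P)
    (u v : 𝒞.Control P), 𝒞.IsLagrangian X u → ∀ s h c : ℝ, 0 ≤ c →
    (∀ t ∈ Icc 0 𝒞.T, eLpNorm (fun ω => ∫ τ in (0 : ℝ)..t, needleExcess X u v s h τ ω)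
      (ENNReal.ofReal 𝒞.p) P ≤ ENNReal.ofReal c) →
    ∃ Y : 𝒞.State P, 𝒞.IsLagrangian Y (u.needle v s h) ∧ Y.at 0 =ᵐ[P] X.at 0 ∧
      (∀ t ∈ Icc 0 𝒞.T, eLpNorm (fun ω => Y.at t ω - X.at t ω) (ENNReal.ofReal 𝒞.p) P
        ≤ ENNReal.ofReal (K * c)) ∧
      eLpNorm (Y.path - X.path) (ENNReal.ofReal 𝒞.p) P ≤ ENNReal.ofReal (K * c)
        + eLpNorm (needleExcessPath X u v s h) (ENNReal.ofReal 𝒞.p) P := by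
  obtain ⟨L, hL0, -, hL₁, hL₂⟩ := exists_lipschitz h𝒞
  obtain ⟨C, hC0, hC⟩ := exists_state_stability (P := P) h𝒞
  have hp1 := one_le_ofReal 𝒞.hpq.lt
  have hT0 := 𝒞.T_pos
  refine ⟨C * (𝒞.T * (L * 2)) + 1, by positivity, fun X u v hX s h c hc hD => ?_⟩
  obtain ⟨Y, hY, hY0⟩ := exists_state h𝒞 (u.needle v s h) (X.memLp_at 0)
  have hDm := memLp_needleExcessPath h𝒞 X u v s h
  have hDt : ∀ t ∈ Icc 0 𝒞.T, eLpNorm (fun ω => 𝒞.ev (needleExcessPath X u v s h ω) t)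
      (ENNReal.ofReal 𝒞.p) P ≤ ENNReal.ofReal c := fun t ht =>
    (eLpNorm_ev_needleExcessPath h𝒞 X u v s h ht).trans_le (hD t ht)
  have hBm :=
    (aestronglyMeasurable_norm_ev_add (𝒞 := 𝒞) hDm.1 L c).norm.prod_swap.integral_prod_right'
  have hY0' : Y.at 0 =ᵐ[P] (correctedState h𝒞 X u v s h).at 0 := by
    filter_upwards [hY0, ae_ev_needleExcessPath h𝒞 X u v s h] with ω h1 h2
    rw [h1, correctedState_at, h2 0 𝒞.zero_mem, intervalIntegral.integral_same, add_zero]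
  have hstab := hC (correctedState h𝒞 X u v s h) Y (u.needle v s h) hY hY0' _ hBm
    (ae_norm_correctedState_sub_le h𝒞 hL0 hL₁ hL₂ v hX s h hc hDt)
  have hstab' : eLpNorm (Y.path - (correctedState h𝒞 X u v s h).path) (ENNReal.ofReal 𝒞.p) P
      ≤ ENNReal.ofReal (C * (𝒞.T * (L * 2)) * c) := by
    refine (hstab.trans (mul_le_mul' le_rfl
      (eLpNorm_integral_norm_ev_add_le hDm.1 hL0 hc hDt))).trans (le_of_eq ?_)
    rw [← ENNReal.ofReal_mul hC0]
    congr 1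
    ring
  have hYX₁m : AEStronglyMeasurable (Y.path - (correctedState h𝒞 X u v s h).path) P :=
    (Y.memLp.sub (correctedState h𝒞 X u v s h).memLp).1
  refine ⟨Y, hY, hY0, fun t ht => ?_, ?_⟩
  · have e : (fun ω => Y.at t ω - X.at t ω)
        = (fun ω => Y.at t ω - (correctedState h𝒞 X u v s h).at t ω)
          + fun ω => 𝒞.ev (needleExcessPath X u v s h ω) t := by
      funext ω
      simp only [Pi.add_apply, correctedState_at]
      abel
    rw [e, add_mul, one_mul, ENNReal.ofReal_add (by positivity) hc]
    refine (eLpNorm_add_le ((Y.memLp_at t).1.sub ((correctedState h𝒞 X u v s h).memLp_at t).1)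
      (aestronglyMeasurable_ev hDm.1 t) hp1).trans (add_le_add (le_trans ?_ hstab') (hDt t ht))
    exact eLpNorm_mono fun ω =>
      𝒞.norm_ev_le (Y.path ω - (correctedState h𝒞 X u v s h).path ω) t
  · have e : Y.path - X.path = (Y.path - (correctedState h𝒞 X u v s h).path)
        + needleExcessPath X u v s h := by
      funext ω
      simp only [Pi.add_apply, Pi.sub_apply, correctedState]
      abel
    rw [e]
    refine (eLpNorm_add_le hYX₁m hDm.1 hp1).trans (add_le_add (hstab'.trans
      (ENNReal.ofReal_le_ofReal ?_)) le_rfl)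
    linarith

end NeedleState

/-! ### Sequences of needle variations -/

section NeedleSequence

variable {d : ℕ} {V : Type*} {𝒞 : Problem d V} [NormedAddCommGroup V]
  {Ω : Type*} [MeasurableSpace Ω] {P : Measure Ω} [IsProbabilityMeasure P]

/-- States `Y n` of needle variations of `(X, u)` at the time `s`, with needles of length `η n`
that shrink to zero so fast that the states converge almost surely, with a domination in `L^p`. -/
structure IsNeedleSequence (X : 𝒞.State P) (u v : 𝒞.Control P) (s C : ℝ) (η : ℕ → ℝ)
    (Y : ℕ → 𝒞.State P) (W : Ω → ℝ) : Prop where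
  nonneg : 0 ≤ s
  C_pos : 0 < C
  pos : ∀ n, 0 < η n
  le : ∀ n, s + η n ≤ 𝒞.T
  tendsto : Tendsto η atTop (𝓝 0)
  isLagrangian : ∀ n, 𝒞.IsLagrangian (Y n) (u.needle v s (η n))
  initial : ∀ n, (Y n).at 0 =ᵐ[P] X.at 0
  eLpNorm_le : ∀ n, ∀ t ∈ Icc 0 𝒞.T,
    eLpNorm (fun ω => (Y n).at t ω - X.at t ω) (ENNReal.ofReal 𝒞.p) P ≤ ENNReal.ofReal (C * η n)
  tendsto_eLpNorm : Tendsto (fun n => eLpNorm ((Y n).path - X.path) (ENNReal.ofReal 𝒞.p) P) atTop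
    (𝓝 0)
  memLp : MemLp W (ENNReal.ofReal 𝒞.p) P
  dominated : ∀ᵐ ω ∂P, ∀ n, ‖(Y n).path ω - X.path ω‖ ≤ W ω
  ae_tendsto : ∀ᵐ ω ∂P, Tendsto (fun n => (Y n).path ω) atTop (𝓝 (X.path ω))

/-- Needle sequences exist at times where both velocities have a linear rate: the `n`-th needle is
chosen so short that the `p`-th power of the distance of the states is at most `2⁻ⁿ`. -/
lemma exists_isNeedleSequence (h𝒞 : 𝒞.Assumptions) {X : 𝒞.State P} {u v : 𝒞.Control P}
    (hX : 𝒞.IsLagrangian X u) {s : ℝ} (hs : s ∈ Ico 0 𝒞.T) (hu : HasLinearRate X u s)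
    (hv : HasLinearRate X v s) :
    ∃ (C : ℝ) (η : ℕ → ℝ) (Y : ℕ → 𝒞.State P) (W : Ω → ℝ), IsNeedleSequence X u v s C η Y W := by
  obtain ⟨K, hK0, hK⟩ := exists_needle_state (P := P) h𝒞
  obtain ⟨C₁, hC₁, hu⟩ := hu
  obtain ⟨C₂, hC₂, hv⟩ := hv
  have hp0 := 𝒞.p_pos
  set M := eLpNorm (fun z : ℝ × Ω => velocity X v z.1 z.2
        - velocity X u z.1 z.2) (ENNReal.ofReal 𝒞.p) (𝒞.timeMeasure.prod P) with hM
  have hMtop : M ≠ ∞ := by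
    have hm : MemLp (fun z : ℝ × Ω => velocity X v z.1 z.2 - velocity X u z.1 z.2)
      (ENNReal.ofReal 𝒞.p) (𝒞.timeMeasure.prod P) :=
      (memLp_velocity h𝒞 X v).sub (memLp_velocity h𝒞 X u)
    exact hm.2.ne
  have hpp : 0 < 1 - 1 / 𝒞.p := by
    rw [sub_pos, div_lt_one hp0]; exact 𝒞.hpq.lt
  have hlim : Tendsto (fun h : ℝ => (ENNReal.ofReal (K * ((C₁ + C₂) * h))
      + ENNReal.ofReal h ^ (1 - 1 / 𝒞.p) * M) ^ 𝒞.p) (𝓝[>] 0) (𝓝 0) := by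
    have h1 : Tendsto (fun h : ℝ => ENNReal.ofReal (K * ((C₁ + C₂) * h))) (𝓝[>] 0) (𝓝 0) := by
      have : Continuous fun h : ℝ => ENNReal.ofReal (K * ((C₁ + C₂) * h)) :=
        ENNReal.continuous_ofReal.comp (by fun_prop)
      simpa using (this.tendsto 0).mono_left nhdsWithin_le_nhds
    have h2 : Tendsto (fun h : ℝ => ENNReal.ofReal h ^ (1 - 1 / 𝒞.p) * M) (𝓝[>] 0) (𝓝 0) := by
      have h3 : Continuous fun h : ℝ => ENNReal.ofReal h ^ (1 - 1 / 𝒞.p) :=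
        ENNReal.continuous_rpow_const.comp ENNReal.continuous_ofReal
      have h4 := (h3.tendsto 0).mono_left (nhdsWithin_le_nhds (s := Ioi (0 : ℝ)))
      rw [ENNReal.ofReal_zero, ENNReal.zero_rpow_of_pos hpp] at h4
      simpa using ENNReal.Tendsto.mul_const h4 (Or.inr hMtop)
    have h6 := h1.add h2
    rw [add_zero] at h6
    have h5 := (ENNReal.continuous_rpow_const (y := 𝒞.p)).tendsto 0 |>.comp h6
    rwa [ENNReal.zero_rpow_of_pos hp0] at h5
  have hex : ∀ n : ℕ, ∃ h : ℝ, ∃ Y : 𝒞.State P, 0 < h ∧ h ≤ 1 / ((n : ℝ) + 1) ∧ s + h ≤ 𝒞.T ∧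
      𝒞.IsLagrangian Y (u.needle v s h) ∧ Y.at 0 =ᵐ[P] X.at 0 ∧
      (∀ t ∈ Icc 0 𝒞.T, eLpNorm (fun ω => Y.at t ω - X.at t ω) (ENNReal.ofReal 𝒞.p) P
        ≤ ENNReal.ofReal (K * ((C₁ + C₂) * h))) ∧
      eLpNorm (Y.path - X.path) (ENNReal.ofReal 𝒞.p) P ^ 𝒞.p ≤ 2⁻¹ ^ n := by
    intro n
    have e1 : ∀ᶠ h : ℝ in 𝓝[>] 0, h ∈ Ioo 0 (min (1 / ((n : ℝ) + 1)) (𝒞.T - s)) :=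
      Ioo_mem_nhdsGT (lt_min (by positivity) (by linarith [hs.2]))
    have e2 := hlim.eventually_le_const (show (0 : ℝ≥0∞) < 2⁻¹ ^ n by
      exact ENNReal.pow_pos (by simp) n)
    obtain ⟨h, h1, h2, h3, h4⟩ := (e1.and (e2.and (hu.and hv))).exists
    have hsh : s + h ≤ 𝒞.T := by linarith [h1.2.trans_le (min_le_right _ _)]
    obtain ⟨Y, hY1, hY2, hY3, hY4⟩ := hK X u v hX s h ((C₁ + C₂) * h)
      (mul_nonneg (by positivity) h1.1.le) fun t ht =>
        eLpNorm_integral_needleExcess_le h𝒞 X u v hs.1 h1.1 hsh hC₁ hC₂ h3 h4 ht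
    refine ⟨h, Y, h1.1, h1.2.le.trans (min_le_left _ _), hsh, hY1, hY2, hY3, ?_⟩
    refine (ENNReal.rpow_le_rpow (hY4.trans (add_le_add le_rfl ?_)) hp0.le).trans h2
    exact eLpNorm_needleExcessPath_le h𝒞 X u v hs.1 hsh
  choose η Y h1 h2 h3 h4 h5 h6 h7 using hex
  have hsum : ∑' n, eLpNorm ((Y n).path - X.path) (ENNReal.ofReal 𝒞.p) P ^ 𝒞.p ≠ ∞ := by
    refine ne_top_of_le_ne_top ?_ (ENNReal.tsum_le_tsum h7)
    rw [ENNReal.tsum_geometric]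
    simp
  have hm : ∀ n, AEStronglyMeasurable ((Y n).path - X.path) P := fun n =>
    ((Y n).memLp.sub X.memLp).1
  obtain ⟨W, hW, hdom, hae⟩ := exists_dominating_of_tsum_ne_top hp0 hm hsum
  -- the summand `1` makes the constant positive
  refine ⟨K * (C₁ + C₂) + 1, η, Y, W, hs.1, by positivity, h1, h3, ?_, h4, h5,
    fun n t ht => (h6 n t ht).trans (ENNReal.ofReal_le_ofReal ?_), ?_, hW, hdom, ?_⟩
  · exact squeeze_zero (fun n => (h1 n).le) h2 tendsto_one_div_add_atTop_nhds_zero_nat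
  · nlinarith [h1 n]
  · have e1 := ENNReal.tendsto_atTop_zero_of_tsum_ne_top hsum
    have e2 := (ENNReal.continuous_rpow_const (y := 𝒞.p⁻¹)).tendsto 0 |>.comp e1
    rw [ENNReal.zero_rpow_of_pos (by positivity)] at e2
    refine e2.congr fun n => ?_
    simp only [Function.comp_apply]
    rw [← ENNReal.rpow_mul, mul_inv_cancel₀ hp0.ne', ENNReal.rpow_one]
  · filter_upwards [hae] with ω hω
    exact tendsto_sub_nhds_zero_iff.1 hω

end NeedleSequence

end Problem

/-! ### Integration by parts -/

section ByParts

variable {E F : Type*} [NormedAddCommGroup E] [NormedSpace ℝ E] [NormedAddCommGroup F]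
  [NormedSpace ℝ F] [CompleteSpace E] [CompleteSpace F]

/-- Integration by parts for a bilinear pairing of primitives, as an application of Fubini's
theorem on a triangle. -/
lemma integral_primitive_apply {a b : ℝ} (hab : a ≤ b) {α : ℝ → E →L[ℝ] F} {β : ℝ → E}
    (hα : IntervalIntegrable α volume a b) (hβ : IntervalIntegrable β volume a b) :
    ∫ t in a..b, (∫ r in a..t, α r) (β t) = ∫ r in a..b, α r (∫ t in r..b, β t) := by
  set μ := (volume : Measure ℝ).restrict (Ioc a b) with hμ
  have hα' : Integrable α μ := hα.1
  have hβ' : Integrable β μ := hβ.1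
  have hS : MeasurableSet {z : ℝ × ℝ | z.2 ≤ z.1} := measurableSet_le measurable_snd measurable_fst
  have hi : Integrable (fun z : ℝ × ℝ => α z.2 (β z.1)) (μ.prod μ) := by
    refine ((hβ'.norm.mul_prod hα'.norm)).mono' ?_ (Eventually.of_forall fun z => ?_)
    · exact (isBoundedBilinearMap_apply.continuous (𝕜 := ℝ)).comp_aestronglyMeasurable
        (hα'.1.comp_snd.prodMk hβ'.1.comp_fst)
    · exact ((α z.2).le_opNorm _).trans (le_of_eq (mul_comm _ _))
  have hswap := integral_integral_swap
    (f := fun t r => indicator {z : ℝ × ℝ | z.2 ≤ z.1} (fun z => α z.2 (β z.1)) (t, r))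
    (μ := μ) (ν := μ) (hi.indicator hS)
  rw [intervalIntegral.integral_of_le hab, intervalIntegral.integral_of_le hab]
  have e1 : ∀ t ∈ Ioc a b, ∫ r, indicator {z : ℝ × ℝ | z.2 ≤ z.1} (fun z => α z.2 (β z.1)) (t, r) ∂μ
      = (∫ r in a..t, α r) (β t) := by
    intro t ht
    have h1 : (fun r => indicator {z : ℝ × ℝ | z.2 ≤ z.1} (fun z => α z.2 (β z.1)) (t, r))
        = indicator (Iic t) fun r => α r (β t) := by
      funext r
      by_cases hr : r ≤ t
      · rw [indicator_of_mem (by exact hr), indicator_of_mem (by exact hr)]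
      · rw [indicator_of_notMem (by exact hr), indicator_of_notMem (by exact hr)]
    rw [h1, integral_indicator measurableSet_Iic, hμ, Measure.restrict_restrict measurableSet_Iic,
      intervalIntegral.integral_of_le ht.1.le, inter_comm, Ioc_inter_Iic, min_eq_right ht.2]
    refine (ContinuousLinearMap.integral_apply ?_ _).symm
    exact hα.1.mono_set (Ioc_subset_Ioc_right ht.2)
  have e2 : ∀ r ∈ Ioc a b, ∫ t, indicator {z : ℝ × ℝ | z.2 ≤ z.1} (fun z => α z.2 (β z.1)) (t, r) ∂μ
      = α r (∫ t in r..b, β t) := by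
    intro r hr
    have h1 : (fun t => indicator {z : ℝ × ℝ | z.2 ≤ z.1} (fun z => α z.2 (β z.1)) (t, r))
        = indicator (Ici r) fun t => α r (β t) := by
      funext t
      by_cases ht : r ≤ t
      · rw [indicator_of_mem (by exact ht), indicator_of_mem (by exact ht)]
      · rw [indicator_of_notMem (by exact ht), indicator_of_notMem (by exact ht)]
    have h2 : Ici r ∩ Ioc a b = Icc r b := by
      ext t
      exact ⟨fun h => ⟨h.1, h.2.2⟩, fun h => ⟨h.1, hr.1.trans_le h.1, h.2⟩⟩
    rw [h1, integral_indicator measurableSet_Ici, hμ, Measure.restrict_restrict measurableSet_Ici,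
      h2, integral_Icc_eq_integral_Ioc, intervalIntegral.integral_of_le hr.2]
    exact (α r).integral_comp_comm (hβ.1.mono_set (Ioc_subset_Ioc_left hr.1.le))
  rw [setIntegral_congr_fun measurableSet_Ioc e1, setIntegral_congr_fun measurableSet_Ioc e2]
    at hswap
  exact hswap

lemma intervalIntegrable_clm_apply_continuous {a b : ℝ} {α : ℝ → E →L[ℝ] F} {x : ℝ → E}
    (hα : IntervalIntegrable α volume a b) (hx : ContinuousOn x (uIcc a b)) :
    IntervalIntegrable (fun t => α t (x t)) volume a b := by
  obtain ⟨M, hM⟩ := isCompact_uIcc.exists_bound_of_continuousOn hx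
  have hxm : AEStronglyMeasurable x (volume.restrict (uIoc a b)) :=
    (hx.mono uIoc_subset_uIcc).aestronglyMeasurable measurableSet_uIoc
  refine (hα.norm.mul_const M).mono_fun' ?_ ?_
  · exact (isBoundedBilinearMap_apply.continuous (𝕜 := ℝ)).comp_aestronglyMeasurable
      (hα.def'.1.prodMk hxm)
  · filter_upwards [ae_restrict_mem measurableSet_uIoc] with t ht
    exact ((α t).le_opNorm _).trans (mul_le_mul_of_nonneg_left (hM t (uIoc_subset_uIcc ht))
      (norm_nonneg _))

lemma intervalIntegrable_continuous_apply {a b : ℝ} {A : ℝ → E →L[ℝ] F} {β : ℝ → E}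
    (hA : ContinuousOn A (uIcc a b)) (hβ : IntervalIntegrable β volume a b) :
    IntervalIntegrable (fun t => A t (β t)) volume a b := by
  obtain ⟨M, hM⟩ := isCompact_uIcc.exists_bound_of_continuousOn hA
  have hAm : AEStronglyMeasurable A (volume.restrict (uIoc a b)) :=
    (hA.mono uIoc_subset_uIcc).aestronglyMeasurable measurableSet_uIoc
  refine (hβ.norm.const_mul M).mono_fun' ?_ ?_
  · exact (isBoundedBilinearMap_apply.continuous (𝕜 := ℝ)).comp_aestronglyMeasurable
      (hAm.prodMk hβ.def'.1)
  · filter_upwards [ae_restrict_mem measurableSet_uIoc] with t ht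
    exact ((A t).le_opNorm _).trans (mul_le_mul_of_nonneg_right (hM t (uIoc_subset_uIcc ht))
      (norm_nonneg _))

/-- The product rule in integral form, the second factor starting at zero. -/
lemma integral_apply_add_integral_apply {a b : ℝ} (hab : a ≤ b) {α : ℝ → E →L[ℝ] F} {β : ℝ → E}
    {A : ℝ → E →L[ℝ] F} {B : ℝ → E} (hα : IntervalIntegrable α volume a b)
    (hβ : IntervalIntegrable β volume a b)
    (hA : ∀ t ∈ Icc a b, A t = A a + ∫ r in a..t, α r)
    (hB : ∀ t ∈ Icc a b, B t = ∫ r in a..t, β r) :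
    ∫ t in a..b, (α t (B t) + A t (β t)) = A b (B b) := by
  have hu : uIcc a b = Icc a b := uIcc_of_le hab
  have hb : b ∈ Icc a b := right_mem_Icc.2 hab
  have hBc : ContinuousOn B (uIcc a b) := by
    rw [hu]
    refine ContinuousOn.congr ?_ hB
    rw [← hu]
    exact intervalIntegral.continuousOn_primitive_interval' hβ left_mem_uIcc
  have hPc : ContinuousOn (fun t => ∫ r in a..t, α r) (uIcc a b) :=
    intervalIntegral.continuousOn_primitive_interval' hα left_mem_uIcc
  have hAc : ContinuousOn A (uIcc a b) := by
    rw [hu]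
    refine ContinuousOn.congr ?_ hA
    rw [← hu]
    exact continuousOn_const.add hPc
  have i1 := intervalIntegrable_clm_apply_continuous hα hBc
  have i2 := intervalIntegrable_continuous_apply hAc hβ
  have i3 := intervalIntegrable_continuous_apply hPc hβ
  have i4 : IntervalIntegrable (fun t => A a (β t)) volume a b :=
    intervalIntegrable_continuous_apply continuousOn_const hβ
  have i5 : IntervalIntegrable (fun t => α t (B b)) volume a b :=
    intervalIntegrable_clm_apply_continuous hα continuousOn_const
  have e1 : ∫ t in a..b, A t (β t) = A a (B b) + ∫ t in a..b, (∫ r in a..t, α r) (β t) := by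
    rw [hB b hb, ← (A a).intervalIntegral_comp_comm hβ, ← intervalIntegral.integral_add i4 i3]
    refine intervalIntegral.integral_congr fun t ht => ?_
    rw [hu] at ht
    simp only [hA t ht, _root_.add_apply]
  have e2 : ∫ r in a..b, α r (∫ t in r..b, β t)
      = (∫ r in a..b, α r) (B b) - ∫ t in a..b, α t (B t) := by
    rw [ContinuousLinearMap.intervalIntegral_apply hα, ← intervalIntegral.integral_sub i5 i1]
    refine intervalIntegral.integral_congr fun t ht => ?_
    rw [hu] at ht
    have h1 := intervalIntegral.integral_add_adjacent_intervals
      (intervalIntegrable_mono_mem hβ hab (left_mem_Icc.2 hab) ht)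
      (intervalIntegrable_mono_mem hβ hab ht hb)
    rw [← map_sub, hB t ht, hB b hb, ← h1, add_sub_cancel_left]
  rw [intervalIntegral.integral_add i1 i2, e1, integral_primitive_apply hab hα hβ, e2, hA b hb,
    _root_.add_apply]
  abel

end ByParts

namespace Problem

/-! ### The expansion of the costs along a needle sequence -/

section CostExpansion

variable {d : ℕ} {V : Type*} {𝒞 : Problem d V} [NormedAddCommGroup V]
  {Ω : Type*} [MeasurableSpace Ω] {P : Measure Ω} [IsProbabilityMeasure P]

namespace IsNeedleSequence

variable {X : 𝒞.State P} {u v : 𝒞.Control P} {s C : ℝ} {η : ℕ → ℝ} {Y : ℕ → 𝒞.State P} {W : Ω → ℝ}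

lemma eLpNorm_at_le (h : IsNeedleSequence X u v s C η Y W) (n : ℕ) (t : ℝ) :
    eLpNorm (fun ω => (Y n).at t ω - X.at t ω) (ENNReal.ofReal 𝒞.p) P
      ≤ ENNReal.ofReal (C * η n) := by
  have e : ∀ Z : 𝒞.State P, Z.at t = Z.at (projIcc 0 𝒞.T 𝒞.T_pos.le t) := fun Z => by
    funext ω; simp [State.at, ev, IccExtend]
  rw [e X, e (Y n)]
  exact h.eLpNorm_le n _ (projIcc 0 𝒞.T 𝒞.T_pos.le t).2

lemma memLp_dominating (h : IsNeedleSequence X u v s C η Y W) :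
    MemLp (fun ω => ‖X.path ω‖ + W ω) (ENNReal.ofReal 𝒞.p) P :=
  memLp_fun_add X.memLp.norm h.memLp

lemma ae_norm_path_le (h : IsNeedleSequence X u v s C η Y W) :
    ∀ᵐ ω ∂P, ‖X.path ω‖ ≤ ‖X.path ω‖ + W ω ∧ ∀ n, ‖(Y n).path ω‖ ≤ ‖X.path ω‖ + W ω := by
  filter_upwards [h.dominated] with ω hω
  have h0 : 0 ≤ W ω := (norm_nonneg _).trans (hω 0)
  refine ⟨by linarith, fun n => ?_⟩
  have := norm_add_le (X.path ω) ((Y n).path ω - X.path ω)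
  rw [add_sub_cancel] at this
  linarith [hω n]

lemma ae_norm_at_le (h : IsNeedleSequence X u v s C η Y W) :
    ∀ᵐ ω ∂P, ∀ t, ‖X.at t ω‖ ≤ ‖X.path ω‖ + W ω ∧ ∀ n, ‖(Y n).at t ω‖ ≤ ‖X.path ω‖ + W ω := by
  filter_upwards [h.ae_norm_path_le] with ω hω t
  exact ⟨(𝒞.norm_ev_le _ _).trans hω.1, fun n => (𝒞.norm_ev_le _ _).trans (hω.2 n)⟩

lemma ae_tendsto_at (h : IsNeedleSequence X u v s C η Y W) :
    ∀ᵐ ω ∂P, ∀ t, Tendsto (fun n => (Y n).at t ω) atTop (𝓝 (X.at t ω)) := by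
  filter_upwards [h.ae_tendsto] with ω hω t
  exact ((continuous_eval_const (projIcc 0 𝒞.T 𝒞.T_pos.le t)).tendsto (X.path ω)).comp hω

/-- The rate of the perturbation of the state. -/
lemma exists_rate (h : IsNeedleSequence X u v s C η Y W) : ∃ D : ℝ, 0 < D ∧
    (∀ n t, eLpNorm (fun ω => (Y n).at t ω - X.at t ω) (ENNReal.ofReal 𝒞.p) P
      ≤ ENNReal.ofReal (D * η n)) ∧
    ∀ n, eLpNorm (fun z : ℝ × Ω => (Y n).at z.1 z.2 - X.at z.1 z.2) (ENNReal.ofReal 𝒞.p)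
      (𝒞.timeMeasure.prod P) ≤ ENNReal.ofReal (D * η n) := by
  have hC := h.C_pos
  have hT := 𝒞.T_pos
  refine ⟨(1 + 𝒞.T ^ (1 / 𝒞.p)) * C, by positivity, fun n t => (h.eLpNorm_at_le n t).trans
    (ENNReal.ofReal_le_ofReal ?_), fun n => ?_⟩
  · have := h.pos n
    have h2 : 0 ≤ 𝒞.T ^ (1 / 𝒞.p) * (C * η n) := by positivity
    linarith
  · have hm : AEStronglyMeasurable (fun z : ℝ × Ω => (Y n).at z.1 z.2 - X.at z.1 z.2)
        (𝒞.timeMeasure.prod P) :=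
      (aestronglyMeasurable_ev_prod (Y n).memLp.1 _).sub (aestronglyMeasurable_ev_prod X.memLp.1 _)
    refine (eLpNorm_prod_le (g := fun t ω => (Y n).at t ω - X.at t ω) 𝒞.p_pos hm
      (Eventually.of_forall fun t => h.eLpNorm_at_le n t)).trans ?_
    rw [Measure.restrict_apply_univ, Real.volume_Icc, sub_zero,
      ENNReal.ofReal_rpow_of_nonneg hT.le (by have := 𝒞.p_pos; positivity),
      ← ENNReal.ofReal_mul (by positivity)]
    refine ENNReal.ofReal_le_ofReal ?_
    have := h.pos n
    nlinarith [mul_pos hC this]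

lemma tendsto_rate (h : IsNeedleSequence X u v s C η Y W) (D : ℝ) :
    Tendsto (fun n => ENNReal.ofReal (D * η n)) atTop (𝓝 0) := by
  have := ENNReal.tendsto_ofReal (h.tendsto.const_mul D)
  simpa using this

end IsNeedleSequence

/-- The first-order expansion of the terminal cost. -/
lemma IsNeedleSequence.tendsto_terminal (h𝒞 : 𝒞.Assumptions) {X : 𝒞.State P} {u v : 𝒞.Control P}
    {s C : ℝ} {η : ℕ → ℝ} {Y : ℕ → 𝒞.State P} {W : Ω → ℝ}
    (h : IsNeedleSequence X u v s C η Y W) {D : ℝ} (hD : 0 < D)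
    (hrate : ∀ n t, eLpNorm (fun ω => (Y n).at t ω - X.at t ω) (ENNReal.ofReal 𝒞.p) P
      ≤ ENNReal.ofReal (D * η n)) :
    Tendsto (fun n => (∫⁻ ω, ‖𝒞.σ ((Y n).at 𝒞.T ω) ((Y n).law 𝒞.T) - 𝒞.σ (X.at 𝒞.T ω) (X.law 𝒞.T)
      - fderiv ℝ (fun x => 𝒞.σ x (X.law 𝒞.T)) (X.at 𝒞.T ω) ((Y n).at 𝒞.T ω - X.at 𝒞.T ω)
      - ∫ ω', intrinsicDeriv (fun m => 𝒞.σ (X.at 𝒞.T ω) m) (X.law 𝒞.T) (X.at 𝒞.T ω')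
        ((Y n).at 𝒞.T ω' - X.at 𝒞.T ω') ∂P‖ₑ ∂P) / ENNReal.ofReal (D * η n)) atTop (𝓝 0) := by
  obtain ⟨B, hB, -, -, h3, h4⟩ := exists_growth_deriv h𝒞
  have hdx : ∀ ω, HasIntrinsicDeriv fun m => 𝒞.σ (X.at 𝒞.T ω) m := fun ω => h𝒞.σ_diff_m _
  have hXT := (X.memLp_at 𝒞.T).1
  have hYT := fun n => ((Y n).memLp_at 𝒞.T).1
  have hσ : ∀ Z Z' : 𝒞.State P, AEStronglyMeasurable (fun ω => 𝒞.σ (Z.at 𝒞.T ω) (Z'.law 𝒞.T)) P :=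
    fun Z Z' => h𝒞.σ_cont.comp_aestronglyMeasurable
      ((Z.memLp_at 𝒞.T).1.prodMk aestronglyMeasurable_const)
  refine tendsto_lintegral_remainder_div (P := P) (μ := P) (h := fun n => ENNReal.ofReal (D * η n))
    𝒞.hpq
    (K := fun _ x m => 𝒞.σ x m) (Kx := fun _ x m => fderiv ℝ (fun x => 𝒞.σ x m) x)
    (Km := fun ω m y => intrinsicDeriv (fun m => 𝒞.σ (X.at 𝒞.T ω) m) m y)
    (δ := fun ω => flatDeriv fun m => 𝒞.σ (X.at 𝒞.T ω) m)
    (x := X.at 𝒞.T) (x' := fun n => (Y n).at 𝒞.T) (Y := fun _ => X.at 𝒞.T)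
    (Y' := fun n _ => (Y n).at 𝒞.T) (a := fun ω => 1 + ‖X.path ω‖ ^ 𝒞.p)
    (ζ := fun ω => ‖X.path ω‖ + W ω) (Z := fun ω => ‖X.path ω‖ + W ω) (C := B)
    (fun _ => X.memLp_at 𝒞.T) (fun n _ => (Y n).memLp_at 𝒞.T)
    (Eventually.of_forall fun _ x m => (h𝒞.σ_diff_x m x).hasFDerivAt)
    (Eventually.of_forall fun _ => h𝒞.σ_x_cont)
    (Eventually.of_forall fun ω => h𝒞.σ_cont.comp
      (by fun_prop : Continuous fun m : PSpace 𝒞.p d => (X.at 𝒞.T ω, m)))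
    (Eventually.of_forall fun ω => (hdx ω).isFlatDeriv)
    (Eventually.of_forall fun ω m y => ((hdx ω).2 m y).hasFDerivAt)
    (Eventually.of_forall fun ω => h𝒞.σ_m_cont.comp
      (by fun_prop : Continuous fun w : PSpace 𝒞.p d × Rd d => (X.at 𝒞.T ω, w.1, w.2)))
    hB ((integrable_const 1).add X.integrable_path) (fun ω => by positivity)
    (Eventually.of_forall fun ω x m => (h3 x m).trans (mul_le_mul_of_nonneg_left ?_ hB))
    (Eventually.of_forall fun ω m y => (h4 _ m y).trans (mul_le_mul_of_nonneg_left ?_ hB))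
    h.memLp_dominating
    (fun _ => by filter_upwards [h.ae_norm_at_le] with ω hω using (hω _).1)
    (fun _ => by filter_upwards [h.ae_norm_at_le] with ω hω using (hω _).2)
    (fun _ => by filter_upwards [h.ae_tendsto_at] with ω hω using hω _)
    (fun n _ => hrate n _) (h.tendsto_rate D)
    (fun n => by have := mul_pos hD (h.pos n); simpa using this) (fun n => ENNReal.ofReal_ne_top)
    hXT hYT ?_
    (by filter_upwards [h.ae_norm_at_le] with ω hω using (hω _).1)
    (by filter_upwards [h.ae_norm_at_le] with ω hω using (hω _).2)
    (by filter_upwards [h.ae_tendsto_at] with ω hω using hω _)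
    (fun n => hrate n _) (fun n => ?_) (fun n => ?_)
  · have := Real.rpow_nonneg (norm_nonneg (X.path ω)) 𝒞.p
    linarith
  · linarith [X.norm_at_rpow_le 𝒞.T ω]
  · refine (integrable_norm_rpow 𝒞.p_pos h.memLp_dominating).congr ?_
    filter_upwards [h.ae_norm_path_le] with ω hω
    rw [Real.norm_of_nonneg ((norm_nonneg _).trans hω.1)]
  · have hx : AEStronglyMeasurable
        (fun ω => fderiv ℝ (fun x => 𝒞.σ x (X.law 𝒞.T)) (X.at 𝒞.T ω)) P :=
      h𝒞.σ_x_cont.comp_aestronglyMeasurable (hXT.prodMk aestronglyMeasurable_const)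
    exact ((hσ (Y n) (Y n)).sub (hσ X (Y n))).sub
      ((isBoundedBilinearMap_apply.continuous (𝕜 := ℝ)).comp_aestronglyMeasurable
        (hx.prodMk ((hYT n).sub hXT)))
  · have hm : AEStronglyMeasurable (fun z : Ω × Ω => intrinsicDeriv (fun m => 𝒞.σ (X.at 𝒞.T z.1) m)
        (X.law 𝒞.T) (X.at 𝒞.T z.2)) (P.prod P) :=
      h𝒞.σ_m_cont.comp_aestronglyMeasurable
        (hXT.comp_fst.prodMk (aestronglyMeasurable_const.prodMk hXT.comp_snd))
    have hΔ : AEStronglyMeasurable (fun z : Ω × Ω => (Y n).at 𝒞.T z.2 - X.at 𝒞.T z.2) (P.prod P) :=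
      ((hYT n).sub hXT).comp_snd
    have hi : AEStronglyMeasurable (fun ω => ∫ ω', intrinsicDeriv (fun m => 𝒞.σ (X.at 𝒞.T ω) m)
        (X.law 𝒞.T) (X.at 𝒞.T ω') ((Y n).at 𝒞.T ω' - X.at 𝒞.T ω') ∂P) P :=
      AEStronglyMeasurable.integral_prod_right'
        ((isBoundedBilinearMap_apply.continuous (𝕜 := ℝ)).comp_aestronglyMeasurable (hm.prodMk hΔ))
    exact ((hσ X (Y n)).sub (hσ X X)).sub hi

end CostExpansion

section RunningExpansion

variable {d : ℕ} {V : Type*} {𝒞 : Problem d V} [NormedAddCommGroup V]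
  {Ω : Type*} [MeasurableSpace Ω] {P : Measure Ω} [IsProbabilityMeasure P]

lemma memLp_ev_prod {F : Type*} [NormedAddCommGroup F] {r : ℝ≥0∞} {Ψ : Ω → 𝒞.Path F}
    (hΨ : MemLp Ψ r P) :
    MemLp (fun z : ℝ × Ω => 𝒞.ev (Ψ z.2) z.1) r (𝒞.timeMeasure.prod P) :=
  (hΨ.comp_snd 𝒞.timeMeasure).of_le (aestronglyMeasurable_ev_prod hΨ.1 _)
    (Eventually.of_forall fun _ => 𝒞.norm_ev_le _ _)

/-- The Hamiltonian along the state `Y`, the laws of `Z` and the control `w`. -/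
noncomputable def hamAlong (Ψ : Ω → 𝒞.Path (RdStar d)) (Y Z : 𝒞.State P) (w : 𝒞.Control P) (t : ℝ)
    (ω : Ω) : ℝ :=
  𝒞.hamiltonian t (Y.at t ω) (Z.law t) (𝒞.ev (Ψ ω) t) (w.val t ω)

/-- The derivative of the Hamiltonian in `x` along a control process. -/
noncomputable def hamDx (Ψ : Ω → 𝒞.Path (RdStar d)) (X : 𝒞.State P) (u : 𝒞.Control P) (t : ℝ)
    (ω : Ω) : RdStar d :=
  (𝒞.ev (Ψ ω) t).comp (dxf X u t ω) - dxf₀ X u t ω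

/-- The intrinsic derivative of the Hamiltonian at `ω`, evaluated at the position of `ω'`. -/
noncomputable def hamDm (Ψ : Ω → 𝒞.Path (RdStar d)) (X : 𝒞.State P) (u : 𝒞.Control P) (t : ℝ)
    (ω ω' : Ω) : RdStar d :=
  (𝒞.ev (Ψ ω) t).comp (dmf X u t ω ω') - dmf₀ X u t ω ω'

lemma aestronglyMeasurable_clm_apply {β E F : Type*} [MeasurableSpace β] {μ : Measure β}
    [NormedAddCommGroup E] [NormedSpace ℝ E] [NormedAddCommGroup F] [NormedSpace ℝ F]
    {f : β → E →L[ℝ] F} {g : β → E} (hf : AEStronglyMeasurable f μ)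
    (hg : AEStronglyMeasurable g μ) : AEStronglyMeasurable (fun x => f x (g x)) μ :=
  (isBoundedBilinearMap_apply.continuous (𝕜 := ℝ)).comp_aestronglyMeasurable (hf.prodMk hg)

lemma aestronglyMeasurable_hamAlong (h𝒞 : 𝒞.Assumptions) {Ψ : Ω → 𝒞.Path (RdStar d)}
    (hΨ : AEStronglyMeasurable Ψ P) (Y Z : 𝒞.State P) (w : 𝒞.Control P) :
    AEStronglyMeasurable (fun z : ℝ × Ω => hamAlong Ψ Y Z w z.1 z.2) (𝒞.timeMeasure.prod P) := by
  have h1 := aestronglyMeasurable_clm_apply (aestronglyMeasurable_ev_prod hΨ 𝒞.timeMeasure)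
    (memLp_f h𝒞 Y Z w).1
  have h2 := aestronglyMeasurable_comp h𝒞 (φ := 𝒞.f₀) h𝒞.f₀_cont Y Z w
  exact h1.sub h2

lemma aestronglyMeasurable_hamDx (h𝒞 : 𝒞.Assumptions) {Ψ : Ω → 𝒞.Path (RdStar d)}
    (hΨ : AEStronglyMeasurable Ψ P) (X : 𝒞.State P) (u : 𝒞.Control P) :
    AEStronglyMeasurable (fun z : ℝ × Ω => hamDx Ψ X u z.1 z.2) (𝒞.timeMeasure.prod P) := by
  have h1 := aestronglyMeasurable_clm_comp (aestronglyMeasurable_ev_prod hΨ 𝒞.timeMeasure)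
    (aestronglyMeasurable_dxf h𝒞 X u)
  have h2 := aestronglyMeasurable_dxf₀ h𝒞 X u
  exact h1.sub h2

lemma aestronglyMeasurable_hamDm (h𝒞 : 𝒞.Assumptions) {Ψ : Ω → 𝒞.Path (RdStar d)}
    (hΨ : AEStronglyMeasurable Ψ P) (X : 𝒞.State P) (u : 𝒞.Control P) :
    AEStronglyMeasurable (fun z : (ℝ × Ω) × Ω => hamDm Ψ X u z.1.1 z.1.2 z.2)
      ((𝒞.timeMeasure.prod P).prod P) := by
  have h0 := (aestronglyMeasurable_ev_prod hΨ 𝒞.timeMeasure).comp_fst (ν := P)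
  have h1 := aestronglyMeasurable_clm_comp h0 (aestronglyMeasurable_dmf h𝒞 X u)
  have h2 := aestronglyMeasurable_dmf₀ h𝒞 X u
  exact h1.sub h2

lemma norm_comp_sub_rpow_le {q : ℝ} (hq : 1 < q) {E F : Type*} [NormedAddCommGroup E]
    [NormedSpace ℝ E] [NormedAddCommGroup F] [NormedSpace ℝ F] (ψ : F →L[ℝ] ℝ) (A : E →L[ℝ] F)
    (B : E →L[ℝ] ℝ) {L M b : ℝ} (hM : 0 ≤ M) (hL : 0 ≤ L) (hA : ‖A‖ ≤ L) (hB : ‖B‖ ^ q ≤ M * b)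
    (hb : 0 ≤ b) :
    ‖ψ.comp A - B‖ ^ q ≤ 2 ^ (q - 1) * (L ^ q + M) * (‖ψ‖ ^ q + b) := by
  have hq0 : 0 < q := by linarith
  have h1 : ‖ψ.comp A‖ ^ q ≤ L ^ q * ‖ψ‖ ^ q := by
    rw [← Real.mul_rpow hL (norm_nonneg _)]
    refine Real.rpow_le_rpow (norm_nonneg _) ((ψ.opNorm_comp_le A).trans ?_) hq0.le
    rw [mul_comm]
    exact mul_le_mul_of_nonneg_right hA (norm_nonneg _)
  refine (Real.rpow_le_rpow (norm_nonneg _) (norm_sub_le _ _) hq0.le).trans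
    ((add_rpow_le_mul hq.le (norm_nonneg _) (norm_nonneg _)).trans ?_)
  rw [mul_assoc]
  refine mul_le_mul_of_nonneg_left ?_ (by positivity)
  have h2 : 0 ≤ L ^ q := by positivity
  have h3 : 0 ≤ ‖ψ‖ ^ q := by positivity
  nlinarith [mul_nonneg h2 hb, mul_nonneg hM h3]

/-- The part of the bound for the derivatives of the Hamiltonian that does not depend on the
position and the law. -/
noncomputable def hamBound (Ψ : Ω → 𝒞.Path (RdStar d)) (X : 𝒞.State P) (u : 𝒞.Control P)
    (z : ℝ × Ω) : ℝ :=
  ‖𝒞.ev (Ψ z.2) z.1‖ ^ 𝒞.q + (1 + ‖X.path z.2‖ ^ 𝒞.p + ‖u.val z.1 z.2‖ ^ 𝒞.p)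

lemma hamBound_nonneg (Ψ : Ω → 𝒞.Path (RdStar d)) (X : 𝒞.State P) (u : 𝒞.Control P)
    (z : ℝ × Ω) : 0 ≤ hamBound Ψ X u z := by
  have h1 := Real.rpow_nonneg (norm_nonneg (𝒞.ev (Ψ z.2) z.1)) 𝒞.q
  have h2 := Real.rpow_nonneg (norm_nonneg (X.path z.2)) 𝒞.p
  have h3 := Real.rpow_nonneg (norm_nonneg (u.val z.1 z.2)) 𝒞.p
  unfold hamBound
  linarith

lemma integrable_hamBound {Ψ : Ω → 𝒞.Path (RdStar d)} (hΨ : MemLp Ψ (ENNReal.ofReal 𝒞.q) P)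
    (X : 𝒞.State P) (u : 𝒞.Control P) :
    Integrable (hamBound Ψ X u) (𝒞.timeMeasure.prod P) := by
  have h1 := integrable_norm_rpow 𝒞.q_pos (memLp_ev_prod hΨ)
  exact h1.add (integrable_bound X u 1)

/-- The bounds for the derivatives of the Hamiltonian at all positions and laws. -/
lemma exists_hamiltonian_bounds (h𝒞 : 𝒞.Assumptions) : ∃ B : ℝ, 0 ≤ B ∧
    ∀ (Ψ : Ω → 𝒞.Path (RdStar d)) (X : 𝒞.State P) (u : 𝒞.Control P), ∀ z : ℝ × Ω, z.1 ∈ Icc 0 𝒞.T →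
    (∀ x m, ‖(𝒞.ev (Ψ z.2) z.1).comp (fderiv ℝ (fun x => 𝒞.f z.1 x m (u.val z.1 z.2)) x)
        - fderiv ℝ (fun x => 𝒞.f₀ z.1 x m (u.val z.1 z.2)) x‖ ^ 𝒞.q
      ≤ B * (hamBound Ψ X u z + ‖x‖ ^ 𝒞.p + m.Mp ^ 𝒞.p)) ∧
    (∀ m y, ‖(𝒞.ev (Ψ z.2) z.1).comp (intrinsicDeriv (fun m => 𝒞.f z.1 (X.at z.1 z.2) m
          (u.val z.1 z.2)) m y)
        - intrinsicDeriv (fun m => 𝒞.f₀ z.1 (X.at z.1 z.2) m (u.val z.1 z.2)) m y‖ ^ 𝒞.q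
      ≤ B * (hamBound Ψ X u z + ‖y‖ ^ 𝒞.p + m.Mp ^ 𝒞.p)) := by
  obtain ⟨L, hL0, hL, hL₁, -⟩ := exists_lipschitz h𝒞
  obtain ⟨M, hM, h1, h2, -, -⟩ := exists_growth_deriv h𝒞
  have hB0 : (0 : ℝ) ≤ 2 ^ (𝒞.q - 1) * (L ^ 𝒞.q + M) := by positivity
  refine ⟨2 ^ (𝒞.q - 1) * (L ^ 𝒞.q + M), hB0, fun Ψ X u z hz => ?_⟩
  have hu := u.mem z.1 hz z.2
  have h4 := Real.rpow_nonneg (norm_nonneg (X.path z.2)) 𝒞.p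
  have h5 := Real.rpow_nonneg (norm_nonneg (u.val z.1 z.2)) 𝒞.p
  have h6 := X.norm_at_rpow_le z.1 z.2
  refine ⟨fun x m => ?_, fun m y => ?_⟩
  · have h7 := Real.rpow_nonneg m.Mp_nonneg 𝒞.p
    have h8 := Real.rpow_nonneg (norm_nonneg x) 𝒞.p
    refine (norm_comp_sub_rpow_le 𝒞.one_lt_q _ _ _ hM hL0 (hL z.1 hz x m _ hu)
      (h1 z.1 hz x m _ hu) (by positivity)).trans (mul_le_mul_of_nonneg_left ?_ hB0)
    unfold hamBound
    linarith
  · have h7 := Real.rpow_nonneg m.Mp_nonneg 𝒞.p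
    have h8 := Real.rpow_nonneg (norm_nonneg y) 𝒞.p
    refine (norm_comp_sub_rpow_le 𝒞.one_lt_q _ _ _ hM hL0 (hL₁ z.1 hz _ m y _ hu)
      (h2 z.1 hz _ m y _ hu) (by positivity)).trans (mul_le_mul_of_nonneg_left ?_ hB0)
    unfold hamBound
    linarith

lemma hasFDerivAt_hamiltonian (h𝒞 : 𝒞.Assumptions) {t : ℝ} (ht : t ∈ Icc 0 𝒞.T) {w : V}
    (hw : w ∈ 𝒞.U) (ψ : RdStar d) (x : Rd d) (m : PSpace 𝒞.p d) :
    HasFDerivAt (fun x => 𝒞.hamiltonian t x m ψ w)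
      (ψ.comp (fderiv ℝ (fun x => 𝒞.f t x m w) x) - fderiv ℝ (fun x => 𝒞.f₀ t x m w) x) x :=
  (ψ.hasFDerivAt.comp x (h𝒞.f_diff_x t ht m w hw x).hasFDerivAt).sub
    (h𝒞.f₀_diff_x t ht m w hw x).hasFDerivAt

lemma continuous_hamiltonian_dx (h𝒞 : 𝒞.Assumptions) {t : ℝ} (ht : t ∈ Icc 0 𝒞.T) {w : V}
    (hw : w ∈ 𝒞.U) (ψ : RdStar d) :
    Continuous fun z : Rd d × PSpace 𝒞.p d =>
      ψ.comp (fderiv ℝ (fun x => 𝒞.f t x z.2 w) z.1) - fderiv ℝ (fun x => 𝒞.f₀ t x z.2 w) z.1 := by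
  have h1 := h𝒞.f_x_cont.comp_continuous
    (f := fun z : Rd d × PSpace 𝒞.p d => (t, z.1, z.2, w)) (by fun_prop)
    fun m => ⟨ht, mem_univ _, mem_univ _, hw⟩
  have h2 := h𝒞.f₀_x_cont.comp_continuous
    (f := fun z : Rd d × PSpace 𝒞.p d => (t, z.1, z.2, w)) (by fun_prop)
    fun m => ⟨ht, mem_univ _, mem_univ _, hw⟩
  exact (continuous_const.clm_comp h1).sub h2

lemma continuous_hamiltonian_dm (h𝒞 : 𝒞.Assumptions) {t : ℝ} (ht : t ∈ Icc 0 𝒞.T) {w : V}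
    (hw : w ∈ 𝒞.U) (ψ : RdStar d) (x : Rd d) :
    Continuous fun z : PSpace 𝒞.p d × Rd d =>
      ψ.comp (intrinsicDeriv (fun m => 𝒞.f t x m w) z.1 z.2)
        - intrinsicDeriv (fun m => 𝒞.f₀ t x m w) z.1 z.2 := by
  have h1 := h𝒞.f_m_cont.comp_continuous
    (f := fun z : PSpace 𝒞.p d × Rd d => (t, x, z.1, z.2, w)) (by fun_prop)
    fun m => ⟨ht, mem_univ _, mem_univ _, mem_univ _, hw⟩
  have h2 := h𝒞.f₀_m_cont.comp_continuous
    (f := fun z : PSpace 𝒞.p d × Rd d => (t, x, z.1, z.2, w)) (by fun_prop)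
    fun m => ⟨ht, mem_univ _, mem_univ _, mem_univ _, hw⟩
  exact (continuous_const.clm_comp h1).sub h2

lemma continuous_hamiltonian_m (h𝒞 : 𝒞.Assumptions) {t : ℝ} (ht : t ∈ Icc 0 𝒞.T) {w : V}
    (hw : w ∈ 𝒞.U) (ψ : RdStar d) (x : Rd d) : Continuous fun m => 𝒞.hamiltonian t x m ψ w := by
  have h2 := h𝒞.f₀_cont.comp_continuous (f := fun m : PSpace 𝒞.p d => (t, x, m, w)) (by fun_prop)
    fun m => ⟨ht, mem_univ _, mem_univ _, hw⟩
  exact (ψ.continuous.comp (continuous_f_m h𝒞 ht x hw)).sub h2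

/-- The first-order expansion of the Hamiltonian with a frozen costate and control. -/
lemma IsNeedleSequence.tendsto_running (h𝒞 : 𝒞.Assumptions) {Ψ : Ω → 𝒞.Path (RdStar d)}
    (hΨ : MemLp Ψ (ENNReal.ofReal 𝒞.q) P) {X : 𝒞.State P} {u v : 𝒞.Control P}
    {s C : ℝ} {η : ℕ → ℝ} {Y : ℕ → 𝒞.State P} {W : Ω → ℝ}
    (h : IsNeedleSequence X u v s C η Y W) {D : ℝ} (hD : 0 < D)
    (hrate : ∀ n t, eLpNorm (fun ω => (Y n).at t ω - X.at t ω) (ENNReal.ofReal 𝒞.p) P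
      ≤ ENNReal.ofReal (D * η n))
    (hrate' : ∀ n, eLpNorm (fun z : ℝ × Ω => (Y n).at z.1 z.2 - X.at z.1 z.2) (ENNReal.ofReal 𝒞.p)
      (𝒞.timeMeasure.prod P) ≤ ENNReal.ofReal (D * η n)) :
    Tendsto (fun n => (∫⁻ z : ℝ × Ω, ‖hamAlong Ψ (Y n) (Y n) u z.1 z.2 - hamAlong Ψ X X u z.1 z.2
      - hamDx Ψ X u z.1 z.2 ((Y n).at z.1 z.2 - X.at z.1 z.2)
      - ∫ ω', hamDm Ψ X u z.1 z.2 ω' ((Y n).at z.1 ω' - X.at z.1 ω') ∂P‖ₑ ∂(𝒞.timeMeasure.prod P))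
      / ENNReal.ofReal (D * η n)) atTop (𝓝 0) := by
  obtain ⟨B, hB, hbd⟩ := exists_hamiltonian_bounds (P := P) h𝒞
  have hf : ∀ z : ℝ × Ω, z.1 ∈ Icc 0 𝒞.T →
      HasIntrinsicDeriv fun m => 𝒞.f z.1 (X.at z.1 z.2) m (u.val z.1 z.2) :=
    fun z hz => h𝒞.f_diff_m z.1 hz _ _ (u.mem z.1 hz z.2)
  have hf₀ : ∀ z : ℝ × Ω, z.1 ∈ Icc 0 𝒞.T →
      HasIntrinsicDeriv fun m => 𝒞.f₀ z.1 (X.at z.1 z.2) m (u.val z.1 z.2) :=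
    fun z hz => h𝒞.f₀_diff_m z.1 hz _ _ (u.mem z.1 hz z.2)
  have hXm : AEStronglyMeasurable (fun z : ℝ × Ω => X.at z.1 z.2) (𝒞.timeMeasure.prod P) :=
    aestronglyMeasurable_ev_prod X.memLp.1 _
  have hYm : ∀ n, AEStronglyMeasurable (fun z : ℝ × Ω => (Y n).at z.1 z.2)
      (𝒞.timeMeasure.prod P) := fun n => aestronglyMeasurable_ev_prod (Y n).memLp.1 _
  have hae := 𝒞.ae_mem_time P
  have hsnd : ∀ {Q : Ω → Prop}, (∀ᵐ ω ∂P, Q ω) → ∀ᵐ z : ℝ × Ω ∂(𝒞.timeMeasure.prod P), Q z.2 :=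
    fun hQ => Measure.quasiMeasurePreserving_snd.ae hQ
  -- the costate and the control are frozen, that is, parts of the parameter `z = (t, ω)`
  refine tendsto_lintegral_remainder_div (P := P) (μ := 𝒞.timeMeasure.prod P)
    (h := fun n => ENNReal.ofReal (D * η n)) 𝒞.hpq
    (K := fun z x m => 𝒞.hamiltonian z.1 x m (𝒞.ev (Ψ z.2) z.1) (u.val z.1 z.2))
    (Kx := fun z x m => (𝒞.ev (Ψ z.2) z.1).comp (fderiv ℝ (fun x => 𝒞.f z.1 x m (u.val z.1 z.2)) x)
        - fderiv ℝ (fun x => 𝒞.f₀ z.1 x m (u.val z.1 z.2)) x)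
    (Km := fun z m y => (𝒞.ev (Ψ z.2) z.1).comp (intrinsicDeriv (fun m => 𝒞.f z.1 (X.at z.1 z.2) m
          (u.val z.1 z.2)) m y)
        - intrinsicDeriv (fun m => 𝒞.f₀ z.1 (X.at z.1 z.2) m (u.val z.1 z.2)) m y)
    (δ := fun z m y => 𝒞.ev (Ψ z.2) z.1 (flatDeriv (fun m => 𝒞.f z.1 (X.at z.1 z.2) m
          (u.val z.1 z.2)) m y)
        - flatDeriv (fun m => 𝒞.f₀ z.1 (X.at z.1 z.2) m (u.val z.1 z.2)) m y)
    (x := fun z => X.at z.1 z.2) (x' := fun n z => (Y n).at z.1 z.2) (Y := fun z => X.at z.1)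
    (Y' := fun n z => (Y n).at z.1) (a := hamBound Ψ X u)
    (ζ := fun z => ‖X.path z.2‖ + W z.2) (Z := fun ω => ‖X.path ω‖ + W ω) (C := B)
    (fun z => X.memLp_at z.1) (fun n z => (Y n).memLp_at z.1)
    ?_ ?_ ?_ ?_ ?_ ?_
    hB (integrable_hamBound hΨ X u) (hamBound_nonneg Ψ X u) ?_ ?_
    h.memLp_dominating
    (fun z => by filter_upwards [h.ae_norm_at_le] with ω hω using (hω _).1)
    (fun z => by filter_upwards [h.ae_norm_at_le] with ω hω using (hω _).2)
    (fun z => by filter_upwards [h.ae_tendsto_at] with ω hω using hω _)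
    (fun n z => hrate n _) (h.tendsto_rate D)
    (fun n => by have := mul_pos hD (h.pos n); simpa using this) (fun n => ENNReal.ofReal_ne_top)
    hXm hYm ?_
    (by filter_upwards [hsnd h.ae_norm_at_le] with z hz using (hz _).1)
    (by filter_upwards [hsnd h.ae_norm_at_le] with z hz using (hz _).2)
    (by filter_upwards [hsnd h.ae_tendsto_at] with z hz using hz _)
    hrate' (fun n => ?_) (fun n => ?_)
  · filter_upwards [hae] with z hz x m
    exact hasFDerivAt_hamiltonian h𝒞 hz (u.mem z.1 hz z.2) _ x m
  · filter_upwards [hae] with z hz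
    exact continuous_hamiltonian_dx h𝒞 hz (u.mem z.1 hz z.2) _
  · filter_upwards [hae] with z hz
    exact continuous_hamiltonian_m h𝒞 hz (u.mem z.1 hz z.2) _ _
  · filter_upwards [hae] with z hz
    exact (hf z hz).isFlatDeriv.clm_comp_sub (hf₀ z hz).isFlatDeriv (𝒞.ev (Ψ z.2) z.1)
  · filter_upwards [hae] with z hz m y
    exact ((𝒞.ev (Ψ z.2) z.1).hasFDerivAt.comp y ((hf z hz).2 m y).hasFDerivAt).sub
      ((hf₀ z hz).2 m y).hasFDerivAt
  · filter_upwards [hae] with z hz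
    exact continuous_hamiltonian_dm h𝒞 hz (u.mem z.1 hz z.2) _ _
  · filter_upwards [hae] with z hz using (hbd Ψ X u z hz).1
  · filter_upwards [hae] with z hz using (hbd Ψ X u z hz).2
  · have := integrable_norm_rpow 𝒞.p_pos (h.memLp_dominating.comp_snd 𝒞.timeMeasure)
    refine this.congr ?_
    filter_upwards [hsnd h.ae_norm_path_le] with z hz
    rw [Real.norm_of_nonneg ((norm_nonneg _).trans hz.1)]
  · exact ((aestronglyMeasurable_hamAlong h𝒞 hΨ.1 (Y n) (Y n) u).sub
      (aestronglyMeasurable_hamAlong h𝒞 hΨ.1 X (Y n) u)).sub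
      (aestronglyMeasurable_clm_apply (aestronglyMeasurable_hamDx h𝒞 hΨ.1 X u) ((hYm n).sub hXm))
  · have hΔ : AEStronglyMeasurable (fun z : (ℝ × Ω) × Ω => (Y n).at z.1.1 z.2 - X.at z.1.1 z.2)
        ((𝒞.timeMeasure.prod P).prod P) := by
      have h1 : AEStronglyMeasurable
        (fun z : (ℝ × Ω) × Ω => (Y n).at z.1.1 z.1.2 - X.at z.1.1 z.1.2)
        ((𝒞.timeMeasure.prod P).prod P) := ((hYm n).sub hXm).comp_fst
      exact h1.comp_measurePreserving measurePreserving_swap_right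
    have hi := (aestronglyMeasurable_clm_apply (aestronglyMeasurable_hamDm h𝒞 hΨ.1 X u)
      hΔ).integral_prod_right'
    exact ((aestronglyMeasurable_hamAlong h𝒞 hΨ.1 X (Y n) u).sub
      (aestronglyMeasurable_hamAlong h𝒞 hΨ.1 X X u)).sub hi

end RunningExpansion

/-! ### The increment of the cost -/

section Increment

variable {d : ℕ} {V : Type*} {𝒞 : Problem d V} [NormedAddCommGroup V]
  {Ω : Type*} [MeasurableSpace Ω] {P : Measure Ω} [IsProbabilityMeasure P]

lemma memLp_at_prod (X : 𝒞.State P) :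
    MemLp (fun z : ℝ × Ω => X.at z.1 z.2) (ENNReal.ofReal 𝒞.p) (𝒞.timeMeasure.prod P) :=
  memLp_ev_prod X.memLp

lemma memLp_at_sub_prod (X Y : 𝒞.State P) :
    MemLp (fun z : ℝ × Ω => Y.at z.1 z.2 - X.at z.1 z.2) (ENNReal.ofReal 𝒞.p)
      (𝒞.timeMeasure.prod P) :=
  (memLp_at_prod Y).sub (memLp_at_prod X)

lemma memLp_at_sub_triple (X Y : 𝒞.State P) :
    MemLp (fun z : (ℝ × Ω) × Ω => Y.at z.1.1 z.2 - X.at z.1.1 z.2) (ENNReal.ofReal 𝒞.p)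
      ((𝒞.timeMeasure.prod P).prod P) :=
  ((memLp_at_sub_prod X Y).comp_fst P).comp_measurePreserving measurePreserving_swap_right

lemma memLp_hamDx (h𝒞 : 𝒞.Assumptions) {Ψ : Ω → 𝒞.Path (RdStar d)}
    (hΨ : MemLp Ψ (ENNReal.ofReal 𝒞.q) P) (X : 𝒞.State P) (u : 𝒞.Control P) :
    MemLp (fun z : ℝ × Ω => hamDx Ψ X u z.1 z.2) (ENNReal.ofReal 𝒞.q) (𝒞.timeMeasure.prod P) := by
  obtain ⟨B, hB, hbd⟩ := exists_hamiltonian_bounds (P := P) h𝒞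
  have h1 : Integrable (fun z : ℝ × Ω => ‖X.path z.2‖ ^ 𝒞.p) (𝒞.timeMeasure.prod P) :=
    X.integrable_path.comp_snd 𝒞.timeMeasure
  refine memLp_of_norm_rpow_le 𝒞.q_pos (aestronglyMeasurable_hamDx h𝒞 hΨ.1 X u)
    ((((integrable_hamBound hΨ X u).add h1).add (integrable_const (X.lpNorm ^ 𝒞.p))).const_mul B) ?_
  filter_upwards [𝒞.ae_mem_time P] with z hz
  refine ((hbd Ψ X u z hz).1 _ _).trans (mul_le_mul_of_nonneg_left ?_ hB)
  exact add_le_add (add_le_add le_rfl (X.norm_at_rpow_le _ _)) (X.Mp_law_rpow_le _)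

lemma memLp_hamDm (h𝒞 : 𝒞.Assumptions) {Ψ : Ω → 𝒞.Path (RdStar d)}
    (hΨ : MemLp Ψ (ENNReal.ofReal 𝒞.q) P) (X : 𝒞.State P) (u : 𝒞.Control P) :
    MemLp (fun z : (ℝ × Ω) × Ω => hamDm Ψ X u z.1.1 z.1.2 z.2) (ENNReal.ofReal 𝒞.q)
      ((𝒞.timeMeasure.prod P).prod P) := by
  obtain ⟨B, hB, hbd⟩ := exists_hamiltonian_bounds (P := P) h𝒞
  have h1 : Integrable (fun z : (ℝ × Ω) × Ω => ‖X.path z.2‖ ^ 𝒞.p)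
    ((𝒞.timeMeasure.prod P).prod P) := X.integrable_path.comp_snd _
  have h2 : Integrable (fun z : (ℝ × Ω) × Ω => hamBound Ψ X u z.1)
    ((𝒞.timeMeasure.prod P).prod P) := (integrable_hamBound hΨ X u).comp_fst P
  refine memLp_of_norm_rpow_le 𝒞.q_pos (aestronglyMeasurable_hamDm h𝒞 hΨ.1 X u)
    (((h2.add h1).add (integrable_const (X.lpNorm ^ 𝒞.p))).const_mul B) ?_
  have : ∀ᵐ z : (ℝ × Ω) × Ω ∂((𝒞.timeMeasure.prod P).prod P), z.1.1 ∈ Icc 0 𝒞.T :=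
    Measure.quasiMeasurePreserving_fst.ae (𝒞.ae_mem_time P)
  filter_upwards [this] with z hz
  refine ((hbd Ψ X u z.1 hz).2 _ _).trans (mul_le_mul_of_nonneg_left ?_ hB)
  exact add_le_add (add_le_add le_rfl (X.norm_at_rpow_le _ _)) (X.Mp_law_rpow_le _)

lemma integrable_hamDm_apply (h𝒞 : 𝒞.Assumptions) {Ψ : Ω → 𝒞.Path (RdStar d)}
    (hΨ : MemLp Ψ (ENNReal.ofReal 𝒞.q) P) (X Y : 𝒞.State P) (u : 𝒞.Control P) :
    Integrable (fun z : (ℝ × Ω) × Ω => hamDm Ψ X u z.1.1 z.1.2 z.2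
      (Y.at z.1.1 z.2 - X.at z.1.1 z.2)) ((𝒞.timeMeasure.prod P).prod P) :=
  integrable_clm_apply 𝒞.hpq (memLp_hamDm h𝒞 hΨ X u) (memLp_at_sub_triple X Y)

lemma memLp_costateRhs (h𝒞 : 𝒞.Assumptions) {Ψ : Ω → 𝒞.Path (RdStar d)}
    (hΨ : MemLp Ψ (ENNReal.ofReal 𝒞.q) P) (X : 𝒞.State P) (u : 𝒞.Control P) :
    MemLp (fun z : ℝ × Ω => costateRhs X u Ψ z.1 z.2) (ENNReal.ofReal 𝒞.q)
      (𝒞.timeMeasure.prod P) := by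
  obtain ⟨L, hL0, hL, hL₁, -⟩ := exists_lipschitz h𝒞
  exact (isVolterraDriver_costate h𝒞 hL0 hL hL₁ X u).memLp hL0 hΨ

lemma ae_integrable_hamDm (h𝒞 : 𝒞.Assumptions) {Ψ : Ω → 𝒞.Path (RdStar d)}
    (hΨ : MemLp Ψ (ENNReal.ofReal 𝒞.q) P) (X : 𝒞.State P) (u : 𝒞.Control P) :
    ∀ᵐ z : ℝ × Ω ∂(𝒞.timeMeasure.prod P),
      Integrable (fun ω' => hamDm Ψ X u z.1 ω' z.2) P := by
  have h1 := (memLp_hamDm h𝒞 hΨ X u).integrable (one_le_ofReal 𝒞.one_lt_q)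
  have h2 := measurePreserving_swap_right.integrable_comp_of_integrable h1
  exact h2.prod_right_ae

/-- The right-hand side of the costate equation is minus the derivative of the Hamiltonian, with the
intrinsic derivative in its adjoint form. -/
lemma ae_costateRhs_eq (h𝒞 : 𝒞.Assumptions) {Ψ : Ω → 𝒞.Path (RdStar d)}
    (hΨ : MemLp Ψ (ENNReal.ofReal 𝒞.q) P) (X : 𝒞.State P) (u : 𝒞.Control P) :
    ∀ᵐ z : ℝ × Ω ∂(𝒞.timeMeasure.prod P), costateRhs X u Ψ z.1 z.2
      = -hamDx Ψ X u z.1 z.2 - ∫ ω', hamDm Ψ X u z.1 ω' z.2 ∂P := by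
  obtain ⟨L, hL0, hL, hL₁, -⟩ := exists_lipschitz h𝒞
  filter_upwards [ae_integrable_hamDm h𝒞 hΨ X u, 𝒞.ae_mem_time P] with z h1 hz
  have h2 := integrable_ev_comp_dmf h𝒞 hL₁ X u hΨ hz z.2
  have h3 : ∫ ω', dmf₀ X u z.1 ω' z.2 ∂P = ∫ ω', (𝒞.ev (Ψ ω') z.1).comp (dmf X u z.1 ω' z.2) ∂P
      - ∫ ω', hamDm Ψ X u z.1 ω' z.2 ∂P := by
    rw [← integral_sub h2 h1]
    congr 1
    funext ω'
    rw [hamDm, sub_sub_cancel]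
  rw [costateRhs, h3, hamDx]
  abel

/-- Fubini's theorem turns the derivative of the mean Hamiltonian in the direction `Y - X` into a
pairing with the right-hand side of the costate equation. -/
lemma integral_hamDx_add_hamDm (h𝒞 : 𝒞.Assumptions) {Ψ : Ω → 𝒞.Path (RdStar d)}
    (hΨ : MemLp Ψ (ENNReal.ofReal 𝒞.q) P) (X Y : 𝒞.State P) (u : 𝒞.Control P) {β : Measure ℝ}
    [SFinite β] (hβ : β ≤ 𝒞.timeMeasure) :
    Integrable (fun z : ℝ × Ω => hamDx Ψ X u z.1 z.2 (Y.at z.1 z.2 - X.at z.1 z.2)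
      + ∫ ω', hamDm Ψ X u z.1 z.2 ω' (Y.at z.1 ω' - X.at z.1 ω') ∂P) (β.prod P) ∧
    ∫ z : ℝ × Ω, (hamDx Ψ X u z.1 z.2 (Y.at z.1 z.2 - X.at z.1 z.2)
      + ∫ ω', hamDm Ψ X u z.1 z.2 ω' (Y.at z.1 ω' - X.at z.1 ω') ∂P) ∂(β.prod P)
    = -∫ z : ℝ × Ω, costateRhs X u Ψ z.1 z.2 (Y.at z.1 z.2 - X.at z.1 z.2) ∂(β.prod P) := by
  have hle : β.prod P ≤ 𝒞.timeMeasure.prod P := Measure.prod_mono hβ le_rfl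
  have hle3 : (β.prod P).prod P ≤ (𝒞.timeMeasure.prod P).prod P := Measure.prod_mono hle le_rfl
  have i1 : Integrable (fun z : ℝ × Ω => hamDx Ψ X u z.1 z.2 (Y.at z.1 z.2 - X.at z.1 z.2))
      (β.prod P) :=
    (integrable_clm_apply 𝒞.hpq (memLp_hamDx h𝒞 hΨ X u) (memLp_at_sub_prod X Y)).mono_measure hle
  have i3 := (integrable_hamDm_apply h𝒞 hΨ X Y u).mono_measure hle3
  have i2 := i3.integral_prod_left
  -- exchanging `ω` and `ω'` moves the increment out of the inner integral
  have i4 := measurePreserving_swap_right.integrable_comp_of_integrable i3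
  have e1 : ∫ z : ℝ × Ω, (∫ ω', hamDm Ψ X u z.1 z.2 ω' (Y.at z.1 ω' - X.at z.1 ω') ∂P) ∂(β.prod P)
      = ∫ z : ℝ × Ω, (∫ ω', hamDm Ψ X u z.1 ω' z.2 ∂P) (Y.at z.1 z.2 - X.at z.1 z.2)
        ∂(β.prod P) := by
    have e3 : ∀ᵐ z : ℝ × Ω ∂(β.prod P),
        (∫ ω', hamDm Ψ X u z.1 ω' z.2 ∂P) (Y.at z.1 z.2 - X.at z.1 z.2)
        = ∫ ω', hamDm Ψ X u z.1 ω' z.2 (Y.at z.1 z.2 - X.at z.1 z.2) ∂P := by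
      filter_upwards [(ae_integrable_hamDm h𝒞 hΨ X u).filter_mono (ae_mono hle)] with z hz
      exact ContinuousLinearMap.integral_apply hz _
    rw [integral_congr_ae e3]
    have e4 := integral_prod _ i3
    have e5 := integral_prod _ i4
    rw [← e4]
    refine Eq.trans ?_ e5
    have hmp := measurePreserving_swap_right (P := P) (α := β)
    conv_lhs => rw [← hmp.map_eq]
    rw [integral_map hmp.measurable.aemeasurable]
    · rfl
    · rw [hmp.map_eq]; exact i3.1
  have i6 : Integrable (fun z : ℝ × Ω => costateRhs X u Ψ z.1 z.2 (Y.at z.1 z.2 - X.at z.1 z.2))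
      (β.prod P) :=
    (integrable_clm_apply 𝒞.hpq (memLp_costateRhs h𝒞 hΨ X u)
      (memLp_at_sub_prod X Y)).mono_measure hle
  have e7 : ∀ᵐ z : ℝ × Ω ∂(β.prod P),
      (∫ ω', hamDm Ψ X u z.1 ω' z.2 ∂P) (Y.at z.1 z.2 - X.at z.1 z.2)
      = -costateRhs X u Ψ z.1 z.2 (Y.at z.1 z.2 - X.at z.1 z.2)
        - hamDx Ψ X u z.1 z.2 (Y.at z.1 z.2 - X.at z.1 z.2) := by
    filter_upwards [(ae_costateRhs_eq h𝒞 hΨ X u).filter_mono (ae_mono hle)] with z hz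
    rw [hz, _root_.sub_apply, _root_.neg_apply]
    ring
  have i7 : Integrable (fun z : ℝ × Ω => -costateRhs X u Ψ z.1 z.2 (Y.at z.1 z.2 - X.at z.1 z.2))
      (β.prod P) := i6.neg
  refine ⟨i1.add i2, ?_⟩
  rw [integral_add i1 i2, e1, integral_congr_ae e7, integral_sub i7 i1, integral_neg]
  ring

/-- Integration by parts for the costate and the difference of two states. -/
lemma integral_costate_terminal (h𝒞 : 𝒞.Assumptions) {Ψ : Ω → 𝒞.Path (RdStar d)}
    (hΨ : MemLp Ψ (ENNReal.ofReal 𝒞.q) P) {X Y : 𝒞.State P} {u w : 𝒞.Control P}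
    (hcost : 𝒞.CostateEquation X u Ψ) (hX : 𝒞.IsLagrangian X u) (hY : 𝒞.IsLagrangian Y w)
    (h0 : Y.at 0 =ᵐ[P] X.at 0) :
    ∫ ω, 𝒞.ev (Ψ ω) 𝒞.T (Y.at 𝒞.T ω - X.at 𝒞.T ω) ∂P
      = (∫ z : ℝ × Ω, costateRhs X u Ψ z.1 z.2 (Y.at z.1 z.2 - X.at z.1 z.2)
          ∂(𝒞.timeMeasure.prod P))
        + ∫ z : ℝ × Ω, 𝒞.ev (Ψ z.2) z.1 (velocity Y w z.1 z.2 - velocity X u z.1 z.2)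
          ∂(𝒞.timeMeasure.prod P) := by
  have i1 := integrable_clm_apply 𝒞.hpq (memLp_costateRhs h𝒞 hΨ X u) (memLp_at_sub_prod X Y)
  have i2 := integrable_clm_apply 𝒞.hpq (memLp_ev_prod hΨ)
    ((memLp_velocity h𝒞 Y w).sub (memLp_velocity h𝒞 X u))
  have i3 := i1.add i2
  have e1 := integral_add i1 i2
  have e2 := integral_prod_symm _ i3
  rw [Pi.add_def] at e2
  simp only [Pi.sub_apply] at e1 e2
  rw [← e1, e2]
  refine integral_congr_ae ?_
  filter_upwards [costateEquation_iff.1 hcost, hX, hY, h0, ae_intervalIntegrable_velocity h𝒞 X u,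
    ae_intervalIntegrable_velocity h𝒞 Y w] with ω h1 h2 h3 h4 h5 h6
  have hmono : ∀ {g : ℝ → Rd d}, IntervalIntegrable g volume 0 𝒞.T → ∀ {t : ℝ},
      t ∈ Icc 0 𝒞.T → IntervalIntegrable g volume 0 t :=
    fun hg _ ht => intervalIntegrable_mono_mem hg 𝒞.T_pos.le 𝒞.zero_mem ht
  have key := integral_apply_add_integral_apply 𝒞.T_pos.le
    (α := fun t => costateRhs X u Ψ t ω) (β := fun t => velocity Y w t ω - velocity X u t ω)
    (A := fun t => 𝒞.ev (Ψ ω) t) (B := fun t => Y.at t ω - X.at t ω) h1.1 (h6.sub h5) h1.2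
    (fun t ht => by
      have e3 : X.at t ω = X.at 0 ω + ∫ τ in (0 : ℝ)..t, velocity X u τ ω := h2.2 t ht
      have e4 : Y.at t ω = Y.at 0 ω + ∫ τ in (0 : ℝ)..t, velocity Y w τ ω := h3.2 t ht
      rw [intervalIntegral.integral_sub (hmono h6 ht) (hmono h5 ht), e3, e4, h4]
      abel)
  rw [← key, intervalIntegral.integral_of_le 𝒞.T_pos.le, ← integral_Icc_eq_integral_Ioc]

lemma integrable_σ (h𝒞 : 𝒞.Assumptions) (X : 𝒞.State P) :
    Integrable (fun ω => 𝒞.σ (X.at 𝒞.T ω) (X.law 𝒞.T)) P := by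
  obtain ⟨C, hC0, -, -, hC⟩ := exists_growth h𝒞
  refine (((integrable_const (1 + X.lpNorm ^ 𝒞.p)).add X.integrable_path).const_mul C).mono'
    (h𝒞.σ_cont.comp_aestronglyMeasurable ((X.memLp_at 𝒞.T).1.prodMk aestronglyMeasurable_const))
    (Eventually.of_forall fun ω => (hC _ _).trans (mul_le_mul_of_nonneg_left ?_ hC0))
  simp only [Pi.add_apply]
  linarith [X.norm_at_rpow_le 𝒞.T ω, X.Mp_law_rpow_le 𝒞.T]

lemma integrable_f₀ (h𝒞 : 𝒞.Assumptions) (X : 𝒞.State P) (u : 𝒞.Control P) :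
    Integrable (fun z : ℝ × Ω => 𝒞.f₀ z.1 (X.at z.1 z.2) (X.law z.1) (u.val z.1 z.2))
      (𝒞.timeMeasure.prod P) := by
  obtain ⟨C, hC0, -, hC, -⟩ := exists_growth h𝒞
  refine ((integrable_bound X u (1 + X.lpNorm ^ 𝒞.p)).const_mul C).mono'
    (aestronglyMeasurable_comp h𝒞 (φ := 𝒞.f₀) h𝒞.f₀_cont X X u) ?_
  filter_upwards [𝒞.ae_mem_time P] with z hz
  refine (hC z.1 hz _ _ _ (u.mem z.1 hz z.2)).trans (mul_le_mul_of_nonneg_left ?_ hC0)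
  linarith [X.norm_at_rpow_le z.1 z.2, X.Mp_law_rpow_le z.1]

lemma payoff_eq (h𝒞 : 𝒞.Assumptions) (X : 𝒞.State P) (u : 𝒞.Control P) :
    𝒞.payoff X u = ∫ ω, 𝒞.σ (X.at 𝒞.T ω) (X.law 𝒞.T) ∂P
      + ∫ z : ℝ × Ω, 𝒞.f₀ z.1 (X.at z.1 z.2) (X.law z.1) (u.val z.1 z.2)
        ∂(𝒞.timeMeasure.prod P) := by
  have h1 := integrable_f₀ h𝒞 X u
  have e : ∀ ω, ∫ t in (0 : ℝ)..𝒞.T, 𝒞.f₀ t (X.at t ω) (X.law t) (u.val t ω)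
      = ∫ t, 𝒞.f₀ t (X.at t ω) (X.law t) (u.val t ω) ∂𝒞.timeMeasure := fun ω => by
    rw [intervalIntegral.integral_of_le 𝒞.T_pos.le, ← integral_Icc_eq_integral_Ioc]
  rw [payoff, integral_prod_symm _ h1]
  simp only [e]
  exact integral_add (integrable_σ h𝒞 X) h1.integral_prod_right

lemma integrable_hamAlong (h𝒞 : 𝒞.Assumptions) {Ψ : Ω → 𝒞.Path (RdStar d)}
    (hΨ : MemLp Ψ (ENNReal.ofReal 𝒞.q) P) (X : 𝒞.State P) (u : 𝒞.Control P) :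
    Integrable (fun z : ℝ × Ω => hamAlong Ψ X X u z.1 z.2) (𝒞.timeMeasure.prod P) :=
  (integrable_clm_apply 𝒞.hpq (memLp_ev_prod hΨ) (memLp_velocity h𝒞 X u)).sub
    (integrable_f₀ h𝒞 X u)

end Increment

section PayoffIncrement

variable {d : ℕ} {V : Type*} {𝒞 : Problem d V} [NormedAddCommGroup V]
  {Ω : Type*} [MeasurableSpace Ω] {P : Measure Ω} [IsProbabilityMeasure P]

/-- `∇ₓσ` at the terminal time along a state. -/
noncomputable def dxσ (X : 𝒞.State P) (ω : Ω) : RdStar d :=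
  fderiv ℝ (fun x => 𝒞.σ x (X.law 𝒞.T)) (X.at 𝒞.T ω)

/-- `∇ₘσ` at the terminal time along a state, with the conventions of `dmf`. -/
noncomputable def dmσ (X : 𝒞.State P) (ω ω' : Ω) : RdStar d :=
  intrinsicDeriv (fun m => 𝒞.σ (X.at 𝒞.T ω) m) (X.law 𝒞.T) (X.at 𝒞.T ω')

lemma memLp_dxσ (h𝒞 : 𝒞.Assumptions) (X : 𝒞.State P) :
    MemLp (dxσ X) (ENNReal.ofReal 𝒞.q) P := by
  obtain ⟨C, hC, -, -, h3, -⟩ := exists_growth_deriv h𝒞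
  refine memLp_of_norm_rpow_le 𝒞.q_pos (h𝒞.σ_x_cont.comp_aestronglyMeasurable
    ((X.memLp_at 𝒞.T).1.prodMk aestronglyMeasurable_const))
    (((integrable_const (1 + X.lpNorm ^ 𝒞.p)).add X.integrable_path).const_mul C)
    (Eventually.of_forall fun ω => (h3 _ _).trans (mul_le_mul_of_nonneg_left ?_ hC))
  simp only [Pi.add_apply]
  linarith [X.norm_at_rpow_le 𝒞.T ω, X.Mp_law_rpow_le 𝒞.T]

lemma memLp_dmσ (h𝒞 : 𝒞.Assumptions) (X : 𝒞.State P) :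
    MemLp (fun z : Ω × Ω => dmσ X z.1 z.2) (ENNReal.ofReal 𝒞.q) (P.prod P) := by
  obtain ⟨C, hC, -, -, -, h4⟩ := exists_growth_deriv h𝒞
  have hXT := (X.memLp_at 𝒞.T).1
  have i1 : Integrable (fun z : Ω × Ω => ‖X.path z.1‖ ^ 𝒞.p) (P.prod P) :=
    X.integrable_path.comp_fst P
  have i2 : Integrable (fun z : Ω × Ω => ‖X.path z.2‖ ^ 𝒞.p) (P.prod P) :=
    X.integrable_path.comp_snd P
  refine memLp_of_norm_rpow_le 𝒞.q_pos (h𝒞.σ_m_cont.comp_aestronglyMeasurable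
      (hXT.comp_fst.prodMk (aestronglyMeasurable_const.prodMk hXT.comp_snd)))
    (((integrable_const (1 + X.lpNorm ^ 𝒞.p)).add (i1.add i2)).const_mul C)
    (Eventually.of_forall fun z => (h4 _ _ _).trans (mul_le_mul_of_nonneg_left ?_ hC))
  simp only [Pi.add_apply]
  linarith [X.norm_at_rpow_le 𝒞.T z.1, X.norm_at_rpow_le 𝒞.T z.2, X.Mp_law_rpow_le 𝒞.T]

/-- Fubini's theorem turns the derivative of the mean terminal cost into a pairing with the terminal
value of the costate. -/
lemma integral_dxσ_add_dmσ (h𝒞 : 𝒞.Assumptions) {Ψ : Ω → 𝒞.Path (RdStar d)} {X : 𝒞.State P}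
    (hΨT : 𝒞.Transversality X Ψ) {Δ : Ω → Rd d} (hΔ : MemLp Δ (ENNReal.ofReal 𝒞.p) P) :
    Integrable (fun ω => dxσ X ω (Δ ω) + ∫ ω', dmσ X ω ω' (Δ ω') ∂P) P ∧
    ∫ ω, (dxσ X ω (Δ ω) + ∫ ω', dmσ X ω ω' (Δ ω') ∂P) ∂P
      = -∫ ω, 𝒞.ev (Ψ ω) 𝒞.T (Δ ω) ∂P := by
  have i1 := integrable_clm_apply 𝒞.hpq (memLp_dxσ h𝒞 X) hΔ
  have hm := memLp_dmσ h𝒞 X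
  have i2 : Integrable (fun z : Ω × Ω => dmσ X z.1 z.2 (Δ z.2)) (P.prod P) :=
    integrable_clm_apply 𝒞.hpq hm (hΔ.comp_snd P)
  have i3 := i2.integral_prod_left
  have i4 := (hm.integrable (one_le_ofReal 𝒞.one_lt_q)).prod_left_ae
  have e1 : ∫ ω, ∫ ω', dmσ X ω ω' (Δ ω') ∂P ∂P
      = ∫ ω, (∫ ω', dmσ X ω' ω ∂P) (Δ ω) ∂P := by
    rw [integral_integral_swap (f := fun ω ω' => dmσ X ω ω' (Δ ω')) i2]
    refine integral_congr_ae ?_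
    filter_upwards [i4] with ω hω
    exact (ContinuousLinearMap.integral_apply hω _).symm
  have i5 : Integrable (fun ω => (∫ ω', dmσ X ω' ω ∂P) (Δ ω)) P := by
    refine i2.integral_prod_right.congr ?_
    filter_upwards [i4] with ω hω
    exact (ContinuousLinearMap.integral_apply hω _).symm
  refine ⟨i1.add i3, ?_⟩
  rw [integral_add i1 i3, e1, ← integral_add i1 i5, ← integral_neg]
  refine integral_congr_ae ?_
  filter_upwards [hΨT] with ω hω
  have h1 : 𝒞.ev (Ψ ω) 𝒞.T = -dxσ X ω - ∫ ω', dmσ X ω' ω ∂P := hω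
  rw [h1, _root_.sub_apply, _root_.neg_apply]
  ring

/-- The remainder of the first-order expansion of the terminal cost. -/
noncomputable def terminalRemainder (X Y : 𝒞.State P) (ω : Ω) : ℝ :=
  𝒞.σ (Y.at 𝒞.T ω) (Y.law 𝒞.T) - 𝒞.σ (X.at 𝒞.T ω) (X.law 𝒞.T)
    - dxσ X ω (Y.at 𝒞.T ω - X.at 𝒞.T ω) - ∫ ω', dmσ X ω ω' (Y.at 𝒞.T ω' - X.at 𝒞.T ω') ∂P

/-- The remainder of the first-order expansion of the Hamiltonian with frozen costate and
control. -/
noncomputable def hamRemainder (Ψ : Ω → 𝒞.Path (RdStar d)) (X Y : 𝒞.State P) (u : 𝒞.Control P)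
    (t : ℝ) (ω : Ω) : ℝ :=
  hamAlong Ψ Y Y u t ω - hamAlong Ψ X X u t ω - hamDx Ψ X u t ω (Y.at t ω - X.at t ω)
    - ∫ ω', hamDm Ψ X u t ω ω' (Y.at t ω' - X.at t ω') ∂P

/-- By transversality, the derivative of the mean terminal cost is the pairing with minus the
terminal costate. -/
lemma integral_terminalRemainder (h𝒞 : 𝒞.Assumptions) {Ψ : Ω → 𝒞.Path (RdStar d)}
    {X : 𝒞.State P} (hΨT : 𝒞.Transversality X Ψ) (Y : 𝒞.State P) :
    ∫ ω, terminalRemainder X Y ω ∂P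
      = ∫ ω, 𝒞.σ (Y.at 𝒞.T ω) (Y.law 𝒞.T) ∂P - ∫ ω, 𝒞.σ (X.at 𝒞.T ω) (X.law 𝒞.T) ∂P
        + ∫ ω, 𝒞.ev (Ψ ω) 𝒞.T (Y.at 𝒞.T ω - X.at 𝒞.T ω) ∂P := by
  obtain ⟨i, e⟩ := integral_dxσ_add_dmσ h𝒞 hΨT ((Y.memLp_at 𝒞.T).sub (X.memLp_at 𝒞.T))
  simp only [Pi.sub_apply] at i e
  have h1 : ∀ ω, terminalRemainder X Y ω
      = (𝒞.σ (Y.at 𝒞.T ω) (Y.law 𝒞.T) - 𝒞.σ (X.at 𝒞.T ω) (X.law 𝒞.T))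
        - (dxσ X ω (Y.at 𝒞.T ω - X.at 𝒞.T ω)
          + ∫ ω', dmσ X ω ω' (Y.at 𝒞.T ω' - X.at 𝒞.T ω') ∂P) := fun ω => sub_sub _ _ _
  have i2 : Integrable (fun ω => 𝒞.σ (Y.at 𝒞.T ω) (Y.law 𝒞.T) - 𝒞.σ (X.at 𝒞.T ω) (X.law 𝒞.T)) P :=
    (integrable_σ h𝒞 Y).sub (integrable_σ h𝒞 X)
  simp_rw [h1]
  rw [integral_sub i2 i, integral_sub (integrable_σ h𝒞 Y) (integrable_σ h𝒞 X), e, sub_neg_eq_add]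

lemma integral_hamRemainder (h𝒞 : 𝒞.Assumptions) {Ψ : Ω → 𝒞.Path (RdStar d)}
    (hΨ : MemLp Ψ (ENNReal.ofReal 𝒞.q) P) (X Y : 𝒞.State P) (u : 𝒞.Control P) {β : Measure ℝ}
    [SFinite β] (hβ : β ≤ 𝒞.timeMeasure) :
    ∫ z : ℝ × Ω, hamRemainder Ψ X Y u z.1 z.2 ∂(β.prod P)
      = ∫ z : ℝ × Ω, hamAlong Ψ Y Y u z.1 z.2 ∂(β.prod P)
        - ∫ z : ℝ × Ω, hamAlong Ψ X X u z.1 z.2 ∂(β.prod P)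
        + ∫ z : ℝ × Ω, costateRhs X u Ψ z.1 z.2 (Y.at z.1 z.2 - X.at z.1 z.2) ∂(β.prod P) := by
  have hle : β.prod P ≤ 𝒞.timeMeasure.prod P := Measure.prod_mono hβ le_rfl
  obtain ⟨i, e⟩ := integral_hamDx_add_hamDm h𝒞 hΨ X Y u hβ
  have h1 : ∀ z : ℝ × Ω, hamRemainder Ψ X Y u z.1 z.2
      = (hamAlong Ψ Y Y u z.1 z.2 - hamAlong Ψ X X u z.1 z.2)
        - (hamDx Ψ X u z.1 z.2 (Y.at z.1 z.2 - X.at z.1 z.2)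
          + ∫ ω', hamDm Ψ X u z.1 z.2 ω' (Y.at z.1 ω' - X.at z.1 ω') ∂P) := fun z => sub_sub _ _ _
  have iY := (integrable_hamAlong h𝒞 hΨ Y u).mono_measure hle
  have iX := (integrable_hamAlong h𝒞 hΨ X u).mono_measure hle
  have i2 : Integrable (fun z : ℝ × Ω => hamAlong Ψ Y Y u z.1 z.2 - hamAlong Ψ X X u z.1 z.2)
      (β.prod P) := iY.sub iX
  simp_rw [h1]
  rw [integral_sub i2 i, integral_sub iY iX, e, sub_neg_eq_add]

lemma integral_hamAlong (h𝒞 : 𝒞.Assumptions) {Ψ : Ω → 𝒞.Path (RdStar d)}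
    (hΨ : MemLp Ψ (ENNReal.ofReal 𝒞.q) P) (X : 𝒞.State P) (u : 𝒞.Control P) :
    ∫ z : ℝ × Ω, hamAlong Ψ X X u z.1 z.2 ∂(𝒞.timeMeasure.prod P)
      = ∫ z : ℝ × Ω, 𝒞.ev (Ψ z.2) z.1 (velocity X u z.1 z.2) ∂(𝒞.timeMeasure.prod P)
        - ∫ z : ℝ × Ω, 𝒞.f₀ z.1 (X.at z.1 z.2) (X.law z.1) (u.val z.1 z.2)
          ∂(𝒞.timeMeasure.prod P) :=
  integral_sub (integrable_clm_apply 𝒞.hpq (memLp_ev_prod hΨ) (memLp_velocity h𝒞 X u))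
    (integrable_f₀ h𝒞 X u)

/-- The increment of the payoff between two control processes with the same initial state: up to
second-order remainders, it is minus the increment of the mean Hamiltonian in the control. -/
lemma payoff_sub_eq (h𝒞 : 𝒞.Assumptions) {Ψ : Ω → 𝒞.Path (RdStar d)}
    (hΨ : MemLp Ψ (ENNReal.ofReal 𝒞.q) P) {X Y : 𝒞.State P} {u w : 𝒞.Control P}
    (hcost : 𝒞.CostateEquation X u Ψ) (hΨT : 𝒞.Transversality X Ψ) (hX : 𝒞.IsLagrangian X u)
    (hY : 𝒞.IsLagrangian Y w) (h0 : Y.at 0 =ᵐ[P] X.at 0) :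
    𝒞.payoff Y w - 𝒞.payoff X u = ∫ ω, terminalRemainder X Y ω ∂P
      - ∫ z : ℝ × Ω, hamRemainder Ψ X Y u z.1 z.2 ∂(𝒞.timeMeasure.prod P)
      - ∫ z : ℝ × Ω, (hamAlong Ψ Y Y w z.1 z.2 - hamAlong Ψ Y Y u z.1 z.2)
        ∂(𝒞.timeMeasure.prod P) := by
  have iψ := memLp_ev_prod hΨ
  have e1 : ∫ z : ℝ × Ω, 𝒞.ev (Ψ z.2) z.1 (velocity Y w z.1 z.2 - velocity X u z.1 z.2)
      ∂(𝒞.timeMeasure.prod P)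
      = ∫ z : ℝ × Ω, 𝒞.ev (Ψ z.2) z.1 (velocity Y w z.1 z.2) ∂(𝒞.timeMeasure.prod P)
        - ∫ z : ℝ × Ω, 𝒞.ev (Ψ z.2) z.1 (velocity X u z.1 z.2) ∂(𝒞.timeMeasure.prod P) := by
    rw [← integral_sub (integrable_clm_apply 𝒞.hpq iψ (memLp_velocity h𝒞 Y w))
      (integrable_clm_apply 𝒞.hpq iψ (memLp_velocity h𝒞 X u))]
    exact integral_congr_ae (Eventually.of_forall fun z => map_sub _ _ _)
  rw [integral_sub (integrable_hamAlong h𝒞 hΨ Y w) (integrable_hamAlong h𝒞 hΨ Y u),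
    integral_terminalRemainder h𝒞 hΨT Y, integral_hamRemainder h𝒞 hΨ X Y u le_rfl,
    integral_costate_terminal h𝒞 hΨ hcost hX hY h0, e1, integral_hamAlong h𝒞 hΨ Y w,
    integral_hamAlong h𝒞 hΨ X u, payoff_eq h𝒞 X u, payoff_eq h𝒞 Y w]
  ring

lemma Ioc_subset_Icc_time {s h : ℝ} (hs : 0 ≤ s) (hsh : s + h ≤ 𝒞.T) :
    Ioc s (s + h) ⊆ Icc 0 𝒞.T := fun _ ht => ⟨hs.trans ht.1.le, ht.2.trans hsh⟩

lemma restrict_Ioc_le_timeMeasure {s h : ℝ} (hs : 0 ≤ s) (hsh : s + h ≤ 𝒞.T) :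
    (volume : Measure ℝ).restrict (Ioc s (s + h)) ≤ 𝒞.timeMeasure :=
  Measure.restrict_mono (Ioc_subset_Icc_time hs hsh) le_rfl

/-- The Hamiltonians of a needle variation and of the original control differ on the needle only. -/
lemma integral_hamAlong_needle_sub {Ψ : Ω → 𝒞.Path (RdStar d)} (Y : 𝒞.State P)
    (u v : 𝒞.Control P) {s h : ℝ} (hs : 0 ≤ s) (hsh : s + h ≤ 𝒞.T) :
    ∫ z : ℝ × Ω, (hamAlong Ψ Y Y (u.needle v s h) z.1 z.2 - hamAlong Ψ Y Y u z.1 z.2)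
        ∂(𝒞.timeMeasure.prod P)
      = ∫ z : ℝ × Ω, (hamAlong Ψ Y Y v z.1 z.2 - hamAlong Ψ Y Y u z.1 z.2)
        ∂(((volume : Measure ℝ).restrict (Ioc s (s + h))).prod P) := by
  have hS : MeasurableSet ((Ioc s (s + h)) ×ˢ (univ : Set Ω)) := measurableSet_Ioc.prod .univ
  have e : ((volume : Measure ℝ).restrict (Ioc s (s + h))).prod P
      = (𝒞.timeMeasure.prod P).restrict (Ioc s (s + h) ×ˢ univ) := by
    rw [← Measure.prod_restrict, Measure.restrict_univ, Measure.restrict_restrict measurableSet_Ioc,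
      inter_eq_left.2 (Ioc_subset_Icc_time hs hsh)]
  rw [e, ← integral_indicator hS]
  congr 1
  funext z
  by_cases hz : z.1 ∈ Ioc s (s + h)
  · rw [indicator_of_mem (by exact ⟨hz, mem_univ _⟩), hamAlong, hamAlong, hamAlong,
      u.needle_of_mem v hz]
  · rw [indicator_of_notMem (fun hm => hz hm.1), hamAlong, hamAlong,
      u.needle_of_notMem v hz, sub_self]

end PayoffIncrement

end Problem

/-! ### Means over the needles -/

/-- Convergence of real difference quotients from extended nonnegative bounds. -/
lemma tendsto_inv_mul_of_enorm_le {η x : ℕ → ℝ} {a : ℕ → ℝ≥0∞} {D : ℝ} (hD : 0 < D)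
    (hη : ∀ n, 0 < η n) (hx : ∀ n, ‖x n‖ₑ ≤ a n)
    (ha : Tendsto (fun n => a n / ENNReal.ofReal (D * η n)) atTop (𝓝 0)) :
    Tendsto (fun n => (η n)⁻¹ * x n) atTop (𝓝 0) := by
  rw [tendsto_zero_iff_enorm_tendsto_zero]
  have h1 : Tendsto (fun n => ENNReal.ofReal D * (a n / ENNReal.ofReal (D * η n))) atTop (𝓝 0) := by
    simpa using ENNReal.Tendsto.const_mul ha (Or.inr ENNReal.ofReal_ne_top)
  refine tendsto_of_tendsto_of_tendsto_of_le_of_le tendsto_const_nhds h1 (fun _ => zero_le)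
    fun n => ?_
  have e1 : (η n)⁻¹ * x n = (D * (D * η n)⁻¹) * x n := by
    rw [mul_inv, ← mul_assoc D, mul_inv_cancel₀ hD.ne', one_mul]
  have e2 : ‖(η n)⁻¹ * x n‖ₑ = ENNReal.ofReal D * (ENNReal.ofReal (D * η n))⁻¹ * ‖x n‖ₑ := by
    rw [e1, enorm_mul, enorm_mul, Real.enorm_eq_ofReal hD.le, Real.enorm_eq_ofReal (by
      have := mul_pos hD (hη n); positivity), ENNReal.ofReal_inv_of_pos (mul_pos hD (hη n))]
  simp only
  rw [e2, mul_assoc, ENNReal.div_eq_inv_mul]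
  exact mul_le_mul' le_rfl (mul_le_mul' le_rfl (hx n))

lemma enorm_integral_clm_apply_le {β E F : Type*} [MeasurableSpace β] {μ : Measure β}
    [NormedAddCommGroup E] [NormedSpace ℝ E] [NormedAddCommGroup F] [NormedSpace ℝ F]
    {p q : ℝ} (hpq : p.HolderConjugate q) {f : β → E →L[ℝ] F} {g : β → E}
    (hf : AEStronglyMeasurable f μ) (hg : AEStronglyMeasurable g μ) :
    ‖∫ x, f x (g x) ∂μ‖ₑ ≤ eLpNorm f (ENNReal.ofReal q) μ * eLpNorm g (ENNReal.ofReal p) μ :=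
  (enorm_integral_le_lintegral_enorm _).trans
    ((lintegral_mono fun x => (f x).le_opENorm (g x)).trans (lintegral_enorm_mul_le μ hpq hf hg))

namespace Problem

section NeedleMeans

variable {d : ℕ} {V : Type*} {𝒞 : Problem d V} [NormedAddCommGroup V]
  {Ω : Type*} [MeasurableSpace Ω] {P : Measure Ω} [IsProbabilityMeasure P]

lemma restrict_Ioc_prod_eq {s h : ℝ} (hs : 0 ≤ s) (hsh : s + h ≤ 𝒞.T) :
    ((volume : Measure ℝ).restrict (Ioc s (s + h))).prod P
      = (𝒞.timeMeasure.prod P).restrict (Ioc s (s + h) ×ˢ univ) := by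
  rw [← Measure.prod_restrict, Measure.restrict_univ, Measure.restrict_restrict measurableSet_Ioc,
    inter_eq_left.2 (Ioc_subset_Icc_time hs hsh)]

/-- The `L^r`-norms on short time intervals tend to zero. -/
lemma tendsto_eLpNorm_restrict_Ioc {E : Type*} [NormedAddCommGroup E] {r : ℝ≥0∞} (hr : 1 ≤ r)
    (hr' : r ≠ ∞) {g : ℝ × Ω → E} (hg : MemLp g r (𝒞.timeMeasure.prod P)) {s : ℝ}
    (hs : s ∈ Ico 0 𝒞.T) :
    Tendsto (fun h => eLpNorm g r (((volume : Measure ℝ).restrict (Ioc s (s + h))).prod P))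
      (𝓝[>] 0) (𝓝 0) := by
  rw [ENNReal.tendsto_nhds_zero]
  intro ε hε
  rcases eq_or_ne ε ∞ with rfl | hε'
  · exact Eventually.of_forall fun _ => le_top
  obtain ⟨δ, hδ, hle⟩ := hg.eLpNorm_indicator_le hr hr' (ENNReal.toReal_pos hε.ne' hε')
  filter_upwards [Ioo_mem_nhdsGT (lt_min hδ (show 0 < 𝒞.T - s by linarith [hs.2]))] with h hh
  have hh1 := hh.2.trans_le (min_le_left _ _)
  have hh2 := hh.2.trans_le (min_le_right _ _)
  have hS : MeasurableSet ((Ioc s (s + h)) ×ˢ (univ : Set Ω)) := measurableSet_Ioc.prod .univ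
  rw [restrict_Ioc_prod_eq hs.1 (by linarith), ← eLpNorm_indicator_eq_eLpNorm_restrict hS]
  refine (hle _ hS ?_).trans (le_of_eq (ENNReal.ofReal_toReal hε'))
  rw [Measure.prod_prod, measure_univ, mul_one]
  refine (Measure.restrict_apply_le _ _).trans ?_
  rw [Real.volume_Ioc, add_sub_cancel_left]
  exact ENNReal.ofReal_le_ofReal hh1.le

namespace IsNeedleSequence

variable {X : 𝒞.State P} {u v : 𝒞.Control P} {s C : ℝ} {η : ℕ → ℝ} {Y : ℕ → 𝒞.State P} {W : Ω → ℝ}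

lemma mem_Ico (h : IsNeedleSequence X u v s C η Y W) : s ∈ Ico 0 𝒞.T :=
  ⟨h.nonneg, by linarith [h.pos 0, h.le 0]⟩

lemma tendsto_nhdsGT (h : IsNeedleSequence X u v s C η Y W) : Tendsto η atTop (𝓝[>] 0) :=
  tendsto_nhdsWithin_iff.2 ⟨h.tendsto, Eventually.of_forall h.pos⟩

/-- On the needles, the perturbation of the state does not contribute to the mean Hamiltonian of the
original control in the first order. -/
lemma tendsto_mean_hamAlong_sub (h𝒞 : 𝒞.Assumptions) {Ψ : Ω → 𝒞.Path (RdStar d)}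
    (hΨ : MemLp Ψ (ENNReal.ofReal 𝒞.q) P) (h : IsNeedleSequence X u v s C η Y W) :
    Tendsto (fun n => (η n)⁻¹ *
      (∫ z : ℝ × Ω, hamAlong Ψ (Y n) (Y n) u z.1 z.2
          ∂(((volume : Measure ℝ).restrict (Ioc s (s + η n))).prod P)
        - ∫ z : ℝ × Ω, hamAlong Ψ X X u z.1 z.2
          ∂(((volume : Measure ℝ).restrict (Ioc s (s + η n))).prod P))) atTop (𝓝 0) := by
  obtain ⟨D, hD, hrate, hrate'⟩ := h.exists_rate
  have hcm := memLp_costateRhs h𝒞 hΨ X u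
  set κ : ℕ → ℝ≥0∞ := fun n => eLpNorm (fun z : ℝ × Ω => costateRhs X u Ψ z.1 z.2)
    (ENNReal.ofReal 𝒞.q) (((volume : Measure ℝ).restrict (Ioc s (s + η n))).prod P) with hκ
  have hκ0 : Tendsto κ atTop (𝓝 0) :=
    (tendsto_eLpNorm_restrict_Ioc (one_le_ofReal 𝒞.one_lt_q) ENNReal.ofReal_ne_top hcm
      h.mem_Ico).comp h.tendsto_nhdsGT
  have hR : Tendsto (fun n => (∫⁻ z : ℝ × Ω, ‖hamRemainder Ψ X (Y n) u z.1 z.2‖ₑ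
      ∂(𝒞.timeMeasure.prod P)) / ENNReal.ofReal (D * η n)) atTop (𝓝 0) :=
    h.tendsto_running h𝒞 hΨ hD hrate hrate'
  have hpos : ∀ n, 0 < ENNReal.ofReal (D * η n) := fun n => by
    have := mul_pos hD (h.pos n); simpa using this
  refine tendsto_inv_mul_of_enorm_le hD h.pos (a := fun n =>
    (∫⁻ z : ℝ × Ω, ‖hamRemainder Ψ X (Y n) u z.1 z.2‖ₑ ∂(𝒞.timeMeasure.prod P))
      + κ n * ENNReal.ofReal (D * η n)) (fun n => ?_) ?_
  · have hle : ((volume : Measure ℝ).restrict (Ioc s (s + η n))).prod P ≤ 𝒞.timeMeasure.prod P :=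
      Measure.prod_mono (restrict_Ioc_le_timeMeasure h.nonneg (h.le n)) le_rfl
    have e := integral_hamRemainder h𝒞 hΨ X (Y n) u (restrict_Ioc_le_timeMeasure h.nonneg (h.le n))
    rw [← sub_eq_iff_eq_add] at e
    rw [← e]
    refine (enorm_sub_le).trans (add_le_add ?_ ?_)
    · exact (enorm_integral_le_lintegral_enorm _).trans (lintegral_mono' hle le_rfl)
    · refine (enorm_integral_clm_apply_le 𝒞.hpq (hcm.1.mono_measure hle)
        ((memLp_at_sub_prod X (Y n)).1.mono_measure hle)).trans (mul_le_mul' le_rfl ?_)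
      exact (eLpNorm_mono_measure _ hle).trans (hrate' n)
  · have := hR.add hκ0
    rw [add_zero] at this
    refine this.congr fun n => ?_
    rw [ENNReal.add_div, ENNReal.mul_div_cancel_right (hpos n).ne' ENNReal.ofReal_ne_top]

end IsNeedleSequence

end NeedleMeans

/-! ### Means at regular times -/

section RegularTimes

variable {d : ℕ} {V : Type*} {𝒞 : Problem d V} [NormedAddCommGroup V]
  {Ω : Type*} [MeasurableSpace Ω] {P : Measure Ω} [IsProbabilityMeasure P]

lemma ae_at_sub_at_eq (h𝒞 : 𝒞.Assumptions) {X : 𝒞.State P} {u : 𝒞.Control P}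
    (hX : 𝒞.IsLagrangian X u) :
    ∀ᵐ ω ∂P, ∀ a ∈ Icc 0 𝒞.T, ∀ b ∈ Icc 0 𝒞.T,
      X.at b ω - X.at a ω = ∫ τ in a..b, velocity X u τ ω := by
  filter_upwards [hX, ae_intervalIntegrable_velocity h𝒞 X u] with ω h1 h2 a ha b hb
  have e1 : X.at a ω = X.at 0 ω + ∫ τ in (0 : ℝ)..a, velocity X u τ ω := h1.2 a ha
  have e2 : X.at b ω = X.at 0 ω + ∫ τ in (0 : ℝ)..b, velocity X u τ ω := h1.2 b hb
  have e3 := intervalIntegral.integral_add_adjacent_intervals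
    (intervalIntegrable_mono_mem h2 𝒞.T_pos.le 𝒞.zero_mem ha)
    (intervalIntegrable_mono_mem h2 𝒞.T_pos.le ha hb)
  rw [e1, e2, ← e3]
  abel

/-- On a short interval after `s`, the increments of the state are of the order of its length. -/
lemma HasLinearRate.eLpNorm_at_sub_le (h𝒞 : 𝒞.Assumptions) {X : 𝒞.State P} {u : 𝒞.Control P}
    (hX : 𝒞.IsLagrangian X u) {s : ℝ} (hs : s ∈ Ico 0 𝒞.T) (hu : HasLinearRate X u s) :
    ∃ C : ℝ, 0 ≤ C ∧ ∀ᶠ h in 𝓝[>] (0 : ℝ), ∀ t ∈ Ioc s (s + h),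
      eLpNorm (fun ω => X.at (s + h) ω - X.at t ω) (ENNReal.ofReal 𝒞.p) P
        ≤ ENNReal.ofReal (C * h) := by
  obtain ⟨C, hC, hle⟩ := hu
  have hsT := Ico_subset_Icc_self hs
  refine ⟨2 * C, by positivity, ?_⟩
  filter_upwards [hle, Ioo_mem_nhdsGT (show 0 < 𝒞.T - s by linarith [hs.2])] with h hh hT t ht
  have key : ∀ r ∈ Ioc s (s + h), eLpNorm (fun ω => X.at r ω - X.at s ω) (ENNReal.ofReal 𝒞.p) P
      ≤ ENNReal.ofReal (C * h) := fun r hr => by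
    have h1 := hh (r - s) (by linarith [hr.1]) (by linarith [hr.2])
    rw [add_sub_cancel] at h1
    have h2 : eLpNorm (fun ω => X.at r ω - X.at s ω) (ENNReal.ofReal 𝒞.p) P
        = eLpNorm (fun ω => ∫ τ in s..r, velocity X u τ ω) (ENNReal.ofReal 𝒞.p) P := by
      refine eLpNorm_congr_ae ?_
      filter_upwards [ae_at_sub_at_eq h𝒞 hX] with ω hω
      exact hω s hsT r ⟨by linarith [hr.1, hs.1], by linarith [hr.2, hT.2]⟩
    rw [h2]
    exact h1.trans (ENNReal.ofReal_le_ofReal (mul_le_mul_of_nonneg_left (by linarith [hr.2]) hC))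
  have e : (fun ω => X.at (s + h) ω - X.at t ω)
      = (fun ω => X.at (s + h) ω - X.at s ω) - fun ω => X.at t ω - X.at s ω := by
    funext ω; simp
  have hm : ∀ r, AEStronglyMeasurable (fun ω => X.at r ω - X.at s ω) P :=
    fun r => (X.memLp_at r).1.sub (X.memLp_at s).1
  rw [e]
  refine (eLpNorm_sub_le (hm _) (hm _) (one_le_ofReal 𝒞.hpq.lt)).trans ?_
  have hCh : 0 ≤ C * h := mul_nonneg hC hT.1.le
  rw [mul_assoc, two_mul, ENNReal.ofReal_add hCh hCh]
  exact add_le_add (key _ ⟨by linarith [hT.1], le_rfl⟩) (key t ht)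

lemma integral_prod_Ioc_eq {g : ℝ × Ω → ℝ} (hg : Integrable g (𝒞.timeMeasure.prod P)) {s h : ℝ}
    (hs : 0 ≤ s) (h0 : 0 ≤ h) (hsh : s + h ≤ 𝒞.T) :
    ∫ z, g z ∂(((volume : Measure ℝ).restrict (Ioc s (s + h))).prod P)
      = ∫ ω, (∫ t in s..(s + h), g (t, ω)) ∂P := by
  have hle : ((volume : Measure ℝ).restrict (Ioc s (s + h))).prod P ≤ 𝒞.timeMeasure.prod P :=
    Measure.prod_mono (restrict_Ioc_le_timeMeasure hs hsh) le_rfl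
  rw [integral_prod_symm _ (hg.mono_measure hle)]
  simp_rw [intervalIntegral.integral_of_le (show s ≤ s + h by linarith)]

/-- The variation of the costate over a short interval, integrated by parts against the velocity. -/
lemma integral_costate_velocity (h𝒞 : 𝒞.Assumptions) {Ψ : Ω → 𝒞.Path (RdStar d)}
    (hΨ : MemLp Ψ (ENNReal.ofReal 𝒞.q) P) {X : 𝒞.State P} {u : 𝒞.Control P}
    (hcost : 𝒞.CostateEquation X u Ψ) (hX : 𝒞.IsLagrangian X u) {s h : ℝ} (hs : 0 ≤ s)
    (h0 : 0 ≤ h) (hsh : s + h ≤ 𝒞.T) :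
    ∫ z : ℝ × Ω, 𝒞.ev (Ψ z.2) z.1 (velocity X u z.1 z.2)
        ∂(((volume : Measure ℝ).restrict (Ioc s (s + h))).prod P)
      = ∫ ω, 𝒞.ev (Ψ ω) s (X.at (s + h) ω - X.at s ω) ∂P
        + ∫ z : ℝ × Ω, costateRhs X u Ψ z.1 z.2 (X.at (s + h) z.2 - X.at z.1 z.2)
          ∂(((volume : Measure ℝ).restrict (Ioc s (s + h))).prod P) := by
  have i1 := integrable_clm_apply 𝒞.hpq (memLp_ev_prod hΨ) (memLp_velocity h𝒞 X u)
  have m2 : MemLp (fun z : ℝ × Ω => X.at (s + h) z.2 - X.at z.1 z.2) (ENNReal.ofReal 𝒞.p)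
      (𝒞.timeMeasure.prod P) := ((X.memLp_at (s + h)).comp_snd _).sub (memLp_at_prod X)
  have i2 := integrable_clm_apply 𝒞.hpq (memLp_costateRhs h𝒞 hΨ X u) m2
  have m3 : MemLp (fun ω => X.at (s + h) ω - X.at s ω) (ENNReal.ofReal 𝒞.p) P :=
    (X.memLp_at (s + h)).sub (X.memLp_at s)
  have i3 : Integrable (fun ω => 𝒞.ev (Ψ ω) s (X.at (s + h) ω - X.at s ω)) P :=
    integrable_clm_apply 𝒞.hpq (memLp_ev hΨ s) m3
  have hle : ((volume : Measure ℝ).restrict (Ioc s (s + h))).prod P ≤ 𝒞.timeMeasure.prod P :=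
    Measure.prod_mono (restrict_Ioc_le_timeMeasure hs hsh) le_rfl
  have i4 : Integrable (fun ω => ∫ t in s..(s + h),
      costateRhs X u Ψ t ω (X.at (s + h) ω - X.at t ω)) P := by
    have := (i2.mono_measure hle).integral_prod_right
    simp_rw [intervalIntegral.integral_of_le (show s ≤ s + h by linarith)]
    exact this
  have hsm : s ∈ Icc 0 𝒞.T := ⟨hs, by linarith⟩
  have hshm : s + h ∈ Icc 0 𝒞.T := ⟨by linarith, hsh⟩
  rw [integral_prod_Ioc_eq i1 hs h0 hsh, integral_prod_Ioc_eq i2 hs h0 hsh, ← integral_add i3 i4]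
  refine integral_congr_ae ?_
  filter_upwards [costateEquation_iff.1 hcost, ae_at_sub_at_eq h𝒞 hX,
    ae_intervalIntegrable_velocity h𝒞 X u] with ω h1 h2 h3
  have j1 : IntervalIntegrable (fun t => costateRhs X u Ψ t ω) volume s (s + h) :=
    intervalIntegrable_mono_mem h1.1 𝒞.T_pos.le hsm hshm
  have j2 : IntervalIntegrable (fun t => velocity X u t ω) volume s (s + h) :=
    intervalIntegrable_mono_mem h3 𝒞.T_pos.le hsm hshm
  have hsub : ∀ t ∈ uIcc s (s + h), t ∈ Icc 0 𝒞.T := fun t ht => by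
    rw [uIcc_of_le (by linarith)] at ht
    exact ⟨hs.trans ht.1, ht.2.trans hsh⟩
  have hev : ∀ t ∈ uIcc s (s + h), 𝒞.ev (Ψ ω) t (velocity X u t ω)
      = 𝒞.ev (Ψ ω) s (velocity X u t ω)
        + (∫ r in s..t, costateRhs X u Ψ r ω) (velocity X u t ω) := fun t ht => by
    have e1 : 𝒞.ev (Ψ ω) s = 𝒞.ev (Ψ ω) 0 + ∫ r in (0 : ℝ)..s, costateRhs X u Ψ r ω := h1.2 s hsm
    have e2 : 𝒞.ev (Ψ ω) t = 𝒞.ev (Ψ ω) 0 + ∫ r in (0 : ℝ)..t, costateRhs X u Ψ r ω :=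
      h1.2 t (hsub t ht)
    have e3 := intervalIntegral.integral_add_adjacent_intervals
      (intervalIntegrable_mono_mem h1.1 𝒞.T_pos.le 𝒞.zero_mem hsm)
      (intervalIntegrable_mono_mem h1.1 𝒞.T_pos.le hsm (hsub t ht))
    rw [← _root_.add_apply, e1, e2, ← e3, add_assoc]
  have k1 : IntervalIntegrable (fun t => 𝒞.ev (Ψ ω) s (velocity X u t ω)) volume s (s + h) :=
    intervalIntegrable_continuous_apply continuousOn_const j2
  have k2 : IntervalIntegrable (fun t => (∫ r in s..t, costateRhs X u Ψ r ω) (velocity X u t ω))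
      volume s (s + h) :=
    intervalIntegrable_continuous_apply
      (intervalIntegral.continuousOn_primitive_interval' j1 left_mem_uIcc) j2
  have e4 : ∫ t in s..(s + h), costateRhs X u Ψ t ω (X.at (s + h) ω - X.at t ω)
      = ∫ t in s..(s + h), costateRhs X u Ψ t ω (∫ τ in t..(s + h), velocity X u τ ω) :=
    intervalIntegral.integral_congr fun t ht => by
      simp only [h2 t (hsub t ht) (s + h) hshm]
  rw [intervalIntegral.integral_congr hev, intervalIntegral.integral_add k1 k2, e4,
    integral_primitive_apply (by linarith) j1 j2, h2 s hsm (s + h) hshm,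
    (𝒞.ev (Ψ ω) s).intervalIntegral_comp_comm j2]

lemma integrable_f₀_at (h𝒞 : 𝒞.Assumptions) (X : 𝒞.State P) {ν : Ω → V} {t : ℝ}
    (ht : t ∈ Icc 0 𝒞.T) (hν : MemLp ν (ENNReal.ofReal 𝒞.p) P) (hνU : ∀ ω, ν ω ∈ 𝒞.U) :
    Integrable (fun ω => 𝒞.f₀ t (X.at t ω) (X.law t) (ν ω)) P := by
  obtain ⟨C, hC0, -, hC, -⟩ := exists_growth h𝒞
  refine ((((integrable_const (1 + X.lpNorm ^ 𝒞.p)).add X.integrable_path).add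
    (integrable_norm_rpow 𝒞.p_pos hν)).const_mul C).mono'
    (aestronglyMeasurable_comp_at h𝒞 h𝒞.f₀_cont ht (X.memLp_at t).1 _ hν.1 hνU)
    (Eventually.of_forall fun ω =>
      (hC t ht _ _ _ (hνU ω)).trans (mul_le_mul_of_nonneg_left ?_ hC0))
  simp only [Pi.add_apply]
  linarith [X.norm_at_rpow_le t ω, X.Mp_law_rpow_le t]

/-- At a regular time, the means of the running cost converge. -/
lemma IsRegular.tendsto_mean_f₀ (h𝒞 : 𝒞.Assumptions) {X : 𝒞.State P} {u : 𝒞.Control P} {s : ℝ}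
    (hs : 𝒞.IsRegular X u s) :
    Tendsto (fun h => h⁻¹ * ∫ z : ℝ × Ω, 𝒞.f₀ z.1 (X.at z.1 z.2) (X.law z.1) (u.val z.1 z.2)
        ∂(((volume : Measure ℝ).restrict (Ioc s (s + h))).prod P)) (𝓝[>] 0)
      (𝓝 (∫ ω, 𝒞.f₀ s (X.at s ω) (X.law s) (u.val s ω) ∂P)) := by
  have hsT := Ico_subset_Icc_self hs.1
  have hi := integrable_f₀ h𝒞 X u
  have hsm : ∀ᶠ h in 𝓝[>] (0 : ℝ), h ∈ Ioo 0 (𝒞.T - s) :=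
    Ioo_mem_nhdsGT (show 0 < 𝒞.T - s by linarith [hs.1.2])
  have hI : ∀ᶠ h in 𝓝[>] (0 : ℝ), Integrable (fun ω =>
      (1 / h) • ∫ τ in s..(s + h), 𝒞.f₀ τ (X.at τ ω) (X.law τ) (u.val τ ω)) P := by
    filter_upwards [hsm] with h hh
    have hle : ((volume : Measure ℝ).restrict (Ioc s (s + h))).prod P ≤ 𝒞.timeMeasure.prod P :=
      Measure.prod_mono (restrict_Ioc_le_timeMeasure hs.1.1 (by linarith [hh.2])) le_rfl
    have := (hi.mono_measure hle).integral_prod_right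
    simp_rw [intervalIntegral.integral_of_le (show s ≤ s + h by linarith [hh.1])]
    exact this.smul (1 / h)
  have h1 := tendsto_integral_of_L1' _ (integrable_f₀_at h𝒞 X hsT hs.memLp (u.mem s hsT)).1 hI
    hs.2.2.2
  refine h1.congr' ?_
  filter_upwards [hsm] with h hh
  rw [integral_prod_Ioc_eq hi hs.1.1 hh.1.le (by linarith [hh.2]), ← integral_const_mul]
  simp only [smul_eq_mul, one_div]

/-- At a regular time, the means of the pairing of the costate with the velocity converge. -/
lemma IsRegular.tendsto_mean_costate_velocity (h𝒞 : 𝒞.Assumptions) {Ψ : Ω → 𝒞.Path (RdStar d)}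
    (hΨ : MemLp Ψ (ENNReal.ofReal 𝒞.q) P) {X : 𝒞.State P} {u : 𝒞.Control P}
    (hcost : 𝒞.CostateEquation X u Ψ) (hX : 𝒞.IsLagrangian X u) {s : ℝ}
    (hs : 𝒞.IsRegular X u s) :
    Tendsto (fun h => h⁻¹ * ∫ z : ℝ × Ω, 𝒞.ev (Ψ z.2) z.1 (velocity X u z.1 z.2)
        ∂(((volume : Measure ℝ).restrict (Ioc s (s + h))).prod P)) (𝓝[>] 0)
      (𝓝 (∫ ω, 𝒞.ev (Ψ ω) s (velocity X u s ω) ∂P)) := by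
  have hsT := Ico_subset_Icc_self hs.1
  have hcm := memLp_costateRhs h𝒞 hΨ X u
  have hv := memLp_velocity_at h𝒞 X u hsT hs.memLp
  obtain ⟨C, hC, hrate⟩ := (hs.hasLinearRate h𝒞).eLpNorm_at_sub_le h𝒞 hX hs.1
  have hκ := tendsto_eLpNorm_restrict_Ioc (one_le_ofReal 𝒞.one_lt_q) ENNReal.ofReal_ne_top hcm hs.1
  have hsm : ∀ᶠ h in 𝓝[>] (0 : ℝ), h ∈ Ioo 0 (min 1 (𝒞.T - s)) :=
    Ioo_mem_nhdsGT (lt_min one_pos (show 0 < 𝒞.T - s by linarith [hs.1.2]))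
  have hΨs := memLp_ev hΨ s
  rw [tendsto_iff_edist_tendsto_0]
  have hlim : Tendsto (fun h => eLpNorm (fun ω => 𝒞.ev (Ψ ω) s) (ENNReal.ofReal 𝒞.q) P *
      eLpNorm (fun ω => (1 / h) • (∫ τ in s..(s + h), 𝒞.f τ (X.at τ ω) (X.law τ) (u.val τ ω))
        - 𝒞.f s (X.at s ω) (X.law s) (u.val s ω)) (ENNReal.ofReal 𝒞.p) P
      + eLpNorm (fun z : ℝ × Ω => costateRhs X u Ψ z.1 z.2) (ENNReal.ofReal 𝒞.q)
        (((volume : Measure ℝ).restrict (Ioc s (s + h))).prod P) * ENNReal.ofReal C) (𝓝[>] 0)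
      (𝓝 0) := by
    have h1 := ENNReal.Tendsto.const_mul hs.2.2.1 (Or.inr hΨs.2.ne)
    have h2 := ENNReal.Tendsto.mul_const hκ (Or.inr (ENNReal.ofReal_ne_top (r := C)))
    simpa using h1.add h2
  refine tendsto_of_tendsto_of_tendsto_of_le_of_le' tendsto_const_nhds hlim
    (Eventually.of_forall fun _ => zero_le) ?_
  filter_upwards [hrate, hsm] with h hr hh
  have hh1 := hh.2.trans_le (min_le_left _ _)
  have hh2 := hh.2.trans_le (min_le_right _ _)
  have hshT : s + h ≤ 𝒞.T := by linarith
  have hle : ((volume : Measure ℝ).restrict (Ioc s (s + h))).prod P ≤ 𝒞.timeMeasure.prod P :=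
    Measure.prod_mono (restrict_Ioc_le_timeMeasure hs.1.1 hshT) le_rfl
  set Δ : Ω → Rd d := fun ω => X.at (s + h) ω - X.at s ω with hΔ
  have mΔ : MemLp Δ (ENNReal.ofReal 𝒞.p) P := (X.memLp_at (s + h)).sub (X.memLp_at s)
  set w : Ω → Rd d := fun ω => h⁻¹ • Δ ω - velocity X u s ω with hw
  have mw : MemLp w (ENNReal.ofReal 𝒞.p) P := (mΔ.const_smul h⁻¹).sub hv
  have ew : eLpNorm w (ENNReal.ofReal 𝒞.p) P = eLpNorm (fun ω => (1 / h) •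
      (∫ τ in s..(s + h), 𝒞.f τ (X.at τ ω) (X.law τ) (u.val τ ω))
        - 𝒞.f s (X.at s ω) (X.law s) (u.val s ω)) (ENNReal.ofReal 𝒞.p) P := by
    refine eLpNorm_congr_ae ?_
    filter_upwards [ae_at_sub_at_eq h𝒞 hX] with ω hω
    have := hω s hsT (s + h) ⟨by linarith [hs.1.1, hh.1], hshT⟩
    simp only [hw, hΔ, this, one_div]
    rfl
  have e1 : ∫ ω, 𝒞.ev (Ψ ω) s (w ω) ∂P
      = h⁻¹ * ∫ ω, 𝒞.ev (Ψ ω) s (Δ ω) ∂P - ∫ ω, 𝒞.ev (Ψ ω) s (velocity X u s ω) ∂P := by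
    rw [← integral_const_mul, ← integral_sub
      ((integrable_clm_apply 𝒞.hpq hΨs mΔ).const_mul _) (integrable_clm_apply 𝒞.hpq hΨs hv)]
    refine integral_congr_ae (Eventually.of_forall fun ω => ?_)
    simp only [hw, map_sub, map_smul, smul_eq_mul]
  have e2 := integral_costate_velocity h𝒞 hΨ hcost hX hs.1.1 hh.1.le hshT
  rw [edist_eq_enorm_sub, e2, mul_add, add_sub_right_comm, ← e1, ← ew]
  refine (enorm_add_le _ _).trans (add_le_add
    (enorm_integral_clm_apply_le 𝒞.hpq hΨs.1 mw.1) ?_)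
  have mD : AEStronglyMeasurable (fun z : ℝ × Ω => X.at (s + h) z.2 - X.at z.1 z.2)
      (𝒞.timeMeasure.prod P) := (X.memLp_at (s + h)).1.comp_snd.sub (memLp_at_prod X).1
  have hD : eLpNorm (fun z : ℝ × Ω => X.at (s + h) z.2 - X.at z.1 z.2) (ENNReal.ofReal 𝒞.p)
      (((volume : Measure ℝ).restrict (Ioc s (s + h))).prod P) ≤ ENNReal.ofReal (C * h) := by
    refine (eLpNorm_prod_le (g := fun t ω => X.at (s + h) ω - X.at t ω) 𝒞.p_pos
      (mD.mono_measure hle) ((ae_restrict_mem measurableSet_Ioc).mono hr)).trans ?_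
    have h1 : (volume : Measure ℝ).restrict (Ioc s (s + h)) univ ≤ 1 := by
      rw [Measure.restrict_apply_univ, Real.volume_Ioc, add_sub_cancel_left]
      exact ENNReal.ofReal_le_one.2 hh1.le
    have hp := 𝒞.p_pos
    calc _ ≤ (1 : ℝ≥0∞) ^ (1 / 𝒞.p) * ENNReal.ofReal (C * h) :=
          mul_le_mul' (ENNReal.rpow_le_rpow h1 (by positivity)) le_rfl
      _ = ENNReal.ofReal (C * h) := by rw [ENNReal.one_rpow, one_mul]
  rw [enorm_mul, Real.enorm_eq_ofReal (inv_nonneg.2 hh.1.le)]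
  refine (mul_le_mul' le_rfl (enorm_integral_clm_apply_le 𝒞.hpq (hcm.1.mono_measure hle)
    (mD.mono_measure hle))).trans ((mul_le_mul' le_rfl (mul_le_mul' le_rfl hD)).trans
      (le_of_eq ?_))
  rw [mul_left_comm, ← ENNReal.ofReal_mul (inv_nonneg.2 hh.1.le), mul_comm C, ← mul_assoc,
    inv_mul_cancel₀ hh.1.ne', one_mul]

/-- At a regular time, the means of the Hamiltonian along the control process converge. The velocity
need not converge in `L^p` along the times `t ↓ s`, only its means do; the costate is therefore
frozen at the time `s` by an integration by parts. -/
lemma IsRegular.tendsto_mean_hamAlong (h𝒞 : 𝒞.Assumptions) {Ψ : Ω → 𝒞.Path (RdStar d)}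
    (hΨ : MemLp Ψ (ENNReal.ofReal 𝒞.q) P) {X : 𝒞.State P} {u : 𝒞.Control P}
    (hcost : 𝒞.CostateEquation X u Ψ) (hX : 𝒞.IsLagrangian X u) {s : ℝ}
    (hs : 𝒞.IsRegular X u s) :
    Tendsto (fun h => h⁻¹ * ∫ z : ℝ × Ω, hamAlong Ψ X X u z.1 z.2
        ∂(((volume : Measure ℝ).restrict (Ioc s (s + h))).prod P)) (𝓝[>] 0)
      (𝓝 (∫ ω, hamAlong Ψ X X u s ω ∂P)) := by
  have hsT := Ico_subset_Icc_self hs.1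
  have hi := integrable_f₀ h𝒞 X u
  have hj := integrable_clm_apply 𝒞.hpq (memLp_ev_prod hΨ) (memLp_velocity h𝒞 X u)
  have e : ∫ ω, hamAlong Ψ X X u s ω ∂P = ∫ ω, 𝒞.ev (Ψ ω) s (velocity X u s ω) ∂P
      - ∫ ω, 𝒞.f₀ s (X.at s ω) (X.law s) (u.val s ω) ∂P :=
    integral_sub (integrable_clm_apply 𝒞.hpq (memLp_ev hΨ s)
      (memLp_velocity_at h𝒞 X u hsT hs.memLp))
      (integrable_f₀_at h𝒞 X hsT hs.memLp (u.mem s hsT))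
  rw [e]
  refine ((hs.tendsto_mean_costate_velocity h𝒞 hΨ hcost hX).sub (hs.tendsto_mean_f₀ h𝒞)).congr' ?_
  filter_upwards [Ioo_mem_nhdsGT (show 0 < 𝒞.T - s by linarith [hs.1.2])] with h hh
  have hle : ((volume : Measure ℝ).restrict (Ioc s (s + h))).prod P ≤ 𝒞.timeMeasure.prod P :=
    Measure.prod_mono (restrict_Ioc_le_timeMeasure hs.1.1 (by linarith [hh.2])) le_rfl
  rw [← mul_sub, ← integral_sub (hj.mono_measure hle) (hi.mono_measure hle)]
  rfl

end RegularTimes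

/-! ### Means for constant controls -/

section ConstantNeedles

variable {d : ℕ} {V : Type*} {𝒞 : Problem d V} [NormedAddCommGroup V]
  {Ω : Type*} [MeasurableSpace Ω] {P : Measure Ω} [IsProbabilityMeasure P]

lemma memLp_norm_path {F : Type*} [NormedAddCommGroup F] {r : ℝ≥0∞} {Ψ : Ω → 𝒞.Path F}
    (hΨ : MemLp Ψ r P) : MemLp (fun ω => ‖Ψ ω‖) r P := hΨ.norm

lemma abs_hamiltonian_le {C : ℝ} (hC0 : 0 ≤ C)
    (hf : ∀ t ∈ Icc 0 𝒞.T, ∀ x m, ∀ u ∈ 𝒞.U, ‖𝒞.f t x m u‖ ≤ C * (1 + ‖x‖ + m.Mp + ‖u‖))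
    (hf₀ : ∀ t ∈ Icc 0 𝒞.T, ∀ x m, ∀ u ∈ 𝒞.U,
      |𝒞.f₀ t x m u| ≤ C * (1 + ‖x‖ ^ 𝒞.p + m.Mp ^ 𝒞.p + ‖u‖ ^ 𝒞.p))
    {t : ℝ} (ht : t ∈ Icc 0 𝒞.T) {x : Rd d} {m : PSpace 𝒞.p d} {ψ : RdStar d} {v : V}
    (hv : v ∈ 𝒞.U) {a M k : ℝ} (hx : ‖x‖ ≤ a) (hm : m.Mp ≤ M) (hψ : ‖ψ‖ ≤ k) :
    ‖𝒞.hamiltonian t x m ψ v‖ ≤ k ^ 𝒞.q + ‖C * (1 + a + M + ‖v‖)‖ ^ 𝒞.p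
      + C * (1 + a ^ 𝒞.p + M ^ 𝒞.p + ‖v‖ ^ 𝒞.p) := by
  have hp := 𝒞.p_pos
  have hm0 := m.Mp_nonneg
  have ha : 0 ≤ a := (norm_nonneg _).trans hx
  have hM : 0 ≤ M := hm0.trans hm
  have hk : 0 ≤ k := (norm_nonneg _).trans hψ
  have h1 : ‖𝒞.f t x m v‖ ≤ C * (1 + a + M + ‖v‖) :=
    (hf t ht x m v hv).trans (mul_le_mul_of_nonneg_left (by linarith) hC0)
  have h2 : |𝒞.f₀ t x m v| ≤ C * (1 + a ^ 𝒞.p + M ^ 𝒞.p + ‖v‖ ^ 𝒞.p) := by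
    refine (hf₀ t ht x m v hv).trans (mul_le_mul_of_nonneg_left ?_ hC0)
    have e1 := Real.rpow_le_rpow (norm_nonneg _) hx hp.le
    have e2 := Real.rpow_le_rpow hm0 hm hp.le
    linarith
  set b := C * (1 + a + M + ‖v‖) with hb
  have hb0 : 0 ≤ b := (norm_nonneg _).trans h1
  have h3 : ‖ψ (𝒞.f t x m v)‖ ≤ k * b :=
    (ψ.le_opNorm _).trans (mul_le_mul hψ h1 (norm_nonneg _) hk)
  have h4 := Real.young_inequality_of_nonneg hk hb0 𝒞.hpq.symm
  have h5 : k ^ 𝒞.q / 𝒞.q ≤ k ^ 𝒞.q := div_le_self (by positivity) 𝒞.one_lt_q.le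
  have h6 : b ^ 𝒞.p / 𝒞.p ≤ b ^ 𝒞.p := div_le_self (by positivity) 𝒞.hpq.lt.le
  rw [Real.norm_of_nonneg hb0]
  refine (norm_sub_le _ _).trans ?_
  rw [Real.norm_eq_abs (𝒞.f₀ t x m v)]
  linarith

/-- The dominating function for the Hamiltonian with a control that is constant in time. -/
lemma integrable_ham_growth {k : Ω → ℝ} (hk : MemLp k (ENNReal.ofReal 𝒞.q) P)
    {Z : Ω → ℝ} (hZ : MemLp Z (ENNReal.ofReal 𝒞.p) P) {ν : Ω → V}
    (hν : MemLp ν (ENNReal.ofReal 𝒞.p) P) (K M : ℝ) :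
    Integrable (fun ω => ‖k ω‖ ^ 𝒞.q + ‖K * (1 + ‖Z ω‖ + M + ‖ν ω‖)‖ ^ 𝒞.p
      + K * (1 + ‖Z ω‖ ^ 𝒞.p + M ^ 𝒞.p + ‖ν ω‖ ^ 𝒞.p)) P := by
  have h1 : MemLp (fun _ : Ω => (1 : ℝ)) (ENNReal.ofReal 𝒞.p) P := memLp_const 1
  have h2 : MemLp (fun _ : Ω => M) (ENNReal.ofReal 𝒞.p) P := memLp_const M
  have hg : MemLp (fun ω => K * (1 + ‖Z ω‖ + M + ‖ν ω‖)) (ENNReal.ofReal 𝒞.p) P :=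
    (memLp_fun_add (memLp_fun_add (memLp_fun_add h1 hZ.norm) h2) hν.norm).const_mul K
  have ik : Integrable (fun ω => ‖k ω‖ ^ 𝒞.q) P := integrable_norm_rpow 𝒞.q_pos hk
  have iZ : Integrable (fun ω => ‖Z ω‖ ^ 𝒞.p) P := integrable_norm_rpow 𝒞.p_pos hZ
  have iν : Integrable (fun ω => ‖ν ω‖ ^ 𝒞.p) P := integrable_norm_rpow 𝒞.p_pos hν
  have ig : Integrable (fun ω => ‖K * (1 + ‖Z ω‖ + M + ‖ν ω‖)‖ ^ 𝒞.p) P :=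
    integrable_norm_rpow 𝒞.p_pos hg
  have i1 : Integrable (fun ω => 1 + ‖Z ω‖ ^ 𝒞.p) P := (integrable_const _).add iZ
  have i2 : Integrable (fun ω => 1 + ‖Z ω‖ ^ 𝒞.p + M ^ 𝒞.p) P := i1.add (integrable_const _)
  have i3 : Integrable (fun ω => K * (1 + ‖Z ω‖ ^ 𝒞.p + M ^ 𝒞.p + ‖ν ω‖ ^ 𝒞.p)) P :=
    (i2.add iν).const_mul K
  exact (ik.add ig).add i3

lemma aestronglyMeasurable_hamiltonian (h𝒞 : 𝒞.Assumptions) {Ψ : Ω → 𝒞.Path (RdStar d)}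
    (hΨ : AEStronglyMeasurable Ψ P) (X : 𝒞.State P) (m : PSpace 𝒞.p d) {t : ℝ}
    (ht : t ∈ Icc 0 𝒞.T) {ν : Ω → V} (hν : AEStronglyMeasurable ν P) (hνU : ∀ ω, ν ω ∈ 𝒞.U) :
    AEStronglyMeasurable (fun ω => 𝒞.hamiltonian t (X.at t ω) m (𝒞.ev (Ψ ω) t) (ν ω)) P := by
  have h1 := aestronglyMeasurable_clm_apply (aestronglyMeasurable_ev hΨ t)
    (aestronglyMeasurable_comp_at h𝒞 h𝒞.f_cont ht (X.memLp_at t).1 m hν hνU)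
  have h2 := aestronglyMeasurable_comp_at h𝒞 h𝒞.f₀_cont ht (X.memLp_at t).1 m hν hνU
  exact h1.sub h2

lemma continuousOn_hamiltonian (h𝒞 : 𝒞.Assumptions) : ContinuousOn
    (fun z : RdStar d × ℝ × Rd d × PSpace 𝒞.p d × V =>
      𝒞.hamiltonian z.2.1 z.2.2.1 z.2.2.2.1 z.1 z.2.2.2.2) (univ ×ˢ 𝒞.dataSet) := by
  have h1 : ContinuousOn (fun z : RdStar d × ℝ × Rd d × PSpace 𝒞.p d × V =>
      𝒞.f z.2.1 z.2.2.1 z.2.2.2.1 z.2.2.2.2) (univ ×ˢ 𝒞.dataSet) :=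
    h𝒞.f_cont.comp (f := fun z : RdStar d × ℝ × Rd d × PSpace 𝒞.p d × V => z.2)
      continuous_snd.continuousOn fun z hz => hz.2
  have h2 : ContinuousOn (fun z : RdStar d × ℝ × Rd d × PSpace 𝒞.p d × V =>
      𝒞.f₀ z.2.1 z.2.2.1 z.2.2.2.1 z.2.2.2.2) (univ ×ˢ 𝒞.dataSet) :=
    h𝒞.f₀_cont.comp (f := fun z : RdStar d × ℝ × Rd d × PSpace 𝒞.p d × V => z.2)
      continuous_snd.continuousOn fun z hz => hz.2
  exact (continuous_fst.continuousOn.clm_apply h1).sub h2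

namespace IsNeedleSequence

variable {X : 𝒞.State P} {u v : 𝒞.Control P} {s C : ℝ} {η : ℕ → ℝ} {Y : ℕ → 𝒞.State P} {W : Ω → ℝ}

lemma tendsto_law (h : IsNeedleSequence X u v s C η Y W) :
    Tendsto (fun z : ℕ × ℝ => (Y z.1).law z.2) (atTop ×ˢ 𝓝 s) (𝓝 (X.law s)) := by
  rw [tendsto_iff_edist_tendsto_0]
  have h1 : Tendsto (fun z : ℕ × ℝ => ENNReal.ofReal (C * η z.1) + edist (X.law z.2) (X.law s))
      (atTop ×ˢ 𝓝 s) (𝓝 0) := by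
    have e1 := (h.tendsto_rate C).comp (tendsto_fst (f := atTop) (g := 𝓝 s))
    have e2 := (tendsto_iff_edist_tendsto_0.1 (X.continuous_law.tendsto s)).comp
      (tendsto_snd (f := (atTop : Filter ℕ)) (g := 𝓝 s))
    simpa using e1.add e2
  refine tendsto_of_tendsto_of_tendsto_of_le_of_le tendsto_const_nhds h1 (fun _ => zero_le)
    fun z => (edist_triangle _ (X.law z.2) _).trans (add_le_add ?_ le_rfl)
  exact (edist_law_le _ _).trans (h.eLpNorm_at_le z.1 z.2)

lemma ae_tendsto_at_prod (h : IsNeedleSequence X u v s C η Y W) :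
    ∀ᵐ ω ∂P, Tendsto (fun z : ℕ × ℝ => (Y z.1).at z.2 ω) (atTop ×ˢ 𝓝 s) (𝓝 (X.at s ω)) := by
  filter_upwards [h.ae_tendsto] with ω hω
  have h1 : Continuous fun w : 𝒞.Path (Rd d) × ℝ => w.1 (projIcc 0 𝒞.T 𝒞.T_pos.le w.2) := by
    have := continuous_projIcc (h := 𝒞.T_pos.le)
    fun_prop
  have h2 := (h1.tendsto (X.path ω, s)).comp
    ((hω.comp (tendsto_fst (f := atTop) (g := 𝓝 s))).prodMk_nhds
      (tendsto_snd (f := (atTop : Filter ℕ)) (g := 𝓝 s)))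
  exact h2

/-- The mean Hamiltonian along the perturbed states is continuous at the time of the needle. -/
lemma tendsto_meanHamiltonian (h𝒞 : 𝒞.Assumptions) {Ψ : Ω → 𝒞.Path (RdStar d)}
    (hΨ : MemLp Ψ (ENNReal.ofReal 𝒞.q) P) (h : IsNeedleSequence X u v s C η Y W) {ν : Ω → V}
    (hν : MemLp ν (ENNReal.ofReal 𝒞.p) P) (hνU : ∀ ω, ν ω ∈ 𝒞.U) :
    Tendsto (fun z : ℕ × ℝ => ∫ ω, 𝒞.hamiltonian z.2 ((Y z.1).at z.2 ω) ((Y z.1).law z.2)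
        (𝒞.ev (Ψ ω) z.2) (ν ω) ∂P) (atTop ×ˢ 𝓝[Icc 0 𝒞.T] s)
      (𝓝 (∫ ω, 𝒞.hamiltonian s (X.at s ω) (X.law s) (𝒞.ev (Ψ ω) s) (ν ω) ∂P)) := by
  obtain ⟨K, hK, hf, hf₀, -⟩ := exists_growth h𝒞
  set Z : Ω → ℝ := fun ω => ‖X.path ω‖ + W ω with hZ
  have hZm : MemLp Z (ENNReal.ofReal 𝒞.p) P := h.memLp_dominating
  set M := (eLpNorm Z (ENNReal.ofReal 𝒞.p) P).toReal with hM
  obtain ⟨k, hk, hev⟩ : ∃ k : Ω → ℝ, MemLp k (ENNReal.ofReal 𝒞.q) P ∧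
      ∀ t ω, ‖𝒞.ev (Ψ ω) t‖ ≤ ‖k ω‖ := by
    exact ⟨_, memLp_norm_path hΨ, fun t ω => (𝒞.norm_ev_le (Ψ ω) t).trans (le_abs_self _)⟩
  have hle : (atTop : Filter ℕ) ×ˢ 𝓝[Icc 0 𝒞.T] s ≤ atTop ×ˢ 𝓝 s :=
    Filter.prod_mono le_rfl nhdsWithin_le_nhds
  have hmem : ∀ᶠ z : ℕ × ℝ in (atTop : Filter ℕ) ×ˢ 𝓝[Icc 0 𝒞.T] s, z.2 ∈ Icc 0 𝒞.T :=
    tendsto_snd.eventually (eventually_mem_nhdsWithin (a := s) (s := Icc 0 𝒞.T))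
  have hMp : ∀ n t, ((Y n).law t).Mp ≤ M := fun n t => by
    refine ((Y n).Mp_law_le t).trans (ENNReal.toReal_mono hZm.2.ne (eLpNorm_mono_ae ?_))
    filter_upwards [h.ae_norm_path_le] with ω hω
    exact (hω.2 n).trans (le_abs_self _)
  refine tendsto_integral_filter_of_dominated_convergence
    (fun ω => ‖k ω‖ ^ 𝒞.q + ‖K * (1 + ‖Z ω‖ + M + ‖ν ω‖)‖ ^ 𝒞.p
      + K * (1 + ‖Z ω‖ ^ 𝒞.p + M ^ 𝒞.p + ‖ν ω‖ ^ 𝒞.p)) ?_ ?_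
      (integrable_ham_growth hk hZm hν K M) ?_
  · filter_upwards [hmem] with z hz
    exact aestronglyMeasurable_hamiltonian h𝒞 hΨ.1 (Y z.1) _ hz hν.1 hνU
  · filter_upwards [hmem] with z hz
    filter_upwards [h.ae_norm_at_le] with ω hω
    exact abs_hamiltonian_le hK hf hf₀ hz (hνU ω) (((hω z.2).2 z.1).trans (le_abs_self _))
      (hMp _ _) (hev _ _)
  · filter_upwards [h.ae_tendsto_at_prod] with ω hω
    have hs : s ∈ Icc 0 𝒞.T := Ico_subset_Icc_self h.mem_Ico
    have h1 := continuousOn_hamiltonian h𝒞 (𝒞.ev (Ψ ω) s, s, X.at s ω, X.law s, ν ω)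
      ⟨mem_univ _, hs, mem_univ _, mem_univ _, hνU ω⟩
    have h2 : Tendsto (fun z : ℕ × ℝ =>
        (𝒞.ev (Ψ ω) z.2, z.2, (Y z.1).at z.2 ω, (Y z.1).law z.2, ν ω))
        (atTop ×ˢ 𝓝[Icc 0 𝒞.T] s)
        (𝓝[univ ×ˢ 𝒞.dataSet] (𝒞.ev (Ψ ω) s, s, X.at s ω, X.law s, ν ω)) := by
      refine tendsto_nhdsWithin_iff.2 ⟨?_, ?_⟩
      · have e0 : Tendsto (fun z : ℕ × ℝ => z.2) (atTop ×ˢ 𝓝[Icc 0 𝒞.T] s) (𝓝 s) :=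
          tendsto_snd.mono_left hle
        exact (((𝒞.continuous_ev (Ψ ω)).tendsto s).comp e0).prodMk_nhds
          (e0.prodMk_nhds ((hω.mono_left hle).prodMk_nhds
            ((h.tendsto_law.mono_left hle).prodMk_nhds tendsto_const_nhds)))
      · filter_upwards [hmem] with z hz
        exact ⟨mem_univ _, hz, mem_univ _, mem_univ _, hνU ω⟩
    exact h1.tendsto.comp h2

/-- The means of the Hamiltonian over the needles of a constant control converge. -/
lemma tendsto_mean_hamAlong_const (h𝒞 : 𝒞.Assumptions) {Ψ : Ω → 𝒞.Path (RdStar d)}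
    (hΨ : MemLp Ψ (ENNReal.ofReal 𝒞.q) P) (h : IsNeedleSequence X u v s C η Y W) {ν : Ω → V}
    (hν : MemLp ν (ENNReal.ofReal 𝒞.p) P) (hv : ∀ t, v.val t = ν) (hνU : ∀ ω, ν ω ∈ 𝒞.U) :
    Tendsto (fun n => (η n)⁻¹ * ∫ z : ℝ × Ω, hamAlong Ψ (Y n) (Y n) v z.1 z.2
        ∂(((volume : Measure ℝ).restrict (Ioc s (s + η n))).prod P)) atTop
      (𝓝 (∫ ω, 𝒞.hamiltonian s (X.at s ω) (X.law s) (𝒞.ev (Ψ ω) s) (ν ω) ∂P)) := by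
  set G : ℝ := ∫ ω, 𝒞.hamiltonian s (X.at s ω) (X.law s) (𝒞.ev (Ψ ω) s) (ν ω) ∂P with hG
  set g : ℕ → ℝ → ℝ := fun n t => ∫ ω, hamAlong Ψ (Y n) (Y n) v t ω ∂P with hgdef
  have hg : Tendsto (fun z : ℕ × ℝ => g z.1 z.2) (atTop ×ˢ 𝓝[Icc 0 𝒞.T] s) (𝓝 G) := by
    have := h.tendsto_meanHamiltonian h𝒞 hΨ hν hνU
    simpa only [hgdef, hamAlong, hv] using this
  rw [Metric.tendsto_nhds]
  intro ε hε
  obtain ⟨pa, hpa, pb, hpb, hab⟩ :=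
    Filter.eventually_prod_iff.1 (Metric.tendsto_nhds.1 hg (ε / 2) (half_pos hε))
  obtain ⟨δ, hδ, hball⟩ := Metric.mem_nhdsWithin_iff.1 hpb
  filter_upwards [hpa, h.tendsto.eventually_lt_const hδ] with n hn hnδ
  have hηn := h.pos n
  have hle : ((volume : Measure ℝ).restrict (Ioc s (s + η n))).prod P ≤ 𝒞.timeMeasure.prod P :=
    Measure.prod_mono (restrict_Ioc_le_timeMeasure h.nonneg (h.le n)) le_rfl
  have hi := (integrable_hamAlong h𝒞 hΨ (Y n) v).mono_measure hle
  have hbd : ∀ t ∈ Ioc s (s + η n), ‖g n t - G‖ ≤ ε / 2 := fun t ht => by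
    refine (hab hn (hball ⟨?_, Ioc_subset_Icc_time h.nonneg (h.le n) ht⟩)).le
    rw [Metric.mem_ball, Real.dist_eq, abs_lt]
    constructor <;> linarith [ht.1, ht.2]
  have hvol : (volume : Measure ℝ).real (Ioc s (s + η n)) = η n := by
    rw [Real.volume_real_Ioc_of_le (by linarith), add_sub_cancel_left]
  have e : (η n)⁻¹ * ∫ z : ℝ × Ω, hamAlong Ψ (Y n) (Y n) v z.1 z.2
      ∂(((volume : Measure ℝ).restrict (Ioc s (s + η n))).prod P) - G
      = (η n)⁻¹ * ∫ t in Ioc s (s + η n), (g n t - G) := by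
    rw [integral_prod _ hi, integral_sub hi.integral_prod_left
      (integrableOn_const (by simp)), setIntegral_const, hvol, smul_eq_mul, mul_sub,
      ← mul_assoc, inv_mul_cancel₀ hηn.ne', one_mul]
  rw [Real.dist_eq, e, abs_mul, abs_of_pos (inv_pos.2 hηn)]
  have h1 := norm_setIntegral_le_of_norm_le_const (μ := volume) (s := Ioc s (s + η n))
    (f := fun t => g n t - G) (C := ε / 2) (by simp) hbd
  rw [hvol, Real.norm_eq_abs] at h1
  calc (η n)⁻¹ * |∫ t in Ioc s (s + η n), (g n t - G)| ≤ (η n)⁻¹ * (ε / 2 * η n) :=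
        mul_le_mul_of_nonneg_left h1 (inv_nonneg.2 hηn.le)
    _ = ε / 2 := by rw [mul_comm (ε / 2), ← mul_assoc, inv_mul_cancel₀ hηn.ne', one_mul]
    _ < ε := half_lt_self hε

end IsNeedleSequence

end ConstantNeedles

/-! ### The maximum condition -/

section MaximumPrinciple

variable {d : ℕ} {V : Type*} {𝒞 : Problem d V} [NormedAddCommGroup V]
  {Ω : Type*} [MeasurableSpace Ω] {P : Measure Ω} [IsProbabilityMeasure P]

/-- If the needle variations do not lower the payoff, then the constant value on the needles does
not raise the mean Hamiltonian. The payoff is a cost, to be minimized. -/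
lemma IsNeedleSequence.integral_hamiltonian_le (h𝒞 : 𝒞.Assumptions) {Ψ : Ω → 𝒞.Path (RdStar d)}
    (hΨ : MemLp Ψ (ENNReal.ofReal 𝒞.q) P) {X : 𝒞.State P} {u v : 𝒞.Control P}
    {s C : ℝ} {η : ℕ → ℝ} {Y : ℕ → 𝒞.State P} {W : Ω → ℝ}
    (hcost : 𝒞.CostateEquation X u Ψ) (hΨT : 𝒞.Transversality X Ψ) (hX : 𝒞.IsLagrangian X u)
    (hs : 𝒞.IsRegular X u s) (h : IsNeedleSequence X u v s C η Y W) {ν : Ω → V}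
    (hν : MemLp ν (ENNReal.ofReal 𝒞.p) P) (hv : ∀ t, v.val t = ν) (hνU : ∀ ω, ν ω ∈ 𝒞.U)
    (hmin : ∀ᶠ n in atTop, 𝒞.payoff X u ≤ 𝒞.payoff (Y n) (u.needle v s (η n))) :
    ∫ ω, 𝒞.hamiltonian s (X.at s ω) (X.law s) (𝒞.ev (Ψ ω) s) (ν ω) ∂P
      ≤ ∫ ω, 𝒞.hamiltonian s (X.at s ω) (X.law s) (𝒞.ev (Ψ ω) s) (u.val s ω) ∂P := by
  obtain ⟨D, hD, hrate, hrate'⟩ := h.exists_rate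
  have t1 := h.tendsto_mean_hamAlong_const h𝒞 hΨ hν hv hνU
  have t2 := h.tendsto_mean_hamAlong_sub h𝒞 hΨ
  have t3 := (hs.tendsto_mean_hamAlong h𝒞 hΨ hcost hX).comp h.tendsto_nhdsGT
  have t4 : Tendsto (fun n => (η n)⁻¹ * ∫ ω, terminalRemainder X (Y n) ω ∂P) atTop (𝓝 0) :=
    tendsto_inv_mul_of_enorm_le hD h.pos (fun n => enorm_integral_le_lintegral_enorm _)
      (h.tendsto_terminal h𝒞 hD hrate)
  have t5 : Tendsto (fun n => (η n)⁻¹ * ∫ z : ℝ × Ω, hamRemainder Ψ X (Y n) u z.1 z.2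
      ∂(𝒞.timeMeasure.prod P)) atTop (𝓝 0) :=
    tendsto_inv_mul_of_enorm_le hD h.pos (fun n => enorm_integral_le_lintegral_enorm _)
      (h.tendsto_running h𝒞 hΨ hD hrate hrate')
  have t6 := ((t2.add t3).add t4).sub t5
  rw [zero_add, add_zero, sub_zero] at t6
  refine le_of_tendsto_of_tendsto t1 t6 ?_
  filter_upwards [hmin] with n hn
  have e1 := payoff_sub_eq h𝒞 hΨ hcost hΨT hX (h.isLagrangian n) (h.initial n)
  have hle : ((volume : Measure ℝ).restrict (Ioc s (s + η n))).prod P ≤ 𝒞.timeMeasure.prod P :=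
    Measure.prod_mono (restrict_Ioc_le_timeMeasure h.nonneg (h.le n)) le_rfl
  rw [integral_hamAlong_needle_sub (Y n) u v h.nonneg (h.le n),
    integral_sub ((integrable_hamAlong h𝒞 hΨ (Y n) v).mono_measure hle)
      ((integrable_hamAlong h𝒞 hΨ (Y n) u).mono_measure hle)] at e1
  simp only [Function.comp_apply]
  rw [← mul_add, ← mul_add, ← mul_sub]
  exact mul_le_mul_of_nonneg_left (by linarith) (inv_nonneg.2 (h.pos n).le)

lemma IsNeedleSequence.eventually_wasserstein_le {X : 𝒞.State P} {u v : 𝒞.Control P}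
    {s C : ℝ} {η : ℕ → ℝ} {Y : ℕ → 𝒞.State P} {W : Ω → ℝ} (h : IsNeedleSequence X u v s C η Y W)
    {ε : ℝ} (hε : 0 < ε) : ∀ᶠ n in atTop, ∀ t ∈ Icc 0 𝒞.T,
      wasserstein 𝒞.p ((Y n).law t).meas (X.law t).meas ≤ ENNReal.ofReal ε := by
  filter_upwards [(h.tendsto_rate C).eventually_le_const (ENNReal.ofReal_pos.2 hε)] with n hn t _
  exact (edist_law_le ((Y n).memLp_at t) (X.memLp_at t)).trans ((h.eLpNorm_at_le n t).trans hn)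

lemma MemAdm.of_initial {m₀ : PSpace 𝒞.p d} {X Y : 𝒞.State P} {u w : 𝒞.Control P}
    (hX : 𝒞.MemAdm m₀ X u) (hY : 𝒞.IsLagrangian Y w) (h0 : Y.at 0 =ᵐ[P] X.at 0) :
    𝒞.MemAdm m₀ Y w :=
  ⟨hY, (PSpace.ext_meas (Measure.map_congr h0)).trans hX.2⟩

/-- Needle variations do not lower the payoff of a minimizer of one of the three types. -/
lemma IsNeedleSequence.eventually_payoff_le {X : 𝒞.State P} {u v : 𝒞.Control P}
    {s C : ℝ} {η : ℕ → ℝ} {Y : ℕ → 𝒞.State P} {W : Ω → ℝ} (h : IsNeedleSequence X u v s C η Y W)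
    (hmin : (∃ m₀, 𝒞.IsPontryaginWpMin m₀ X u) ∨
      (∃ X₀, MemLp X₀ (ENNReal.ofReal 𝒞.p) P ∧ 𝒞.IsStrongLpMin X₀ X u) ∨
      (∃ m₀, 𝒞.IsStrongWpMin m₀ X u)) :
    ∀ᶠ n in atTop, 𝒞.payoff X u ≤ 𝒞.payoff (Y n) (u.needle v s (η n)) := by
  rcases hmin with ⟨m₀, hm, ε, hε, hmin⟩ | ⟨X₀, -, hm, ε, hε, hmin⟩ | ⟨m₀, hm, ε, hε, hmin⟩
  · filter_upwards [h.eventually_wasserstein_le hε, h.tendsto.eventually_le_const hε] with n h1 h2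
    exact hmin _ _ (MemAdm.of_initial hm (h.isLagrangian n) (h.initial n)) h1
      ((controlDiff_needle_le u v s (η n)).trans (ENNReal.ofReal_le_ofReal h2))
  · filter_upwards [h.tendsto_eLpNorm.eventually_le_const (ENNReal.ofReal_pos.2 hε)] with n h1
    exact hmin _ _ ⟨h.isLagrangian n, (h.initial n).trans hm.2⟩ h1
  · filter_upwards [h.eventually_wasserstein_le hε] with n h1
    exact hmin _ _ (MemAdm.of_initial hm (h.isLagrangian n) (h.initial n)) h1

lemma isLagrangian_of_isMin {X : 𝒞.State P} {u : 𝒞.Control P}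
    (hmin : (∃ m₀, 𝒞.IsPontryaginWpMin m₀ X u) ∨
      (∃ X₀, MemLp X₀ (ENNReal.ofReal 𝒞.p) P ∧ 𝒞.IsStrongLpMin X₀ X u) ∨
      (∃ m₀, 𝒞.IsStrongWpMin m₀ X u)) : 𝒞.IsLagrangian X u := by
  rcases hmin with ⟨_, hm, _⟩ | ⟨_, -, hm, _⟩ | ⟨_, hm, _⟩ <;> exact hm.1

/-- The maximum condition in integral form. -/
lemma IsRegular.integralMaximum (h𝒞 : 𝒞.Assumptions) {Ψ : Ω → 𝒞.Path (RdStar d)}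
    (hΨ : MemLp Ψ (ENNReal.ofReal 𝒞.q) P) {X : 𝒞.State P} {u : 𝒞.Control P} {s : ℝ}
    (hcost : 𝒞.CostateEquation X u Ψ) (hΨT : 𝒞.Transversality X Ψ)
    (hmin : (∃ m₀, 𝒞.IsPontryaginWpMin m₀ X u) ∨
      (∃ X₀, MemLp X₀ (ENNReal.ofReal 𝒞.p) P ∧ 𝒞.IsStrongLpMin X₀ X u) ∨
      (∃ m₀, 𝒞.IsStrongWpMin m₀ X u))
    (hs : 𝒞.IsRegular X u s) : 𝒞.IntegralMaximum X u Ψ s := by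
  have hsT := Ico_subset_Icc_self hs.1
  refine ⟨⟨u.val s, ⟨hs.memLp, u.mem s hsT⟩, rfl⟩, ?_⟩
  rintro _ ⟨ν, ⟨hν, hνU⟩, rfl⟩
  obtain ⟨ω₀⟩ : Nonempty Ω := nonempty_of_isProbabilityMeasure P
  -- a control has to be strongly measurable with values in `U` everywhere, and `ν` is so only up to
  -- a null set
  borelize V
  obtain ⟨ν', hν'm, hν'U, hνν'⟩ := AEStronglyMeasurable.exists_stronglyMeasurable_range_subset hν.1
    h𝒞.U_closed.measurableSet ⟨_, hνU ω₀⟩ (Eventually.of_forall hνU)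
  have hν' := hν.ae_eq hνν'
  have hX := isLagrangian_of_isMin hmin
  obtain ⟨C, η, Y, W, h⟩ := exists_isNeedleSequence h𝒞 hX hs.1 (hs.hasLinearRate h𝒞)
    (hasLinearRate_const h𝒞 X hν'm hν'U hν' hs.1)
  have key := h.integral_hamiltonian_le h𝒞 hΨ hcost hΨT hX hs hν' (fun _ => rfl) hν'U
    (h.eventually_payoff_le hmin)
  refine le_trans (le_of_eq (integral_congr_ae ?_)) key
  filter_upwards [hνν'] with ω hω
  simp only [hω]
  rfl

lemma integrable_hamiltonian_at (h𝒞 : 𝒞.Assumptions) {Ψ : Ω → 𝒞.Path (RdStar d)}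
    (hΨ : MemLp Ψ (ENNReal.ofReal 𝒞.q) P) (X : 𝒞.State P) {t : ℝ} (ht : t ∈ Icc 0 𝒞.T) {ν : Ω → V}
    (hν : MemLp ν (ENNReal.ofReal 𝒞.p) P) (hνU : ∀ ω, ν ω ∈ 𝒞.U) :
    Integrable (fun ω => 𝒞.hamiltonian t (X.at t ω) (X.law t) (𝒞.ev (Ψ ω) t) (ν ω)) P := by
  obtain ⟨K, hK, hf, hf₀, -⟩ := exists_growth h𝒞
  exact (integrable_ham_growth (memLp_ev hΨ t).norm (X.memLp_at t).norm hν K X.lpNorm).mono'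
    (aestronglyMeasurable_hamiltonian h𝒞 hΨ.1 X _ ht hν.1 hνU) (Eventually.of_forall fun ω =>
      abs_hamiltonian_le hK hf hf₀ ht (hνU ω) (norm_norm _).ge (X.Mp_law_le t) (norm_norm _).ge)

/-- The integral form of the maximum condition, localized to the set where a given value of the
control raises the Hamiltonian. -/
lemma IntegralMaximum.ae_hamiltonian_le (h𝒞 : 𝒞.Assumptions) {Ψ : Ω → 𝒞.Path (RdStar d)}
    (hΨ : MemLp Ψ (ENNReal.ofReal 𝒞.q) P) {X : 𝒞.State P} {u : 𝒞.Control P} {s : ℝ}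
    (hs : 𝒞.IsRegular X u s) (hmax : 𝒞.IntegralMaximum X u Ψ s) {v : V} (hv : v ∈ 𝒞.U) :
    ∀ᵐ ω ∂P, 𝒞.hamiltonian s (X.at s ω) (X.law s) (𝒞.ev (Ψ ω) s) v
      ≤ 𝒞.hamiltonian s (X.at s ω) (X.law s) (𝒞.ev (Ψ ω) s) (u.val s ω) := by
  have hsT := Ico_subset_Icc_self hs.1
  set Hv : Ω → ℝ := fun ω => 𝒞.hamiltonian s (X.at s ω) (X.law s) (𝒞.ev (Ψ ω) s) v with hHv
  set Hu : Ω → ℝ := fun ω => 𝒞.hamiltonian s (X.at s ω) (X.law s) (𝒞.ev (Ψ ω) s) (u.val s ω)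
    with hHu
  have iv : Integrable Hv P := integrable_hamiltonian_at h𝒞 hΨ X hsT (memLp_const v) fun _ => hv
  have iu : Integrable Hu P := integrable_hamiltonian_at h𝒞 hΨ X hsT hs.memLp (u.mem s hsT)
  have iD : Integrable (Hv - Hu) P := iv.sub iu
  set D := iD.1.mk with hD
  have hDm : StronglyMeasurable D := iD.1.stronglyMeasurable_mk
  have hDae : Hv - Hu =ᵐ[P] D := iD.1.ae_eq_mk
  have hA : MeasurableSet {ω | 0 < D ω} := measurableSet_lt measurable_const hDm.measurable
  classical
  -- the competitor switches to `v` where this raises the Hamiltonian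
  set ν : Ω → V := {ω | 0 < D ω}.piecewise (fun _ => v) (u.val s) with hν
  have hνp : MemLp ν (ENNReal.ofReal 𝒞.p) P :=
    MemLp.piecewise hA ((memLp_const v).restrict _) (hs.memLp.restrict _)
  have hνU : ∀ ω, ν ω ∈ 𝒞.U := fun ω => by
    by_cases hω : ω ∈ {ω | 0 < D ω}
    · rw [hν, piecewise_eq_of_mem _ _ _ hω]; exact hv
    · rw [hν, piecewise_eq_of_notMem _ _ _ hω]; exact u.mem s hsT ω
  have iν := integrable_hamiltonian_at h𝒞 hΨ X hsT hνp hνU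
  have hle : ∫ ω, 𝒞.hamiltonian s (X.at s ω) (X.law s) (𝒞.ev (Ψ ω) s) (ν ω) ∂P ≤ ∫ ω, Hu ω ∂P :=
    hmax.2 ⟨ν, ⟨hνp, hνU⟩, rfl⟩
  have e : (fun ω => 𝒞.hamiltonian s (X.at s ω) (X.law s) (𝒞.ev (Ψ ω) s) (ν ω) - Hu ω)
      =ᵐ[P] fun ω => max (D ω) 0 := by
    filter_upwards [hDae] with ω hω
    by_cases h0 : 0 < D ω
    · rw [hν, piecewise_eq_of_mem _ _ _ (by exact h0), max_eq_left h0.le, ← hω]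
      rfl
    · rw [hν, piecewise_eq_of_notMem _ _ _ (by exact h0), max_eq_right (not_lt.1 h0)]
      exact sub_self _
  have h1 : ∫ ω, max (D ω) 0 ∂P ≤ 0 := by
    rw [← integral_congr_ae e, integral_sub iν iu]
    linarith
  have h2 : 0 ≤ᵐ[P] fun ω => max (D ω) 0 := Eventually.of_forall fun ω => le_max_right _ _
  have h3 := (integral_eq_zero_iff_of_nonneg_ae h2 ((iν.sub iu).congr e)).1
    (le_antisymm h1 (integral_nonneg_of_ae h2))
  filter_upwards [h3, hDae] with ω h4 h5
  have h6 : D ω ≤ 0 := max_eq_right_iff.1 h4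
  have h7 : Hv ω - Hu ω = D ω := h5
  linarith

/-- The maximum condition in pointwise form. Only countably many values of the control matter: the
sets of positions, costates and levels at which a value of the control exceeds the level are open
subsets of a second countable space, even if the control set is not separable. -/
lemma IntegralMaximum.pointwiseMaximum (h𝒞 : 𝒞.Assumptions) {Ψ : Ω → 𝒞.Path (RdStar d)}
    (hΨ : MemLp Ψ (ENNReal.ofReal 𝒞.q) P) {X : 𝒞.State P} {u : 𝒞.Control P} {s : ℝ}
    (hs : 𝒞.IsRegular X u s) (hmax : 𝒞.IntegralMaximum X u Ψ s) :
    𝒞.PointwiseMaximum X u Ψ s := by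
  have hsT := Ico_subset_Icc_self hs.1
  set O : V → Set (Rd d × RdStar d × ℝ) := fun v =>
    {z | z.2.2 < 𝒞.hamiltonian s z.1 (X.law s) z.2.1 v} with hO
  have hopen : ∀ v ∈ 𝒞.U, IsOpen (O v) := fun v hv => by
    refine isOpen_lt (by fun_prop) ?_
    exact (continuousOn_hamiltonian h𝒞).comp_continuous
      (f := fun z : Rd d × RdStar d × ℝ => (z.2.1, s, z.1, X.law s, v)) (by fun_prop)
      fun z => ⟨mem_univ _, hsT, mem_univ _, mem_univ _, hv⟩
  obtain ⟨T, hTU, hT, hcov⟩ := TopologicalSpace.isOpen_biUnion_countable 𝒞.U O hopen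
  filter_upwards [(ae_ball_iff hT).2 fun v hv => hmax.ae_hamiltonian_le h𝒞 hΨ hs (hTU hv)]
    with ω hω
  refine ⟨⟨u.val s ω, u.mem s hsT ω, rfl⟩, ?_⟩
  rintro _ ⟨v, hv, rfl⟩
  by_contra hlt
  have hin : (X.at s ω, 𝒞.ev (Ψ ω) s,
      𝒞.hamiltonian s (X.at s ω) (X.law s) (𝒞.ev (Ψ ω) s) (u.val s ω)) ∈ ⋃ v ∈ 𝒞.U, O v :=
    mem_iUnion₂.2 ⟨v, hv, not_le.1 hlt⟩
  rw [← hcov] at hin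
  obtain ⟨v', hv', hlt'⟩ := mem_iUnion₂.1 hin
  exact absurd (hω v' hv') (not_le.2 hlt')

end MaximumPrinciple

end Problem

end MFC

theorem corollary4p3 {d : ℕ} {V : Type*} [NormedAddCommGroup V] [NormedSpace ℝ V]
    [CompleteSpace V] (𝒞 : MFC.Problem d V) (h𝒞 : 𝒞.Assumptions)
    {Ω : Type*} [MeasurableSpace Ω] (P : Measure Ω) [IsProbabilityMeasure P]
    (X : 𝒞.State P) (u : 𝒞.Control P)
    (hmin : (∃ m₀, 𝒞.IsPontryaginWpMin m₀ X u) ∨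
      (∃ X₀, MemLp X₀ (ENNReal.ofReal 𝒞.p) P ∧ 𝒞.IsStrongLpMin X₀ X u) ∨
      (∃ m₀, 𝒞.IsStrongWpMin m₀ X u)) :
    ∃ Ψ : Ω → 𝒞.Path (MFC.RdStar d),
      MemLp Ψ (ENNReal.ofReal 𝒞.q) P ∧
      𝒞.CostateEquation X u Ψ ∧
      𝒞.Transversality X Ψ ∧
      ∀ s, 𝒞.IsRegular X u s →
        𝒞.IntegralMaximum X u Ψ s ∧ 𝒞.PointwiseMaximum X u Ψ s := by
  obtain ⟨Ψ, hΨ, hcost, hΨT⟩ := MFC.Problem.exists_costate h𝒞 X u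
  refine ⟨Ψ, hΨ, hcost, hΨT, fun s hs => ?_⟩
  have hmax := hs.integralMaximum h𝒞 hΨ hcost hΨT hmin
  exact ⟨hmax, hmax.pointwiseMaximum h𝒞 hΨ hs⟩
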